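/- **Setting.** Let $k$ be a scheme and let $\mathcal V$ be a full subcategory of the category of $k$-schemes such that: every scheme in $\mathcal V$ is quasi-compact and quasi-separated and has an ample family of line bundles; $k$ and $\varnothing$ are in $\mathcal V$; if $X,Y\in\mathcal V$, then $X\sqcup Y$ and $X\times_k Y$ are in $\mathcal V$; quasi-compact open subschemes of schemes in $\mathcal V$ are in $\mathcal V$; and if $X\in\mathcal V$ and $Y$ is a quasi-compact open subscheme of a Grassmannian bundle $\mathrm{Gr}_X(r,E)$ (where $E$ is a vector bundle on $X$) such that $Y\to X$ is affine, then $Y\in\mathcal V$. Closed subsets $Z\subset X$ below are such that $X$ and $X\smallsetminus Z$ are in $\mathcal V$. A *cohomology theory* on $\mathcal V$ assigns to each such pair an abelian group $A_Z(X)$ and, functorially, to each $f\colon X'\to X$ with $f^{-1}(Z)\subset Z'$ a homomorphism $f^A\colon A_Z(X)\to A_{Z'}(X')$ (with $A(X)=A_X(X)$), together with natural boundary maps $\partial\colon A(X\smallsetminus Z)\to A_Z(X)$, such that 1. the sequences $A(X\smallsetminus Z)\xrightarrow{\partial}A_Z(X)\to A(X)\to A(X\smallsetminus Z)\xrightarrow{\partial}A_Z(X)$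 are exact; 2. $f^A\colon A_Z(X)\to A_{Z'}(X')$ is an isomorphism if $f$ is étale, $Z'=f^{-1}(Z)$ and $f$ induces an isomorphism $Z'\to Z$; 3. $A(X)\to A(X\times\mathbb A^1)$ is an isomorphism. A *ring cohomology theory* has moreover functorial, bilinear, associative cup products $\cup\colon A_Z(X)\times A_W(X)\to A_{Z\cap W}(X)$, and an element $1\in A(k)$ whose pullbacks $1_X\in A(X)$ are two-sided units for all $A_Z(X)$, with $\partial(a\cup b|_{X\smallsetminus Z})=\partial a\cup b$ for $a\in A(X\smallsetminus Z)$ and $b\in A(X)$. A *symplectic bundle* $(E,\phi)$ is a vector bundle with a nondegenerate alternating bilinear form; it is *trivial* of rank $2n$ if it is isometric to $\mathrm{Hyp}(\mathcal O_X)^{\perp n}$, where $\mathrm{Hyp}(\mathcal O_X)=\bigl(\mathcal O_X^{2},\bigl(\begin{smallmatrix}0&-1\\1&0\end{smallmatrix}\bigr)\bigr)$. The total space of a bundle is denoted by the same letter as the bundle, and $X\subset E$ is the zero section. A *symplectic Thom structure* on $A$ assigns to each rank $2$ symplectic bundle $(E,\phi)$ over $X\in\mathcal V$ an $A(X)$-central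 element $\mathrm{Th}(E,\phi)\in A_X(E)$, compatibly with isometries and with pullbacks along morphisms $Y\to X$ in $\mathcal V$, such that $\cup\,\mathrm{Th}(\mathrm{Hyp}(\mathcal O_X))\colon A(X)\to A_X(X\times\mathbb A^2)$ is an isomorphism for every $X\in\mathcal V$. The *Pontryagin class* of a rank $2$ symplectic bundle is $p(E,\phi)=-z^Ae^A\,\mathrm{Th}(E,\phi)\in A(X)$, where $e^A\colon A_X(E)\to A(E)$ is extension of supports and $z\colon X\to E$ is the zero section. For a symplectic bundle $(E,\phi)$ of rank $2n$ over $S$, the *quaternionic projective bundle* $\pi\colon \mathrm{HP}_S(E,\phi)\to S$ is the open subscheme of $\mathrm{Gr}_S(2,E)$ over which $\phi$ is nondegenerate on the tautological rank $2$ subbundle; the restriction of the latter to $\mathrm{HP}_S(E,\phi)$ is the tautological rank $2$ symplectic subbundle $(\mathcal U,\phi|_{\mathcal U})\subset\pi^*(E,\phi)$. **Theorem (Quaternionic projective bundle theorem).** Let $A$ be a ring cohomology theory on $\mathcal V$ with a symplectic Thom structure. Let $n\ge 0$, let $(E,\phi)$ be a symplectic bundle of rank $2n$ over a scheme $S\in\mathcal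 V$, and let $\zeta=p(\mathcal U,\phi|_{\mathcal U})\in A(\mathrm{HP}_S(E,\phi))$. Then: (a) For every closed subset $Z\subset S$ with $S\smallsetminus Z\in\mathcal V$, the map $$(1,\zeta,\dots,\zeta^{n-1})\colon A_Z(S)^{\oplus n}\longrightarrow A_{\pi^{-1}(Z)}(\mathrm{HP}_S(E,\phi)),\qquad (a_0,\dots,a_{n-1})\longmapsto\sum_{i=0}^{n-1}\pi^A(a_i)\cup\zeta^i,$$ is an isomorphism of two-sided $A(S)$-modules. (b) There are unique classes $p_i(E,\phi)\in A(S)$, $1\le i\le n$, such that in $A(\mathrm{HP}_S(E,\phi))$ $$\zeta^n-p_1(E,\phi)\cup\zeta^{n-1}+p_2(E,\phi)\cup\zeta^{n-2}-\cdots+(-1)^np_n(E,\phi)=0,$$ where $p_i(E,\phi)$ acts through $\pi^A$. (c) If $(E,\phi)$ is trivial, then $p_i(E,\phi)=0$ for $1\le i\le n$. -/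

import Mathlib

open CategoryTheory AlgebraicGeometry TopologicalSpace

universe u w

noncomputable section

namespace QuatProj

/-! ## Vector bundles and symplectic bundles -/

/-- A vector bundle of rank `r` over a scheme `X`, given by its total space `E → X`.
For every `T → X` the set `E(T)` of `X`-morphisms `T ⟶ E` (the sections of `E` over `T`) is a
module over `Γ(T, 𝒪_T)`, naturally in `T`, and locally on `X` this functor of modules
is isomorphic to `T ↦ Γ(T, 𝒪_T) ^ r`, by means of a frame `e`. -/
structure VectorBundle (X : Scheme.{u}) (r : ℕ) where
  /-- the total space with its projection -/
  total : Over X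
  addCommGroup : ∀ T : Over X, AddCommGroup (T ⟶ total)
  module : ∀ T : Over X, Module Γ(T.left, ⊤) (T ⟶ total)
  comp_add : ∀ {T' T : Over X} (g : T' ⟶ T) (s t : T ⟶ total),
    g ≫ (s + t) = g ≫ s + g ≫ t
  comp_smul : ∀ {T' T : Over X} (g : T' ⟶ T) (a : Γ(T.left, ⊤)) (s : T ⟶ total),
    g ≫ (a • s) = (g.left.appTop.hom a) • (g ≫ s)
  exists_frame : ∀ x : X, ∃ U : X.Opens, x ∈ U ∧
    ∃ e : Fin r → (Over.mk U.ι ⟶ total), ∀ (T : Over X) (g : T ⟶ Over.mk U.ι),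
      Function.Bijective (fun c : Fin r → Γ(T.left, ⊤) => ∑ i, c i • (g ≫ e i))

attribute [instance] VectorBundle.addCommGroup VectorBundle.module

/-- The `K`-point `p : Spec K ⟶ X` as an `X`-scheme. -/
abbrev fieldPoint {X : Scheme.{u}} (K : Type u) [Field K] (p : Spec (.of K) ⟶ X) : Over X :=
  Over.mk p

namespace VectorBundle

variable {X : Scheme.{u}} {r : ℕ} (E : VectorBundle X r)

lemma comp_zero {T' T : Over X} (g : T' ⟶ T) : g ≫ (0 : T ⟶ E.total) = 0 := by
  have h := E.comp_add g 0 0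
  rw [add_zero] at h
  exact left_eq_add.mp h

lemma comp_sum {ι : Type*} (s : Finset ι) {T' T : Over X} (g : T' ⟶ T)
    (f : ι → (T ⟶ E.total)) : g ≫ (∑ i ∈ s, f i) = ∑ i ∈ s, g ≫ f i := by
  classical
  induction s using Finset.induction_on with
  | empty => simpa using E.comp_zero g
  | insert a s ha ih => rw [Finset.sum_insert ha, Finset.sum_insert ha, E.comp_add, ih]

/-- The zero section `X ⟶ E`. -/
def zeroSection : X ⟶ E.total.left := (0 : Over.mk (𝟙 X) ⟶ E.total).left

@[simp] lemma zeroSection_comp : E.zeroSection ≫ E.total.hom = 𝟙 X :=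
  Over.w (0 : Over.mk (𝟙 X) ⟶ E.total)

lemma zero_left (T : Over X) : (0 : T ⟶ E.total).left = T.hom ≫ E.zeroSection := by
  rw [← E.comp_zero (Over.homMk T.hom : T ⟶ Over.mk (𝟙 X))]
  rfl

lemma isClosed_range_zeroSection : IsClosed (Set.range E.zeroSection) := by
  rw [← isOpen_compl_iff, isOpen_iff_forall_mem_open]
  intro t ht
  obtain ⟨U, hU, e, he⟩ := E.exists_frame (E.total.hom t)
  let W : E.total.left.Opens := E.total.hom ⁻¹ᵁ U
  let t' : W.toScheme := ⟨t, hU⟩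
  let T : Over X := Over.mk (W.ι ≫ E.total.hom)
  let τ : T ⟶ E.total := Over.homMk W.ι
  let g : T ⟶ Over.mk U.ι := Over.homMk (E.total.hom ∣_ U) (by
    simp [T, W, morphismRestrict_ι])
  obtain ⟨c, hc⟩ := (he T g).2 τ
  simp only at hc
  have key : ∃ i, t' ∈ T.left.basicOpen (c i) := by
    by_contra hcon
    push Not at hcon
    apply ht
    let q : Spec (W.toScheme.residueField t') ⟶ W.toScheme := W.toScheme.fromSpecResidueField t'
    let Q : Over X := Over.mk (q ≫ T.hom)
    let q' : Q ⟶ T := Over.homMk q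
    have h0 : ∀ i, q'.left.appTop.hom (c i) = 0 := by
      intro i
      have : IsReduced Q.left := inferInstanceAs (IsReduced (Spec (W.toScheme.residueField t')))
      rw [← basicOpen_eq_bot_iff, ← Scheme.preimage_basicOpen_top, eq_bot_iff]
      intro z hz
      refine absurd ?_ (hcon i)
      have hz' : q z ∈ T.left.basicOpen (c i) := hz
      have : q z = t' := W.toScheme.fromSpecResidueField_apply t' z
      rwa [this] at hz'
    have h1 : q' ≫ τ = 0 := by
      rw [← hc, E.comp_sum]
      refine Finset.sum_eq_zero fun i _ => ?_
      rw [E.comp_smul, h0, zero_smul]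
    have h2 : q ≫ W.ι = (q ≫ W.ι ≫ E.total.hom) ≫ E.zeroSection := by
      have h2 := congrArg (fun s => s.left) h1
      simp only [E.zero_left] at h2
      exact h2
    let z : Spec (W.toScheme.residueField t') := IsLocalRing.closedPoint _
    have hz : q z = t' := W.toScheme.fromSpecResidueField_apply t' z
    refine ⟨(q ≫ W.ι ≫ E.total.hom) z, ?_⟩
    rw [← Scheme.Hom.comp_apply, ← h2, Scheme.Hom.comp_apply, hz]
    rfl
  obtain ⟨i, hi⟩ := key
  let B : W.toScheme.Opens := T.left.basicOpen (c i)
  refine ⟨W.ι ''ᵁ B, ?_, (W.ι ''ᵁ B).isOpen, ⟨t', hi, rfl⟩⟩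
  rintro _ ⟨b, hb, rfl⟩ ⟨x, hx⟩
  replace hx : E.zeroSection x = W.ι b := hx
  -- along the zero section all coordinates vanish
  have hxU : x ∈ U := by
    have h3 : E.total.hom (W.ι b) ∈ U := b.2
    rw [← hx, ← Scheme.Hom.comp_apply, E.zeroSection_comp] at h3
    exact h3
  obtain ⟨l, hW⟩ : ∃ l : U.toScheme ⟶ W.toScheme, U.ι ≫ E.zeroSection = l ≫ W.ι :=
    ⟨IsOpenImmersion.lift W.ι (U.ι ≫ E.zeroSection) (by
      rintro _ ⟨y, rfl⟩
      simp only [Scheme.Opens.range_ι]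
      change E.total.hom ((U.ι ≫ E.zeroSection) y) ∈ U
      rw [← Scheme.Hom.comp_apply, Category.assoc, E.zeroSection_comp]
      exact y.2), (IsOpenImmersion.lift_fac _ _ _).symm⟩
  let l' : Over.mk U.ι ⟶ T := Over.homMk l (by
    change l ≫ W.ι ≫ E.total.hom = U.ι
    rw [← Category.assoc, ← hW, Category.assoc, E.zeroSection_comp, Category.comp_id])
  have h4 : l' ≫ τ = 0 := by
    ext1
    rw [E.zero_left]
    exact hW.symm
  have h5 : (fun j => l'.left.appTop.hom (c j)) = 0 := by
    apply (he _ (l' ≫ g)).1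
    simp only [Pi.zero_apply, zero_smul, Finset.sum_const_zero]
    rw [← h4, ← hc, E.comp_sum]
    exact Finset.sum_congr rfl fun j _ => by rw [E.comp_smul, Category.assoc]
  let x' : U.toScheme := ⟨x, hxU⟩
  have h6 : l x' = b := by
    apply W.ι.isOpenEmbedding.injective
    have h : (U.ι ≫ E.zeroSection) x' = (l ≫ W.ι) x' := by rw [hW]
    rw [Scheme.Hom.comp_apply, Scheme.Hom.comp_apply] at h
    exact h.symm.trans hx
  have h7 : x' ∈ l'.left ⁻¹ᵁ T.left.basicOpen (c i) := by
    change l x' ∈ B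
    rwa [h6]
  rw [Scheme.preimage_basicOpen_top] at h7
  have h8 : l'.left.appTop.hom (c i) = 0 := congrFun h5 i
  rw [h8, Scheme.basicOpen_zero] at h7
  exact h7

/-- The zero section `X ⊆ E`, as a closed subset of the total space. -/
def zeroLocus : Closeds E.total.left := ⟨Set.range E.zeroSection, E.isClosed_range_zeroSection⟩

/-- The points of `X` at which the section `s` of `E` does not vanish. -/
def nonvanishing (s : Over.mk (𝟙 X) ⟶ E.total) : Set X :=
  {x | (Over.homMk (X.fromSpecResidueField x) :
    Over.mk (X.fromSpecResidueField x) ⟶ Over.mk (𝟙 X)) ≫ s ≠ 0}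

end VectorBundle

/-- A morphism of vector bundles `F ⟶ E` covering `f : Y ⟶ X` (equivalently a morphism
`F ⟶ f^* E` of vector bundles over `Y`): a morphism of total spaces over `f` which is
linear on sections. -/
structure BundleHom {Y X : Scheme.{u}} (f : Y ⟶ X) {r n : ℕ}
    (F : VectorBundle Y r) (E : VectorBundle X n) where
  hom : (Over.map f).obj F.total ⟶ E.total
  map_add : ∀ (T : Over Y) (s t : T ⟶ F.total),
    (Over.map f).map (s + t) ≫ hom = (Over.map f).map s ≫ hom + (Over.map f).map t ≫ hom
  map_smul : ∀ (T : Over Y) (a : Γ(T.left, ⊤)) (s : T ⟶ F.total),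
    (Over.map f).map (a • s) ≫ hom =
      (show Γ(((Over.map f).obj T).left, ⊤) from a) • ((Over.map f).map s ≫ hom)

namespace BundleHom

variable {Y X : Scheme.{u}} {f : Y ⟶ X} {r n : ℕ} {F : VectorBundle Y r} {E : VectorBundle X n}
  (h : BundleHom f F E)

/-- The image of a section of `F` over `T`, as a section of `E` over `T`. -/
def push {T : Over Y} (s : T ⟶ F.total) : (Over.map f).obj T ⟶ E.total :=
  (Over.map f).map s ≫ h.hom

/-- The underlying morphism of total spaces. -/
def left : F.total.left ⟶ E.total.left := h.hom.left

lemma left_comp : h.left ≫ E.total.hom = F.total.hom ≫ f := Over.w h.hom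

/-- `F` is the pullback `f^* E` by means of `h`. -/
def IsCartesian : Prop := IsPullback h.left F.total.hom E.total.hom f

/-- `h` makes `F` a subbundle of `f^* E`: it is injective on all fibres. -/
def IsSubbundle : Prop :=
  ∀ (K : Type u) [Field K] (p : Spec (.of K) ⟶ Y),
    Function.Injective (h.push (T := fieldPoint K p))

lemma push_zero (T : Over Y) : h.push (0 : T ⟶ F.total) = 0 := by
  have := h.map_add T 0 0
  rw [add_zero] at this
  exact left_eq_add.mp this

lemma zeroSection_comp_left : F.zeroSection ≫ h.left = f ≫ E.zeroSection := by
  have := congrArg (fun t => t.left) (h.push_zero (Over.mk (𝟙 Y)))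
  simp only [E.zero_left] at this
  simpa [push, left, VectorBundle.zeroSection] using! this

/-- For a pullback bundle the inverse image of the zero section is the zero section. -/
lemma IsCartesian.preimage_zeroLocus (hh : h.IsCartesian) :
    h.left ⁻¹' (E.zeroLocus : Set E.total.left) ⊆ (F.zeroLocus : Set F.total.left) := by
  have h1 : IsPullback F.zeroSection f h.left E.zeroSection := by
    refine IsPullback.of_right (h₁₂ := F.total.hom) (h₂₂ := E.total.hom) (v₁₃ := f) ?_
      h.zeroSection_comp_left hh.flip
    rw [F.zeroSection_comp, E.zeroSection_comp]
    exact IsPullback.of_horiz_isIso ⟨by simp⟩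
  intro y hy
  change y ∈ h.left ⁻¹' (Set.range E.zeroSection) at hy
  rw [← Scheme.Pullback.range_fst] at hy
  obtain ⟨z, hz⟩ := hy
  refine ⟨h1.isoPullback.inv z, ?_⟩
  rw [← Scheme.Hom.comp_apply, h1.isoPullback_inv_fst, hz]

end BundleHom

/-- A symplectic bundle of rank `r` over `X`: a vector bundle with an alternating bilinear
form which is nondegenerate on all fibres. -/
structure SymplecticBundle (X : Scheme.{u}) (r : ℕ) extends VectorBundle X r where
  form : ∀ T : Over X, LinearMap.BilinForm Γ(T.left, ⊤) (T ⟶ total)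
  form_comp : ∀ {T' T : Over X} (g : T' ⟶ T) (s t : T ⟶ total),
    form T' (g ≫ s) (g ≫ t) = g.left.appTop.hom (form T s t)
  form_self : ∀ (T : Over X) (s : T ⟶ total), form T s s = 0
  form_nondegenerate : ∀ (K : Type u) [Field K] (p : Spec (.of K) ⟶ X)
    (s : fieldPoint K p ⟶ total), (∀ t, form (fieldPoint K p) s t = 0) → s = 0

/-- `E` is a trivial symplectic bundle, i.e. isometric to the orthogonal sum of `n` copies of
`Hyp(𝒪_X)`: it has a global frame of length `2 n` in which the form has the Gram matrix
`Matrix.J = (0, -1; 1, 0)`. -/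
def SymplecticBundle.IsTrivial {X : Scheme.{u}} {r : ℕ} (E : SymplecticBundle X r) (n : ℕ) :
    Prop :=
  ∃ e : Fin n ⊕ Fin n → (Over.mk (𝟙 X) ⟶ E.total),
    (∀ (T : Over X) (g : T ⟶ Over.mk (𝟙 X)),
      Function.Bijective (fun c : Fin n ⊕ Fin n → Γ(T.left, ⊤) => ∑ i, c i • (g ≫ e i))) ∧
    ∀ i j, E.form (Over.mk (𝟙 X)) (e i) (e j) = Matrix.J (Fin n) Γ(X, ⊤) i j

/-- A morphism of symplectic bundles covering `f` which is compatible with the forms. -/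
def BundleHom.IsIsometric {Y X : Scheme.{u}} {f : Y ⟶ X} {r n : ℕ} {F : SymplecticBundle Y r}
    {E : SymplecticBundle X n} (h : BundleHom f F.toVectorBundle E.toVectorBundle) : Prop :=
  ∀ (T : Over Y) (s t : T ⟶ F.total),
    E.form ((Over.map f).obj T) (h.push s) (h.push t) = F.form T s t

/-! ## Grassmannian bundles and quaternionic projective bundles -/

/-- `π : G ⟶ X` is the Grassmannian bundle `Gr_X(r, E)` with tautological subbundle
`ι : U ⊆ π^* E` of rank `r`: every subbundle `W ⊆ f^* E` of rank `r` over an `X`-scheme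
`f : T ⟶ X` is the pullback of `U` along a unique `X`-morphism `g : T ⟶ G`. -/
structure IsGrassmannian {X : Scheme.{u}} {n : ℕ} (E : VectorBundle X n) (r : ℕ)
    {G : Scheme.{u}} (π : G ⟶ X) (U : VectorBundle G r) (ι : BundleHom π U E) : Prop where
  isSubbundle : ι.IsSubbundle
  existsUnique : ∀ (T : Scheme.{u}) (f : T ⟶ X) (W : VectorBundle T r) (h : BundleHom f W E),
    h.IsSubbundle → ∃! g : T ⟶ G, g ≫ π = f ∧
      ∃ k : BundleHom g W U, k.IsCartesian ∧ k.left ≫ ι.left = h.left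

/-- `π : P ⟶ S` is the quaternionic projective bundle `HP_S(E, φ)` with tautological
rank `2` symplectic subbundle `ι : (U, φ|U) ⊆ π^* (E, φ)`: `P` is the open subscheme of the
Grassmannian bundle `Gr_S(2, E)` whose points are those at which `φ` is nondegenerate on
the tautological subbundle, and `U` is the restriction of the tautological subbundle, with the
restricted form. -/
def IsQuaternionicProjectiveBundle {S : Scheme.{u}} {r : ℕ} (E : SymplecticBundle S r)
    {P : Scheme.{u}} (π : P ⟶ S) (U : SymplecticBundle P 2)
    (ι : BundleHom π U.toVectorBundle E.toVectorBundle) : Prop :=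
  ∃ (G : Scheme.{u}) (πG : G ⟶ S) (UG : VectorBundle G 2)
    (ιG : BundleHom πG UG E.toVectorBundle) (j : P ⟶ G) (k : BundleHom j U.toVectorBundle UG),
    IsGrassmannian E.toVectorBundle 2 πG UG ιG ∧
    IsOpenImmersion j ∧ j ≫ πG = π ∧
    (∀ (K : Type u) [Field K] (p : Spec (.of K) ⟶ G),
      Set.range p ⊆ Set.range j ↔
        ∀ s : fieldPoint K p ⟶ UG.total,
          (∀ t : fieldPoint K p ⟶ UG.total, E.form _ (ιG.push s) (ιG.push t) = 0) → s = 0) ∧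
    k.IsCartesian ∧ k.left ≫ ιG.left = ι.left ∧ ι.IsIsometric

/-! ## Categories of schemes -/

/-- `X` has an ample family of line bundles: `X` is covered by affine open
subschemes which are nonvanishing loci of sections of line bundles. (All line bundles are
allowed, so tensor powers need not be mentioned.) -/
def HasAmpleFamily (X : Scheme.{u}) : Prop :=
  ∀ x : X, ∃ (L : VectorBundle X 1) (s : Over.mk (𝟙 X) ⟶ L.total) (W : X.Opens),
    x ∈ W ∧ IsAffineOpen W ∧ (W : Set X) = L.nonvanishing s

/-- A (full) category of `k`-schemes with the closure properties needed for the theory. -/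
structure SchemeCategory (k : Scheme.{u}) where
  /-- the objects of the category -/
  Mem : Over k → Prop
  compactSpace : ∀ X, Mem X → CompactSpace X.left
  quasiSeparatedSpace : ∀ X, Mem X → QuasiSeparatedSpace X.left
  hasAmpleFamily : ∀ X, Mem X → HasAmpleFamily X.left
  base_mem : Mem (Over.mk (𝟙 k))
  empty_mem : Mem (Over.mk k.emptyTo)
  coprod_mem : ∀ X Y, Mem X → Mem Y → Mem (Over.mk (Limits.coprod.desc X.hom Y.hom))
  prod_mem : ∀ X Y, Mem X → Mem Y →
    Mem (Over.mk (Limits.pullback.fst X.hom Y.hom ≫ X.hom))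
  /-- quasi-compact open subschemes -/
  open_mem : ∀ (X Y : Over k) (j : Y ⟶ X), Mem X → IsOpenImmersion j.left →
    CompactSpace Y.left → Mem Y
  /-- quasi-compact open subschemes of Grassmannian bundles, if affine over the base -/
  grassmannian_mem : ∀ (X : Over k), Mem X → ∀ (n r : ℕ) (E : VectorBundle X.left n)
    (G : Scheme.{u}) (π : G ⟶ X.left) (U : VectorBundle G r) (ι : BundleHom π U E),
    IsGrassmannian E r π U ι → ∀ (Y : Scheme.{u}) (j : Y ⟶ G), IsOpenImmersion j →
    CompactSpace Y → IsAffineHom (j ≫ π) → Mem (Over.mk ((j ≫ π) ≫ X.hom))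

/-- The open subscheme `X ∖ Z`. -/
def compl {k : Scheme.{u}} (X : Over k) (Z : Closeds X.left) : Over k :=
  Over.mk (Scheme.Opens.ι (X := X.left) Z.compl ≫ X.hom)

/-- The inclusion `X ∖ Z ⟶ X`. -/
def complι {k : Scheme.{u}} (X : Over k) (Z : Closeds X.left) : compl X Z ⟶ X :=
  Over.homMk (Scheme.Opens.ι (X := X.left) Z.compl)

/-- `(X, Z)` is a pair of the category: `X` and `X ∖ Z` belong to it. -/
def SchemeCategory.Pair {k : Scheme.{u}} (V : SchemeCategory k) (X : Over k)
    (Z : Closeds X.left) : Prop :=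
  V.Mem X ∧ V.Mem (compl X Z)

/-! ## Cohomology theories -/

lemma subset_top {α : Type*} [TopologicalSpace α] (s : Set α) :
    s ⊆ ((⊤ : Closeds α) : Set α) := fun _ _ => Set.mem_univ _

lemma preimage_inf_subset {α β : Type*} [TopologicalSpace α] [TopologicalSpace β] (f : α → β)
    {Z W : Closeds β} {Z' W' : Closeds α} (hZ : f ⁻¹' (Z : Set β) ⊆ Z')
    (hW : f ⁻¹' (W : Set β) ⊆ W') :
    f ⁻¹' ((Z ⊓ W : Closeds β) : Set β) ⊆ ((Z' ⊓ W' : Closeds α) : Set α) :=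
  fun _ hx => ⟨hZ hx.1, hW hx.2⟩

/-- A cohomology theory on a category `V` of `k`-schemes. The groups `A_Z(X)` and the maps are
subject to axioms for pairs `(X, Z)` of `V` only (their values elsewhere are immaterial). -/
structure CohomologyTheory {k : Scheme.{u}} (V : SchemeCategory k) where
  /-- the group `A_Z(X)` -/
  obj : (X : Over k) → Closeds X.left → Type w
  addCommGroup : ∀ X Z, AddCommGroup (obj X Z)
  /-- the map `f^A : A_Z(X) ⟶ A_{Z'}(X')` for `f : X' ⟶ X` with `f⁻¹(Z) ⊆ Z'` -/
  pull : ∀ {X' X : Over k} (f : X' ⟶ X) {Z : Closeds X.left} {Z' : Closeds X'.left},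
    f.left ⁻¹' (Z : Set X.left) ⊆ Z' → (obj X Z →+ obj X' Z')
  pull_id : ∀ {X : Over k} {Z : Closeds X.left}, V.Pair X Z →
    ∀ (h : (𝟙 X : X ⟶ X).left ⁻¹' (Z : Set X.left) ⊆ Z) (a : obj X Z), pull (𝟙 X) h a = a
  pull_comp : ∀ {X'' X' X : Over k} (g : X'' ⟶ X') (f : X' ⟶ X) {Z : Closeds X.left}
    {Z' : Closeds X'.left} {Z'' : Closeds X''.left},
    V.Pair X Z → V.Pair X' Z' → V.Pair X'' Z'' →
    ∀ (hf : f.left ⁻¹' (Z : Set X.left) ⊆ Z') (hg : g.left ⁻¹' (Z' : Set X'.left) ⊆ Z'')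
      (hgf : (g ≫ f).left ⁻¹' (Z : Set X.left) ⊆ Z'') (a : obj X Z),
      pull (g ≫ f) hgf a = pull g hg (pull f hf a)
  /-- the boundary map `∂ : A(X ∖ Z) ⟶ A_Z(X)` -/
  bdry : ∀ (X : Over k) (Z : Closeds X.left), obj (compl X Z) ⊤ →+ obj X Z
  bdry_natural : ∀ {X' X : Over k} (f : X' ⟶ X) {Z : Closeds X.left} {Z' : Closeds X'.left},
    V.Pair X Z → V.Pair X' Z' → ∀ (h : f.left ⁻¹' (Z : Set X.left) ⊆ Z')
      (g : compl X' Z' ⟶ compl X Z), g ≫ complι X Z = complι X' Z' ≫ f →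
      ∀ a, pull f h (bdry X Z a) = bdry X' Z' (pull g (subset_top _) a)
  /-- localization -/
  exact_bdry_ext : ∀ {X : Over k} {Z : Closeds X.left}, V.Pair X Z →
    Function.Exact (bdry X Z) (pull (𝟙 X) (Z := Z) (Z' := ⊤) (subset_top _))
  exact_ext_restrict : ∀ {X : Over k} {Z : Closeds X.left}, V.Pair X Z →
    Function.Exact (pull (𝟙 X) (Z := Z) (Z' := ⊤) (subset_top _))
      (pull (complι X Z) (Z := ⊤) (Z' := ⊤) (subset_top _))
  exact_restrict_bdry : ∀ {X : Over k} {Z : Closeds X.left}, V.Pair X Z →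
    Function.Exact (pull (complι X Z) (Z := ⊤) (Z' := ⊤) (subset_top _)) (bdry X Z)
  /-- étale excision: here `Z` and `Z'` carry their reduced scheme structures -/
  excision : ∀ {X' X : Over k} (f : X' ⟶ X) {Z : Closeds X.left} {Z' : Closeds X'.left},
    V.Pair X Z → V.Pair X' Z' → Etale f.left →
    ∀ (h : f.left ⁻¹' (Z : Set X.left) = Z')
      (g : (Scheme.IdealSheafData.vanishingIdeal Z').subscheme ⟶
        (Scheme.IdealSheafData.vanishingIdeal Z).subscheme),
      IsIso g →
      g ≫ (Scheme.IdealSheafData.vanishingIdeal Z).subschemeι =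
        (Scheme.IdealSheafData.vanishingIdeal Z').subschemeι ≫ f.left →
      Function.Bijective (pull f h.subset)
  /-- homotopy invariance -/
  homotopy : ∀ {X : Over k}, V.Mem X →
    Function.Bijective (pull
      (Over.homMk (𝔸(PUnit.{u + 1}; X.left) ↘ X.left) :
        Over.mk ((𝔸(PUnit.{u + 1}; X.left) ↘ X.left) ≫ X.hom) ⟶ X)
      (Z := ⊤) (Z' := ⊤) (subset_top _))

attribute [instance] CohomologyTheory.addCommGroup

namespace CohomologyTheory

variable {k : Scheme.{u}} {V : SchemeCategory k} (A : CohomologyTheory.{u, w} V)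

/-- Extension of supports `A_Z(X) ⟶ A_{Z'}(X)` for `Z ⊆ Z'`. -/
def ext {X : Over k} {Z Z' : Closeds X.left} (h : Z ≤ Z') : A.obj X Z →+ A.obj X Z' :=
  A.pull (𝟙 X) (fun _ hx => h hx)

/-- The pullback `f^A : A(X) ⟶ A(X')`, where `A(X) = A_X(X)`. -/
def pullTop {X' X : Over k} (f : X' ⟶ X) : A.obj X ⊤ →+ A.obj X' ⊤ :=
  A.pull f (subset_top _)

end CohomologyTheory

/-- A ring cohomology theory. -/
structure RingCohomologyTheory {k : Scheme.{u}} (V : SchemeCategory k) extends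
    CohomologyTheory.{u, w} V where
  /-- the cup product `A_Z(X) × A_W(X) ⟶ A_{Z ∩ W}(X)` -/
  cup : ∀ {X : Over k} (Z W : Closeds X.left), obj X Z →+ obj X W →+ obj X (Z ⊓ W)
  pull_cup : ∀ {X' X : Over k} (f : X' ⟶ X) {Z W : Closeds X.left} {Z' W' : Closeds X'.left},
    V.Pair X Z → V.Pair X W → V.Pair X' Z' → V.Pair X' W' →
    ∀ (hZ : f.left ⁻¹' (Z : Set X.left) ⊆ Z') (hW : f.left ⁻¹' (W : Set X.left) ⊆ W')
      (a : obj X Z) (b : obj X W),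
      pull f (preimage_inf_subset _ hZ hW) (cup Z W a b) =
        cup Z' W' (pull f hZ a) (pull f hW b)
  cup_assoc : ∀ {X : Over k} {Z W Y : Closeds X.left},
    V.Pair X Z → V.Pair X W → V.Pair X Y →
    ∀ (a : obj X Z) (b : obj X W) (c : obj X Y),
      toCohomologyTheory.ext (inf_assoc Z W Y).le (cup (Z ⊓ W) Y (cup Z W a b) c) =
        cup Z (W ⊓ Y) a (cup W Y b c)
  /-- the element `1 ∈ A(k)` -/
  one : obj (Over.mk (𝟙 k)) ⊤
  one_cup : ∀ {X : Over k} {Z : Closeds X.left}, V.Pair X Z → ∀ a : obj X Z,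
    toCohomologyTheory.ext (inf_le_right : ⊤ ⊓ Z ≤ Z)
      (cup ⊤ Z (toCohomologyTheory.pullTop (Over.mkIdTerminal.from X) one) a) = a
  cup_one : ∀ {X : Over k} {Z : Closeds X.left}, V.Pair X Z → ∀ a : obj X Z,
    toCohomologyTheory.ext (inf_le_left : Z ⊓ ⊤ ≤ Z)
      (cup Z ⊤ a (toCohomologyTheory.pullTop (Over.mkIdTerminal.from X) one)) = a
  bdry_cup : ∀ {X : Over k} {Z : Closeds X.left}, V.Pair X Z →
    ∀ (a : obj (compl X Z) ⊤) (b : obj X ⊤),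
      bdry X Z (toCohomologyTheory.ext (inf_le_left : ⊤ ⊓ ⊤ ≤ ⊤)
        (cup ⊤ ⊤ a (toCohomologyTheory.pullTop (complι X Z) b))) =
      toCohomologyTheory.ext (inf_le_left : Z ⊓ ⊤ ≤ Z) (cup Z ⊤ (bdry X Z a) b)

namespace RingCohomologyTheory

variable {k : Scheme.{u}} {V : SchemeCategory k} (A : RingCohomologyTheory.{u, w} V)

/-- The left action `A(X) × A_Z(X) ⟶ A_Z(X)`. -/
def lact {X : Over k} {Z : Closeds X.left} (a : A.obj X ⊤) (b : A.obj X Z) : A.obj X Z :=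
  A.ext (inf_le_right : ⊤ ⊓ Z ≤ Z) (A.cup ⊤ Z a b)

/-- The right action `A_Z(X) × A(X) ⟶ A_Z(X)`. -/
def ract {X : Over k} {Z : Closeds X.left} (b : A.obj X Z) (a : A.obj X ⊤) : A.obj X Z :=
  A.ext (inf_le_left : Z ⊓ ⊤ ≤ Z) (A.cup Z ⊤ b a)

/-- The unit `1_X ∈ A(X)`. -/
def unit (X : Over k) : A.obj X ⊤ := A.pullTop (Over.mkIdTerminal.from X) A.one

/-- Powers in the ring `A(X)`. -/
def pow {X : Over k} (a : A.obj X ⊤) : ℕ → A.obj X ⊤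
  | 0 => A.unit X
  | n + 1 => A.lact (pow a n) a

end RingCohomologyTheory

/-! ## Symplectic Thom structures and Pontryagin classes -/

/-- The total space of a bundle over a `k`-scheme, as a `k`-scheme. -/
def totalOver {k : Scheme.{u}} (X : Over k) {r : ℕ} (E : VectorBundle X.left r) : Over k :=
  Over.mk (E.total.hom ≫ X.hom)

/-- The bundle projection. -/
def projOver {k : Scheme.{u}} (X : Over k) {r : ℕ} (E : VectorBundle X.left r) :
    totalOver X E ⟶ X :=
  Over.homMk E.total.hom

/-- The zero section. -/
def zeroOver {k : Scheme.{u}} (X : Over k) {r : ℕ} (E : VectorBundle X.left r) :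
    X ⟶ totalOver X E :=
  Over.homMk E.zeroSection (by
    change E.zeroSection ≫ E.total.hom ≫ X.hom = X.hom
    rw [← Category.assoc, E.zeroSection_comp, Category.id_comp])

/-- The morphism of `k`-schemes `F ⟶ E` underlying a morphism of bundles. -/
def BundleHom.over {k : Scheme.{u}} {Y X : Over k} {f : Y ⟶ X} {r n : ℕ}
    {F : VectorBundle Y.left r} {E : VectorBundle X.left n} (h : BundleHom f.left F E) :
    totalOver Y F ⟶ totalOver X E :=
  Over.homMk h.left (by
    change h.left ≫ E.total.hom ≫ X.hom = F.total.hom ≫ Y.hom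
    rw [← Category.assoc, h.left_comp, Category.assoc, Over.w f])

/-- A symplectic Thom structure on a ring cohomology theory. -/
structure SymplecticThomStructure {k : Scheme.{u}} {V : SchemeCategory k}
    (A : RingCohomologyTheory.{u, w} V) where
  /-- the Thom class `Th(E, φ) ∈ A_X(E)` -/
  thom : ∀ (X : Over k) (E : SymplecticBundle X.left 2),
    A.obj (totalOver X E.toVectorBundle) E.zeroLocus
  /-- `Th(E, φ)` is `A(X)`-central -/
  central : ∀ (X : Over k) (E : SymplecticBundle X.left 2), V.Mem X → ∀ a : A.obj X ⊤,
    A.lact (A.pullTop (projOver X E.toVectorBundle) a) (thom X E) =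
      A.ract (thom X E) (A.pullTop (projOver X E.toVectorBundle) a)
  /-- functoriality for pullbacks `(F, ψ) ≅ f^*(E, φ)`, including isomorphisms over `X` -/
  natural : ∀ {Y X : Over k} (f : Y ⟶ X) (F : SymplecticBundle Y.left 2)
    (E : SymplecticBundle X.left 2), V.Mem Y → V.Mem X →
    ∀ (h : BundleHom f.left F.toVectorBundle E.toVectorBundle) (hc : h.IsCartesian),
      h.IsIsometric →
      A.pull h.over hc.preimage_zeroLocus (thom X E) = thom Y F
  /-- nondegeneracy for the trivial bundle `Hyp(𝒪_X)` -/
  nondegenerate : ∀ (X : Over k) (E : SymplecticBundle X.left 2), V.Mem X → E.IsTrivial 1 →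
    Function.Bijective (fun a : A.obj X ⊤ =>
      A.lact (A.pullTop (projOver X E.toVectorBundle) a) (thom X E))

/-- The Pontryagin class `p(E, φ) = - z^A (e^A Th(E, φ)) ∈ A(X)` of a rank `2` symplectic
bundle. -/
def SymplecticThomStructure.pontryagin {k : Scheme.{u}} {V : SchemeCategory k}
    {A : RingCohomologyTheory.{u, w} V} (Th : SymplecticThomStructure A) (X : Over k)
    (E : SymplecticBundle X.left 2) : A.obj X ⊤ :=
  - A.pullTop (zeroOver X E.toVectorBundle) (A.ext le_top (Th.thom X E))

/-- The inverse image of a closed subset. -/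
def preim {k : Scheme.{u}} {Y X : Over k} (f : Y ⟶ X) (Z : Closeds X.left) : Closeds Y.left :=
  ⟨f.left ⁻¹' (Z : Set X.left), Z.isClosed.preimage f.left.continuous⟩

/-- For `π : P ⟶ S` and `ζ ∈ A(P)` the map
`(1, ζ, …, ζ^(n-1)) : A_Z(S) ^ n ⟶ A_{π⁻¹(Z)}(P)`, `(a_i) ↦ ∑ π^A(a_i) ∪ ζ^i`. -/
def powerMap {k : Scheme.{u}} {V : SchemeCategory k} (A : RingCohomologyTheory.{u, w} V)
    {P S : Over k} (π : P ⟶ S) (ζ : A.obj P ⊤) (n : ℕ) (Z : Closeds S.left)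
    (a : Fin n → A.obj S Z) : A.obj P (preim π Z) :=
  ∑ i : Fin n, A.ract (A.pull π (Z' := preim π Z) subset_rfl (a i)) (A.pow ζ i)

/-- The relation `ζ^n - p_1 ∪ ζ^(n-1) + p_2 ∪ ζ^(n-2) - ⋯ + (-1)^n p_n = 0` in `A(P)`,
where `p i` stands for `p_(i+1)`. -/
def PontryaginRelation {k : Scheme.{u}} {V : SchemeCategory k}
    (A : RingCohomologyTheory.{u, w} V) {P S : Over k} (π : P ⟶ S) (ζ : A.obj P ⊤) (n : ℕ)
    (p : Fin n → A.obj S ⊤) : Prop :=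
  A.pow ζ n +
    ∑ i : Fin n, (-1 : ℤ) ^ (i.val + 1) • A.lact (A.pullTop π (p i)) (A.pow ζ (n - 1 - i)) = 0

end QuatProj

end

/-!
Let `π : P ⟶ S` be the quaternionic projective bundle of `(E, φ)` and `ζ` the Pontryagin class of
the tautological plane `U`. Locally on `S` the bundle `E` has a hyperbolic frame
(`SymplecticBundle.exists_isHyperbolic`), and over such a base the universal property of `P` amounts
to coordinates (`HPCoords`, `IsQuaternionicProjectiveBundle.hpCoords`): a morphism to `P` is a plane
with a nondegenerate form, spanned by two vectors of functions. The next paragraphs concern such a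
base.

Nilpotence. The coordinate functions `inr 0, …, inr (n - 1)` on `U` are the pairings with sections
of `U` (`HPCoords.dual`). These sections have no common zero (`HPCoords.exists_notMem_locus`): the
form of `U` is expressed by the coordinates, and two vectors whose coordinates `inr m` all vanish
are orthogonal. The Thom class of `U` pulled back along the `m`-th section is a class `t m`
supported on its zero locus `N m`, and by homotopy invariance along `U` it becomes `ζ` when the
support is forgotten (`SymplecticThomStructure.ext_thomAlong`). Such data are a `Tower`, and
`ζ ^ n = 0` because the product of the `t m` is supported on the empty set (`Tower.pow_eq_zero`).
This is (c).

Additive structure. The localization sequence of a triple, derived from the axioms in `triple_exact`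
and `triple_injective`, splits off one stratum `(N 0 ∩ ⋯ ∩ N (i - 1)) ∖ N i` after the other
(`Tower.map_bijective_iff`). Over `P ∖ N i` there is the `Cell` of planes with a chosen vector whose
coordinate `inr i` is `1`. It is an affine line locally over `P ∖ N i`
(`HPCoords.Cell.isLocallyAffineSpace`), so it has the same cohomology with supports
(`pull_bijective_of_isLocallyAffineSpace`), and it is an affine space over `S`, on which
`t 0, …, t (i - 1)` become Thom classes of pairs of coordinates
(`HPCoords.Cell.cellMap_bijective_iff`). So a stratum is computed by `i` successive Thom
isomorphisms (`prodCls_bijective`).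

Thom isomorphisms with supports. These iterated isomorphisms require the Thom isomorphism
`A_Z(X) ≅ A_{Z × 0}(X × 𝔸²)` for proper closed subsets `Z`. The axioms provide it for `Z = X` only,
and they contain no Leibniz rule for `∂` on classes with supports that would give the rest by the
five lemma. It is obtained from the union of the first two strata, which looks like a quaternionic
projective line. There only the case `Z = X` is needed to compute `A` without
supports, and the five lemma does apply to multiplication by `1` and `ζ`, which are classes without
supports (`sumMap_two_bijective`).
Splitting off the first cell leaves the second one, which is the desired isomorphism
(`HPCoords.thomIso`).

Globalization. Bijectivity of `a ↦ ∑ π^A(a i) ∪ ζ ^ i` is local on `S`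
(`sumMapTop_bijective_of_locally`), by excision and the five lemma for a union of two open subsets
(`SumMapBijectiveOver.sup`); the five lemma also gives it at every support
(`sumMap_bijective_of_compl`). This is (a), since `ζ` is central
(`SymplecticThomStructure.mul_pontryagin`), and (b) is a formal consequence
(`pontryaginRelation_iff`).

Membership in the category. All this uses that `P` and total spaces of vector bundles lie in `𝒱`.
The morphism `P ⟶ S` is affine (`IsQuaternionicProjectiveBundle.isAffineHom`): over an affine base,
the Plücker coordinates of index `inr j, inl j` are global functions on `P` with sum `1`
(`HPCoords.sum_plucker`), each invertible on an affine open subset. The total space of a vector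
bundle `F` is affine over its base and open in the Grassmannian of lines in `F ⊕ 𝒪`
(`VectorBundle.mem_totalOver`), which is constructed first: the Zariski sheaf of lines with a
section has affine spaces as charts, so it is representable (`SchemePresheaf.exists_representing`),
and the lines are its pairs with vanishing section (`VectorBundle.exists_projectiveBundle`).
-/

noncomputable section

namespace QuatProj

section

/-! ### Reduced closed subschemes and open immersions -/

lemma isReduced_vanishingIdeal_subscheme {X : Scheme.{u}} (Z : Closeds X) :
    IsReduced (Scheme.IdealSheafData.vanishingIdeal Z).subscheme := by
  have h : ∀ U : X.affineOpens,
      IsReduced (Spec (.of (Γ(X, U.1) ⧸ (Scheme.IdealSheafData.vanishingIdeal Z).ideal U))) := by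
    intro U
    rw [affine_isReduced_iff]
    change _root_.IsReduced (Γ(X, U.1) ⧸ (Scheme.IdealSheafData.vanishingIdeal Z).ideal U)
    rw [← Ideal.isRadical_iff_quotient_reduced, Scheme.IdealSheafData.vanishingIdeal_ideal]
    exact PrimeSpectrum.isRadical_vanishingIdeal _
  exact @IsReduced.of_openCover _ (Scheme.IdealSheafData.vanishingIdeal Z).subschemeCover.openCover
    h

/-- A reduced closed subscheme is determined by its underlying set. -/
lemma ker_eq_vanishingIdeal {W X : Scheme.{u}} (i : W ⟶ X) [IsClosedImmersion i] [IsReduced W]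
    {Z : Closeds X} (h : Set.range i = Z) :
    i.ker = Scheme.IdealSheafData.vanishingIdeal Z := by
  have h1 : i.ker.support = Z := by
    apply SetLike.coe_injective
    rw [Scheme.Hom.support_ker, h, Z.isClosed.closure_eq]
  rw [← h1, Scheme.IdealSheafData.vanishingIdeal_support]
  apply le_antisymm (Scheme.IdealSheafData.le_radical _)
  rw [Scheme.IdealSheafData.le_def]
  intro U x hx
  obtain ⟨n, hn⟩ := hx
  rw [Scheme.Hom.ker_apply, RingHom.mem_ker] at hn ⊢
  rw [map_pow] at hn
  exact eq_zero_of_pow_eq_zero hn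

/-- An open immersion whose image contains `Z` satisfies the hypothesis of excision: it induces an
isomorphism on the reduced closed subschemes `f⁻¹(Z)` and `Z`. -/
lemma exists_vanishingIdeal_subscheme_isIso {X' X : Scheme.{u}} (f : X' ⟶ X) [IsOpenImmersion f]
    {Z : Closeds X} {Z' : Closeds X'} (h : f ⁻¹' (Z : Set X) = Z') (hr : (Z : Set X) ⊆ Set.range
      f) :
    ∃ g : (Scheme.IdealSheafData.vanishingIdeal Z').subscheme ⟶
        (Scheme.IdealSheafData.vanishingIdeal Z).subscheme,
      IsIso g ∧ g ≫ (Scheme.IdealSheafData.vanishingIdeal Z).subschemeι =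
        (Scheme.IdealSheafData.vanishingIdeal Z').subschemeι ≫ f := by
  let I := Scheme.IdealSheafData.vanishingIdeal Z
  let I' := Scheme.IdealSheafData.vanishingIdeal Z'
  have hI : Set.range I.subschemeι = Z := by
    rw [Scheme.IdealSheafData.range_subschemeι, Scheme.IdealSheafData.coe_support_vanishingIdeal]
  let a := Limits.pullback.fst I.subschemeι f
  let b := Limits.pullback.snd I.subschemeι f
  have hred := isReduced_vanishingIdeal_subscheme Z
  have : IsReduced (Limits.pullback I.subschemeι f) := isReduced_of_isOpenImmersion a
  have hb : Set.range b = Z' := by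
    rw [Scheme.Pullback.range_snd, hI, h]
  have hker := ker_eq_vanishingIdeal b hb
  have ha : Function.Surjective a := by
    rw [← Set.range_eq_univ, Scheme.Pullback.range_fst, Set.eq_univ_iff_forall]
    intro x
    apply hr
    rw [← hI]
    exact ⟨x, rfl⟩
  have : Surjective a := ⟨ha⟩
  have ha' : IsIso a := (isIso_iff_isOpenImmersion_and_epi_base a).2
    ⟨inferInstance, (TopCat.epi_iff_surjective _).2 ha⟩
  have hl : b.ker = I'.subschemeι.ker := by
    rw [hker, Scheme.IdealSheafData.ker_subschemeι]
  let c := IsClosedImmersion.lift b I'.subschemeι hl.le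
  have hc : c ≫ b = I'.subschemeι := IsClosedImmersion.lift_fac _ _ _
  have : IsIso c := IsClosedImmersion.isIso_of_ker_eq I'.subschemeι b c hc hl.symm
  refine ⟨c ≫ a, inferInstance, ?_⟩
  change (c ≫ a) ≫ I.subschemeι = I'.subschemeι ≫ f
  rw [Category.assoc, Limits.pullback.condition, ← Category.assoc]
  exact congrArg (· ≫ f) hc

end

section

/-! ### Complements and pairs -/

section Compl

variable {k : Scheme.{u}}

instance {X : Over k} (Z : Closeds X.left) : IsOpenImmersion (complι X Z).left :=
  inferInstanceAs (IsOpenImmersion (Scheme.Opens.ι (X := X.left) Z.compl))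

lemma range_complι (X : Over k) (Z : Closeds X.left) :
    Set.range (complι X Z).left = (Z : Set X.left)ᶜ :=
  Scheme.Opens.range_ι (X := X.left) Z.compl

lemma mono_of_isOpenImmersion {X Y : Over k} (f : X ⟶ Y) [IsOpenImmersion f.left] : Mono f :=
  Over.mono_of_mono_left f

instance {X : Over k} (Z : Closeds X.left) : Mono (complι X Z) := mono_of_isOpenImmersion _

/-- The factorization of a morphism through an open immersion whose range contains its range. -/
def openLift {Y U X : Over k} (u : U ⟶ X) [IsOpenImmersion u.left] (f : Y ⟶ X)
    (h : Set.range f.left ⊆ Set.range u.left) : Y ⟶ U :=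
  Over.homMk (IsOpenImmersion.lift u.left f.left h) (by
    rw [← Over.w u, ← Category.assoc, IsOpenImmersion.lift_fac, Over.w])

@[simp]
lemma openLift_comp {Y U X : Over k} (u : U ⟶ X) [IsOpenImmersion u.left] (f : Y ⟶ X)
    (h : Set.range f.left ⊆ Set.range u.left) : openLift u f h ≫ u = f := by
  ext1
  exact IsOpenImmersion.lift_fac _ _ _

lemma isOpenImmersion_openLift {Y U X : Over k} (u : U ⟶ X) [IsOpenImmersion u.left] (f : Y ⟶ X)
    (h : Set.range f.left ⊆ Set.range u.left) [IsOpenImmersion f.left] :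
    IsOpenImmersion (openLift u f h).left := by
  have : IsOpenImmersion ((openLift u f h).left ≫ u.left) := by
    rw [← Over.comp_left, openLift_comp]; infer_instance
  exact IsOpenImmersion.of_comp _ u.left

/-- Two open immersions with the same range have isomorphic sources. -/
def openIso {U U' X : Over k} (u : U ⟶ X) (u' : U' ⟶ X) [IsOpenImmersion u.left]
    [IsOpenImmersion u'.left] (h : Set.range u.left = Set.range u'.left) : U ≅ U' where
  hom := openLift u' u h.le
  inv := openLift u u' h.ge
  hom_inv_id := by
    have := mono_of_isOpenImmersion u
    rw [← cancel_mono u]; simp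
  inv_hom_id := by
    have := mono_of_isOpenImmersion u'
    rw [← cancel_mono u']; simp

@[simp] lemma coe_preim {Y X : Over k} (f : Y ⟶ X) (Z : Closeds X.left) :
    (preim f Z : Set Y.left) = f.left ⁻¹' (Z : Set X.left) := rfl

@[simp] lemma preim_top {Y X : Over k} (f : Y ⟶ X) : preim f ⊤ = ⊤ := rfl

@[simp] lemma preim_inf {Y X : Over k} (f : Y ⟶ X) (Z W : Closeds X.left) :
    preim f (Z ⊓ W) = preim f Z ⊓ preim f W := rfl

lemma preim_comp {Y' Y X : Over k} (g : Y' ⟶ Y) (f : Y ⟶ X) (Z : Closeds X.left) :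
    preim (g ≫ f) Z = preim g (preim f Z) := by
  ext x
  simp [preim]

@[simp] lemma preim_id {X : Over k} (Z : Closeds X.left) : preim (𝟙 X) Z = Z := by
  ext x
  simp [preim]

/-- The morphism `Y ∖ W ⟶ X ∖ Z` induced by `f : Y ⟶ X` with `f⁻¹ Z ⊆ W`. -/
def complMap {Y X : Over k} (f : Y ⟶ X) {Z : Closeds X.left} {W : Closeds Y.left}
    (h : f.left ⁻¹' (Z : Set X.left) ⊆ W) : compl Y W ⟶ compl X Z :=
  openLift (complι X Z) (complι Y W ≫ f) (by
    rw [range_complι]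
    rintro _ ⟨y, rfl⟩ hz
    have hy : (complι Y W).left y ∈ (W : Set Y.left) := h (by simpa using hz)
    have hy' := Set.mem_range_self (f := (complι Y W).left) y
    rw [range_complι] at hy'
    exact hy' hy)

@[simp]
lemma complMap_comp {Y X : Over k} (f : Y ⟶ X) {Z : Closeds X.left} {W : Closeds Y.left}
    (h : f.left ⁻¹' (Z : Set X.left) ⊆ W) : complMap f h ≫ complι X Z = complι Y W ≫ f :=
  openLift_comp _ _ _

lemma complMap_comp_assoc {Y X X' : Over k} (f : Y ⟶ X) {Z : Closeds X.left} {W : Closeds Y.left}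
    (h : f.left ⁻¹' (Z : Set X.left) ⊆ W) (g : X ⟶ X') :
    complMap f h ≫ complι X Z ≫ g = complι Y W ≫ f ≫ g := by
  rw [← Category.assoc, complMap_comp, Category.assoc]

namespace SchemeCategory

variable {V : SchemeCategory k}

lemma quasiCompact_left {X Y : Over k} (f : Y ⟶ X) (hY : V.Mem Y) (hX : V.Mem X) :
    QuasiCompact f.left := by
  have := V.compactSpace Y hY
  have := V.quasiSeparatedSpace X hX
  infer_instance

/-- Membership of the complement is quasi-compactness, as quasi-compact opens belong to `𝒱`. -/
lemma pair_iff {X : Over k} (hX : V.Mem X) (Z : Closeds X.left) :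
    V.Pair X Z ↔ IsCompact ((Z : Set X.left)ᶜ) := by
  constructor
  · intro h
    have := V.compactSpace _ h.2
    rw [← range_complι]
    exact isCompact_range (complι X Z).left.continuous
  · intro h
    refine ⟨hX, V.open_mem X _ (complι X Z) hX inferInstance ?_⟩
    rw [← isCompact_univ_iff, (complι X Z).left.isOpenEmbedding.isCompact_iff, Set.image_univ,
      range_complι]
    exact h

lemma mem_of_isIso {X Y : Over k} (f : Y ⟶ X) [IsIso f] (hX : V.Mem X) : V.Mem Y := by
  have := V.compactSpace X hX
  have : IsIso f.left := inferInstanceAs (IsIso ((Over.forget k).map f))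
  refine V.open_mem X Y f hX inferInstance ?_
  exact (Scheme.homeoOfIso (asIso f.left)).symm.compactSpace

lemma mem_open {X Y : Over k} (f : Y ⟶ X) [IsOpenImmersion f.left] (hX : V.Mem X)
    (h : IsCompact (Set.range f.left)) : V.Mem Y := by
  refine V.open_mem X Y f hX inferInstance ?_
  rwa [← isCompact_univ_iff, f.left.isOpenEmbedding.isCompact_iff, Set.image_univ]

lemma Pair.isCompact {X : Over k} {Z : Closeds X.left} (h : V.Pair X Z) :
    IsCompact ((Z : Set X.left)ᶜ) := (pair_iff h.1 Z).1 h

lemma pair_top {X : Over k} (hX : V.Mem X) : V.Pair X ⊤ := by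
  rw [pair_iff hX]; simp

lemma pair_bot {X : Over k} (hX : V.Mem X) : V.Pair X ⊥ := by
  have := V.compactSpace X hX
  rw [pair_iff hX]; simpa using isCompact_univ

lemma Pair.inf {X : Over k} {Z W : Closeds X.left} (hZ : V.Pair X Z) (hW : V.Pair X W) :
    V.Pair X (Z ⊓ W) := by
  rw [pair_iff hZ.1, Closeds.coe_inf, Set.compl_inter]
  exact hZ.isCompact.union hW.isCompact

lemma Pair.preim {X Y : Over k} (f : Y ⟶ X) (hY : V.Mem Y) {Z : Closeds X.left}
    (hZ : V.Pair X Z) : V.Pair Y (preim f Z) := by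
  rw [pair_iff hY]
  have := quasiCompact_left f hY hZ.1
  exact QuasiCompact.isCompact_preimage (f := f.left) _ Z.isClosed.isOpen_compl hZ.isCompact

end SchemeCategory

end Compl

end

section

/-! ### Pullbacks and supports -/

lemma preim_subset {k : Scheme.{u}} {Y X : Over k} (f : Y ⟶ X) (Z : Closeds X.left) :
    f.left ⁻¹' (Z : Set X.left) ⊆ (preim f Z : Set Y.left) := fun _ hx => hx

lemma id_subset {k : Scheme.{u}} {X : Over k} {Z W : Closeds X.left} (h : Z ≤ W) :
    (𝟙 X : X ⟶ X).left ⁻¹' (Z : Set X.left) ⊆ (W : Set X.left) := fun _ hx => h hx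

namespace CohomologyTheory

variable {k : Scheme.{u}} {V : SchemeCategory k} (A : CohomologyTheory.{u, w} V)

lemma pull_congr {X' X : Over k} {f g : X' ⟶ X} (e : f = g) {Z : Closeds X.left}
    {Z' : Closeds X'.left} (hf : f.left ⁻¹' (Z : Set X.left) ⊆ Z')
    (hg : g.left ⁻¹' (Z : Set X.left) ⊆ Z') (a : A.obj X Z) :
    A.pull f hf a = A.pull g hg a := by
  subst e; rfl

lemma comp_subset {X'' X' X : Over k} (g : X'' ⟶ X') (f : X' ⟶ X) {Z : Closeds X.left}
    {Z' : Closeds X'.left} {Z'' : Closeds X''.left} (hf : f.left ⁻¹' (Z : Set X.left) ⊆ Z')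
    (hg : g.left ⁻¹' (Z' : Set X'.left) ⊆ Z'') :
    (g ≫ f).left ⁻¹' (Z : Set X.left) ⊆ Z'' := fun x hx => hg (hf (by simpa using hx))

variable {A}

lemma pull_pull {X'' X' X : Over k} (g : X'' ⟶ X') (f : X' ⟶ X) {Z : Closeds X.left}
    {Z' : Closeds X'.left} {Z'' : Closeds X''.left}
    (hX : V.Pair X Z) (hX' : V.Pair X' Z') (hX'' : V.Pair X'' Z'')
    (hf : f.left ⁻¹' (Z : Set X.left) ⊆ Z') (hg : g.left ⁻¹' (Z' : Set X'.left) ⊆ Z'')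
    (a : A.obj X Z) :
    A.pull g hg (A.pull f hf a) = A.pull (g ≫ f) (comp_subset g f hf hg) a :=
  (A.pull_comp g f hX hX' hX'' hf hg _ a).symm

/-- Two composites of pullbacks along equal composite morphisms agree. -/
lemma pull_square {X'' X' X₁ X : Over k} {g : X'' ⟶ X'} {f : X' ⟶ X} {g₁ : X'' ⟶ X₁} {f₁ : X₁ ⟶ X}
    (e : g ≫ f = g₁ ≫ f₁)
    {Z : Closeds X.left} {Z' : Closeds X'.left} {Z₁ : Closeds X₁.left} {Z'' : Closeds X''.left}
    (hX : V.Pair X Z) (hX' : V.Pair X' Z') (hX₁ : V.Pair X₁ Z₁) (hX'' : V.Pair X'' Z'')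
    (hf : f.left ⁻¹' (Z : Set X.left) ⊆ Z') (hg : g.left ⁻¹' (Z' : Set X'.left) ⊆ Z'')
    (hf₁ : f₁.left ⁻¹' (Z : Set X.left) ⊆ Z₁) (hg₁ : g₁.left ⁻¹' (Z₁ : Set X₁.left) ⊆ Z'')
    (a : A.obj X Z) :
    A.pull g hg (A.pull f hf a) = A.pull g₁ hg₁ (A.pull f₁ hf₁ a) := by
  rw [pull_pull _ _ hX hX' hX'', pull_pull _ _ hX hX₁ hX'']
  exact A.pull_congr e _ _ a

lemma ext_eq_pull {X : Over k} {Z W : Closeds X.left} (h : Z ≤ W) :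
    A.ext h = A.pull (𝟙 X) (id_subset h) := rfl

lemma ext_self {X : Over k} {Z : Closeds X.left} (hX : V.Pair X Z) (h : Z ≤ Z) (a : A.obj X Z) :
    A.ext h a = a := A.pull_id hX _ a

lemma pull_eq_self {X : Over k} {f : X ⟶ X} (e : f = 𝟙 X) {Z : Closeds X.left} (hX : V.Pair X Z)
    (h : f.left ⁻¹' (Z : Set X.left) ⊆ Z) (a : A.obj X Z) : A.pull f h a = a := by
  subst e
  exact A.pull_id hX _ a

lemma pull_ext {X' X : Over k} (f : X' ⟶ X) {Z W : Closeds X.left} {Z' : Closeds X'.left}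
    (hZ : V.Pair X Z) (hW : V.Pair X W) (hZ' : V.Pair X' Z') (h : Z ≤ W)
    (hf : f.left ⁻¹' (W : Set X.left) ⊆ Z') (a : A.obj X Z) :
    A.pull f hf (A.ext h a) = A.pull f ((Set.preimage_mono h).trans hf) a := by
  rw [ext_eq_pull, pull_pull f _ hZ hW hZ']
  exact A.pull_congr (Category.comp_id f) _ _ a

lemma ext_pull {X' X : Over k} (f : X' ⟶ X) {Z : Closeds X.left} {Z' W' : Closeds X'.left}
    (hZ : V.Pair X Z) (hZ' : V.Pair X' Z') (hW' : V.Pair X' W') (h : Z' ≤ W')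
    (hf : f.left ⁻¹' (Z : Set X.left) ⊆ Z') (a : A.obj X Z) :
    A.ext h (A.pull f hf a) = A.pull f (hf.trans h) a := by
  rw [ext_eq_pull, pull_pull _ f hZ hZ' hW']
  exact A.pull_congr (Category.id_comp f) _ _ a

lemma ext_ext {X : Over k} {Z W Y : Closeds X.left}
    (hZ : V.Pair X Z) (hW : V.Pair X W) (hY : V.Pair X Y) (h : Z ≤ W) (h' : W ≤ Y)
    (a : A.obj X Z) : A.ext h' (A.ext h a) = A.ext (h.trans h') a :=
  ext_pull _ hZ hW hY h' _ a

lemma ext_bijective {X : Over k} {Z W : Closeds X.left} (hZ : V.Pair X Z) (e : Z = W) (h : Z ≤ W) :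
    Function.Bijective (A.ext h) := by
  subst e
  have : A.ext h = AddMonoidHom.id _ := by ext a; exact ext_self hZ h a
  rw [this]
  exact Function.bijective_id

lemma pull_bijective_of_isIso {X' X : Over k} (f : X' ⟶ X) [IsIso f] {Z : Closeds X.left}
    {Z' : Closeds X'.left} (hX : V.Pair X Z) (e : preim f Z = Z')
    (h : f.left ⁻¹' (Z : Set X.left) ⊆ Z') : Function.Bijective (A.pull f h) := by
  subst e
  have hX' : V.Pair X' (preim f Z) := hX.preim f (SchemeCategory.mem_of_isIso f hX.1)
  have h' : (inv f).left ⁻¹' (preim f Z : Set X'.left) ⊆ Z := by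
    rw [← coe_preim, ← preim_comp, IsIso.inv_hom_id, preim_id]
  refine Function.bijective_iff_has_inverse.2 ⟨A.pull (inv f) h', fun a => ?_, fun a => ?_⟩
  · rw [pull_pull _ _ hX hX' hX]
    exact pull_eq_self (by simp) hX _ a
  · rw [pull_pull _ _ hX' hX hX']
    exact pull_eq_self (by simp) hX' _ a

/-- Excision for open immersions. -/
lemma pull_bijective_of_isOpenImmersion {X' X : Over k} (f : X' ⟶ X) [IsOpenImmersion f.left]
    {Z : Closeds X.left} {Z' : Closeds X'.left} (hX : V.Pair X Z) (hX' : V.Mem X')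
    (e : preim f Z = Z') (hr : (Z : Set X.left) ⊆ Set.range f.left)
    (h : f.left ⁻¹' (Z : Set X.left) ⊆ Z') : Function.Bijective (A.pull f h) := by
  subst e
  obtain ⟨g, hg, hgf⟩ := exists_vanishingIdeal_subscheme_isIso f.left (Z' := preim f Z) rfl hr
  exact A.excision f hX (hX.preim f hX') inferInstance rfl g hg hgf

/-- Restriction to `X ∖ ∅` is an isomorphism, so exactness on both sides gives `A_∅(X) = 0`. -/
lemma subsingleton_obj_bot {X : Over k} (hX : V.Mem X) : Subsingleton (A.obj X ⊥) := by
  have hb := SchemeCategory.pair_bot hX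
  have ht := SchemeCategory.pair_top hX
  have : IsIso (complι X ⊥).left := by
    rw [isIso_iff_isOpenImmersion_and_epi_base, TopCat.epi_iff_surjective]
    refine ⟨inferInstance, ?_⟩
    rw [← Set.range_eq_univ]
    simpa using range_complι X ⊥
  have : IsIso (complι X ⊥) := by
    have : IsIso ((Over.forget k).map (complι X ⊥)) := this
    exact isIso_of_reflects_iso _ (Over.forget k)
  have hbij : Function.Bijective (A.pull (complι X ⊥) (Z := ⊤) (Z' := ⊤) (subset_top _)) :=
    pull_bijective_of_isIso _ ht rfl _
  refine ⟨fun a b => ?_⟩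
  have key : ∀ a : A.obj X ⊥, a = 0 := by
    intro a
    have h1 := (A.exact_ext_restrict hb).apply_apply_eq_zero a
    rw [map_eq_zero_iff _ hbij.1] at h1
    obtain ⟨y, rfl⟩ := (A.exact_bdry_ext hb a).1 h1
    exact (A.exact_restrict_bdry hb y).2 (hbij.2 y)
  rw [key a, key b]

lemma obj_eq_zero_of_eq_bot {X : Over k} (hX : V.Mem X) {Z : Closeds X.left} (e : Z = ⊥)
    (a : A.obj X Z) : a = 0 := by
  subst e
  exact (subsingleton_obj_bot hX).elim a 0

/-! ### The localization sequence of a triple -/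

section Triple

variable {X : Over k} {Z N : Closeds X.left}

/-- For `Z ⊆ N` the boundary map of `(X, N)`, restricted to `X ∖ Z`, is the boundary map of
`(X ∖ Z, N ∖ Z)`. -/
lemma pull_complι_bdry (hZ : V.Pair X Z) (hN : V.Pair X N) (y : A.obj (compl X N) ⊤) :
    A.pull (complι X Z) (Z' := preim (complι X Z) N) (preim_subset _ _) (A.bdry X N y) =
      A.bdry _ (preim (complι X Z) N) (A.pullTop (complMap (complι X Z) (preim_subset _ _)) y) :=
  A.bdry_natural _ hN (hN.preim _ hZ.2) _ _ (complMap_comp _ _) y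

/-- Exactness of `A_Z(X) ⟶ A_N(X) ⟶ A_{N ∖ Z}(X ∖ Z)` in the middle, for `Z ⊆ N`. It follows from
the localization sequences of `(X, Z)`, `(X, N)` and `(X ∖ Z, N ∖ Z)`. -/
lemma triple_exact (hZ : V.Pair X Z) (hN : V.Pair X N) (hZN : Z ≤ N) (c : A.obj X N)
    (hc : A.pull (complι X Z) (Z' := preim (complι X Z) N) (preim_subset _ _) c = 0) :
    ∃ z, A.ext hZN z = c := by
  have hX := SchemeCategory.pair_top hZ.1
  have hU := SchemeCategory.pair_top hZ.2
  have hNU := hN.preim (complι X Z) hZ.2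
  have h1 : A.pull (complι X Z) (Z := ⊤) (Z' := ⊤) (subset_top _) (A.ext le_top c) = 0 := by
    rw [pull_ext _ hN hX hU, ← A.ext_pull _ hN hNU hU le_top (preim_subset _ _), hc, map_zero]
  obtain ⟨d, hd⟩ := (A.exact_ext_restrict hZ _).1 h1
  have hd' : A.ext (le_top : Z ≤ ⊤) d = A.ext le_top c := hd
  have h2 : A.pull (𝟙 X) (Z := N) (Z' := ⊤) (subset_top _) (c - A.ext hZN d) = 0 := by
    change A.ext le_top _ = 0
    rw [map_sub, ext_ext hZ hN hX, hd', sub_self]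
  obtain ⟨y, hy⟩ := (A.exact_bdry_ext hN _).1 h2
  -- `d` restricts to zero on `X ∖ Z`
  have h3 : A.pull (complι X Z) (Z' := preim (complι X Z) N) (preim_subset _ _) (A.ext hZN d) =
    0 := by
    rw [pull_ext _ hZ hN hNU]
    have e : preim (complι X Z) Z = ⊥ := by
      ext x
      have hx := Set.mem_range_self (f := (complι X Z).left) x
      rw [range_complι] at hx
      simpa using hx
    have h4 := obj_eq_zero_of_eq_bot hZ.2 e (A.pull (complι X Z) (preim_subset _ _) d)
    rw [← A.ext_pull _ hZ (hZ.preim _ hZ.2) hNU (fun x hx => hZN hx) (preim_subset _ _), h4,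
      map_zero]
  have h5 := congrArg (A.pull (complι X Z) (Z' := preim (complι X Z) N) (preim_subset _ _)) hy
  rw [pull_complι_bdry hZ hN, map_sub, hc, h3, sub_zero] at h5
  obtain ⟨w, hw⟩ := (A.exact_restrict_bdry hNU _).1 h5
  refine ⟨d + A.bdry X Z w, ?_⟩
  have h6 : A.ext hZN (A.bdry X Z w) = A.bdry X N y := by
    have hg : complMap (𝟙 X) (Z := Z) (W := N) (id_subset hZN) ≫ complι X Z =
      complι X N ≫ 𝟙 X := complMap_comp _ _
    rw [ext_eq_pull, A.bdry_natural (𝟙 X) hZ hN _ _ hg w]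
    congr 1
    have hNc := SchemeCategory.pair_top hN.2
    -- compare on `(X ∖ Z) ∖ (N ∖ Z)`, which is isomorphic to `X ∖ N`
    let φ : compl (compl X Z) (preim (complι X Z) N) ⟶ compl X N :=
      complMap (complι X Z) (preim_subset _ _)
    have hr : Set.range ((complι _ (preim (complι X Z) N)) ≫ complι X Z).left =
        Set.range (complι X N).left := by
      rw [range_complι]
      ext x
      constructor
      · rintro ⟨x, rfl⟩
        have := Set.mem_range_self (f := (complι _ (preim (complι X Z) N)).left) x
        rw [range_complι] at this
        simpa using this
      · intro hx
        have hxZ : x ∈ Set.range (complι X Z).left := by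
          rw [range_complι]; exact fun h => hx (hZN h)
        obtain ⟨x, rfl⟩ := hxZ
        have : x ∈ Set.range (complι _ (preim (complι X Z) N)).left := by
          rw [range_complι]; exact hx
        obtain ⟨x, rfl⟩ := this
        exact ⟨x, by simp⟩
    have : IsOpenImmersion ((complι _ (preim (complι X Z) N)) ≫ complι X Z).left := by
      rw [Over.comp_left]; infer_instance
    have hφ : φ = (openIso ((complι _ (preim (complι X Z) N)) ≫ complι X Z) (complι X N)
      hr).hom := by
      rw [← cancel_mono (complι X N)]
      simp [φ, openIso]
    have : IsIso φ := by rw [hφ]; infer_instance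
    have hbij : Function.Bijective (A.pull φ (Z := ⊤) (Z' := ⊤) (subset_top _)) :=
      pull_bijective_of_isIso _ hNc rfl _
    apply hbij.1
    rw [pull_pull _ _ hU hNc (SchemeCategory.pair_top hNU.2)]
    refine Eq.trans ?_ hw
    apply A.pull_congr
    rw [← cancel_mono (complι X Z), Category.assoc, hg, Category.comp_id]
    exact complMap_comp _ _
  rw [map_add, h6, hy]
  abel

/-- Exactness of the sequence of a triple `Z ⊆ N` at `A_Z(X)`, in a form which avoids the boundary
map `A_{N ∖ Z}(X ∖ Z) ⟶ A_Z(X)` of the triple. -/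
lemma triple_injective (hZ : V.Pair X Z) (hN : V.Pair X N) (hZN : Z ≤ N)
    (hs : Function.Surjective (A.pull (complι X Z) (Z := N) (Z' := preim (complι X Z) N)
      (preim_subset _ _))) :
    Function.Injective (A.ext hZN) := by
  have hX := SchemeCategory.pair_top hZ.1
  have hU := SchemeCategory.pair_top hZ.2
  have hNU := hN.preim (complι X Z) hZ.2
  have hNc := SchemeCategory.pair_top hN.2
  rw [injective_iff_map_eq_zero]
  intro x hx
  have h1 : A.pull (𝟙 X) (Z := Z) (Z' := ⊤) (subset_top _) x = 0 := by
    have := congrArg (A.ext (le_top : N ≤ ⊤)) hx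
    rwa [ext_ext hZ hN hX, map_zero] at this
  obtain ⟨y, rfl⟩ := (A.exact_bdry_ext hZ _).1 h1
  have hg : complMap (𝟙 X) (Z := Z) (W := N) (id_subset hZN) ≫ complι X Z =
      complι X N ≫ 𝟙 X := complMap_comp _ _
  have h2 := A.bdry_natural (𝟙 X) hZ hN (id_subset hZN) _ hg y
  rw [← ext_eq_pull hZN, hx] at h2
  obtain ⟨v, hv⟩ := (A.exact_restrict_bdry hN _).1 h2.symm
  -- after subtracting a global class, `y` comes from classes supported on `N ∖ Z`
  have h3 : A.pull (complι _ (preim (complι X Z) N)) (Z := ⊤) (Z' := ⊤) (subset_top _)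
      (y - A.pull (complι X Z) (Z := ⊤) (Z' := ⊤) (subset_top _) v) = 0 := by
    have e : complι _ (preim (complι X Z) N) = complMap (complι X Z) (Z := N) (preim_subset _ _) ≫
        complMap (𝟙 X) (Z := Z) (W := N) (id_subset hZN) := by
      rw [← cancel_mono (complι X Z), Category.assoc, hg, Category.comp_id]
      exact (complMap_comp _ _).symm
    rw [map_sub, A.pull_congr e _ (subset_top _),
      ← A.pull_pull _ _ hU hNc (SchemeCategory.pair_top hNU.2) (subset_top _) (subset_top _), ← hv,
      sub_eq_zero]
    exact pull_square (complMap_comp _ _) hX hNc hU (SchemeCategory.pair_top hNU.2) _ _ _ _ v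
  obtain ⟨c, hc⟩ := (A.exact_ext_restrict hNU _).1 h3
  obtain ⟨c', rfl⟩ := hs c
  have h4 : y = A.pull (complι X Z) (Z := ⊤) (Z' := ⊤) (subset_top _) (v + A.ext le_top c') := by
    rw [map_add, pull_ext _ hN hX hU, ← A.ext_pull _ hN hNU hU le_top (preim_subset _ _)]
    rw [← sub_eq_iff_eq_add']
    exact hc.symm
  rw [h4]
  exact (A.exact_restrict_bdry hZ).apply_apply_eq_zero _

end Triple

end CohomologyTheory

end

section

/-! ### Products with supports -/

namespace RingCohomologyTheory

open CohomologyTheory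

variable {k : Scheme.{u}} {V : SchemeCategory k} (A : RingCohomologyTheory.{u, w} V)

/-- The cup product `A_Z(X) × A_W(X) ⟶ A_K(X)`, for any `K` containing `Z ∩ W`. -/
def mul {X : Over k} {Z W K : Closeds X.left} (h : Z ⊓ W ≤ K) :
    A.obj X Z →+ A.obj X W →+ A.obj X K :=
  (AddMonoidHom.compHom (A.ext h)).comp (A.cup Z W)

lemma mul_def {X : Over k} {Z W K : Closeds X.left} (h : Z ⊓ W ≤ K) (a : A.obj X Z)
    (b : A.obj X W) : A.mul h a b = A.ext h (A.cup Z W a b) := rfl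

lemma lact_eq_mul {X : Over k} {Z : Closeds X.left} (a : A.obj X ⊤) (b : A.obj X Z) :
    A.lact a b = A.mul inf_le_right a b := rfl

lemma ract_eq_mul {X : Over k} {Z : Closeds X.left} (b : A.obj X Z) (a : A.obj X ⊤) :
    A.ract b a = A.mul inf_le_left b a := rfl

variable {A}

lemma pull_mul {X' X : Over k} (f : X' ⟶ X) {Z W K : Closeds X.left} {Z' W' K' : Closeds X'.left}
    (pZ : V.Pair X Z) (pW : V.Pair X W) (pK : V.Pair X K)
    (pZ' : V.Pair X' Z') (pW' : V.Pair X' W') (pK' : V.Pair X' K')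
    (hZ : f.left ⁻¹' (Z : Set X.left) ⊆ Z') (hW : f.left ⁻¹' (W : Set X.left) ⊆ W')
    (hK : f.left ⁻¹' (K : Set X.left) ⊆ K') (h : Z ⊓ W ≤ K) (h' : Z' ⊓ W' ≤ K')
    (a : A.obj X Z) (b : A.obj X W) :
    A.pull f hK (A.mul h a b) = A.mul h' (A.pull f hZ a) (A.pull f hW b) := by
  rw [mul_def, mul_def, pull_ext f (pZ.inf pW) pK pK', ← A.pull_cup f pZ pW pZ' pW' hZ hW,
    ext_pull f (pZ.inf pW) (pZ'.inf pW') pK']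

lemma ext_mul {X : Over k} {Z W K Z' W' K' : Closeds X.left}
    (pZ : V.Pair X Z) (pW : V.Pair X W) (pK : V.Pair X K)
    (pZ' : V.Pair X Z') (pW' : V.Pair X W') (pK' : V.Pair X K')
    (hZ : Z ≤ Z') (hW : W ≤ W') (hK : K ≤ K') (h : Z ⊓ W ≤ K) (h' : Z' ⊓ W' ≤ K')
    (a : A.obj X Z) (b : A.obj X W) :
    A.ext hK (A.mul h a b) = A.mul h' (A.ext hZ a) (A.ext hW b) :=
  pull_mul (𝟙 X) pZ pW pK pZ' pW' pK' (id_subset hZ) (id_subset hW) (id_subset hK) h h' a b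

lemma mul_assoc {X : Over k} {Z W Y K₁ K₂ K : Closeds X.left}
    (pZ : V.Pair X Z) (pW : V.Pair X W) (pY : V.Pair X Y)
    (pK₁ : V.Pair X K₁) (pK₂ : V.Pair X K₂) (pK : V.Pair X K)
    (h₁ : Z ⊓ W ≤ K₁) (h₂ : K₁ ⊓ Y ≤ K) (h₃ : W ⊓ Y ≤ K₂) (h₄ : Z ⊓ K₂ ≤ K)
    (a : A.obj X Z) (b : A.obj X W) (c : A.obj X Y) :
    A.mul h₂ (A.mul h₁ a b) c = A.mul h₄ a (A.mul h₃ b c) := by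
  have pZW := pZ.inf pW
  have pWY := pW.inf pY
  have e1 : A.mul h₂ (A.mul h₁ a b) c =
      A.mul ((inf_le_inf_right Y h₁).trans h₂) (A.cup Z W a b) c := by
    have := ext_mul (A := A) pZW pY pK pK₁ pY pK h₁ le_rfl le_rfl
      ((inf_le_inf_right Y h₁).trans h₂) h₂ (A.cup Z W a b) c
    rwa [ext_self pK, ext_self pY, eq_comm] at this
  have e2 : A.mul h₄ a (A.mul h₃ b c) =
      A.mul ((inf_le_inf_left Z h₃).trans h₄) a (A.cup W Y b c) := by
    have := ext_mul (A := A) pZ pWY pK pZ pK₂ pK le_rfl h₃ le_rfl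
      ((inf_le_inf_left Z h₃).trans h₄) h₄ a (A.cup W Y b c)
    rwa [ext_self pK, ext_self pZ, eq_comm] at this
  rw [e1, e2, mul_def, mul_def, ← A.cup_assoc pZ pW pY,
    ext_ext (pZW.inf pY) (pZ.inf pWY) pK]

lemma unit_mul {X : Over k} {Z K : Closeds X.left} (pZ : V.Pair X Z) (pK : V.Pair X K)
    (h : ⊤ ⊓ Z ≤ K) (a : A.obj X Z) :
    A.mul h (A.unit X) a = A.ext ((le_inf le_top le_rfl).trans h) a := by
  conv_rhs => rw [← A.one_cup pZ a]
  rw [ext_ext ((SchemeCategory.pair_top pZ.1).inf pZ) pZ pK]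
  rfl

lemma mul_unit {X : Over k} {Z K : Closeds X.left} (pZ : V.Pair X Z) (pK : V.Pair X K)
    (h : Z ⊓ ⊤ ≤ K) (a : A.obj X Z) :
    A.mul h a (A.unit X) = A.ext ((le_inf le_rfl le_top).trans h) a := by
  conv_rhs => rw [← A.cup_one pZ a]
  rw [ext_ext (pZ.inf (SchemeCategory.pair_top pZ.1)) pZ pK]
  rfl

lemma pullTop_unit {X' X : Over k} (f : X' ⟶ X) (hX : V.Mem X) (hX' : V.Mem X') :
    A.pullTop f (A.unit X) = A.unit X' := by
  have hk := SchemeCategory.pair_top V.base_mem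
  unfold unit
  rw [CohomologyTheory.pullTop, CohomologyTheory.pullTop, CohomologyTheory.pullTop,
    pull_pull _ _ hk (SchemeCategory.pair_top hX) (SchemeCategory.pair_top hX')]
  exact A.pull_congr (Over.mkIdTerminal.hom_ext _ _) _ _ _

lemma bdry_mul {X : Over k} {Z : Closeds X.left} (pZ : V.Pair X Z) (a : A.obj (compl X Z) ⊤)
    (b : A.obj X ⊤) :
    A.bdry X Z (A.mul inf_le_left a (A.pullTop (complι X Z) b)) =
      A.mul inf_le_left (A.bdry X Z a) b :=
  A.bdry_cup pZ a b

/-! ### Sums of products with fixed classes -/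

variable {ι : Type*} [Fintype ι]

variable (A) in
/-- For `q : Y ⟶ X` with `q⁻¹(Z) ⊆ Z'` and classes `t i ∈ A(Y)` the map
`A_Z(X) ^ ι ⟶ A_{Z'}(Y)`, `a ↦ ∑ q^A(a i) ∪ t i`. -/
def sumMap {Y X : Over k} (q : Y ⟶ X) (t : ι → A.obj Y ⊤) {Z : Closeds X.left}
    {Z' : Closeds Y.left} (h : q.left ⁻¹' (Z : Set X.left) ⊆ Z') :
    (ι → A.obj X Z) →+ A.obj Y Z' where
  toFun a := ∑ i, A.mul inf_le_left (A.pull q h (a i)) (t i)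
  map_zero' := by simp
  map_add' a b := by simp [Finset.sum_add_distrib]

variable (A) in
/-- The map `A(X) ^ ι ⟶ A(Y)`, `a ↦ ∑ q^A(a i) ∪ t i`. -/
abbrev sumMapTop {Y X : Over k} (q : Y ⟶ X) (t : ι → A.obj Y ⊤) :
    (ι → A.obj X ⊤) →+ A.obj Y ⊤ := A.sumMap q t (subset_top _)

lemma sumMap_apply {Y X : Over k} (q : Y ⟶ X) (t : ι → A.obj Y ⊤) {Z : Closeds X.left}
    {Z' : Closeds Y.left} (h : q.left ⁻¹' (Z : Set X.left) ⊆ Z') (a : ι → A.obj X Z) :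
    A.sumMap q t h a = ∑ i, A.mul inf_le_left (A.pull q h (a i)) (t i) := rfl

lemma pull_sumMap {Y X B C : Over k} {q : Y ⟶ X} {b : B ⟶ X} {c : C ⟶ Y} {q' : C ⟶ B}
    (e : c ≫ q = q' ≫ b) (t : ι → A.obj Y ⊤)
    {Z : Closeds X.left} {Z' : Closeds B.left} {W : Closeds Y.left} {W' : Closeds C.left}
    (pZ : V.Pair X Z) (pZ' : V.Pair B Z') (pY : V.Pair Y W) (pC : V.Pair C W')
    (hW : q.left ⁻¹' (Z : Set X.left) ⊆ W) (hW' : q'.left ⁻¹' (Z' : Set B.left) ⊆ W')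
    (hb : b.left ⁻¹' (Z : Set X.left) ⊆ Z') (hc : c.left ⁻¹' (W : Set Y.left) ⊆ W')
    (a : ι → A.obj X Z) :
    A.pull c hc (A.sumMap q t hW a) =
      A.sumMap q' (fun i => A.pullTop c (t i)) hW' (fun i => A.pull b hb (a i)) := by
  have pYt := SchemeCategory.pair_top pY.1
  have pCt := SchemeCategory.pair_top pC.1
  rw [sumMap_apply, sumMap_apply, map_sum]
  refine Finset.sum_congr rfl fun i _ => ?_
  rw [pull_mul c pY pYt pY pC pCt pC hc (subset_top _) hc inf_le_left inf_le_left,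
    pull_square e pZ pY pZ' pC _ _ hb hW']
  rfl

lemma sumMap_bdry {Y X : Over k} (q : Y ⟶ X) (hY : V.Mem Y) (t : ι → A.obj Y ⊤)
    {Z : Closeds X.left} (pZ : V.Pair X Z) (a : ι → A.obj (compl X Z) ⊤) :
    A.bdry Y (preim q Z) (A.sumMapTop (complMap q (preim_subset q Z))
      (fun i => A.pullTop (complι Y (preim q Z)) (t i)) a) =
      A.sumMap q t (preim_subset q Z) (fun i => A.bdry X Z (a i)) := by
  have pY := pZ.preim q hY
  rw [sumMap_apply, sumMap_apply, map_sum]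
  refine Finset.sum_congr rfl fun i _ => ?_
  rw [A.bdry_natural q pZ pY _ _ (complMap_comp _ _)]
  exact bdry_mul pY _ _

lemma exact_pi {ι : Type*} {M N P : Type*} [AddCommGroup M] [AddCommGroup N] [AddCommGroup P]
    {f : M →+ N} {g : N →+ P} (h : Function.Exact f g) :
    Function.Exact (f.compLeft ι) (g.compLeft ι) := by
  intro a
  constructor
  · intro ha
    choose b hb using fun i => (h (a i)).1 (congrFun ha i)
    exact ⟨b, funext hb⟩
  · rintro ⟨b, rfl⟩
    exact funext fun i => h.apply_apply_eq_zero (b i)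

section FiveLemma

variable {Y X : Over k} (q : Y ⟶ X) {Z : Closeds X.left}

lemma sumMap_ext (hY : V.Mem Y) (t : ι → A.obj Y ⊤) (pZ : V.Pair X Z)
    (a : ι → A.obj X Z) :
    A.pull (𝟙 Y) (Z := preim q Z) (Z' := ⊤) (subset_top _) (A.sumMap q t (preim_subset q Z) a) =
      A.sumMapTop q t (fun i => A.pull (𝟙 X) (Z := Z) (Z' := ⊤) (subset_top _) (a i)) := by
  have h := pull_sumMap (A := A) (q := q) (b := 𝟙 X) (c := 𝟙 Y) (q' := q) (by simp) t pZ
    (SchemeCategory.pair_top pZ.1) (pZ.preim q hY) (SchemeCategory.pair_top hY) (preim_subset q Z)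
    (subset_top _) (subset_top _) (subset_top _) a
  refine h.trans ?_
  congr 1
  congr 1
  funext i
  exact A.pull_id (SchemeCategory.pair_top hY) _ _

lemma sumMap_restrict (hY : V.Mem Y) (t : ι → A.obj Y ⊤) (pZ : V.Pair X Z)
    (a : ι → A.obj X ⊤) :
    A.pull (complι Y (preim q Z)) (Z := ⊤) (Z' := ⊤) (subset_top _) (A.sumMapTop q t a) =
      A.sumMapTop (complMap q (preim_subset q Z))
        (fun i => A.pullTop (complι Y (preim q Z)) (t i))
        (fun i => A.pull (complι X Z) (Z := ⊤) (Z' := ⊤) (subset_top _) (a i)) :=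
  pull_sumMap (complMap_comp _ _).symm t (SchemeCategory.pair_top pZ.1)
    (SchemeCategory.pair_top pZ.2) (SchemeCategory.pair_top hY)
    (SchemeCategory.pair_top (pZ.preim q hY).2) _ _ _ _ a

/-- The five lemma: bijectivity on `X` and on `X ∖ Z` implies bijectivity with support in `Z`. -/
lemma sumMap_bijective_of_compl (hY : V.Mem Y) (t : ι → A.obj Y ⊤) (pZ : V.Pair X Z)
    (h : Function.Bijective (A.sumMapTop q t))
    (h' : Function.Bijective (A.sumMapTop (complMap q (preim_subset q Z))
      (fun i => A.pullTop (complι Y (preim q Z)) (t i)))) :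
    Function.Bijective (A.sumMap q t (preim_subset q Z)) := by
  have pY := pZ.preim q hY
  exact AddMonoidHom.bijective_of_surjective_of_bijective_of_bijective_of_injective
    (AddMonoidHom.compLeft (A.pull (complι X Z) (Z := ⊤) (Z' := ⊤) (subset_top _)) ι)
    (AddMonoidHom.compLeft (A.bdry X Z) ι)
    (AddMonoidHom.compLeft (A.pull (𝟙 X) (Z := Z) (Z' := ⊤) (subset_top _)) ι)
    (AddMonoidHom.compLeft (A.pull (complι X Z) (Z := ⊤) (Z' := ⊤) (subset_top _)) ι)
    (A.pull (complι Y (preim q Z)) (Z := ⊤) (Z' := ⊤) (subset_top _))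
    (A.bdry Y (preim q Z))
    (A.pull (𝟙 Y) (Z := preim q Z) (Z' := ⊤) (subset_top _))
    (A.pull (complι Y (preim q Z)) (Z := ⊤) (Z' := ⊤) (subset_top _))
    _ _ _ _ _
    (AddMonoidHom.ext fun a => sumMap_restrict q hY t pZ a)
    (AddMonoidHom.ext fun a => sumMap_bdry q hY t pZ a)
    (AddMonoidHom.ext fun a => sumMap_ext q hY t pZ a)
    (AddMonoidHom.ext fun a => sumMap_restrict q hY t pZ a)
    (exact_pi (A.exact_restrict_bdry pZ)) (exact_pi (A.exact_bdry_ext pZ))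
    (exact_pi (A.exact_ext_restrict pZ)) (A.exact_restrict_bdry pY) (A.exact_bdry_ext pY)
    (A.exact_ext_restrict pY) h.2 h' h h'.1

/-- The five lemma: bijectivity with support in `Z` and on `X ∖ Z` implies bijectivity on `X`. -/
lemma sumMap_bijective_of_support (hY : V.Mem Y) (t : ι → A.obj Y ⊤) (pZ : V.Pair X Z)
    (h : Function.Bijective (A.sumMap q t (preim_subset q Z)))
    (h' : Function.Bijective (A.sumMapTop (complMap q (preim_subset q Z))
      (fun i => A.pullTop (complι Y (preim q Z)) (t i)))) :
    Function.Bijective (A.sumMapTop q t) := by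
  have pY := pZ.preim q hY
  exact AddMonoidHom.bijective_of_surjective_of_bijective_of_bijective_of_injective
    (AddMonoidHom.compLeft (A.bdry X Z) ι)
    (AddMonoidHom.compLeft (A.pull (𝟙 X) (Z := Z) (Z' := ⊤) (subset_top _)) ι)
    (AddMonoidHom.compLeft (A.pull (complι X Z) (Z := ⊤) (Z' := ⊤) (subset_top _)) ι)
    (AddMonoidHom.compLeft (A.bdry X Z) ι)
    (A.bdry Y (preim q Z))
    (A.pull (𝟙 Y) (Z := preim q Z) (Z' := ⊤) (subset_top _))
    (A.pull (complι Y (preim q Z)) (Z := ⊤) (Z' := ⊤) (subset_top _))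
    (A.bdry Y (preim q Z))
    _ _ _ _ _
    (AddMonoidHom.ext fun a => sumMap_bdry q hY t pZ a)
    (AddMonoidHom.ext fun a => sumMap_ext q hY t pZ a)
    (AddMonoidHom.ext fun a => sumMap_restrict q hY t pZ a)
    (AddMonoidHom.ext fun a => sumMap_bdry q hY t pZ a)
    (exact_pi (A.exact_bdry_ext pZ)) (exact_pi (A.exact_ext_restrict pZ))
    (exact_pi (A.exact_restrict_bdry pZ)) (A.exact_bdry_ext pY) (A.exact_ext_restrict pY)
    (A.exact_restrict_bdry pY) h'.2 h h' h.1

end FiveLemma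

/-- Comparison of the maps for `q` and `q'` along pullbacks which are isomorphisms on source and
target. -/
lemma sumMap_bijective_iff {Y X B C : Over k} {q : Y ⟶ X} {b : B ⟶ X} {c : C ⟶ Y} {q' : C ⟶ B}
    (e : c ≫ q = q' ≫ b) (t : ι → A.obj Y ⊤)
    {Z : Closeds X.left} {Z' : Closeds B.left} {W : Closeds Y.left} {W' : Closeds C.left}
    (pZ : V.Pair X Z) (pZ' : V.Pair B Z') (pY : V.Pair Y W) (pC : V.Pair C W')
    (hW : q.left ⁻¹' (Z : Set X.left) ⊆ W) (hW' : q'.left ⁻¹' (Z' : Set B.left) ⊆ W')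
    (hb : b.left ⁻¹' (Z : Set X.left) ⊆ Z') (hc : c.left ⁻¹' (W : Set Y.left) ⊆ W')
    (hb' : Function.Bijective (A.pull b hb)) (hc' : Function.Bijective (A.pull c hc)) :
    Function.Bijective (A.sumMap q t hW) ↔
      Function.Bijective (A.sumMap q' (fun i => A.pullTop c (t i)) hW') := by
  have h1 : (A.pull c hc) ∘ (A.sumMap q t hW) =
      (A.sumMap q' (fun i => A.pullTop c (t i)) hW') ∘ (fun a i => A.pull b hb (a i)) :=
    funext fun a => pull_sumMap e t pZ pZ' pY pC hW hW' hb hc a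
  have h2 : Function.Bijective (fun (a : ι → A.obj X Z) i => A.pull b hb (a i)) :=
    Function.Bijective.piMap fun _ => hb'
  rw [← Function.Bijective.of_comp_iff' hc', h1, Function.Bijective.of_comp_iff _ h2]

/-! ### Locality on the base -/

/-- Bijectivity of `sumMap` over the open subscheme of `X` with underlying set `W`. -/
def SumMapBijectiveOver {Y X : Over k} (q : Y ⟶ X) (t : ι → A.obj Y ⊤) (W : Set X.left) : Prop :=
  ∀ (B C : Over k) (b : B ⟶ X) (c : C ⟶ Y) (q' : C ⟶ B), IsOpenImmersion b.left →
    IsOpenImmersion c.left → c ≫ q = q' ≫ b → Set.range b.left = W →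
    Set.range c.left = q.left ⁻¹' W →
    Function.Bijective (A.sumMapTop q' (fun i => A.pullTop c (t i)))

lemma pullTop_pullTop {X'' X' X : Over k} (g : X'' ⟶ X') (f : X' ⟶ X) (hX : V.Mem X)
    (hX' : V.Mem X') (hX'' : V.Mem X'') (a : A.obj X ⊤) :
    A.pullTop g (A.pullTop f a) = A.pullTop (g ≫ f) a :=
  pull_pull g f (SchemeCategory.pair_top hX) (SchemeCategory.pair_top hX')
    (SchemeCategory.pair_top hX'') _ _ a

/-- The condition does not depend on the models of the open subset and its inverse image. -/
lemma SumMapBijectiveOver.of_exists {Y X B C : Over k} {q : Y ⟶ X} {t : ι → A.obj Y ⊤}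
    {W : Set X.left} {b : B ⟶ X} [IsOpenImmersion b.left]
    (hY : V.Mem Y) (hC : V.Mem C) (hB : V.Mem B)
    {c : C ⟶ Y} {q' : C ⟶ B} [IsOpenImmersion c.left] (e : c ≫ q = q' ≫ b)
    (hb : Set.range b.left = W) (hr : Set.range c.left = q.left ⁻¹' W)
    (h : Function.Bijective (A.sumMapTop q' (fun i => A.pullTop c (t i)))) :
    SumMapBijectiveOver q t W := by
  intro B' C' b' c' q'' hb'o hc' e' hb' hr'
  let β := openIso b' b (hb'.trans hb.symm)
  let γ := openIso c' c (by rw [hr, hr'])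
  have hγ : γ.hom ≫ c = c' := openLift_comp _ _ _
  have hβ : β.hom ≫ b = b' := openLift_comp _ _ _
  have hC' : V.Mem C' := SchemeCategory.mem_of_isIso γ.hom hC
  have hB' : V.Mem B' := SchemeCategory.mem_of_isIso β.hom hB
  have pC := SchemeCategory.pair_top hC
  have pB := SchemeCategory.pair_top hB
  have e'' : γ.hom ≫ q' = q'' ≫ β.hom := by
    have := mono_of_isOpenImmersion b
    rw [← cancel_mono b, Category.assoc, ← e, ← Category.assoc, hγ, e', Category.assoc, hβ]
  have := (sumMap_bijective_iff e'' (fun i => A.pullTop c (t i)) pB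
    (SchemeCategory.pair_top hB') pC (SchemeCategory.pair_top hC') (subset_top _) (subset_top _)
    (subset_top _) (subset_top _)
    (pull_bijective_of_isIso _ pB rfl _) (pull_bijective_of_isIso _ pC rfl _)).1 h
  convert this using 2
  congr 1
  funext i
  rw [pullTop_pullTop _ _ hY hC hC']
  exact A.pull_congr hγ.symm _ _ _

lemma isCompact_preimage_of_subset_range {X Y : Over k} (b : Y ⟶ X) [IsOpenImmersion b.left]
    {W : Set X.left} (hW : IsCompact W) (h : W ⊆ Set.range b.left) : IsCompact (b.left ⁻¹' W) := by
  rw [b.left.isOpenEmbedding.isCompact_iff, Set.image_preimage_eq_inter_range,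
    Set.inter_eq_left.2 h]
  exact hW

/-- Bijectivity over two open subsets `U₁` and `U₂` and over all open subsets of `U₂` implies
bijectivity over `U₁ ∪ U₂`: excision compares the supports `(U₁ ∪ U₂) ∖ U₁` and `U₂ ∖ U₁`. -/
lemma SumMapBijectiveOver.sup {Y X : Over k} {q : Y ⟶ X} {t : ι → A.obj Y ⊤} (hY : V.Mem Y)
    (hX : V.Mem X) {U₁ U₂ : X.left.Opens} (hU₁ : IsCompact (U₁ : Set X.left))
    (hU₂ : IsCompact (U₂ : Set X.left)) (h₁ : SumMapBijectiveOver q t (U₁ : Set X.left))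
    (h₂ : ∀ U : X.left.Opens, IsCompact (U : Set X.left) → U ≤ U₂ →
      SumMapBijectiveOver q t (U : Set X.left)) :
    SumMapBijectiveOver q t ((U₁ ⊔ U₂ : X.left.Opens) : Set X.left) := by
  have := V.quasiSeparatedSpace X hX
  have memX : ∀ U : X.left.Opens, IsCompact (U : Set X.left) → V.Pair X U.compl := fun U hU => by
    rw [SchemeCategory.pair_iff hX]; simpa using hU
  have hU : IsCompact ((U₁ ⊔ U₂ : X.left.Opens) : Set X.left) := by
    rw [Opens.coe_sup]; exact hU₁.union hU₂
  have pB := memX _ hU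
  have pB₂ := memX _ hU₂
  have pC := pB.preim q hY
  have pC₂ := pB₂.preim q hY
  let b := complι X (U₁ ⊔ U₂).compl
  let b₂ := complι X U₂.compl
  let c := complι Y (preim q (U₁ ⊔ U₂).compl)
  let c₂ := complι Y (preim q U₂.compl)
  let q' := complMap q (preim_subset q (U₁ ⊔ U₂).compl)
  let q₂ := complMap q (preim_subset q U₂.compl)
  have hb : Set.range b.left = ((U₁ ⊔ U₂ : X.left.Opens) : Set X.left) := by
    simp [b, range_complι, Set.compl_inter]
  have hb₂ : Set.range b₂.left = (U₂ : Set X.left) := by simp [b₂, range_complι]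
  have hc : Set.range c.left = q.left ⁻¹' ((U₁ ⊔ U₂ : X.left.Opens) : Set X.left) := by
    simp [c, range_complι, Set.compl_inter]
  have hc₂ : Set.range c₂.left = q.left ⁻¹' (U₂ : Set X.left) := by simp [c₂, range_complι]
  have e : c ≫ q = q' ≫ b := (complMap_comp _ _).symm
  have e₂ : c₂ ≫ q = q₂ ≫ b₂ := (complMap_comp _ _).symm
  refine .of_exists hY pC.2 pB.2 e hb hc ?_
  let Z : Closeds (compl X (U₁ ⊔ U₂).compl).left := preim b U₁.compl
  have pZ : V.Pair _ Z := by
    rw [SchemeCategory.pair_iff pB.2]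
    have : (Z : Set (compl X (U₁ ⊔ U₂).compl).left)ᶜ = b.left ⁻¹' (U₁ : Set X.left) := by
      simp [Z]
    rw [this]
    refine isCompact_preimage_of_subset_range b hU₁ ?_
    rw [hb]
    exact (le_sup_left : U₁ ≤ U₁ ⊔ U₂)
  have pW := pZ.preim q' pC.2
  -- the support `Z = (U₁ ∪ U₂) ∖ U₁` lies in `U₂`, so excision compares it with its trace on `U₂`,
  -- where the five lemma applies with `U₂` and `U₁ ∩ U₂`
  refine sumMap_bijective_of_support q' pC.2 _ pZ ?_ ?_
  · let β : compl X U₂.compl ⟶ compl X (U₁ ⊔ U₂).compl := openLift b b₂ (by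
      rw [hb, hb₂]; exact (le_sup_right : U₂ ≤ U₁ ⊔ U₂))
    let γ : compl Y (preim q U₂.compl) ⟶ compl Y (preim q (U₁ ⊔ U₂).compl) := openLift c c₂ (by
      rw [hc, hc₂]; exact Set.preimage_mono (le_sup_right : U₂ ≤ U₁ ⊔ U₂))
    have hβ : β ≫ b = b₂ := openLift_comp _ _ _
    have hγ : γ ≫ c = c₂ := openLift_comp _ _ _
    have : IsOpenImmersion β.left := isOpenImmersion_openLift _ _ _
    have : IsOpenImmersion γ.left := isOpenImmersion_openLift _ _ _
    have eβ : γ ≫ q' = q₂ ≫ β := by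
      rw [← cancel_mono b, Category.assoc, ← e, ← Category.assoc, hγ, e₂, Category.assoc, hβ]
    have pZ₂ := pZ.preim β pB₂.2
    have pW₂ := pW.preim γ pC₂.2
    have eW : preim γ (preim q' Z) = preim q₂ (preim β Z) := by
      rw [← preim_comp, eβ, preim_comp]
    have rβ : (Z : Set (compl X (U₁ ⊔ U₂).compl).left) ⊆ Set.range β.left := by
      intro z hz
      have h1 : b.left z ∈ Set.range b.left := ⟨z, rfl⟩
      have h2 : b.left z ∉ U₁ := hz
      rw [hb] at h1
      have h3 : b.left z ∈ Set.range b₂.left := by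
        rw [hb₂]; exact h1.resolve_left h2
      obtain ⟨y, hy⟩ := h3
      refine ⟨y, b.left.isOpenEmbedding.injective ?_⟩
      rw [← Scheme.Hom.comp_apply, ← Over.comp_left, hβ, hy]
    have rγ : (preim q' Z : Set (compl Y (preim q (U₁ ⊔ U₂).compl)).left) ⊆
        Set.range γ.left := by
      intro z hz
      obtain ⟨y, hy⟩ := rβ hz
      have h3 : c.left z ∈ Set.range c₂.left := by
        rw [hc₂, Set.mem_preimage, ← hb₂]
        refine ⟨y, ?_⟩
        rw [← hβ, Over.comp_left, Scheme.Hom.comp_apply, hy, ← Scheme.Hom.comp_apply,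
          ← Scheme.Hom.comp_apply, ← Over.comp_left, ← Over.comp_left, e]
      obtain ⟨y, hy⟩ := h3
      refine ⟨y, c.left.isOpenEmbedding.injective ?_⟩
      rw [← Scheme.Hom.comp_apply, ← Over.comp_left, hγ, hy]
    rw [sumMap_bijective_iff eβ _ pZ pZ₂ pW (pZ₂.preim q₂ pC₂.2) (preim_subset q' Z)
      (preim_subset q₂ (preim β Z)) (preim_subset β Z) (by rw [← eW]; exact preim_subset _ _)
      (pull_bijective_of_isOpenImmersion β pZ pB₂.2 rfl rβ _)
      (pull_bijective_of_isOpenImmersion γ pW pC₂.2 eW rγ _)]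
    have et : (fun i => A.pullTop γ (A.pullTop c (t i))) = fun i => A.pullTop c₂ (t i) := by
      funext i
      rw [pullTop_pullTop _ _ hY pC.2 pC₂.2]
      exact A.pull_congr hγ _ _ _
    rw [et]
    refine sumMap_bijective_of_compl q₂ pC₂.2 _ pZ₂ ?_ ?_
    · exact h₂ U₂ hU₂ le_rfl _ _ b₂ c₂ q₂ inferInstance inferInstance e₂ hb₂ hc₂
    · let b₃ := complι _ (preim β Z) ≫ b₂
      let c₃ := complι _ (preim q₂ (preim β Z)) ≫ c₂
      have : IsOpenImmersion b₃.left := by dsimp only [b₃]; rw [Over.comp_left]; infer_instance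
      have : IsOpenImmersion c₃.left := by dsimp only [c₃]; rw [Over.comp_left]; infer_instance
      have et₃ : (fun i => A.pullTop (complι _ (preim q₂ (preim β Z))) (A.pullTop c₂ (t i))) =
          fun i => A.pullTop c₃ (t i) := by
        funext i
        rw [pullTop_pullTop _ _ hY pC₂.2 (pZ₂.preim q₂ pC₂.2).2]
      rw [et₃]
      have r₃ : Set.range b₃.left = ((U₁ ⊓ U₂ : X.left.Opens) : Set X.left) := by
        have e3 : b₃.left = (complι _ (preim β Z)).left ≫ b₂.left := rfl
        have e4 : preim β Z = preim b₂ U₁.compl := by rw [← hβ, preim_comp]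
        rw [e3, Scheme.Hom.comp_base, TopCat.coe_comp, Set.range_comp, range_complι, e4]
        have : ((preim b₂ U₁.compl : Closeds (compl X U₂.compl).left) : Set _)ᶜ =
          b₂.left ⁻¹' (U₁ : Set X.left) := by simp
        rw [this, Set.image_preimage_eq_inter_range, hb₂]
        rfl
      refine h₂ (U₁ ⊓ U₂) ?_ inf_le_right _ _ b₃ c₃ (complMap q₂ (preim_subset q₂ (preim β Z)))
        inferInstance inferInstance ?_ r₃ ?_
      · rw [← r₃]
        have := V.compactSpace _ pZ₂.2
        exact isCompact_range b₃.left.continuous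
      · simp only [b₃, c₃, Category.assoc, complMap_comp_assoc, e₂]
      · have e3 : c₃.left = (complι _ (preim q₂ (preim β Z))).left ≫ c₂.left := rfl
        have e4 : preim q₂ (preim β Z) = preim c₂ (preim q U₁.compl) := by
          rw [← preim_comp, ← preim_comp, ← preim_comp, e₂, Category.assoc, hβ]
        rw [e3, Scheme.Hom.comp_base, TopCat.coe_comp, Set.range_comp, range_complι, e4]
        have : ((preim c₂ (preim q U₁.compl) : Closeds (compl Y (preim q U₂.compl)).left) :
          Set _)ᶜ = c₂.left ⁻¹' (q.left ⁻¹' (U₁ : Set X.left)) := by simp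
        rw [this, Set.image_preimage_eq_inter_range, hc₂]
        rfl
  -- the complement of `Z` is `U₁`
  · let b₁ := complι _ Z ≫ b
    let c₁ := complι _ (preim q' Z) ≫ c
    have : IsOpenImmersion b₁.left := by dsimp only [b₁]; rw [Over.comp_left]; infer_instance
    have : IsOpenImmersion c₁.left := by dsimp only [c₁]; rw [Over.comp_left]; infer_instance
    have et₁ : (fun i => A.pullTop (complι _ (preim q' Z)) (A.pullTop c (t i))) =
        fun i => A.pullTop c₁ (t i) := by
      funext i
      rw [pullTop_pullTop _ _ hY pC.2 pW.2]
    rw [et₁]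
    refine h₁ _ _ b₁ c₁ (complMap q' (preim_subset q' Z)) inferInstance inferInstance ?_ ?_ ?_
    · simp only [b₁, c₁, Category.assoc, complMap_comp_assoc, e]
    · have e3 : b₁.left = (complι _ Z).left ≫ b.left := rfl
      rw [e3, Scheme.Hom.comp_base, TopCat.coe_comp, Set.range_comp, range_complι]
      have : (Z : Set (compl X (U₁ ⊔ U₂).compl).left)ᶜ = b.left ⁻¹' (U₁ : Set X.left) := by
        simp [Z]
      rw [this, Set.image_preimage_eq_inter_range, hb]
      exact Set.inter_eq_left.2 (le_sup_left : U₁ ≤ U₁ ⊔ U₂)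
    · have e3 : c₁.left = (complι _ (preim q' Z)).left ≫ c.left := rfl
      have e4 : preim q' Z = preim c (preim q U₁.compl) := by
        rw [← preim_comp, ← preim_comp, e]
      rw [e3, Scheme.Hom.comp_base, TopCat.coe_comp, Set.range_comp, range_complι, e4]
      have : ((preim c (preim q U₁.compl) : Closeds (compl Y (preim q (U₁ ⊔ U₂).compl)).left) :
        Set _)ᶜ = c.left ⁻¹' (q.left ⁻¹' (U₁ : Set X.left)) := by simp
      rw [this, Set.image_preimage_eq_inter_range, hc, ← Set.preimage_inter]
      congr 1
      exact Set.inter_eq_left.2 (le_sup_left : U₁ ≤ U₁ ⊔ U₂)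

/-- Bijectivity of `sumMap` is local on the base. -/
theorem sumMapTop_bijective_of_locally {Y X : Over k} {q : Y ⟶ X} {t : ι → A.obj Y ⊤}
    (hY : V.Mem Y) (hX : V.Mem X)
    (h : ∀ x : X.left, ∃ W : X.left.Opens, x ∈ W ∧ ∀ U : X.left.Opens,
      IsCompact (U : Set X.left) → U ≤ W → SumMapBijectiveOver q t (U : Set X.left)) :
    Function.Bijective (A.sumMapTop q t) := by
  have := V.compactSpace X hX
  have := V.quasiSeparatedSpace X hX
  have h' : ∀ x : X.left, ∃ U : X.left.affineOpens, x ∈ U.1 ∧ ∀ U' : X.left.Opens,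
      IsCompact (U' : Set X.left) → U' ≤ U.1 → SumMapBijectiveOver q t (U' : Set X.left) := by
    intro x
    obtain ⟨W, hxW, hW⟩ := h x
    obtain ⟨_, ⟨U, hU, rfl⟩, hxU, hUW⟩ :=
      X.left.isBasis_affineOpens.exists_subset_of_mem_open hxW W.isOpen
    exact ⟨⟨U, hU⟩, hxU, fun U' hU' hle => hW U' hU' (hle.trans hUW)⟩
  choose N hxN hN using h'
  obtain ⟨s, hs⟩ := isCompact_univ.elim_finite_subcover (fun x => ((N x).1 : Set X.left))
    (fun x => (N x).1.isOpen) (fun x _ => Set.mem_iUnion.2 ⟨x, hxN x⟩)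
  -- induction over the number of affine open subsets of a finite cover
  have key : ∀ s : Finset X.left, SumMapBijectiveOver q t
      ((⨆ x ∈ s, (N x).1 : X.left.Opens) : Set X.left) := by
    classical
    intro s
    induction s using Finset.induction_on with
    | empty =>
      intro B C b c q' hb hc e rb rc
      have rb' : Set.range b.left = ∅ := by simpa using rb
      have rc' : Set.range c.left = ∅ := by simpa using rc
      have eB : IsEmpty B.left := Set.range_eq_empty_iff.1 rb'
      have eC : IsEmpty C.left := Set.range_eq_empty_iff.1 rc'
      have hB : V.Mem B := SchemeCategory.mem_open b hX (by rw [rb']; exact isCompact_empty)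
      have hC : V.Mem C := SchemeCategory.mem_open c hY (by rw [rc']; exact isCompact_empty)
      have zB : ∀ a : A.obj B ⊤, a = 0 := obj_eq_zero_of_eq_bot hB (by ext x; exact eB.elim x)
      have zC : ∀ a : A.obj C ⊤, a = 0 := obj_eq_zero_of_eq_bot hC (by ext x; exact eC.elim x)
      -- both groups vanish over the empty scheme
      refine ⟨fun a a' _ => funext fun i => (zB _).trans (zB _).symm, fun a => ⟨0, ?_⟩⟩
      rw [map_zero, zC a]
    | insert x s hx ih =>
      rw [Finset.iSup_insert, sup_comm]
      refine ih.sup hY hX ?_ (N x).2.isCompact (hN x)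
      simp only [Opens.coe_iSup]
      exact s.isCompact_biUnion fun x _ => (N x).2.isCompact
  have hall := key s (X) (Y) (𝟙 X) (𝟙 Y) q
    (inferInstanceAs (IsOpenImmersion (𝟙 X.left))) (inferInstanceAs (IsOpenImmersion (𝟙 Y.left)))
    (by simp)
  have e : ((⨆ x ∈ s, (N x).1 : X.left.Opens) : Set X.left) = Set.univ := by
    simpa [Set.eq_univ_iff_forall] using! hs
  have := hall (by rw [e]; simp) (by rw [e]; simp)
  convert this using 2
  congr 1
  funext i
  exact (A.pull_id (SchemeCategory.pair_top hY) _ _).symm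

end RingCohomologyTheory

end

section

/-! ### Gluing morphisms and functions -/

/-- Morphisms defined on a neighbourhood of every point and compatible on overlaps glue. -/
theorem exists_glue {T Z : Scheme.{u}} (W : T → T.Opens) (hW : ∀ x, x ∈ W x)
    (s : ∀ x, (W x).toScheme ⟶ Z)
    (compat : ∀ (x y) (T' : Scheme.{u}) (a : T' ⟶ W x) (b : T' ⟶ W y),
      a ≫ (W x).ι = b ≫ (W y).ι → a ≫ s x = b ≫ s y) :
    ∃ t : T ⟶ Z, ∀ x, (W x).ι ≫ t = s x := by
  let 𝒰 : T.OpenCover := {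
    I₀ := T, X i := (W i), f i := (W i).ι,
    mem₀ := by
      rw [Scheme.presieve₀_mem_precoverage_iff]
      refine ⟨fun x ↦ ⟨x, by simpa using hW x⟩, inferInstance⟩ }
  exact ⟨𝒰.glueMorphisms s (fun x y => compat x y _ _ _ Limits.pullback.condition),
    fun x => 𝒰.ι_glueMorphisms s _ x⟩

/-- The restriction of `T ⟶ X` to an open subscheme of `T`. -/
def res {X : Scheme.{u}} (T : Over X) (W : T.left.Opens) : Over X := Over.mk (W.ι ≫ T.hom)

/-- The inclusion of an open subscheme, over `X`. -/
def resι {X : Scheme.{u}} (T : Over X) (W : T.left.Opens) : res T W ⟶ T := Over.homMk W.ι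

lemma over_hom_ext {X : Scheme.{u}} {T Z : Over X} (s t : T ⟶ Z)
    (h : ∀ x : T.left, ∃ W : T.left.Opens, x ∈ W ∧ resι T W ≫ s = resι T W ≫ t) : s = t := by
  ext1
  refine Scheme.hom_ext_of_forall _ _ fun x => ?_
  obtain ⟨W, hx, hW⟩ := h x
  exact ⟨W, hx, congrArg (fun s => s.left) hW⟩

/-- Morphisms over `X` which exist locally and are unique as such exist globally. -/
theorem exists_of_locally {X : Scheme.{u}} {T Z : Over X}
    (Q : ∀ {T' : Over X}, (T' ⟶ T) → (T' ⟶ Z) → Prop)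
    (comp : ∀ {T' T'' : Over X} (h : T'' ⟶ T') (g : T' ⟶ T) (s : T' ⟶ Z),
      Q g s → Q (h ≫ g) (h ≫ s))
    (uniq : ∀ {T' : Over X} (g : T' ⟶ T) (s s' : T' ⟶ Z), Q g s → Q g s' → s = s')
    (loc : ∀ x : T.left, ∃ W : T.left.Opens, x ∈ W ∧ ∃ s, Q (resι T W) s) :
    ∃ s : T ⟶ Z, ∀ x : T.left, ∃ W : T.left.Opens, x ∈ W ∧ Q (resι T W) (resι T W ≫ s) := by
  choose W hW s hs using loc
  obtain ⟨t, ht⟩ := exists_glue W hW (fun x => (s x).left) (by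
    intro x y T' a b hab
    let T'' : Over X := Over.mk (a ≫ (W x).ι ≫ T.hom)
    let a' : T'' ⟶ res T (W x) := Over.homMk a
    let b' : T'' ⟶ res T (W y) := Over.homMk b (by
      change b ≫ (W y).ι ≫ T.hom = a ≫ (W x).ι ≫ T.hom
      rw [← Category.assoc, ← hab, Category.assoc])
    have e : a' ≫ resι T (W x) = b' ≫ resι T (W y) := by ext1; exact hab
    have := uniq _ _ _ (comp a' _ _ (hs x)) (by rw [e]; exact comp b' _ _ (hs y))
    exact congrArg (fun s => s.left) this)
  let t' : T ⟶ Z := Over.homMk t (by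
    refine Scheme.hom_ext_of_forall _ _ fun x => ⟨W x, hW x, ?_⟩
    rw [← Category.assoc, ht]
    exact Over.w (s x))
  have ht' : ∀ x, resι T (W x) ≫ t' = s x := fun x => by ext1; exact ht x
  exact ⟨t', fun x => ⟨W x, hW x, by rw [ht' x]; exact hs x⟩⟩

lemma function_eq_of_locally {T : Scheme.{u}} (a b : Γ(T, ⊤))
    (h : ∀ x : T, ∃ W : T.Opens, x ∈ W ∧ W.ι.appTop.hom a = W.ι.appTop.hom b) : a = b := by
  have key : (fun _ : PUnit => a) = fun _ => b := by
    apply (AffineSpace.toSpecMvPolyIntEquiv PUnit).symm.injective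
    refine Scheme.hom_ext_of_forall _ _ fun x => ?_
    obtain ⟨W, hx, hW⟩ := h x
    refine ⟨W, hx, (AffineSpace.toSpecMvPolyIntEquiv PUnit).injective ?_⟩
    ext i
    rw [AffineSpace.toSpecMvPolyIntEquiv_comp, AffineSpace.toSpecMvPolyIntEquiv_comp,
      Equiv.apply_symm_apply, Equiv.apply_symm_apply]
    exact hW
  exact congrFun key ⟨⟩

/-! ### Frames -/

namespace VectorBundle

variable {X : Scheme.{u}} {r : ℕ} (E : VectorBundle X r)

/-- The sections `b` of `E` over `T` form a frame: a basis of the sections over every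
`T`-scheme. -/
def IsFrame {ι : Type*} [Fintype ι] {T : Over X} (b : ι → (T ⟶ E.total)) : Prop :=
  ∀ (T' : Over X) (g : T' ⟶ T),
    Function.Bijective (fun c : ι → Γ(T'.left, ⊤) => ∑ i, c i • (g ≫ b i))

variable {E} in
lemma IsFrame.comp {ι : Type*} [Fintype ι] {T : Over X} {b : ι → (T ⟶ E.total)}
    (hb : E.IsFrame b) {T' : Over X} (g : T' ⟶ T) : E.IsFrame (fun i => g ≫ b i) := by
  intro T'' h
  simpa only [Category.assoc] using hb T'' (h ≫ g)

variable {E} in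
lemma IsFrame.reindex {ι κ : Type*} [Fintype ι] [Fintype κ] {T : Over X} {b : ι → (T ⟶ E.total)}
    (hb : E.IsFrame b) (e : κ ≃ ι) : E.IsFrame (fun i => b (e i)) := by
  intro T' h
  have : (fun c : κ → Γ(T'.left, ⊤) => ∑ i, c i • (h ≫ b (e i))) =
      (fun c : ι → Γ(T'.left, ⊤) => ∑ i, c i • (h ≫ b i)) ∘ (fun c => c ∘ e.symm) := by
    funext c
    simp only [Function.comp]
    rw [← e.sum_comp]
    simp
  rw [this]
  exact (hb T' h).comp (e.symm.arrowCongr (Equiv.refl _)).symm.bijective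

/-- The restriction of `T` to the inverse image of an open subscheme of `X`. -/
def resToBase {X : Scheme.{u}} (T : Over X) (U : X.Opens) :
    res T (T.hom ⁻¹ᵁ U) ⟶ Over.mk U.ι :=
  Over.homMk (T.hom ∣_ U) (morphismRestrict_ι _ _)

lemma exists_isFrame (T : Over X) (x : T.left) : ∃ W : T.left.Opens, x ∈ W ∧
    ∃ b : Fin r → (res T W ⟶ E.total), E.IsFrame b := by
  obtain ⟨U, hU, e, he⟩ := E.exists_frame (T.hom x)
  have he' : E.IsFrame e := he
  exact ⟨T.hom ⁻¹ᵁ U, hU, _, he'.comp (resToBase T U)⟩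

/-- Equality of sections may be checked in the presence of a frame. -/
lemma section_ext {T : Over X} (s t : T ⟶ E.total)
    (h : ∀ (T' : Over X) (g : T' ⟶ T) (b : Fin r → (T' ⟶ E.total)),
      E.IsFrame b → g ≫ s = g ≫ t) : s = t := by
  refine over_hom_ext _ _ fun x => ?_
  obtain ⟨W, hx, b, hb⟩ := E.exists_isFrame T x
  exact ⟨W, hx, h _ _ b hb⟩

end VectorBundle

/-- A module-valued functor `M` on `X`-schemes, with restriction maps `map`, which is locally
free of rank `r` and is represented, as a functor to sets, by the `X`-scheme `total`. -/
structure SectionFunctor (X : Scheme.{u}) (r : ℕ) where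
  total : Over X
  M : Over X → Type u
  [addCommGroup : ∀ T : Over X, AddCommGroup (M T)]
  [module : ∀ T : Over X, Module Γ(T.left, ⊤) (M T)]
  e : ∀ T, (T ⟶ total) ≃ M T
  map : ∀ {T' T : Over X}, (T' ⟶ T) → M T → M T'
  map_add : ∀ {T' T : Over X} (g : T' ⟶ T) (s t : M T), map g (s + t) = map g s + map g t
  map_smul : ∀ {T' T : Over X} (g : T' ⟶ T) (a : Γ(T.left, ⊤)) (s : M T),
    map g (a • s) = g.left.appTop.hom a • map g s
  e_comp : ∀ {T' T : Over X} (g : T' ⟶ T) (s : T ⟶ total), e T' (g ≫ s) = map g (e T s)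
  frame : ∀ x : X, ∃ U : X.Opens, x ∈ U ∧
    ∃ b : Fin r → M (Over.mk U.ι), ∀ (T : Over X) (g : T ⟶ Over.mk U.ι),
      Function.Bijective (fun c : Fin r → Γ(T.left, ⊤) => ∑ i, c i • map g (b i))

namespace SectionFunctor

attribute [instance] SectionFunctor.addCommGroup SectionFunctor.module

variable {X : Scheme.{u}} {r : ℕ} (D : SectionFunctor X r)

/-- The vector bundle with a given functor of sections. -/
def bundle : VectorBundle X r where
  total := D.total
  addCommGroup T := (D.e T).addCommGroup
  module T := letI := (D.e T).addCommGroup; (D.e T).module _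
  comp_add {T' T} g s t := by
    let _ := (D.e T).addCommGroup
    let _ := (D.e T').addCommGroup
    apply (D.e T').injective
    rw [D.e_comp, Equiv.add_def, Equiv.add_def]
    simp [D.map_add, D.e_comp]
  comp_smul {T' T} g a s := by
    let _ := (D.e T).addCommGroup
    let _ := (D.e T').addCommGroup
    let _ : Module _ (T ⟶ D.total) := (D.e T).module Γ(T.left, ⊤)
    let _ : Module _ (T' ⟶ D.total) := (D.e T').module Γ(T'.left, ⊤)
    apply (D.e T').injective
    rw [D.e_comp]
    change D.map g (D.e T ((D.e T).symm _)) = D.e T' ((D.e T').symm _)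
    simp [D.map_smul, D.e_comp]
  exists_frame x := by
    obtain ⟨U, hU, b, hb⟩ := D.frame x
    refine ⟨U, hU, fun i => (D.e _).symm (b i), fun T g => ?_⟩
    let _ := (D.e T).addCommGroup
    let _ : Module _ (T ⟶ D.total) := (D.e T).module Γ(T.left, ⊤)
    have h := (D.e T).symm.bijective.comp (hb T g)
    convert h using 1
    funext c
    let l : D.M T ≃ₗ[Γ(T.left, ⊤)] (T ⟶ D.total) := ((D.e T).linearEquiv Γ(T.left, ⊤)).symm
    have hl : ∀ m, (D.e T).symm m = l m := fun m => rfl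
    have hg : ∀ i, g ≫ (D.e (Over.mk U.ι)).symm (b i) = l (D.map g (b i)) := fun i => by
      rw [← hl]
      apply (D.e T).injective
      rw [D.e_comp, Equiv.apply_symm_apply, Equiv.apply_symm_apply]
    simp only [Function.comp, hl, map_sum, hg, l.map_smul]

/-- The sections of the bundle over `T`. -/
def sections (T : Over X) : (T ⟶ D.bundle.total) ≃ₗ[Γ(T.left, ⊤)] D.M T :=
  letI := (D.e T).addCommGroup
  (D.e T).linearEquiv _

lemma sections_comp {T' T : Over X} (g : T' ⟶ T) (s : T ⟶ D.bundle.total) :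
    D.sections T' (g ≫ s) = D.map g (D.sections T s) := D.e_comp g s

end SectionFunctor

end

section

/-! ### Pullbacks of bundles -/

lemma bijective_of_eq {α β : Type*} {f g : α → β} (h : Function.Bijective g)
    (e : ∀ x, f x = g x) : Function.Bijective f := (funext e : f = g) ▸ h

namespace BundleHom

variable {Y X : Scheme.{u}} {f : Y ⟶ X} {r n : ℕ} {F : VectorBundle Y r} {E : VectorBundle X n}
  (h : BundleHom f F E)

lemma push_add {T : Over Y} (s t : T ⟶ F.total) : h.push (s + t) = h.push s + h.push t :=
  h.map_add T s t

lemma push_smul {T : Over Y} (a : Γ(T.left, ⊤)) (s : T ⟶ F.total) :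
    h.push (a • s) = (show Γ(((Over.map f).obj T).left, ⊤) from a) • h.push s :=
  h.map_smul T a s

lemma push_comp {T' T : Over Y} (g : T' ⟶ T) (s : T ⟶ F.total) :
    h.push (g ≫ s) = (Over.map f).map g ≫ h.push s := by
  simp [push]

lemma push_left {T : Over Y} (s : T ⟶ F.total) : (h.push s).left = s.left ≫ h.left := rfl

/-- For a pullback bundle, sections correspond to sections of the original bundle. -/
lemma IsCartesian.push_bijective (hh : h.IsCartesian) (T : Over Y) :
    Function.Bijective (h.push (T := T)) := by
  refine ⟨fun s t hst => ?_, fun t => ?_⟩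
  · ext1
    refine hh.hom_ext ?_ ?_
    · exact congrArg (fun s => s.left) hst
    · rw [Over.w, Over.w]
  · refine ⟨Over.homMk (hh.lift t.left T.hom (Over.w t)) (hh.lift_snd _ _ _), ?_⟩
    ext1
    exact hh.lift_fst _ _ _

/-- A morphism of bundles inducing bijections on sections is cartesian. -/
lemma isCartesian_of_push_bijective (hh : ∀ T : Over Y, Function.Bijective (h.push (T := T))) :
    h.IsCartesian := by
  refine IsPullback.of_isLimit' ⟨h.left_comp⟩ (Limits.PullbackCone.IsLimit.mk _
    (fun c => (Function.surjInv (hh (Over.mk c.snd)).2 (Over.homMk c.fst c.condition)).left)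
    (fun c => ?_) (fun c => ?_) (fun c m h1 h2 => ?_))
  · exact congrArg (fun s => s.left)
      (Function.surjInv_eq (hh (Over.mk c.snd)).2 (Over.homMk c.fst c.condition))
  · exact Over.w (Function.surjInv (hh (Over.mk c.snd)).2 (Over.homMk c.fst c.condition))
  · let m' : Over.mk c.snd ⟶ F.total := Over.homMk m h2
    have : m' = Function.surjInv (hh (Over.mk c.snd)).2 (Over.homMk c.fst c.condition) := by
      apply (hh (Over.mk c.snd)).1
      rw [Function.surjInv_eq (hh (Over.mk c.snd)).2]
      ext1
      exact h1
    exact congrArg (fun s => s.left) this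

end BundleHom

namespace VectorBundle

variable {Y X : Scheme.{u}} (f : Y ⟶ X) {r : ℕ} (E : VectorBundle X r)

/-- The module of sections of `f^* E` over a `Y`-scheme `T`. -/
def PullbackSections (T : Over Y) : Type u := (Over.map f).obj T ⟶ E.total

instance (T : Over Y) : AddCommGroup (PullbackSections f E T) :=
  E.addCommGroup ((Over.map f).obj T)

instance (T : Over Y) : Module Γ(T.left, ⊤) (PullbackSections f E T) :=
  E.module ((Over.map f).obj T)

/-- The functor of sections of `f^* E`. -/
def pullbackFunctor : SectionFunctor Y r where
  total := (Over.pullback f).obj E.total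
  M := PullbackSections f E
  e T := ((Over.mapPullbackAdj f).homEquiv T E.total).symm
  map g s := (Over.map f).map g ≫ s
  map_add g s t := E.comp_add ((Over.map f).map g) s t
  map_smul g a s := E.comp_smul ((Over.map f).map g) a s
  e_comp g s := (Over.mapPullbackAdj f).homEquiv_naturality_left_symm g s
  frame y := by
    obtain ⟨U, hU, b, hb⟩ := E.exists_frame (f y)
    let g : (Over.map f).obj (Over.mk (f ⁻¹ᵁ U).ι) ⟶ Over.mk U.ι :=
      Over.homMk (f ∣_ U) (morphismRestrict_ι _ _)
    refine ⟨f ⁻¹ᵁ U, hU, fun i => g ≫ b i, fun T t => ?_⟩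
    have h := hb ((Over.map f).obj T) ((Over.map f).map t ≫ g)
    refine bijective_of_eq h fun c => ?_
    simp only [Category.assoc]
    rfl

/-- The pullback of a vector bundle. -/
def pullback : VectorBundle Y r := (pullbackFunctor f E).bundle

/-- The sections of `f^* E` over `T` are the sections of `E` over `T`. -/
def pullbackLinear (T : Over Y) :
    (T ⟶ (pullback f E).total) ≃ₗ[Γ(T.left, ⊤)] PullbackSections f E T :=
  (pullbackFunctor f E).sections T

lemma pullbackLinear_apply (T : Over Y) (s : T ⟶ (pullback f E).total) :
    (Over.map f).map s ≫ (Over.mapPullbackAdj f).counit.app E.total = pullbackLinear f E T s :=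
  ((Over.mapPullbackAdj f).homEquiv_counit _ _ s).symm

/-- The canonical morphism `f^* E ⟶ E` covering `f`. -/
def pullbackHom : BundleHom f (pullback f E) E where
  hom := (Over.mapPullbackAdj f).counit.app E.total
  map_add T s t := by
    rw [pullbackLinear_apply, pullbackLinear_apply, pullbackLinear_apply]
    exact map_add (pullbackLinear f E T) s t
  map_smul T a s := by
    rw [pullbackLinear_apply, pullbackLinear_apply]
    exact map_smul (pullbackLinear f E T) a s

lemma pullbackHom_isCartesian : (pullbackHom f E).IsCartesian := by
  refine BundleHom.isCartesian_of_push_bijective _ fun T => ?_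
  exact bijective_of_eq ((Over.mapPullbackAdj f).homEquiv T E.total).symm.bijective fun s =>
    ((Over.mapPullbackAdj f).homEquiv_counit _ _ s).symm

end VectorBundle

namespace SymplecticBundle

variable {Y X : Scheme.{u}} (f : Y ⟶ X) {r : ℕ} (E : SymplecticBundle X r)

/-- The linear map on sections induced by the canonical morphism `f^* E ⟶ E`. -/
def pullbackPush (T : Over Y) : (T ⟶ (E.toVectorBundle.pullback f).total) →ₗ[Γ(T.left, ⊤)]
    E.toVectorBundle.PullbackSections f T where
  toFun s := (E.toVectorBundle.pullbackHom f).push s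
  map_add' s t := (E.toVectorBundle.pullbackHom f).push_add s t
  map_smul' a s := (E.toVectorBundle.pullbackHom f).push_smul a s

/-- The pullback of a symplectic bundle. -/
def pullback : SymplecticBundle Y r where
  toVectorBundle := E.toVectorBundle.pullback f
  form T := LinearMap.compl₁₂ (show LinearMap.BilinForm Γ(T.left, ⊤)
    (E.toVectorBundle.PullbackSections f T) from E.form ((Over.map f).obj T))
    (E.pullbackPush f T) (E.pullbackPush f T)
  form_comp g s t := by
    have := E.form_comp ((Over.map f).map g) ((E.toVectorBundle.pullbackHom f).push s)
      ((E.toVectorBundle.pullbackHom f).push t)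
    rw [← BundleHom.push_comp, ← BundleHom.push_comp] at this
    exact this
  form_self T s := E.form_self _ _
  form_nondegenerate K _ p s hs := by
    have hb := (E.toVectorBundle.pullbackHom_isCartesian f).push_bijective _ (fieldPoint K p)
    apply hb.1
    rw [BundleHom.push_zero]
    refine E.form_nondegenerate K (p ≫ f) _ fun t => ?_
    obtain ⟨t', rfl⟩ := hb.2 t
    exact hs t'

/-- The canonical morphism `f^* E ⟶ E` covering `f`. -/
def pullbackHom : BundleHom f (E.pullback f).toVectorBundle E.toVectorBundle :=
  E.toVectorBundle.pullbackHom f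

lemma pullbackHom_isCartesian : (E.pullbackHom f).IsCartesian :=
  E.toVectorBundle.pullbackHom_isCartesian f

lemma pullbackHom_isIsometric : BundleHom.IsIsometric (F := E.pullback f) (E.pullbackHom f) :=
  fun _ _ _ => rfl

end SymplecticBundle

end

section

/-! ### Functions and field-valued points -/

lemma isUnit_iff_basicOpen_eq_top {T : Scheme.{u}} (a : Γ(T, ⊤)) :
    IsUnit a ↔ T.basicOpen a = ⊤ := by
  constructor
  · intro h
    rw [eq_top_iff]
    intro x _
    rw [Scheme.mem_basicOpen_top]
    exact h.map _
  · intro h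
    refine RingedSpace.isUnit_of_isUnit_germ T.toLocallyRingedSpace.toRingedSpace ⊤ a
      fun x hx => ?_
    exact (Scheme.mem_basicOpen_top _ _ _).1 (by rw [h]; trivial)

lemma isUnit_appTop_of_range_subset {T' T : Scheme.{u}} (g : T' ⟶ T) (a : Γ(T, ⊤))
    (h : Set.range g ⊆ T.basicOpen a) : IsUnit (g.appTop.hom a) := by
  rw [isUnit_iff_basicOpen_eq_top, eq_top_iff]
  intro x _
  have := h ⟨x, rfl⟩
  change x ∈ g ⁻¹ᵁ T.basicOpen a at this
  rwa [Scheme.preimage_basicOpen_top] at this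

lemma range_subset_basicOpen {T' T : Scheme.{u}} (g : T' ⟶ T) (a : Γ(T, ⊤))
    (h : IsUnit (g.appTop.hom a)) : Set.range g ⊆ T.basicOpen a := by
  rw [isUnit_iff_basicOpen_eq_top, ← Scheme.preimage_basicOpen_top] at h
  rintro _ ⟨x, rfl⟩
  have : x ∈ g ⁻¹ᵁ T.basicOpen a := by rw [h]; trivial
  exact this

lemma isField_functions (K : Type u) [Field K] : IsField Γ(Spec (.of K), ⊤) :=
  MulEquiv.isField (Field.toIsField K)
    ((Scheme.ΓSpecIso (.of K)).commRingCatIsoToRingEquiv.toMulEquiv)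

lemma mem_basicOpen_iff_ne_zero {T : Scheme.{u}} (a : Γ(T, ⊤)) (x : T) :
    x ∈ T.basicOpen a ↔ (T.fromSpecResidueField x).appTop.hom a ≠ 0 := by
  rw [← not_iff_not, not_not]
  constructor
  · intro h
    rw [← basicOpen_eq_bot_iff, ← Scheme.preimage_basicOpen_top, eq_bot_iff]
    intro z hz
    refine absurd ?_ h
    have hz' : T.fromSpecResidueField x z ∈ T.basicOpen a := hz
    rwa [T.fromSpecResidueField_apply] at hz'
  · intro h hx
    let z : Spec (T.residueField x) := IsLocalRing.closedPoint _
    have hz : z ∈ (T.fromSpecResidueField x) ⁻¹ᵁ T.basicOpen a := by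
      change T.fromSpecResidueField x z ∈ T.basicOpen a
      rwa [T.fromSpecResidueField_apply]
    rw [Scheme.preimage_basicOpen_top, h, Scheme.basicOpen_zero] at hz
    exact hz

/-- The point `x` of an `X`-scheme `T`, as an `X`-scheme. -/
def residuePoint {X : Scheme.{u}} (T : Over X) (x : T.left) : Over X :=
  fieldPoint (T.left.residueField x) (T.left.fromSpecResidueField x ≫ T.hom)

/-- The inclusion of the point `x`. -/
def residuePointι {X : Scheme.{u}} (T : Over X) (x : T.left) : residuePoint T x ⟶ T :=
  Over.homMk (T.left.fromSpecResidueField x)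

lemma isUnit_iff_forall_residuePoint {X : Scheme.{u}} (T : Over X) (a : Γ(T.left, ⊤)) :
    IsUnit a ↔ ∀ x : T.left, (residuePointι T x).left.appTop.hom a ≠ 0 := by
  rw [isUnit_iff_basicOpen_eq_top, eq_top_iff]
  exact ⟨fun h x => (mem_basicOpen_iff_ne_zero a x).1 (h trivial),
    fun h x _ => (mem_basicOpen_iff_ne_zero a x).2 (h x)⟩

/-- An open immersion whose image contains `x` admits a section near `x`. -/
lemma exists_lift_of_isOpenImmersion {X : Scheme.{u}} {T' T : Over X} (g : T' ⟶ T)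
    [IsOpenImmersion g.left] (x : T.left) (hx : x ∈ Set.range g.left) :
    ∃ W : T.left.Opens, x ∈ W ∧ ∃ h : res T W ⟶ T', h ≫ g = resι T W := by
  have hr : Set.range (g.left.opensRange).ι ⊆ Set.range g.left := by simp
  have e : IsOpenImmersion.lift g.left (g.left.opensRange).ι hr ≫ T'.hom =
      (g.left.opensRange).ι ≫ T.hom := by
    rw [← Over.w g, ← Category.assoc, IsOpenImmersion.lift_fac]
  refine ⟨g.left.opensRange, hx,
    Over.homMk (IsOpenImmersion.lift g.left (g.left.opensRange).ι hr) e, ?_⟩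
  · ext1
    exact IsOpenImmersion.lift_fac _ _ _

/-! ### Trivial bundles -/

namespace VectorBundle

/-- The functor of sections of `𝒪_X ^ r`. -/
def trivialFunctor (X : Scheme.{u}) (r : ℕ) : SectionFunctor X r where
  total := Over.mk (𝔸(ULift.{u} (Fin r); X) ↘ X)
  M T := Fin r → Γ(T.left, ⊤)
  e T :=
    { toFun s i := s.left.appTop.hom (AffineSpace.coord X ⟨i⟩)
      invFun c := Over.homMk (AffineSpace.homOfVector T.hom fun i => c i.down)
        (AffineSpace.homOfVector_over _ _)
      left_inv s := by
        ext1
        refine AffineSpace.hom_ext ?_ fun i => ?_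
        · exact (AffineSpace.homOfVector_over _ _).trans (Over.w s).symm
        · exact AffineSpace.homOfVector_appTop_coord _ _ _
      right_inv c := by
        funext i
        exact AffineSpace.homOfVector_appTop_coord _ _ _ }
  map g c i := g.left.appTop.hom (c i)
  map_add g s t := by funext i; exact map_add _ _ _
  map_smul g a s := by funext i; exact map_mul _ _ _
  e_comp g s := rfl
  frame x := by
    refine ⟨⊤, trivial, fun i => Pi.single i 1, fun T g => ?_⟩
    convert Function.bijective_id using 1
    funext c j
    simp [Finset.sum_apply, Pi.single_apply, apply_ite]

/-- The trivial vector bundle `𝒪_X ^ r`. -/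
def trivial (X : Scheme.{u}) (r : ℕ) : VectorBundle X r := (trivialFunctor X r).bundle

variable {X : Scheme.{u}} {r : ℕ}

/-- The coordinates of a section of the trivial bundle. -/
def coords (T : Over X) : (T ⟶ (trivial X r).total) ≃ₗ[Γ(T.left, ⊤)] (Fin r → Γ(T.left, ⊤)) :=
  (trivialFunctor X r).sections T

lemma coords_apply (T : Over X) (s : T ⟶ (trivial X r).total) (i : Fin r) :
    coords T s i = s.left.appTop.hom (AffineSpace.coord X ⟨i⟩) := rfl

lemma coords_comp {T' T : Over X} (g : T' ⟶ T) (s : T ⟶ (trivial X r).total) (i : Fin r) :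
    coords T' (g ≫ s) i = g.left.appTop.hom (coords T s i) :=
  congrFun ((trivialFunctor X r).sections_comp g s) i

lemma coords_symm_comp {T' T : Over X} (g : T' ⟶ T) (c : Fin r → Γ(T.left, ⊤)) :
    g ≫ (coords T).symm c = (coords T').symm fun i => g.left.appTop.hom (c i) := by
  apply (coords T').injective
  funext i
  rw [coords_comp, LinearEquiv.apply_symm_apply, LinearEquiv.apply_symm_apply]

end VectorBundle

namespace BundleHom

variable {Y X : Scheme.{u}} {f : Y ⟶ X} {r n : ℕ} {F : VectorBundle Y r} {E : VectorBundle X n}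

/-- A morphism of bundles from a natural linear map on sections. -/
def ofPush (φ : ∀ T : Over Y, (T ⟶ F.total) → ((Over.map f).obj T ⟶ E.total))
    (comp : ∀ {T' T : Over Y} (g : T' ⟶ T) (s : T ⟶ F.total),
      φ T' (g ≫ s) = (Over.map f).map g ≫ φ T s)
    (add : ∀ (T : Over Y) (s t : T ⟶ F.total), φ T (s + t) = φ T s + φ T t)
    (smul : ∀ (T : Over Y) (a : Γ(T.left, ⊤)) (s : T ⟶ F.total),
      φ T (a • s) = (show Γ(((Over.map f).obj T).left, ⊤) from a) • φ T s) :
    BundleHom f F E where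
  hom := φ F.total (𝟙 _)
  map_add T s t := by
    rw [← comp, ← comp, ← comp, Category.comp_id, Category.comp_id, Category.comp_id, add]
  map_smul T a s := by
    rw [← comp, ← comp, Category.comp_id, Category.comp_id, smul]

lemma ofPush_push (φ : ∀ T : Over Y, (T ⟶ F.total) → ((Over.map f).obj T ⟶ E.total))
    (comp add smul) (T : Over Y) (s : T ⟶ F.total) :
    (ofPush φ comp add smul).push s = φ T s := by
  change (Over.map f).map s ≫ φ F.total (𝟙 _) = _
  rw [← comp, Category.comp_id]

end BundleHom

namespace VectorBundle

variable {Y X : Scheme.{u}} {f : Y ⟶ X} {r n : ℕ} {E : VectorBundle X n}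

/-- The structure morphism of a `Y`-scheme, viewed over `X`. -/
def toBase (f : Y ⟶ X) (T : Over Y) : (Over.map f).obj T ⟶ Over.mk f := Over.homMk T.hom

lemma map_comp_toBase (f : Y ⟶ X) {T' T : Over Y} (g : T' ⟶ T) :
    (Over.map f).map g ≫ toBase f T = toBase f T' := by
  ext1
  exact Over.w g

/-- The morphism `𝒪_Y ^ r ⟶ f^* E` given by `r` sections of `f^* E`. -/
def homOfSections (b : Fin r → (Over.mk f ⟶ E.total)) : BundleHom f (trivial Y r) E :=
  .ofPush (fun T s => ∑ i, (show Γ(((Over.map f).obj T).left, ⊤) from coords T s i) •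
      (toBase f T ≫ b i))
    (fun {T' T} g s => by
      rw [E.comp_sum]
      refine Finset.sum_congr rfl fun i _ => ?_
      rw [E.comp_smul, ← Category.assoc, map_comp_toBase, coords_comp]
      rfl)
    (fun T s t => by
      rw [← Finset.sum_add_distrib]
      refine Finset.sum_congr rfl fun i _ => ?_
      rw [map_add]
      exact add_smul _ _ _)
    (fun T a s => by
      rw [Finset.smul_sum]
      refine Finset.sum_congr rfl fun i _ => ?_
      rw [map_smul]
      exact mul_smul _ _ _)

lemma homOfSections_push (b : Fin r → (Over.mk f ⟶ E.total)) (T : Over Y)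
    (s : T ⟶ (trivial Y r).total) : (homOfSections b).push s =
      ∑ i, (show Γ(((Over.map f).obj T).left, ⊤) from coords T s i) • (toBase f T ≫ b i) :=
  BundleHom.ofPush_push _ _ _ _ _ _

lemma homOfSections_isCartesian {b : Fin r → (Over.mk f ⟶ E.total)} (hb : E.IsFrame b) :
    (homOfSections b).IsCartesian := by
  refine BundleHom.isCartesian_of_push_bijective _ fun T => ?_
  have h := (hb _ (toBase f T)).comp (coords (r := r) T).bijective
  exact bijective_of_eq h fun s => homOfSections_push b T s

end VectorBundle

end

section

/-! ### Symplectic bundles of rank two -/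

namespace SymplecticBundle

variable {X : Scheme.{u}} {r : ℕ} (E : SymplecticBundle X r)

lemma form_neg {T : Over X} (s t : T ⟶ E.total) : E.form T s t = - E.form T t s := by
  have h := E.form_self T (s + t)
  simp only [map_add, LinearMap.add_apply, E.form_self, zero_add, add_zero] at h
  exact eq_neg_of_add_eq_zero_right h

lemma eq_zero_of_form_residuePoint (T : Over X) (x : T.left) (s : residuePoint T x ⟶ E.total)
    (h : ∀ t, E.form _ s t = 0) : s = 0 :=
  E.form_nondegenerate _ _ s h

variable (U : SymplecticBundle X 2)

/-- On a bundle of rank two every alternating trilinear map vanishes. -/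
lemma form_cyclic {T : Over X} (a b c : T ⟶ U.total) :
    U.form T a b • c + U.form T b c • a + U.form T c a • b = 0 := by
  -- the identity is checked in a frame, where it is a calculation in the coefficients
  refine U.section_ext _ _ fun T' g e he => ?_
  rw [U.comp_add, U.comp_add, U.comp_smul, U.comp_smul, U.comp_smul, ← U.form_comp,
    ← U.form_comp, ← U.form_comp, U.comp_zero]
  have he' := (he T' (𝟙 _)).2
  obtain ⟨α, hα⟩ := he' (g ≫ a)
  obtain ⟨β, hβ⟩ := he' (g ≫ b)
  obtain ⟨γ, hγ⟩ := he' (g ≫ c)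
  simp only [Category.id_comp, Fin.sum_univ_two] at hα hβ hγ
  rw [← hα, ← hβ, ← hγ]
  simp only [map_add, LinearMap.add_apply, map_smul, LinearMap.smul_apply, U.form_self,
    U.form_neg (e 1) (e 0), smul_eq_mul]
  module

lemma eq_of_form_eq_one {T : Over X} {a b : T ⟶ U.total} (h : U.form T a b = 1)
    (c : T ⟶ U.total) : c = U.form T c b • a - U.form T c a • b := by
  have := U.form_cyclic a b c
  rw [h, one_smul, U.form_neg b c, neg_smul] at this
  rw [← sub_eq_zero, ← this]
  abel

/-- Two sections of a symplectic bundle of rank two with invertible pairing form a frame. -/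
lemma isFrame_pair {T : Over X} {a b : T ⟶ U.total} (h : IsUnit (U.form T a b)) :
    U.IsFrame ![a, b] := by
  intro T' g
  obtain ⟨d, hd⟩ := h.map g.left.appTop.hom
  rw [← U.form_comp] at hd
  constructor
  · intro c c' hc
    simp only [Fin.sum_univ_two, Matrix.cons_val_zero, Matrix.cons_val_one] at hc
    have h1 := congrArg (fun s => U.form T' s (g ≫ b)) hc
    have h2 := congrArg (fun s => U.form T' (g ≫ a) s) hc
    simp only [map_add, LinearMap.add_apply, map_smul, LinearMap.smul_apply, U.form_self,
      smul_eq_mul, mul_zero, add_zero, zero_add, ← hd] at h1 h2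
    funext i
    fin_cases i
    · exact d.isUnit.mul_right_cancel h1
    · exact d.isUnit.mul_right_cancel h2
  · intro c
    have hc := U.form_cyclic (g ≫ a) (g ≫ b) c
    rw [← hd] at hc
    refine ⟨![-((d⁻¹ : (Γ(T'.left, ⊤))ˣ) : Γ(T'.left, ⊤)) * U.form T' (g ≫ b) c,
      -((d⁻¹ : (Γ(T'.left, ⊤))ˣ) : Γ(T'.left, ⊤)) * U.form T' c (g ≫ a)], ?_⟩
    simp only [Fin.sum_univ_two, Matrix.cons_val_zero, Matrix.cons_val_one]
    have hc' : c = ((d⁻¹ : (Γ(T'.left, ⊤))ˣ) : Γ(T'.left, ⊤)) • ((d : Γ(T'.left, ⊤)) • c) := by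
      rw [smul_smul, Units.inv_mul, one_smul]
    conv_rhs => rw [hc', eq_neg_of_add_eq_zero_left ((add_assoc _ _ _).symm.trans hc)]
    module

/-- The two sections of a frame of a symplectic bundle of rank two have invertible pairing. -/
lemma isUnit_form_of_isFrame {T : Over X} {e : Fin 2 → (T ⟶ U.total)} (he : U.IsFrame e) :
    IsUnit (U.form T (e 0) (e 1)) := by
  rw [isUnit_iff_forall_residuePoint]
  intro y hy
  rw [← U.form_comp] at hy
  set p := residuePointι T y with hp
  have := U.eq_zero_of_form_residuePoint _ _ (p ≫ e 0) fun t => by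
    obtain ⟨c, hc⟩ := (he _ p).2 t
    simp only [Fin.sum_univ_two] at hc
    rw [← hc, map_add, map_smul, map_smul, U.form_self, hy, smul_zero, smul_zero, add_zero]
  have h0 := @(he _ p).1 (Pi.single 0 1) 0 (by
    simp only [Fin.sum_univ_two]
    simp only [Pi.single_eq_same, Pi.zero_apply, zero_smul, this, smul_zero, add_zero, ne_eq,
      one_ne_zero, not_false_eq_true, Pi.single_eq_of_ne])
  have := congrFun h0 0
  simp only [Pi.single_eq_same, Pi.zero_apply] at this
  have hn := (isField_functions (T.left.residueField y)).nontrivial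
  exact one_ne_zero (α := Γ(Spec (.of (T.left.residueField y)), ⊤)) this

/-- A symplectic bundle of rank two has local sections with pairing `1`. -/
lemma exists_form_eq_one (T : Over X) (x : T.left) : ∃ W : T.left.Opens, x ∈ W ∧
    ∃ a b : res T W ⟶ U.total, U.form _ a b = 1 := by
  obtain ⟨W, hW, e, he⟩ := U.exists_isFrame T x
  obtain ⟨d, hd⟩ := U.isUnit_form_of_isFrame he
  refine ⟨W, hW, ((d⁻¹ : (Γ((res T W).left, ⊤))ˣ) : Γ((res T W).left, ⊤)) • e 0, e 1, ?_⟩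
  rw [map_smul, LinearMap.smul_apply, ← hd, smul_eq_mul, Units.inv_mul]

/-- Equality of sections of a symplectic bundle of rank two may be checked in the presence of
sections with pairing `1`. -/
lemma section_ext_pair {T : Over X} (s t : T ⟶ U.total)
    (h : ∀ (T' : Over X) (g : T' ⟶ T) (a b : T' ⟶ U.total), U.form T' a b = 1 →
      g ≫ s = g ≫ t) : s = t := by
  refine over_hom_ext _ _ fun x => ?_
  obtain ⟨W, hx, a, b, hab⟩ := U.exists_form_eq_one T x
  exact ⟨W, hx, h _ _ a b hab⟩

lemma ext_of_form {T : Over X} (s t : T ⟶ U.total)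
    (h : ∀ (T' : Over X) (g : T' ⟶ T) (w : T' ⟶ U.total),
      U.form T' (g ≫ s) w = U.form T' (g ≫ t) w) : s = t := by
  refine U.section_ext_pair _ _ fun T' g a b hab => ?_
  rw [U.eq_of_form_eq_one hab (g ≫ s), U.eq_of_form_eq_one hab (g ≫ t), h, h]

/-- Every linear functional on a symplectic bundle of rank two is represented by a section. -/
lemma exists_dual {T : Over X} (l : ∀ T' : Over X, (T' ⟶ T) →
      ((T' ⟶ U.total) →ₗ[Γ(T'.left, ⊤)] Γ(T'.left, ⊤)))
    (hl : ∀ {T'' T' : Over X} (h : T'' ⟶ T') (g : T' ⟶ T) (w : T' ⟶ U.total),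
      l T'' (h ≫ g) (h ≫ w) = h.left.appTop.hom (l T' g w)) :
    ∃ s : T ⟶ U.total, ∀ (T' : Over X) (g : T' ⟶ T) (w : T' ⟶ U.total),
      U.form T' (g ≫ s) w = l T' g w := by
  obtain ⟨s, hs⟩ := exists_of_locally (T := T) (Z := U.total)
    (fun {T'} g s => ∀ (T'' : Over X) (h : T'' ⟶ T') (w : T'' ⟶ U.total),
      U.form T'' (h ≫ s) w = l T'' (h ≫ g) w)
    (fun {T' T''} h g s hs T₃ h' w => by
      have := hs T₃ (h' ≫ h) w
      rwa [Category.assoc, Category.assoc] at this)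
    (fun {T'} g s s' hs hs' => U.ext_of_form _ _ fun T'' h w => by rw [hs, hs'])
    (fun x => by
      obtain ⟨W, hx, a, b, hab⟩ := U.exists_form_eq_one T x
      refine ⟨W, hx, l _ (resι T W) b • a - l _ (resι T W) a • b, fun T'' h w => ?_⟩
      have hab' : U.form T'' (h ≫ a) (h ≫ b) = 1 := by rw [U.form_comp, hab, map_one]
      have e1 : h ≫ (l _ (resι T W) b • a - l _ (resι T W) a • b) =
          l _ (h ≫ resι T W) (h ≫ b) • (h ≫ a) - l _ (h ≫ resι T W) (h ≫ a) • (h ≫ b) := by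
        rw [hl, hl, sub_eq_add_neg, ← neg_smul, U.comp_add, U.comp_smul, U.comp_smul, map_neg,
          neg_smul, ← sub_eq_add_neg]
      rw [e1]
      conv_rhs => rw [U.eq_of_form_eq_one hab' w]
      simp only [map_sub, LinearMap.sub_apply, map_smul, LinearMap.smul_apply, smul_eq_mul]
      rw [U.form_neg (h ≫ b) w, U.form_neg (h ≫ a) w]
      ring)
  refine ⟨s, fun T' g w => ?_⟩
  refine function_eq_of_locally _ _ fun x => ?_
  obtain ⟨W, hx, hW⟩ := hs (g.left x)
  let i := resι T' (g.left ⁻¹ᵁ W)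
  let j : res T' (g.left ⁻¹ᵁ W) ⟶ res T W := Over.homMk (g.left ∣_ W) (by
    have := morphismRestrict_ι g.left W
    calc (g.left ∣_ W) ≫ W.ι ≫ T.hom = (g.left ⁻¹ᵁ W).ι ≫ g.left ≫ T.hom := by
          rw [← Category.assoc, this, Category.assoc]
      _ = _ := by rw [Over.w]; rfl)
  have hij : j ≫ resι T W = i ≫ g := by
    ext1
    exact morphismRestrict_ι g.left W
  refine ⟨g.left ⁻¹ᵁ W, hx, ?_⟩
  have h1 := hW _ j (i ≫ w)
  rw [← Category.assoc, hij, hl, Category.assoc, U.form_comp] at h1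
  exact h1

end SymplecticBundle

end

section

/-! ### Zero loci of sections -/

lemma residuePointι_apply {X : Scheme.{u}} (T : Over X) (x : T.left)
    (z : (residuePoint T x).left) : (residuePointι T x).left z = x :=
  T.left.fromSpecResidueField_apply x z

lemma isField_residuePoint {X : Scheme.{u}} (T : Over X) (x : T.left) :
    IsField Γ((residuePoint T x).left, ⊤) :=
  isField_functions (T.left.residueField x)

lemma exists_residuePoint_lift {X : Scheme.{u}} (T : Over X) {x : T.left} {W : T.left.Opens}
    (hW : x ∈ W) : ∃ p : residuePoint T x ⟶ res T W, p ≫ resι T W = residuePointι T x := by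
  have h : Set.range (T.left.fromSpecResidueField x) ⊆ Set.range W.ι := by
    rw [T.left.range_fromSpecResidueField]
    simpa using hW
  have hl := IsOpenImmersion.lift_fac W.ι (T.left.fromSpecResidueField x) h
  set l := IsOpenImmersion.lift W.ι (T.left.fromSpecResidueField x) h
  have e : l ≫ W.ι ≫ T.hom = T.left.fromSpecResidueField x ≫ T.hom := by
    rw [← Category.assoc, hl]
  exact ⟨Over.homMk l e, by ext1; exact hl⟩

/-- The inclusion of a smaller open subscheme. -/
def resLE {X : Scheme.{u}} (T : Over X) {V W : T.left.Opens} (h : V ≤ W) : res T V ⟶ res T W :=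
  Over.homMk (T.left.homOfLE h) (by
    have : (T.left.homOfLE h ≫ W.ι) ≫ T.hom = V.ι ≫ T.hom := by rw [Scheme.homOfLE_ι]
    rwa [Category.assoc] at this)

lemma resLE_resι {X : Scheme.{u}} (T : Over X) {V W : T.left.Opens} (h : V ≤ W) :
    resLE T h ≫ resι T W = resι T V := by
  ext1
  exact T.left.homOfLE_ι h

namespace VectorBundle

variable {X : Scheme.{u}} {r : ℕ} (E : VectorBundle X r)

/-- A section meets the zero section exactly at the points at which it vanishes. -/
lemma mem_zeroLocus_iff {T : Over X} (s : T ⟶ E.total) (x : T.left) :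
    s.left x ∈ E.zeroLocus ↔ residuePointι T x ≫ s = 0 := by
  constructor
  · intro hx
    obtain ⟨W, hW, b, hb⟩ := E.exists_isFrame T x
    obtain ⟨p, -⟩ := exists_residuePoint_lift T hW
    obtain ⟨c, hc⟩ := (hb _ p).2 (residuePointι T x ≫ s)
    simp only at hc
    rw [← hc]
    refine Finset.sum_eq_zero fun i _ => ?_
    suffices c i = 0 by rw [this, zero_smul]
    -- a nonzero coefficient is invertible on the spectrum of a field, but it vanishes on the fibre
    -- product with the zero section, which is not empty
    by_contra hne
    have hF := isField_residuePoint T x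
    obtain ⟨d, hd⟩ := hF.mul_inv_cancel hne
    let q : (residuePoint T x).left ⟶ E.total.left := (residuePointι T x ≫ s).left
    let z : (residuePoint T x).left := IsLocalRing.closedPoint (T.left.residueField x)
    have hz : q z = s.left x := congrArg s.left (residuePointι_apply T x z)
    have hz' : z ∈ Set.range (Limits.pullback.fst q E.zeroSection) := by
      rw [Scheme.Pullback.range_fst]
      change q z ∈ Set.range E.zeroSection
      rw [hz]
      exact hx
    obtain ⟨y, -⟩ := hz'
    let P : Over X := Over.mk (Limits.pullback.fst q E.zeroSection ≫ (residuePoint T x).hom)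
    let a : P ⟶ residuePoint T x := Over.homMk (Limits.pullback.fst q E.zeroSection)
    have ha : a ≫ residuePointι T x ≫ s = 0 := by
      ext1
      have h1 : Limits.pullback.fst q E.zeroSection ≫ q =
          Limits.pullback.snd q E.zeroSection ≫ E.zeroSection := Limits.pullback.condition
      have h2 : P.hom = Limits.pullback.snd q E.zeroSection := by
        rw [← Over.w (a ≫ residuePointι T x ≫ s)]
        change (Limits.pullback.fst q E.zeroSection ≫ q) ≫ E.total.hom = _
        rw [h1, Category.assoc, E.zeroSection_comp, Category.comp_id]
      rw [E.zero_left, h2]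
      exact h1
    have h0 := @(hb _ (a ≫ p)).1 (fun i => a.left.appTop.hom (c i)) 0 (by
      simp only [Pi.zero_apply, zero_smul, Finset.sum_const_zero]
      rw [← ha, ← hc, E.comp_sum]
      refine Finset.sum_congr rfl fun i _ => ?_
      rw [E.comp_smul, Category.assoc])
    have h1 : a.left.appTop.hom (c i * d) = 0 := by
      rw [map_mul]
      have : a.left.appTop.hom (c i) = 0 := congrFun h0 i
      rw [this, zero_mul]
    rw [hd, map_one] at h1
    have h2 : P.left.basicOpen (1 : Γ(P.left, ⊤)) = ⊤ := Scheme.basicOpen_of_isUnit _ isUnit_one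
    rw [h1, Scheme.basicOpen_zero] at h2
    have : (y : P.left) ∈ (⊤ : P.left.Opens) := by trivial
    rw [← h2] at this
    exact this
  · intro h
    have h1 := congrArg (fun s => s.left) h
    simp only [E.zero_left] at h1
    let z : (residuePoint T x).left := IsLocalRing.closedPoint (T.left.residueField x)
    have hz : (residuePointι T x ≫ s).left z = s.left x :=
      congrArg s.left (residuePointι_apply T x z)
    rw [h1] at hz
    exact ⟨(residuePoint T x).hom z, by rw [← hz]; rfl⟩

lemma mem_zeroLocus_iff_of_isFrame {T : Over X} {ι : Type*} [Fintype ι] {b : ι → (T ⟶ E.total)}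
    (hb : E.IsFrame b) (c : ι → Γ(T.left, ⊤)) (x : T.left) :
    (∑ i, c i • b i).left x ∈ E.zeroLocus ↔ ∀ i, x ∉ T.left.basicOpen (c i) := by
  rw [E.mem_zeroLocus_iff, E.comp_sum]
  simp only [E.comp_smul, mem_basicOpen_iff_ne_zero, not_not]
  constructor
  · intro h
    have := @(hb _ (residuePointι T x)).1 (fun i => (residuePointι T x).left.appTop.hom (c i)) 0 (by
      simpa using h)
    exact fun i => congrFun this i
  · intro h
    refine Finset.sum_eq_zero fun i _ => ?_
    have : (residuePointι T x).left.appTop.hom (c i) = 0 := h i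
    rw [this, zero_smul]

lemma isCompact_of_locally {α : Type*} [TopologicalSpace α] [CompactSpace α] (s : Set α)
    (h : ∀ x, ∃ V : Set α, IsOpen V ∧ x ∈ V ∧ IsCompact (s ∩ V)) : IsCompact s := by
  choose V hV hx hc using h
  obtain ⟨t, ht⟩ := isCompact_univ.elim_finite_subcover V hV fun x _ =>
    Set.mem_iUnion.2 ⟨x, hx x⟩
  have : s = ⋃ x ∈ t, s ∩ V x := by
    ext y
    constructor
    · intro hy
      obtain ⟨x, hxt, hxy⟩ := Set.mem_iUnion₂.1 (ht (Set.mem_univ y))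
      exact Set.mem_iUnion₂.2 ⟨x, hxt, hy, hxy⟩
    · intro hy
      obtain ⟨x, _, hxy⟩ := Set.mem_iUnion₂.1 hy
      exact hxy.1
  rw [this]
  exact t.isCompact_biUnion fun x _ => hc x

/-- The nonvanishing locus of a section is retrocompact. -/
lemma isCompact_preimage_zeroLocus_compl {T : Over X} [CompactSpace T.left] (s : T ⟶ E.total) :
    IsCompact (s.left ⁻¹' (E.zeroLocus : Set E.total.left))ᶜ := by
  refine isCompact_of_locally _ fun x => ?_
  obtain ⟨W, hW, b, hb⟩ := E.exists_isFrame T x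
  obtain ⟨V, hV, hxV, hVW⟩ := exists_isAffineOpen_mem_and_subset (x := x) (U := W) hW
  let j : res T V ⟶ res T W := resLE T hVW
  obtain ⟨c, hc⟩ := (hb _ j).2 (resι T V ≫ s)
  simp only at hc
  refine ⟨V, V.isOpen, hxV, ?_⟩
  have hAff : IsAffine (res T V).left := hV
  have : (s.left ⁻¹' (E.zeroLocus : Set E.total.left))ᶜ ∩ V =
      V.ι '' (⋃ i, ((res T V).left.basicOpen (c i) : Set (res T V).left)) := by
    ext y
    have key : ∀ y : (res T V).left, s.left (V.ι y) ∈ E.zeroLocus ↔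
        ∀ i, y ∉ (res T V).left.basicOpen (c i) := fun y => by
      rw [← mem_zeroLocus_iff_of_isFrame E (hb.comp j) c y, hc]
      rfl
    constructor
    · rintro ⟨h1, h2⟩
      refine ⟨⟨y, h2⟩, ?_, rfl⟩
      by_contra hcon
      refine h1 ((key ⟨y, h2⟩).2 fun i hi => hcon (Set.mem_iUnion.2 ⟨i, hi⟩))
    · rintro ⟨y, hy, rfl⟩
      refine ⟨fun h => ?_, y.2⟩
      obtain ⟨i, hi⟩ := Set.mem_iUnion.1 hy
      exact (key y).1 h i hi
  rw [this]
  refine IsCompact.image ?_ V.ι.continuous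
  refine isCompact_iUnion fun i => ?_
  exact ((isAffineOpen_top (res T V).left).basicOpen (c i)).isCompact

end VectorBundle

/-! ### Symplectic frames -/

namespace SymplecticBundle

variable {X : Scheme.{u}}

/-- The trivial symplectic bundle `Hyp(𝒪_X)`. -/
def hyp (X : Scheme.{u}) : SymplecticBundle X 2 where
  toVectorBundle := VectorBundle.trivial X 2
  form T := LinearMap.mk₂ Γ(T.left, ⊤)
    (fun s t => VectorBundle.coords T s 1 * VectorBundle.coords T t 0 -
      VectorBundle.coords T s 0 * VectorBundle.coords T t 1)
    (fun s s' t => by simp only [map_add, Pi.add_apply]; ring)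
    (fun a s t => by simp only [map_smul, Pi.smul_apply, smul_eq_mul]; ring)
    (fun s t t' => by simp only [map_add, Pi.add_apply]; ring)
    (fun a s t => by simp only [map_smul, Pi.smul_apply, smul_eq_mul]; ring)
  form_comp g s t := by
    simp only [LinearMap.mk₂_apply, VectorBundle.coords_comp, map_sub, map_mul]
  form_self T s := by
    simp only [LinearMap.mk₂_apply]
    ring
  form_nondegenerate K _ p s hs := by
    have h0 := hs ((VectorBundle.coords _).symm ![0, 1])
    have h1 := hs ((VectorBundle.coords _).symm ![1, 0])
    simp only [LinearMap.mk₂_apply, LinearEquiv.apply_symm_apply, Matrix.cons_val_zero,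
      Matrix.cons_val_one, mul_zero, mul_one, zero_sub, sub_zero, neg_eq_zero] at h0 h1
    apply (VectorBundle.coords _).injective
    funext i
    fin_cases i
    · simpa using h0
    · simpa using h1

lemma hyp_form {T : Over X} (s t : T ⟶ (hyp X).total) : (hyp X).form T s t =
    VectorBundle.coords T s 1 * VectorBundle.coords T t 0 -
      VectorBundle.coords T s 0 * VectorBundle.coords T t 1 := rfl

variable {n : ℕ} {r : ℕ} (E : SymplecticBundle X r)

/-- The sections `e` have the standard hyperbolic Gram matrix. -/
def IsHyperbolic {T : Over X} (e : Fin n ⊕ Fin n → (T ⟶ E.total)) : Prop :=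
  ∀ i j, E.form T (e i) (e j) = Matrix.J (Fin n) Γ(T.left, ⊤) i j

/-- The coordinates of a section with respect to a hyperbolic frame `e`. -/
def hyperbolicCoords {T : Over X} (e : Fin n ⊕ Fin n → (T ⟶ E.total)) :
    (T ⟶ E.total) →ₗ[Γ(T.left, ⊤)] (Fin n ⊕ Fin n → Γ(T.left, ⊤)) where
  toFun s := Sum.elim (fun j => - E.form T s (e (.inr j))) (fun j => E.form T s (e (.inl j)))
  map_add' s t := by
    funext i
    rcases i with i | i
    · exact (congrArg Neg.neg (congrFun (congrArg DFunLike.coe ((E.form T).map_add s t)) _)).trans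
        (neg_add _ _)
    · exact congrFun (congrArg DFunLike.coe ((E.form T).map_add s t)) _
  map_smul' a s := by
    funext i
    rcases i with i | i
    · exact (congrArg Neg.neg (congrFun (congrArg DFunLike.coe ((E.form T).map_smul a s)) _)).trans
        (mul_neg _ _).symm
    · exact congrFun (congrArg DFunLike.coe ((E.form T).map_smul a s)) _

variable {E}

lemma IsHyperbolic.comp {T : Over X} {e : Fin n ⊕ Fin n → (T ⟶ E.total)} (he : E.IsHyperbolic e)
    {T' : Over X} (g : T' ⟶ T) : E.IsHyperbolic fun i => g ≫ e i := by
  intro i j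
  rw [E.form_comp, he]
  have key : (Matrix.J (Fin n) Γ(T.left, ⊤)).map g.left.appTop.hom =
      Matrix.J (Fin n) Γ(T'.left, ⊤) := by
    simp [Matrix.J, Matrix.fromBlocks_map, Matrix.map_neg]
  exact congrFun (congrFun key i) j

lemma IsHyperbolic.hyperbolicCoords_sum {T : Over X} {e : Fin n ⊕ Fin n → (T ⟶ E.total)}
    (he : E.IsHyperbolic e) (c : Fin n ⊕ Fin n → Γ(T.left, ⊤)) :
    E.hyperbolicCoords e (∑ i, c i • e i) = c := by
  funext j
  rcases j with j | j <;>
    simp [hyperbolicCoords, he _ _, Matrix.J, Matrix.one_apply]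

lemma IsHyperbolic.isFrame {E : SymplecticBundle X (2 * n)} {T : Over X}
    {e : Fin n ⊕ Fin n → (T ⟶ E.total)} (he : E.IsHyperbolic e)
    {b : Fin (2 * n) → (T ⟶ E.total)} (hb : E.IsFrame b) : E.IsFrame e := by
  intro T' g
  have he' := he.comp g
  let F : (Fin n ⊕ Fin n → Γ(T'.left, ⊤)) →ₗ[Γ(T'.left, ⊤)] (T' ⟶ E.total) :=
    Fintype.linearCombination Γ(T'.left, ⊤) fun i => g ≫ e i
  let B : (Fin (2 * n) → Γ(T'.left, ⊤)) →ₗ[Γ(T'.left, ⊤)] (T' ⟶ E.total) :=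
    Fintype.linearCombination Γ(T'.left, ⊤) fun i => g ≫ b i
  let C := E.hyperbolicCoords fun i => g ≫ e i
  have hCF : ∀ c, C (F c) = c := fun c => by
    rw [Fintype.linearCombination_apply]
    exact he'.hyperbolicCoords_sum c
  have hB : Function.Bijective B := by
    refine bijective_of_eq (hb _ g) fun c => ?_
    rw [Fintype.linearCombination_apply]
  let σ : Fin n ⊕ Fin n ≃ Fin (2 * n) := finSumFinEquiv.trans (finCongr (by ring))
  have hs : Function.Surjective (C.comp B) := fun c => by
    obtain ⟨d, hd⟩ := hB.2 (F c)
    exact ⟨d, by rw [LinearMap.comp_apply, hd, hCF]⟩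
  have hi : Function.Injective (C.comp B) := by
    have h1 := OrzechProperty.injective_of_surjective_endomorphism
      ((LinearEquiv.funCongrLeft Γ(T'.left, ⊤) Γ(T'.left, ⊤) σ.symm).toLinearMap.comp (C.comp B))
      ((LinearEquiv.funCongrLeft Γ(T'.left, ⊤) Γ(T'.left, ⊤) σ.symm).surjective.comp hs)
    exact fun a b hab => h1 (congrArg (LinearEquiv.funCongrLeft Γ(T'.left, ⊤) Γ(T'.left, ⊤) σ.symm)
      hab)
  have hC : Function.Injective C := by
    intro s t hst
    obtain ⟨s, rfl⟩ := hB.2 s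
    obtain ⟨t, rfl⟩ := hB.2 t
    rw [hi hst]
  have : Function.Bijective F := by
    refine ⟨fun c d h => ?_, fun s => ⟨C s, hC (hCF _)⟩⟩
    rw [← hCF c, h, hCF]
  refine bijective_of_eq this fun c => ?_
  rw [Fintype.linearCombination_apply]

end SymplecticBundle

end

section

/-! ### Local triviality of symplectic bundles -/

instance {X : Scheme.{u}} (T : Over X) (W : T.left.Opens) : IsOpenImmersion (resι T W).left :=
  inferInstanceAs (IsOpenImmersion W.ι)

lemma range_resι {X : Scheme.{u}} (T : Over X) (W : T.left.Opens) :
    Set.range (resι T W).left = W :=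
  W.range_ι

namespace SymplecticBundle

variable {X : Scheme.{u}} {n r : ℕ}

/-- A family `u, v` of `m` orthogonal hyperbolic pairs. -/
structure IsHyperbolicFamily (E : SymplecticBundle X r) {T : Over X} {m : ℕ}
    (u v : Fin m → (T ⟶ E.total)) : Prop where
  uu : ∀ i j, E.form T (u i) (u j) = 0
  vv : ∀ i j, E.form T (v i) (v j) = 0
  uv : ∀ i j, E.form T (u i) (v j) = if i = j then -1 else 0

variable {E : SymplecticBundle X r}

lemma IsHyperbolicFamily.vu {T : Over X} {m : ℕ} {u v : Fin m → (T ⟶ E.total)}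
    (h : E.IsHyperbolicFamily u v) (i j) : E.form T (v i) (u j) = if i = j then 1 else 0 := by
  rw [E.form_neg, h.uv]
  by_cases hij : i = j
  · simp [hij]
  · simp [hij, Ne.symm hij]

lemma IsHyperbolicFamily.comp {T T' : Over X} {m : ℕ} {u v : Fin m → (T ⟶ E.total)}
    (h : E.IsHyperbolicFamily u v) (g : T' ⟶ T) :
    E.IsHyperbolicFamily (fun i => g ≫ u i) (fun i => g ≫ v i) where
  uu i j := by rw [E.form_comp, h.uu, map_zero]
  vv i j := by rw [E.form_comp, h.vv, map_zero]
  uv i j := by rw [E.form_comp, h.uv]; split_ifs <;> simp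

lemma IsHyperbolicFamily.isHyperbolic {T : Over X} {m : ℕ} {u v : Fin m → (T ⟶ E.total)}
    (h : E.IsHyperbolicFamily u v) : E.IsHyperbolic (Sum.elim u v) := by
  intro i j
  rcases i with i | i <;> rcases j with j | j
  · simp [h.uu, Matrix.J]
  · by_cases hij : i = j <;> simp [h.uv, Matrix.J, hij]
  · simp [h.vu, Matrix.J, Matrix.one_apply]
  · simp [h.vv, Matrix.J]

/-- The projection of a section to the orthogonal complement of a hyperbolic family. -/
def orthProj {T : Over X} {m : ℕ} (u v : Fin m → (T ⟶ E.total)) (s : T ⟶ E.total) :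
    T ⟶ E.total :=
  s + ∑ i, E.form T s (v i) • u i - ∑ i, E.form T s (u i) • v i

lemma IsHyperbolicFamily.form_orthProj_v {T : Over X} {m : ℕ} {u v : Fin m → (T ⟶ E.total)}
    (h : E.IsHyperbolicFamily u v) (s : T ⟶ E.total) (j : Fin m) :
    E.form T (orthProj u v s) (v j) = 0 := by
  simp only [orthProj, map_add, map_sub, map_sum, LinearMap.add_apply, LinearMap.sub_apply,
    LinearMap.sum_apply, map_smul, LinearMap.smul_apply, h.uv, h.vv, smul_eq_mul, mul_zero,
    Finset.sum_const_zero, mul_ite, Finset.sum_ite_eq', Finset.mem_univ, if_true]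
  ring

lemma IsHyperbolicFamily.form_orthProj_u {T : Over X} {m : ℕ} {u v : Fin m → (T ⟶ E.total)}
    (h : E.IsHyperbolicFamily u v) (s : T ⟶ E.total) (j : Fin m) :
    E.form T (orthProj u v s) (u j) = 0 := by
  simp only [orthProj, map_add, map_sub, map_sum, LinearMap.add_apply, LinearMap.sub_apply,
    LinearMap.sum_apply, map_smul, LinearMap.smul_apply, h.vu, h.uu, smul_eq_mul, mul_zero,
    Finset.sum_const_zero, mul_ite, Finset.sum_ite_eq', Finset.mem_univ, if_true]
  ring

lemma IsHyperbolicFamily.form_orthProj {T : Over X} {m : ℕ} {u v : Fin m → (T ⟶ E.total)}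
    (h : E.IsHyperbolicFamily u v) (s t : T ⟶ E.total) :
    E.form T (orthProj u v s) (orthProj u v t) = E.form T (orthProj u v s) t := by
  conv_lhs => rw [orthProj.eq_def u v t]
  simp only [map_add, map_sub, map_sum, map_smul, h.form_orthProj_u, h.form_orthProj_v, smul_zero,
    Finset.sum_const_zero, add_zero, sub_zero]

/-- A hyperbolic family which is too small to be a frame can be enlarged locally. -/
lemma IsHyperbolicFamily.exists_succ {E : SymplecticBundle X (2 * n)} {T : Over X} {m : ℕ}
    {u v : Fin m → (T ⟶ E.total)} (h : E.IsHyperbolicFamily u v) (hm : m < n) (x : T.left)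
    {b : Fin (2 * n) → (T ⟶ E.total)} (hb : E.IsFrame b) :
    ∃ W : T.left.Opens, x ∈ W ∧ ∃ u' v' : Fin (m + 1) → (res T W ⟶ E.total),
      E.IsHyperbolicFamily u' v' := by
  obtain ⟨k, l, hkl⟩ : ∃ k l, x ∈ T.left.basicOpen
      (E.form T (orthProj u v (b k)) (orthProj u v (b l))) := by
    -- if all pairings of the projected frame vanish at `x`, then the projections vanish in the
    -- fibre by nondegeneracy, and the `2 m` vectors of the family span a space of dimension `2 n`
    by_contra! hcon
    let p := residuePointι T x
    let R := Γ((residuePoint T x).left, ⊤)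
    have hF : IsField R := isField_residuePoint T x
    have := hF.nontrivial
    have h0 : ∀ k, p ≫ orthProj u v (b k) = 0 := fun k => by
      refine E.eq_zero_of_form_residuePoint T x _ fun t => ?_
      obtain ⟨c, rfl⟩ := (hb _ p).2 t
      rw [map_sum]
      refine Finset.sum_eq_zero fun l _ => ?_
      rw [map_smul, E.form_comp, ← h.form_orthProj]
      have := hcon k l
      rw [mem_basicOpen_iff_ne_zero, not_not] at this
      change c l • p.left.appTop.hom _ = 0
      have h' : p.left.appTop.hom (E.form T (orthProj u v (b k)) (orthProj u v (b l))) = 0 := this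
      rw [h', smul_zero]
    let F : (Fin m ⊕ Fin m → R) →ₗ[R] (residuePoint T x ⟶ E.total) :=
      Fintype.linearCombination R fun i => p ≫ Sum.elim u v i
    let B : (Fin (2 * n) → R) →ₗ[R] (residuePoint T x ⟶ E.total) :=
      Fintype.linearCombination R fun i => p ≫ b i
    have hB : Function.Bijective B :=
      bijective_of_eq (hb _ p) fun c => by rw [Fintype.linearCombination_apply]
    have hbr : ∀ k, p ≫ b k ∈ LinearMap.range F := fun k => by
      refine ⟨Sum.elim (fun i => - p.left.appTop.hom (E.form T (b k) (v i)))
        (fun i => p.left.appTop.hom (E.form T (b k) (u i))), ?_⟩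
      have h1 : b k = orthProj u v (b k) + (∑ i, (-E.form T (b k) (v i)) • u i +
          ∑ i, E.form T (b k) (u i) • v i) := by
        simp only [orthProj, neg_smul, Finset.sum_neg_distrib]
        abel
      conv_rhs => rw [h1, E.comp_add, h0, zero_add, E.comp_add, E.comp_sum, E.comp_sum]
      rw [Fintype.linearCombination_apply, Fintype.sum_sum_type]
      simp only [Sum.elim_inl, Sum.elim_inr, E.comp_smul, map_neg]
    have hF' : Function.Surjective F := by
      rw [← LinearMap.range_eq_top, eq_top_iff]
      rintro s -
      obtain ⟨c, rfl⟩ := hB.2 s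
      rw [Fintype.linearCombination_apply]
      exact Submodule.sum_mem _ fun i _ => Submodule.smul_mem _ _ (hbr i)
    have hc := card_le_of_surjective R ((LinearEquiv.ofBijective B hB).symm.toLinearMap.comp F)
      ((LinearEquiv.ofBijective B hB).symm.surjective.comp hF')
    simp only [Fintype.card_fin, Fintype.card_sum] at hc
    omega
  let W := T.left.basicOpen (E.form T (orthProj u v (b k)) (orthProj u v (b l)))
  have hd : IsUnit ((resι T W).left.appTop.hom
      (E.form T (orthProj u v (b k)) (orthProj u v (b l)))) :=
    isUnit_appTop_of_range_subset _ _ (range_resι T W).subset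
  rw [← E.form_comp] at hd
  obtain ⟨d, hd⟩ := hd
  have hW := h.comp (resι T W)
  have hu : ∀ s j, E.form _ (resι T W ≫ orthProj u v s) (resι T W ≫ u j) = 0 := fun s j => by
    rw [E.form_comp, h.form_orthProj_u, map_zero]
  have hv : ∀ s j, E.form _ (resι T W ≫ orthProj u v s) (resι T W ≫ v j) = 0 := fun s j => by
    rw [E.form_comp, h.form_orthProj_v, map_zero]
  have hu' : ∀ s j, E.form _ (resι T W ≫ u j) (resι T W ≫ orthProj u v s) = 0 := fun s j => by
    rw [E.form_neg, hu, neg_zero]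
  have hv' : ∀ s j, E.form _ (resι T W ≫ v j) (resι T W ≫ orthProj u v s) = 0 := fun s j => by
    rw [E.form_neg, hv, neg_zero]
  -- the factor normalizes the pairing of the new pair to `-1`
  refine ⟨W, hkl, Fin.cons (-((d⁻¹ : (Γ((res T W).left, ⊤))ˣ) : Γ((res T W).left, ⊤)) •
      (resι T W ≫ orthProj u v (b k))) (fun i => resι T W ≫ u i),
    Fin.cons (resι T W ≫ orthProj u v (b l)) (fun i => resι T W ≫ v i), ?_, ?_, ?_⟩
  · intro i j
    refine Fin.cases ?_ (fun i => ?_) i <;> refine Fin.cases ?_ (fun j => ?_) j <;>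
      simp only [Fin.cons_zero, Fin.cons_succ, map_smul, LinearMap.smul_apply, E.form_self, hu, hu',
        hW.uu, smul_zero]
  · intro i j
    refine Fin.cases ?_ (fun i => ?_) i <;> refine Fin.cases ?_ (fun j => ?_) j <;>
      simp only [Fin.cons_zero, Fin.cons_succ, map_smul, LinearMap.smul_apply, E.form_self, hv, hv',
        hW.vv, smul_zero]
  · intro i j
    refine Fin.cases ?_ (fun i => ?_) i <;> refine Fin.cases ?_ (fun j => ?_) j
    · simp only [Fin.cons_zero, map_smul, LinearMap.smul_apply, ← hd, smul_eq_mul, neg_mul,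
        Units.inv_mul, if_true]
    · simp only [Fin.cons_zero, Fin.cons_succ, map_smul, LinearMap.smul_apply, hv, smul_zero,
        (Fin.succ_ne_zero j).symm, if_false]
    · simp only [Fin.cons_zero, Fin.cons_succ, hu', Fin.succ_ne_zero, if_false]
    · simp only [Fin.cons_succ, hW.uv, Fin.succ_inj]

variable (E : SymplecticBundle X (2 * n))

/-- Symplectic Gram–Schmidt: hyperbolic families of any length up to half the rank exist
locally. -/
lemma exists_isHyperbolicFamily (m : ℕ) (hm : m ≤ n) (T : Over X) (x : T.left) :
    ∃ W : T.left.Opens, x ∈ W ∧ ∃ u v : Fin m → (res T W ⟶ E.total),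
      E.IsHyperbolicFamily u v := by
  induction m with
  | zero => exact ⟨⊤, trivial, 0, 0, ⟨fun i => i.elim0, fun i => i.elim0, fun i => i.elim0⟩⟩
  | succ m ih =>
    obtain ⟨W₀, hW₀, u, v, huv⟩ := ih (by omega)
    obtain ⟨W₁, hW₁, b, hb⟩ := E.exists_isFrame T x
    let V := W₀ ⊓ W₁
    obtain ⟨W₂, hW₂, u', v', h'⟩ := (huv.comp (resLE T (inf_le_left : V ≤ W₀))).exists_succ
      (by omega) ⟨x, hW₀, hW₁⟩ (hb.comp (resLE T (inf_le_right : V ≤ W₁)))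
    let g : res (res T V) W₂ ⟶ T := resι _ W₂ ≫ resι T V
    have : IsOpenImmersion g.left := by
      rw [Over.comp_left]
      infer_instance
    obtain ⟨W, hW, k, -⟩ := exists_lift_of_isOpenImmersion g x ⟨⟨⟨x, hW₀, hW₁⟩, hW₂⟩, rfl⟩
    exact ⟨W, hW, _, _, h'.comp k⟩

/-- A symplectic bundle is locally trivial as a symplectic bundle. -/
lemma exists_isHyperbolic (T : Over X) (x : T.left) :
    ∃ W : T.left.Opens, x ∈ W ∧ ∃ e : Fin n ⊕ Fin n → (res T W ⟶ E.total),
      E.IsHyperbolic e ∧ E.IsFrame e := by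
  obtain ⟨W₀, hW₀, u, v, huv⟩ := E.exists_isHyperbolicFamily n le_rfl T x
  obtain ⟨W₁, hW₁, b, hb⟩ := E.exists_isFrame T x
  have h := (huv.comp (resLE T (inf_le_left : W₀ ⊓ W₁ ≤ W₀))).isHyperbolic
  exact ⟨W₀ ⊓ W₁, ⟨hW₀, hW₁⟩, _, h, h.isFrame (hb.comp (resLE T inf_le_right))⟩

end SymplecticBundle

end

section

universe v

/-! ### Representability of Zariski sheaves -/

/-- The open cover given by a jointly surjective family of open immersions. -/
def openCoverOfFamily {T : Scheme.{u}} {ι : Type u} (Y : ι → Scheme.{u}) (j : ∀ i, Y i ⟶ T)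
    (hj : ∀ i, IsOpenImmersion (j i)) (hs : ∀ x : T, ∃ i, x ∈ Set.range (j i)) :
    T.OpenCover where
  I₀ := ι
  X := Y
  f := j
  mem₀ := by
    rw [Scheme.presieve₀_mem_precoverage_iff]
    exact ⟨hs, hj⟩

lemma exists_glue_family {T Z : Scheme.{u}} {ι : Type u} (Y : ι → Scheme.{u}) (j : ∀ i, Y i ⟶ T)
    (hj : ∀ i, IsOpenImmersion (j i)) (hs : ∀ x : T, ∃ i, x ∈ Set.range (j i))
    (s : ∀ i, Y i ⟶ Z)
    (compat : ∀ (i i') (T' : Scheme.{u}) (a : T' ⟶ Y i) (b : T' ⟶ Y i'),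
      a ≫ j i = b ≫ j i' → a ≫ s i = b ≫ s i') :
    ∃ t : T ⟶ Z, ∀ i, j i ≫ t = s i :=
  let 𝓤 := openCoverOfFamily Y j hj hs
  ⟨𝓤.glueMorphisms s (fun x y => compat x y _ _ _ Limits.pullback.condition),
    fun x => 𝓤.ι_glueMorphisms s _ x⟩

lemma hom_ext_family {T Z : Scheme.{u}} {ι : Type u} (Y : ι → Scheme.{u}) (j : ∀ i, Y i ⟶ T)
    (hj : ∀ i, IsOpenImmersion (j i)) (hs : ∀ x : T, ∃ i, x ∈ Set.range (j i))
    (s t : T ⟶ Z) (h : ∀ i, j i ≫ s = j i ≫ t) : s = t :=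
  (openCoverOfFamily Y j hj hs).hom_ext _ _ h

/-- A presheaf of types on schemes. -/
structure SchemePresheaf where
  obj : Scheme.{u} → Type v
  map : ∀ {T' T : Scheme.{u}}, (T' ⟶ T) → obj T → obj T'
  map_id : ∀ (T : Scheme.{u}) (h : obj T), map (𝟙 T) h = h
  map_comp : ∀ {T'' T' T : Scheme.{u}} (g : T'' ⟶ T') (f : T' ⟶ T) (h : obj T),
    map (g ≫ f) h = map g (map f h)

namespace SchemePresheaf

variable (H : SchemePresheaf.{u, v})

/-- The Zariski sheaf condition. -/
structure IsSheaf : Prop where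
  sep : ∀ {T : Scheme.{u}} {ι : Type u} (Y : ι → Scheme.{u}) (j : ∀ i, Y i ⟶ T),
    (∀ i, IsOpenImmersion (j i)) → (∀ x : T, ∃ i, x ∈ Set.range (j i)) → ∀ h h' : H.obj T,
    (∀ i, H.map (j i) h = H.map (j i) h') → h = h'
  glue : ∀ {T : Scheme.{u}} {ι : Type u} (Y : ι → Scheme.{u}) (j : ∀ i, Y i ⟶ T),
    (∀ i, IsOpenImmersion (j i)) → (∀ x : T, ∃ i, x ∈ Set.range (j i)) → ∀ h : ∀ i, H.obj (Y i),
    (∀ (i i') (T' : Scheme.{u}) (a : T' ⟶ Y i) (b : T' ⟶ Y i'), a ≫ j i = b ≫ j i' →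
      H.map a (h i) = H.map b (h i')) → ∃ h' : H.obj T, ∀ i, H.map (j i) h' = h i

/-- The element `u` of `H(C)` identifies `C` with an open subfunctor of `H`. -/
structure IsChart {C : Scheme.{u}} (u : H.obj C) : Prop where
  inj : ∀ {T : Scheme.{u}} (k k' : T ⟶ C), H.map k u = H.map k' u → k = k'
  opn : ∀ {T' T : Scheme.{u}} (g : T' ⟶ T) (h : H.obj T) (k : T' ⟶ C), H.map k u = H.map g h →
    ∀ y : T', ∃ W : T.Opens, g y ∈ W ∧ ∃ k : W.toScheme ⟶ C, H.map k u = H.map W.ι h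

variable {H}

/-- The locus where an element of `H(T)` comes from a chart. -/
lemma IsChart.exists_opens (hH : H.IsSheaf) {C : Scheme.{u}} {u : H.obj C} (hu : H.IsChart u)
    {T : Scheme.{u}} (h : H.obj T) : ∃ (D : T.Opens) (k : D.toScheme ⟶ C),
      H.map k u = H.map D.ι h ∧ ∀ (T' : Scheme.{u}) (g : T' ⟶ T) (k' : T' ⟶ C),
        H.map k' u = H.map g h → ∃ l : T' ⟶ D, l ≫ D.ι = g ∧ l ≫ k = k' := by
  let P : T.Opens → Prop := fun W => ∃ k : W.toScheme ⟶ C, H.map k u = H.map W.ι h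
  let D : T.Opens := sSup {W | P W}
  have hD : ∀ x : {x : T // x ∈ D}, ∃ W : T.Opens, P W ∧ x.1 ∈ W := fun x => by
    obtain ⟨W, hW, hx⟩ := TopologicalSpace.Opens.mem_sSup.1 x.2
    exact ⟨W, hW, hx⟩
  choose W hW hxW using hD
  have hle : ∀ x, W x ≤ D := fun x => le_sSup (hW x)
  choose k hk using hW
  have hι : ∀ x, T.homOfLE (hle x) ≫ D.ι = (W x).ι := fun x => Scheme.homOfLE_ι _ _
  have hs : ∀ x : D.toScheme, ∃ y : {x : T // x ∈ D}, x ∈ Set.range (T.homOfLE (hle y)) :=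
    fun x => by
    refine ⟨⟨x.1, x.2⟩, ⟨x.1, hxW ⟨x.1, x.2⟩⟩, ?_⟩
    apply D.ι.isOpenEmbedding.injective
    have h1 := congrArg (fun f => f (⟨x.1, hxW ⟨x.1, x.2⟩⟩ : (W ⟨x.1, x.2⟩).toScheme))
      (hι ⟨x.1, x.2⟩)
    exact h1
  obtain ⟨k₀, hk₀'⟩ := exists_glue_family (ι := {x : T // x ∈ D}) (fun x => (W x).toScheme)
    (fun x => T.homOfLE (hle x)) (fun x => inferInstance) hs k
    (fun x y T' a b hab => hu.inj _ _ (by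
      rw [H.map_comp, hk, H.map_comp, hk, ← H.map_comp, ← H.map_comp, ← hι, ← hι,
        ← Category.assoc, ← Category.assoc, hab]))
  have hk₀ : H.map k₀ u = H.map D.ι h := by
    refine hH.sep (ι := {x : T // x ∈ D}) (fun x => (W x).toScheme)
      (fun x => T.homOfLE (hle x)) (fun x => inferInstance) hs _ _ fun x => ?_
    rw [← H.map_comp, ← H.map_comp, hk₀', hk, hι]
  refine ⟨D, k₀, hk₀, fun T' g k' hk' => ?_⟩
  have hr : Set.range g ⊆ Set.range D.ι := by
    rintro _ ⟨y, rfl⟩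
    obtain ⟨W, hy, hW⟩ := hu.opn g h k' hk' y
    rw [Scheme.Opens.range_ι]
    exact TopologicalSpace.Opens.mem_sSup.2 ⟨W, hW, hy⟩
  refine ⟨IsOpenImmersion.lift D.ι g hr, IsOpenImmersion.lift_fac _ _ _, hu.inj _ _ ?_⟩
  rw [H.map_comp, hk₀, ← H.map_comp, IsOpenImmersion.lift_fac, hk']

/-- The functor to types underlying a presheaf. -/
def toFunctor (H : SchemePresheaf.{u, u}) : Scheme.{u}ᵒᵖ ⥤ Type u where
  obj T := H.obj T.unop
  map f := ↾(H.map f.unop)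
  map_id T := by ext h; exact H.map_id _ h
  map_comp f g := by ext h; exact H.map_comp _ _ h

/-- The morphism of functors defined by an element. -/
def ofElement (H : SchemePresheaf.{u, u}) {C : Scheme.{u}} (u : H.obj C) :
    yoneda.obj C ⟶ H.toFunctor :=
  { app := fun T => ↾(fun k => H.map k u)
    naturality := fun T T' f => by ext k; exact H.map_comp _ _ _ }

lemma isSheaf_toFunctor {H : SchemePresheaf.{u, u}} (hH : H.IsSheaf) :
    Presheaf.IsSheaf Scheme.zariskiTopology.{u} H.toFunctor := by
  rw [isSheaf_iff_isSheaf_of_type, Scheme.zariskiTopology, Scheme.grothendieckTopology,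
    Precoverage.isSheaf_toGrothendieck_iff_of_isStableUnderBaseChange_of_small.{u}]
  intro T 𝓤 x hx
  have hj : ∀ i, IsOpenImmersion (𝓤.f i) := fun i =>
    ((Scheme.presieve₀_mem_precoverage_iff _).1 𝓤.mem₀).2 i
  have hs : ∀ x : T, ∃ i, x ∈ Set.range (𝓤.f i) :=
    ((Scheme.presieve₀_mem_precoverage_iff _).1 𝓤.mem₀).1
  obtain ⟨h, hh⟩ := hH.glue 𝓤.X 𝓤.f hj hs (fun i => x (𝓤.f i) (.mk i)) fun i j T' a b hab =>
    hx a b (.mk i) (.mk j) hab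
  refine ⟨h, ?_, ?_⟩
  · rintro Z e ⟨i⟩
    exact hh i
  · intro h' hh'
    refine hH.sep 𝓤.X 𝓤.f hj hs _ _ fun i => ?_
    exact (hh' (𝓤.f i) (.mk i)).trans (hh i).symm

lemma IsChart.presheaf {H : SchemePresheaf.{u, u}} (hH : H.IsSheaf) {C : Scheme.{u}} {u : H.obj C}
    (hu : H.IsChart u) : IsOpenImmersion.presheaf (H.ofElement u) := by
  refine MorphismProperty.relative.of_exists fun T g => ?_
  obtain ⟨D, k, hk, hD⟩ := hu.exists_opens hH (yonedaEquiv g)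
  have hg : ∀ (T' : Scheme.{u}) (f : T' ⟶ T), g.app (Opposite.op T') f = H.map f
    (yonedaEquiv g) := by
    intro T' f
    have := congrArg (fun φ => φ (𝟙 T)) (g.naturality f.op)
    simpa [yonedaEquiv_apply] using! this
  refine ⟨D, yoneda.map k, D.ι, ?_, inferInstance⟩
  refine IsPullback.of_forall_isPullback_app fun T' => ?_
  rw [Limits.Types.isPullback_iff]
  refine ⟨?_, ?_, ?_⟩
  · ext l
    change H.map (l ≫ k) u = g.app T' (l ≫ D.ι)
    exact (H.map_comp l k u).trans ((congrArg (H.map l) hk).trans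
      ((H.map_comp l D.ι _).symm.trans (hg _ _).symm))
  · rintro l l' ⟨-, hl⟩
    change l ≫ D.ι = l' ≫ D.ι at hl
    exact (cancel_mono D.ι).1 hl
  · intro k' f hkf
    obtain ⟨l, hl, hl'⟩ := hD T'.unop f k' (hkf.trans (hg _ f))
    exact ⟨l, hl', hl⟩

/-- Representability by an open cover by charts, in the form of the theorem of Mathlib. -/
theorem exists_representing_of_charts {H : SchemePresheaf.{u, u}} (hH : H.IsSheaf) {ι : Type u}
    (C : ι → Scheme.{u})
    (u : ∀ i, H.obj (C i)) (hu : ∀ i, H.IsChart (u i))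
    (cover : ∀ {T : Scheme.{u}} (h : H.obj T) (x : T), ∃ W : T.Opens, x ∈ W ∧
      ∃ (i : ι) (k : W.toScheme ⟶ C i), H.map k (u i) = H.map W.ι h) :
    ∃ (G : Scheme.{u}) (h : H.obj G), ∀ T : Scheme.{u},
      Function.Bijective (fun k : T ⟶ G => H.map k h) := by
  have : Presheaf.IsLocallySurjective Scheme.zariskiTopology
      (Limits.Sigma.desc fun i => H.ofElement (u i)) := by
    refine ⟨fun {T} h => ?_⟩
    choose W hW i k hk using cover (T := T) h
    rw [Scheme.zariskiTopology, Scheme.mem_grothendieckTopology_iff]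
    refine ⟨openCoverOfFamily (ι := T) (fun x => (W x).toScheme) (fun x => (W x).ι)
      (fun x => inferInstance) (fun x => ⟨x, by simpa using hW x⟩), ?_⟩
    rintro Z _ ⟨x⟩
    refine ⟨(Limits.Sigma.ι (fun i => yoneda.obj (C i)) (i x)).app _ (k x), ?_⟩
    have h1 := congrArg (fun φ => φ.app (Opposite.op (W x).toScheme) (k x))
      (Limits.Sigma.ι_desc (fun i => H.ofElement (u i)) (i x))
    exact h1.trans (hk x)
  obtain ⟨G, ⟨R⟩⟩ := Scheme.LocalRepresentability.isRepresentable
    (F := ⟨H.toFunctor, isSheaf_toFunctor hH⟩) (f := fun i => H.ofElement (u i))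
    (fun i => (hu i).presheaf hH)
  refine ⟨G, R.homEquiv (𝟙 G), fun T => ?_⟩
  refine bijective_of_eq R.homEquiv.bijective fun k => ?_
  have h1 := R.homEquiv_comp k (𝟙 G)
  rw [Category.comp_id] at h1
  exact h1.symm

/-- A presheaf with essentially small values, with its values replaced by small ones. -/
def shrink (H : SchemePresheaf.{u, v}) [∀ T, Small.{u} (H.obj T)] : SchemePresheaf.{u, u} where
  obj T := Shrink.{u} (H.obj T)
  map f h := equivShrink _ (H.map f ((equivShrink _).symm h))
  map_id T h := by rw [H.map_id, Equiv.apply_symm_apply]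
  map_comp g f h := by rw [H.map_comp, Equiv.symm_apply_apply]

/-- A Zariski sheaf which is covered by charts is representable. The presheaf may take values in a
larger universe as long as these are essentially small. -/
theorem exists_representing (H : SchemePresheaf.{u, v}) [∀ T, Small.{u} (H.obj T)]
    (hH : H.IsSheaf) {ι : Type u} (C : ι → Scheme.{u})
    (u : ∀ i, H.obj (C i)) (hu : ∀ i, H.IsChart (u i))
    (cover : ∀ {T : Scheme.{u}} (h : H.obj T) (x : T), ∃ W : T.Opens, x ∈ W ∧
      ∃ (i : ι) (k : W.toScheme ⟶ C i), H.map k (u i) = H.map W.ι h) :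
    ∃ (G : Scheme.{u}) (h : H.obj G), ∀ T : Scheme.{u},
      Function.Bijective (fun k : T ⟶ G => H.map k h) := by
  have key : ∀ {T' T T₂ : Scheme.{u}} (k : T' ⟶ T) (k₂ : T' ⟶ T₂) (a : H.obj T)
    (b : H.shrink.obj T₂),
      H.shrink.map k (equivShrink _ a) = H.shrink.map k₂ b ↔
        H.map k a = H.map k₂ ((equivShrink _).symm b) := fun k k₂ a b => by
    change equivShrink _ (H.map k ((equivShrink _).symm (equivShrink _ a))) = equivShrink _ _ ↔ _
    rw [Equiv.symm_apply_apply, (equivShrink _).apply_eq_iff_eq]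
  have key' : ∀ {T' T T₂ : Scheme.{u}} (k : T' ⟶ T) (k₂ : T' ⟶ T₂) (a : H.shrink.obj T)
      (b : H.shrink.obj T₂), H.shrink.map k a = H.shrink.map k₂ b ↔
        H.map k ((equivShrink _).symm a) = H.map k₂ ((equivShrink _).symm b) := fun k k₂ a b => by
    exact (equivShrink _).apply_eq_iff_eq
  have hH' : H.shrink.IsSheaf := by
    refine ⟨fun Y j hj hs h h' e => (equivShrink _).symm.injective
      (hH.sep Y j hj hs _ _ fun i => (key' _ _ _ _).1 (e i)), fun Y j hj hs h e => ?_⟩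
    obtain ⟨t, ht⟩ := hH.glue Y j hj hs (fun i => (equivShrink _).symm (h i))
      fun i i' T' a b hab => (key' _ _ _ _).1 (e i i' T' a b hab)
    refine ⟨equivShrink _ t, fun i => (equivShrink _).symm.injective ?_⟩
    change (equivShrink _).symm (equivShrink _ (H.map _ ((equivShrink _).symm (equivShrink _ t)))) =
      _
    rw [Equiv.symm_apply_apply, Equiv.symm_apply_apply, ht]
  have hu' : ∀ i, H.shrink.IsChart (equivShrink _ (u i)) := fun i =>
    ⟨fun k k' e => (hu i).inj k k' (by simpa using! (key _ _ _ _).1 e), fun g h k e y => by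
      obtain ⟨W, hW, k, hk⟩ := (hu i).opn g _ k ((key _ _ _ _).1 e) y
      exact ⟨W, hW, k, (key _ _ _ _).2 hk⟩⟩
  obtain ⟨G, h, hG⟩ := exists_representing_of_charts hH' C (fun i => equivShrink _ (u i)) hu'
    (fun {T} h x => by
      obtain ⟨W, hW, i, k, hk⟩ := cover ((equivShrink _).symm h) x
      exact ⟨W, hW, i, k, (key _ _ _ _).2 hk⟩)
  exact ⟨G, (equivShrink _).symm h, fun T => bijective_of_eq
    ((equivShrink _).symm.bijective.comp (hG T)) fun k =>
      ((equivShrink _).symm_apply_apply _).symm⟩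

end SchemePresheaf

end

section

/-! ### Lines in a vector bundle -/

namespace VectorBundle

variable {X : Scheme.{u}} {r : ℕ} (F : VectorBundle X r)

/-- A morphism to the total space, as a section over its composite with the projection. -/
def asSection {T : Scheme.{u}} (v : T ⟶ F.total.left) : Over.mk (v ≫ F.total.hom) ⟶ F.total :=
  Over.homMk v

/-- The multiple `a v` of a morphism to the total space. -/
def scale {T : Scheme.{u}} (a : Γ(T, ⊤)) (v : T ⟶ F.total.left) : T ⟶ F.total.left :=
  ((show Γ((Over.mk (v ≫ F.total.hom)).left, ⊤) from a) • F.asSection v).left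

lemma scale_hom {T : Scheme.{u}} (a : Γ(T, ⊤)) (v : T ⟶ F.total.left) :
    F.scale a v ≫ F.total.hom = v ≫ F.total.hom :=
  Over.w ((show Γ((Over.mk (v ≫ F.total.hom)).left, ⊤) from a) • F.asSection v)

lemma scale_left {T : Over X} (a : Γ(T.left, ⊤)) (s : T ⟶ F.total) :
    F.scale a s.left = (a • s).left := by
  let g : Over.mk (s.left ≫ F.total.hom) ⟶ T := Over.homMk (𝟙 _) (by simp)
  have h := congrArg (fun s => s.left) (F.comp_smul g a s)
  have h1 : g.left.appTop.hom a = a := by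
    have : g.left = 𝟙 T.left := rfl
    rw [this]
    simp
  have h2 : g ≫ s = F.asSection s.left := by
    ext1
    exact Category.id_comp _
  rw [h1, h2] at h
  exact h.symm.trans (Category.id_comp _)

lemma comp_scale {T' T : Scheme.{u}} (g : T' ⟶ T) (a : Γ(T, ⊤)) (v : T ⟶ F.total.left) :
    g ≫ F.scale a v = F.scale (g.appTop.hom a) (g ≫ v) := by
  let T₁ : Over X := Over.mk (v ≫ F.total.hom)
  let T₂ : Over X := Over.mk (g ≫ v ≫ F.total.hom)
  let g' : T₂ ⟶ T₁ := Over.homMk g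
  have h := congrArg (fun s => s.left) (F.comp_smul g' a (F.asSection v))
  have h2 := F.scale_left (T := T₂) (g.appTop.hom a) (g' ≫ F.asSection v)
  exact h.trans h2.symm

lemma scale_one {T : Scheme.{u}} (v : T ⟶ F.total.left) : F.scale 1 v = v := by
  have h := F.scale_left (T := Over.mk (v ≫ F.total.hom)) 1 (F.asSection v)
  rw [one_smul] at h
  exact h

lemma scale_scale {T : Scheme.{u}} (a b : Γ(T, ⊤)) (v : T ⟶ F.total.left) :
    F.scale a (F.scale b v) = F.scale (a * b) v := by
  have h1 := F.scale_left (T := Over.mk (v ≫ F.total.hom)) b (F.asSection v)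
  have h2 := F.scale_left (T := Over.mk (v ≫ F.total.hom)) (a * b) (F.asSection v)
  have h3 := F.scale_left (T := Over.mk (v ≫ F.total.hom)) a
    ((show Γ((Over.mk (v ≫ F.total.hom)).left, ⊤) from b) • F.asSection v)
  rw [← mul_smul] at h3
  exact h3.trans h2.symm

/-- The morphism `v` to the total space does not meet the zero section. -/
def IsNowhereZero {T : Scheme.{u}} (v : T ⟶ F.total.left) : Prop := ∀ x : T, v x ∉ F.zeroLocus

variable {F} in
lemma IsNowhereZero.comp {T' T : Scheme.{u}} {v : T ⟶ F.total.left} (hv : F.IsNowhereZero v)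
    (g : T' ⟶ T) : F.IsNowhereZero (g ≫ v) := fun x => hv (g x)

lemma exists_isUnit_coeff {T : Over X} (s : T ⟶ F.total) (x : T.left)
    (hx : s.left x ∉ F.zeroLocus) : ∃ W : T.left.Opens, x ∈ W ∧
      ∃ b : Fin r → (res T W ⟶ F.total), F.IsFrame b ∧ ∃ c : Fin r → Γ((res T W).left, ⊤),
        resι T W ≫ s = ∑ i, c i • b i ∧ ∃ i, IsUnit (c i) := by
  obtain ⟨W, hW, b, hb⟩ := F.exists_isFrame T x
  obtain ⟨c, hc⟩ := (hb _ (𝟙 _)).2 (resι T W ≫ s)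
  simp only [Category.id_comp] at hc
  let x' : (res T W).left := (⟨x, hW⟩ : W.toScheme)
  have h1 : ¬ ∀ i, x' ∉ (res T W).left.basicOpen (c i) := by
    rw [← mem_zeroLocus_iff_of_isFrame F hb c, hc]
    exact hx
  push Not at h1
  obtain ⟨i, hi⟩ := h1
  let B : W.toScheme.Opens := (res T W).left.basicOpen (c i)
  have hle : W.ι ''ᵁ B ≤ W := by
    rintro _ ⟨y, -, rfl⟩
    exact y.2
  let j := resLE T hle
  refine ⟨W.ι ''ᵁ B, ⟨⟨x, hW⟩, hi, rfl⟩, _, hb.comp j, fun i => j.left.appTop.hom (c i), ?_, i, ?_⟩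
  · rw [← resLE_resι T hle, Category.assoc, ← hc, F.comp_sum]
    exact Finset.sum_congr rfl fun i _ => F.comp_smul _ _ _
  · refine isUnit_appTop_of_range_subset _ _ ?_
    rintro _ ⟨y, rfl⟩
    obtain ⟨z, hz, hzy⟩ := y.2
    have : T.left.homOfLE hle y = z := by
      apply W.ι.isOpenEmbedding.injective
      have h2 := congrArg (fun f => f y) (T.left.homOfLE_ι hle)
      exact h2.trans hzy.symm
    change T.left.homOfLE hle y ∈ B
    rw [this]
    exact hz

lemma smul_injective_of_isNowhereZero {T : Over X} {s : T ⟶ F.total}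
    (hs : F.IsNowhereZero s.left) {a a' : Γ(T.left, ⊤)} (h : a • s = a' • s) : a = a' := by
  refine function_eq_of_locally _ _ fun x => ?_
  obtain ⟨W, hW, b, hb, c, hc, i, hi⟩ := F.exists_isUnit_coeff s x (hs x)
  refine ⟨W, hW, ?_⟩
  have h1 := congrArg (fun s => resι T W ≫ s) h
  simp only [F.comp_smul, hc, Finset.smul_sum, smul_smul] at h1
  have h2 := @(hb _ (𝟙 _)).1 (fun i => (resι T W).left.appTop.hom a * c i)
    (fun i => (resι T W).left.appTop.hom a' * c i) (by simpa only [Category.id_comp] using h1)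
  exact hi.mul_right_cancel (congrFun h2 i)

lemma scale_injective {T : Scheme.{u}} {v : T ⟶ F.total.left} (hv : F.IsNowhereZero v)
    {a a' : Γ(T, ⊤)} (h : F.scale a v = F.scale a' v) : a = a' :=
  F.smul_injective_of_isNowhereZero (s := F.asSection v) hv (by ext1; exact h)

/-- A line (subbundle of rank `1`) of the pullback of `F` along `base : T ⟶ X`, given by the
sections of `F` which belong to it: `mem t` is the set of the sections over `t : T' ⟶ T`. -/
@[ext] structure LineIn (T : Scheme.{u}) where
  base : T ⟶ X
  mem : ∀ {T' : Scheme.{u}}, (T' ⟶ T) → Set (T' ⟶ F.total.left)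
  hom : ∀ {T' : Scheme.{u}} (t : T' ⟶ T), ∀ v ∈ mem t, v ≫ F.total.hom = t ≫ base
  restrict : ∀ {T'' T' : Scheme.{u}} (g : T'' ⟶ T') (t : T' ⟶ T), ∀ v ∈ mem t,
    g ≫ v ∈ mem (g ≫ t)
  isLocal : ∀ {T' : Scheme.{u}} (t : T' ⟶ T) (v : T' ⟶ F.total.left),
    (∀ y : T', ∃ W : T'.Opens, y ∈ W ∧ W.ι ≫ v ∈ mem (W.ι ≫ t)) → v ∈ mem t
  exists_gen : ∀ x : T, ∃ (V : Scheme.{u}) (j : V ⟶ T), IsOpenImmersion j ∧ x ∈ Set.range j ∧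
    ∃ v : V ⟶ F.total.left, F.IsNowhereZero v ∧ ∀ (T' : Scheme.{u}) (t : T' ⟶ V),
      mem (t ≫ j) = Set.range fun a => F.scale a (t ≫ v)

/-- The line generated by a nowhere vanishing section. -/
def span {T : Scheme.{u}} (v : T ⟶ F.total.left) (hv : F.IsNowhereZero v) : F.LineIn T where
  base := v ≫ F.total.hom
  mem t := Set.range fun a => F.scale a (t ≫ v)
  hom := by
    rintro T' t _ ⟨a, rfl⟩
    simp only [scale_hom, Category.assoc]
  restrict := by
    rintro T'' T' g t _ ⟨a, rfl⟩
    exact ⟨g.appTop.hom a, by simp only [comp_scale, Category.assoc]⟩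
  isLocal := by
    intro T' t v' h
    let T₁ : Over X := Over.mk (t ≫ v ≫ F.total.hom)
    obtain ⟨s, hs⟩ := exists_of_locally (T := T₁) (Z := (trivial X 1).total)
      (fun {T₂} g s => F.scale (coords T₂ s 0) (g.left ≫ t ≫ v) = g.left ≫ v')
      (by
        intro T₂ T₃ h g s e
        rw [Over.comp_left, Category.assoc, Category.assoc, ← e, comp_scale, coords_comp])
      (by
        intro T₂ g s s' e e'
        apply (coords T₂).injective
        funext i
        rw [Subsingleton.elim i 0]
        exact F.scale_injective ((hv.comp t).comp g.left) (e.trans e'.symm))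
      (by
        intro y
        obtain ⟨W, hW, a, ha⟩ := h y
        let a' : Γ((res T₁ W).left, ⊤) := a
        simp only [Category.assoc] at ha
        refine ⟨W, hW, (coords (res T₁ W)).symm fun _ => a', ?_⟩
        exact (congrArg (fun z => F.scale z ((resι T₁ W).left ≫ t ≫ v))
          (congrFun (LinearEquiv.apply_symm_apply (coords (res T₁ W)) fun _ => a') 0)).trans ha)
    refine ⟨coords T₁ s 0, ?_⟩
    refine Scheme.hom_ext_of_forall _ _ fun x => ?_
    obtain ⟨W, hW, e⟩ := hs x
    refine ⟨W, hW, ?_⟩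
    simp only
    rw [coords_comp] at e
    exact (F.comp_scale _ _ _).trans e
  exists_gen x := ⟨T, 𝟙 T, inferInstance, ⟨x, rfl⟩, v, hv, fun T' t => by
    simp only [Category.comp_id]⟩

namespace LineIn

variable {F} {T : Scheme.{u}} (l : F.LineIn T)

/-- The pullback of a line. -/
def map {T' T : Scheme.{u}} (g : T' ⟶ T) (l : F.LineIn T) : F.LineIn T' where
  base := g ≫ l.base
  mem t := l.mem (t ≫ g)
  hom t v hv := (l.hom _ v hv).trans (Category.assoc _ _ _)
  restrict h t v hv := by
    have := l.restrict h _ v hv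
    rwa [← Category.assoc] at this
  isLocal t v h := l.isLocal _ v fun y => by
    obtain ⟨W, hW, e⟩ := h y
    rw [Category.assoc] at e
    exact ⟨W, hW, e⟩
  exists_gen x := by
    obtain ⟨V, j, hj, hx, v, hv, e⟩ := l.exists_gen (g x)
    let j' : (g ⁻¹ᵁ j.opensRange).toScheme ⟶ T' := (g ⁻¹ᵁ j.opensRange).ι
    have hr : Set.range (j' ≫ g) ⊆ Set.range j := by
      rintro _ ⟨y, rfl⟩
      exact y.2
    refine ⟨_, j', inferInstance, ?_, IsOpenImmersion.lift j (j' ≫ g) hr ≫ v, hv.comp _, ?_⟩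
    · rw [Scheme.Opens.range_ι]
      exact hx
    · intro T'' t
      have := e T'' (t ≫ IsOpenImmersion.lift j (j' ≫ g) hr)
      rw [Category.assoc, IsOpenImmersion.lift_fac, Category.assoc] at this
      rw [Category.assoc, this]

lemma map_id : l.map (𝟙 T) = l := by
  refine LineIn.ext (Category.id_comp l.base) ?_
  simp only [map, Category.comp_id]

lemma map_comp {T'' T' : Scheme.{u}} (g : T'' ⟶ T') (f : T' ⟶ T) :
    l.map (g ≫ f) = (l.map f).map g := by
  refine LineIn.ext (Category.assoc g f l.base) ?_
  simp only [map, Category.assoc]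

end LineIn
end VectorBundle

end

section

/-! ### The presheaf of lines -/

namespace VectorBundle

variable {X : Scheme.{u}} {r : ℕ} (F : VectorBundle X r)

namespace LineIn

variable {F} {T : Scheme.{u}} (l : F.LineIn T)

lemma scale_mem {T' : Scheme.{u}} {t : T' ⟶ T} {v : T' ⟶ F.total.left} (hv : v ∈ l.mem t)
    (a : Γ(T', ⊤)) : F.scale a v ∈ l.mem t := by
  refine l.isLocal _ _ fun y => ?_
  obtain ⟨V, j, hj, hx, v₀, hv₀, e⟩ := l.exists_gen (t y)
  let W : T'.Opens := t ⁻¹ᵁ j.opensRange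
  have hr : Set.range (W.ι ≫ t) ⊆ Set.range j := by
    rintro _ ⟨y, rfl⟩
    exact y.2
  have e' := e _ (IsOpenImmersion.lift j (W.ι ≫ t) hr)
  rw [IsOpenImmersion.lift_fac] at e'
  refine ⟨W, hx, ?_⟩
  have h1 := l.restrict W.ι _ _ hv
  rw [e'] at h1 ⊢
  obtain ⟨b, hb⟩ := h1
  refine ⟨W.ι.appTop.hom a * b, ?_⟩
  simp only at hb ⊢
  rw [comp_scale, ← hb, scale_scale]

/-- A line has a generator on a small open neighbourhood of every point. -/
lemma exists_map_eq_span (x : T) (N : T.Opens) (hx : x ∈ N) : ∃ W : T.Opens, x ∈ W ∧ W ≤ N ∧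
    ∃ (v : W.toScheme ⟶ F.total.left) (hv : F.IsNowhereZero v), l.map W.ι = F.span v hv := by
  obtain ⟨V, j, hj, hxj, v₀, hv₀, e⟩ := l.exists_gen x
  let W : T.Opens := j.opensRange ⊓ N
  have hr : Set.range W.ι ⊆ Set.range j := by
    rintro _ ⟨y, rfl⟩
    exact y.2.1
  let g := IsOpenImmersion.lift j W.ι hr
  have hg : g ≫ j = W.ι := IsOpenImmersion.lift_fac _ _ _
  have hm : ∀ {T' : Scheme.{u}} (t : T' ⟶ W), l.mem (t ≫ W.ι) = Set.range fun a =>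
    F.scale a (t ≫ g ≫ v₀) := by
    intro T' t
    have := e T' (t ≫ g)
    rwa [Category.assoc, hg, Category.assoc] at this
  refine ⟨W, ⟨hxj, hx⟩, inf_le_right, g ≫ v₀, hv₀.comp g, LineIn.ext ?_ ?_⟩
  · have h1 : g ≫ v₀ ∈ l.mem (𝟙 _ ≫ W.ι) := by
      rw [hm]
      exact ⟨1, by simp only [scale_one, Category.id_comp]⟩
    have := l.hom _ _ h1
    rw [Category.id_comp] at this
    exact this.symm
  · funext T' t
    exact hm t

lemma mem_span {T' T : Scheme.{u}} {v : T ⟶ F.total.left} (hv : F.IsNowhereZero v) (t : T' ⟶ T)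
    (w : T' ⟶ F.total.left) : w ∈ (F.span v hv).mem t ↔ ∃ a, F.scale a (t ≫ v) = w := Iff.rfl

lemma map_span {T' T : Scheme.{u}} (g : T' ⟶ T) (v : T ⟶ F.total.left) (hv : F.IsNowhereZero v) :
    (F.span v hv).map g = F.span (g ≫ v) (hv.comp g) := by
  refine LineIn.ext (Category.assoc _ _ _).symm ?_
  simp only [map, span, Category.assoc]

lemma self_mem_span {T : Scheme.{u}} {v : T ⟶ F.total.left} (hv : F.IsNowhereZero v) :
    v ∈ (F.span v hv).mem (𝟙 T) := ⟨1, by simp only [scale_one, Category.id_comp]⟩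

lemma exists_scale_of_span_eq {T : Scheme.{u}} {v w : T ⟶ F.total.left} (hv : F.IsNowhereZero v)
    (hw : F.IsNowhereZero w) (h : F.span v hv = F.span w hw) : ∃ a, F.scale a v = w := by
  have := self_mem_span hw
  rw [← h] at this
  obtain ⟨a, ha⟩ := this
  exact ⟨a, by simpa only [Category.id_comp] using ha⟩

lemma span_eq_of_scale {T : Scheme.{u}} {v w : T ⟶ F.total.left} (hv : F.IsNowhereZero v)
    (hw : F.IsNowhereZero w) (a b : Γ(T, ⊤)) (ha : F.scale a v = w) (hb : F.scale b w = v) :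
    F.span v hv = F.span w hw := by
  refine LineIn.ext ?_ ?_
  · change v ≫ F.total.hom = w ≫ F.total.hom
    rw [← ha, scale_hom]
  · funext T' t
    refine Set.Subset.antisymm ?_ ?_
    · rintro _ ⟨c, rfl⟩
      exact ⟨c * t.appTop.hom b, by simp only [← hb, comp_scale, scale_scale]⟩
    · rintro _ ⟨c, rfl⟩
      exact ⟨c * t.appTop.hom a, by simp only [← ha, comp_scale, scale_scale]⟩

lemma le_of_locally (l' : F.LineIn T) (h : ∀ (W : T.Opens), l.mem W.ι ⊆ l'.mem W.ι)
    {T' : Scheme.{u}} (t : T' ⟶ T) : l.mem t ⊆ l'.mem t := by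
  intro v hv
  refine l'.isLocal _ _ fun y => ?_
  obtain ⟨W, hW, -, v₀, hv₀, e⟩ := l.exists_map_eq_span (t y) ⊤ (Set.mem_univ _)
  have h1 := self_mem_span hv₀
  rw [← e] at h1
  have h2 : v₀ ∈ l.mem W.ι := by
    change v₀ ∈ l.mem (𝟙 _ ≫ W.ι) at h1
    rwa [Category.id_comp] at h1
  have h3 := h W h2
  refine ⟨t ⁻¹ᵁ W, hW, ?_⟩
  have h4 : (t ⁻¹ᵁ W).ι ≫ v ∈ (l.map W.ι).mem (t ∣_ W) := by
    change _ ∈ l.mem _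
    rw [morphismRestrict_ι]
    exact l.restrict _ _ _ hv
  rw [e, mem_span] at h4
  obtain ⟨a, ha⟩ := h4
  rw [← ha, ← morphismRestrict_ι]
  exact l'.scale_mem (l'.restrict _ _ _ h3) a

instance : Small.{u} (F.LineIn T) := by
  let Φ : F.LineIn T → (T ⟶ X) × Set (Σ W : T.Opens, W.toScheme ⟶ F.total.left) :=
    fun l => (l.base, {p | p.2 ∈ l.mem p.1.ι})
  refine small_of_injective (f := Φ) fun l l' h => ?_
  have h1 : ∀ (W : T.Opens) v, v ∈ l.mem W.ι ↔ v ∈ l'.mem W.ι := fun W v =>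
    (Set.ext_iff.1 (congrArg Prod.snd h) ⟨W, v⟩)
  refine LineIn.ext (congrArg Prod.fst h) ?_
  funext T' t
  exact Set.Subset.antisymm (l.le_of_locally l' (fun W v => (h1 W v).1) t)
    (l'.le_of_locally l (fun W v => (h1 W v).2) t)

end LineIn

/-- The presheaf of lines in `F`. -/
def linePresheaf : SchemePresheaf.{u, u + 1} where
  obj := F.LineIn
  map := LineIn.map
  map_id _ l := l.map_id
  map_comp g f l := l.map_comp g f

instance (T : Scheme.{u}) : Small.{u} (F.linePresheaf.obj T) :=
  inferInstanceAs (Small.{u} (F.LineIn T))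

lemma exists_opens_lift {T' T : Scheme.{u}} {ι : Type u} {Y : ι → Scheme.{u}} {j : ∀ i, Y i ⟶ T}
    (hj : ∀ i, IsOpenImmersion (j i)) (hs : ∀ x : T, ∃ i, x ∈ Set.range (j i)) (t : T' ⟶ T)
    (y : T') : ∃ W : T'.Opens, y ∈ W ∧ ∃ (i : ι) (k : W.toScheme ⟶ Y i), k ≫ j i = W.ι ≫ t := by
  obtain ⟨i, hi⟩ := hs (t y)
  have := hj i
  let W : T'.Opens := t ⁻¹ᵁ (j i).opensRange
  have hr : Set.range (W.ι ≫ t) ⊆ Set.range (j i) := by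
    rintro _ ⟨y, rfl⟩
    exact y.2
  exact ⟨W, hi, i, IsOpenImmersion.lift (j i) (W.ι ≫ t) hr, IsOpenImmersion.lift_fac _ _ _⟩

/-- A line is glued by taking as its members the vectors which restrict to the given lines. -/
lemma linePresheaf_isSheaf : F.linePresheaf.IsSheaf where
  sep {T ι} Y j hj hs l l' h := by
    have h' : ∀ i, LineIn.map (j i) l = LineIn.map (j i) l' := h
    have key : ∀ (l l' : F.LineIn T), (∀ i, l.map (j i) = l'.map (j i)) →
        ∀ {T' : Scheme.{u}} (t : T' ⟶ T), l.mem t ⊆ l'.mem t := by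
      intro l l' h T' t v hv
      refine l'.isLocal _ _ fun y => ?_
      obtain ⟨W, hW, i, k, hk⟩ := exists_opens_lift hj hs t y
      refine ⟨W, hW, ?_⟩
      have h1 : W.ι ≫ v ∈ (l.map (j i)).mem k := by
        change _ ∈ l.mem _
        rw [hk]
        exact l.restrict _ _ _ hv
      rw [h i, ← hk] at *
      exact h1
    refine LineIn.ext (hom_ext_family Y j hj hs _ _ fun i => congrArg LineIn.base (h' i)) ?_
    funext T' t
    exact Set.Subset.antisymm (key l l' h' t) (key l' l (fun i => (h' i).symm) t)
  glue {T ι} Y j hj hs l hl := by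
    have hl' : ∀ (i i') (T' : Scheme.{u}) (a : T' ⟶ Y i) (b : T' ⟶ Y i'), a ≫ j i = b ≫ j i' →
      (l i : F.LineIn (Y i)).map a = (l i' : F.LineIn (Y i')).map b := hl
    obtain ⟨f, hf⟩ := exists_glue_family Y j hj hs (fun i => (l i : F.LineIn (Y i)).base)
      fun i i' T' a b hab => congrArg LineIn.base (hl' i i' T' a b hab)
    have hm : ∀ {T' : Scheme.{u}} (v : T' ⟶ F.total.left) (i i') (k : T' ⟶ Y i) (k' : T' ⟶ Y i'),
        k ≫ j i = k' ≫ j i' → v ∈ (l i : F.LineIn (Y i)).mem k →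
          v ∈ (l i' : F.LineIn (Y i')).mem k' := by
      intro T' v i i' k k' e hv
      have h1 : v ∈ ((l i : F.LineIn (Y i)).map k).mem (𝟙 _) := by
        change v ∈ (l i : F.LineIn (Y i)).mem _
        rwa [Category.id_comp]
      rw [hl' i i' _ k k' e] at h1
      change v ∈ (l i' : F.LineIn (Y i')).mem _ at h1
      rwa [Category.id_comp] at h1
    -- the condition runs over all morphisms `g` to the base of `v`, as `v` itself need not factor
    -- through one of the `Y i`
    let L : F.LineIn T :=
      { base := f
        mem := fun {T'} t => {v | v ≫ F.total.hom = t ≫ f ∧ ∀ (T'' : Scheme.{u}) (g : T'' ⟶ T') (i)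
          (k : T'' ⟶ Y i),
          k ≫ j i = g ≫ t → g ≫ v ∈ (l i : F.LineIn (Y i)).mem k}
        hom := fun t v hv => hv.1
        restrict := fun g t v hv => ⟨by rw [Category.assoc, hv.1, Category.assoc],
          fun T'' g' i k hk => by
            rw [← Category.assoc]
            exact hv.2 _ _ i k (by rw [hk, Category.assoc])⟩
        isLocal := fun {T'} t v h => by
          refine ⟨?_, fun T'' g i k hk => ?_⟩
          · refine Scheme.hom_ext_of_forall _ _ fun x => ?_
            obtain ⟨W, hW, e⟩ := h x
            exact ⟨W, hW, by simpa only [Category.assoc] using e.1⟩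
          · refine (l i : F.LineIn (Y i)).isLocal _ _ fun y => ?_
            obtain ⟨W, hW, e⟩ := h (g y)
            refine ⟨g ⁻¹ᵁ W, hW, ?_⟩
            have := e.2 _ (g ∣_ W) i ((g ⁻¹ᵁ W).ι ≫ k) (by
              rw [Category.assoc, hk, ← Category.assoc, ← Category.assoc, morphismRestrict_ι])
            rwa [← Category.assoc, morphismRestrict_ι, Category.assoc] at this
        exists_gen := fun x => by
          obtain ⟨i, y, rfl⟩ := hs x
          obtain ⟨V, j', hj', ⟨z, rfl⟩, v₀, hv₀, e⟩ := (l i : F.LineIn (Y i)).exists_gen y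
          have := hj i
          refine ⟨V, j' ≫ j i, inferInstance, ⟨z, rfl⟩, v₀, hv₀, fun T' t => ?_⟩
          rw [← e]
          refine Set.Subset.antisymm (fun v hv => ?_) (fun v hv => ⟨?_, ?_⟩)
          · have := hv.2 T' (𝟙 _) i (t ≫ j') (by simp only [Category.id_comp, Category.assoc])
            rwa [Category.id_comp] at this
          · rw [(l i : F.LineIn (Y i)).hom _ _ hv, ← hf]
            simp only [Category.assoc]
          · intro T'' g i' k hk
            refine hm _ i i' (g ≫ t ≫ j') k ?_ ((l i : F.LineIn (Y i)).restrict g _ _ hv)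
            rw [hk]
            simp only [Category.assoc] }
    refine ⟨L, fun i => ?_⟩
    refine LineIn.ext (hf i) ?_
    funext T' t
    refine Set.Subset.antisymm (fun v hv => ?_) (fun v hv => ⟨?_, ?_⟩)
    · have := hv.2 T' (𝟙 _) i t (by rw [Category.id_comp])
      rwa [Category.id_comp] at this
    · rw [(l i : F.LineIn (Y i)).hom _ _ hv, Category.assoc, hf]
    · intro T'' g i' k hk
      exact hm _ i i' (g ≫ t) k (by rw [hk, Category.assoc])
        ((l i : F.LineIn (Y i)).restrict g _ _ hv)

/-- The presheaf of lines in `F` together with a section of the line. -/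
def pointedLinePresheaf : SchemePresheaf.{u, u + 1} where
  obj T := {p : F.LineIn T × (T ⟶ F.total.left) // p.2 ∈ p.1.mem (𝟙 T)}
  map g p := ⟨(p.1.1.map g, g ≫ p.1.2), by
    have := p.1.1.restrict g _ _ p.2
    rw [Category.comp_id] at this
    change _ ∈ p.1.1.mem _
    rwa [Category.id_comp]⟩
  map_id T p := Subtype.ext (Prod.ext p.1.1.map_id (Category.id_comp _))
  map_comp g f p := Subtype.ext (Prod.ext (p.1.1.map_comp g f) (Category.assoc _ _ _))

instance (T : Scheme.{u}) : Small.{u} (F.pointedLinePresheaf.obj T) :=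
  inferInstanceAs (Small.{u} {p : F.LineIn T × (T ⟶ F.total.left) // p.2 ∈ p.1.mem (𝟙 T)})

lemma pointedLinePresheaf_isSheaf : F.pointedLinePresheaf.IsSheaf where
  sep Y j hj hs p p' h := by
    refine Subtype.ext (Prod.ext ?_ ?_)
    · exact F.linePresheaf_isSheaf.sep Y j hj hs _ _ fun i =>
        congrArg (fun p => p.1.1) (h i)
    · exact hom_ext_family Y j hj hs _ _ fun i => congrArg (fun p => p.1.2) (h i)
  glue {T ι} Y j hj hs p hp := by
    obtain ⟨l, hl⟩ := F.linePresheaf_isSheaf.glue Y j hj hs (fun i => (p i).1.1)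
      fun i i' T' a b hab => congrArg (fun p => p.1.1) (hp i i' T' a b hab)
    obtain ⟨s, hs'⟩ := exists_glue_family Y j hj hs (fun i => (p i).1.2)
      fun i i' T' a b hab => congrArg (fun p => p.1.2) (hp i i' T' a b hab)
    have hl' : ∀ i, (l : F.LineIn T).map (j i) = (p i).1.1 := hl
    have hm : s ∈ (l : F.LineIn T).mem (𝟙 T) := by
      refine (l : F.LineIn T).isLocal _ _ fun y => ?_
      obtain ⟨W, hW, i, k, hk⟩ := exists_opens_lift hj hs (𝟙 T) y
      refine ⟨W, hW, ?_⟩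
      rw [← hk]
      change _ ∈ ((l : F.LineIn T).map (j i)).mem k
      rw [Category.comp_id] at hk
      rw [hl', ← hk, Category.assoc, hs']
      have := (p i).1.1.restrict k _ _ (p i).2
      rwa [Category.comp_id] at this
    exact ⟨⟨(l, s), hm⟩, fun i => Subtype.ext (Prod.ext (hl i) (hs' i))⟩

end VectorBundle

end

section

/-! ### Affine charts of the projective bundle -/

namespace VectorBundle

variable {X : Scheme.{u}} {r : ℕ} (F : VectorBundle X r)

section combination

variable {F} {U : X.Opens} (b : Fin r → (Over.mk U.ι ⟶ F.total))

/-- The linear combination of the sections `b` with coefficients `d`. -/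
def comb {T : Scheme.{u}} (f : T ⟶ U.toScheme) (d : Fin r → Γ(T, ⊤)) : T ⟶ F.total.left :=
  (∑ j, (show Γ((Over.mk (f ≫ U.ι)).left, ⊤) from d j) •
    ((Over.homMk f : Over.mk (f ≫ U.ι) ⟶ Over.mk U.ι) ≫ b j)).left

lemma comb_hom {T : Scheme.{u}} (f : T ⟶ U.toScheme) (d : Fin r → Γ(T, ⊤)) :
    comb b f d ≫ F.total.hom = f ≫ U.ι :=
  Over.w (∑ j, (show Γ((Over.mk (f ≫ U.ι)).left, ⊤) from d j) •
    ((Over.homMk f : Over.mk (f ≫ U.ι) ⟶ Over.mk U.ι) ≫ b j))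

lemma comp_comb {T' T : Scheme.{u}} (g : T' ⟶ T) (f : T ⟶ U.toScheme) (d : Fin r → Γ(T, ⊤)) :
    g ≫ comb b f d = comb b (g ≫ f) fun j => g.appTop.hom (d j) := by
  let g' : Over.mk ((g ≫ f) ≫ U.ι) ⟶ Over.mk (f ≫ U.ι) := Over.homMk g (Category.assoc _ _ _).symm
  have h := F.comp_sum Finset.univ g' fun j =>
    (show Γ((Over.mk (f ≫ U.ι)).left, ⊤) from d j) •
      ((Over.homMk f : Over.mk (f ≫ U.ι) ⟶ Over.mk U.ι) ≫ b j)
  simp only [F.comp_smul] at h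
  exact congrArg (fun s => s.left) h

lemma scale_comb {T : Scheme.{u}} (a : Γ(T, ⊤)) (f : T ⟶ U.toScheme) (d : Fin r → Γ(T, ⊤)) :
    F.scale a (comb b f d) = comb b f fun j => a * d j := by
  have h := F.scale_left (T := Over.mk (f ≫ U.ι)) a (∑ j,
    (show Γ((Over.mk (f ≫ U.ι)).left, ⊤) from d j) •
    ((Over.homMk f : Over.mk (f ≫ U.ι) ⟶ Over.mk U.ι) ≫ b j))
  rw [Finset.smul_sum] at h
  simp only [smul_smul] at h
  exact h

variable {b}

lemma comb_injective (hb : F.IsFrame b) {T : Scheme.{u}} (f : T ⟶ U.toScheme) :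
    Function.Injective (comb b f) := fun d d' h =>
  (hb _ (Over.homMk f : Over.mk (f ≫ U.ι) ⟶ Over.mk U.ι)).1 (Over.OverMorphism.ext h)

lemma exists_eq_comb (hb : F.IsFrame b) {T : Scheme.{u}} (f : T ⟶ U.toScheme)
    (v : T ⟶ F.total.left) (h : v ≫ F.total.hom = f ≫ U.ι) : ∃ d, v = comb b f d := by
  obtain ⟨d, hd⟩ := (hb _ (Over.homMk f : Over.mk (f ≫ U.ι) ⟶ Over.mk U.ι)).2 (Over.homMk v h)
  exact ⟨d, congrArg (fun s => s.left) hd.symm⟩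

lemma comb_mem_zeroLocus_iff (hb : F.IsFrame b) {T : Scheme.{u}} (f : T ⟶ U.toScheme)
    (d : Fin r → Γ(T, ⊤)) (x : T) : comb b f d x ∈ F.zeroLocus ↔ ∀ i, x ∉ T.basicOpen (d i) :=
  mem_zeroLocus_iff_of_isFrame F
    (hb.comp (Over.homMk f : Over.mk (f ≫ U.ι) ⟶ Over.mk U.ι)) d x

lemma isNowhereZero_comb (hb : F.IsFrame b) {T : Scheme.{u}} (f : T ⟶ U.toScheme)
    (d : Fin r → Γ(T, ⊤)) (i : Fin r) (hi : IsUnit (d i)) : F.IsNowhereZero (comb b f d) := by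
  intro x hx
  rw [comb_mem_zeroLocus_iff hb] at hx
  refine hx i ?_
  rw [(isUnit_iff_basicOpen_eq_top _).1 hi]
  exact Set.mem_univ x

end combination

/-- The data of an affine chart of the projective bundle: a frame over an open subscheme and
the index of the coordinate which is normalized to be `1`. -/
structure LineChart where
  U : X.Opens
  b : Fin r → (Over.mk U.ι ⟶ F.total)
  isFrame : F.IsFrame b
  i : Fin r

namespace LineChart

variable {F} (C : F.LineChart)

/-- The vector with the coordinates `c`, except for the `i`-th one, which is `1`. -/
def vec {T : Scheme.{u}} (f : T ⟶ C.U.toScheme) (c : Fin r → Γ(T, ⊤)) : T ⟶ F.total.left :=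
  comb C.b f (Function.update c C.i 1)

lemma isNowhereZero_vec {T : Scheme.{u}} (f : T ⟶ C.U.toScheme) (c : Fin r → Γ(T, ⊤)) :
    F.IsNowhereZero (C.vec f c) :=
  isNowhereZero_comb C.isFrame f _ C.i (by rw [Function.update_self]; exact isUnit_one)

lemma comp_vec {T' T : Scheme.{u}} (g : T' ⟶ T) (f : T ⟶ C.U.toScheme) (c : Fin r → Γ(T, ⊤)) :
    g ≫ C.vec f c = C.vec (g ≫ f) fun j => g.appTop.hom (c j) := by
  rw [vec, comp_comb, vec]
  congr 1
  funext j
  by_cases h : j = C.i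
  · subst h
    simp
  · simp [h]

/-- The line spanned by `vec f c`, with the section `c i • vec f c`. -/
def elt {T : Scheme.{u}} (f : T ⟶ C.U.toScheme) (c : Fin r → Γ(T, ⊤)) :
    F.pointedLinePresheaf.obj T :=
  ⟨(F.span (C.vec f c) (C.isNowhereZero_vec f c), F.scale (c C.i) (C.vec f c)),
    LineIn.scale_mem (F.span (C.vec f c) (C.isNowhereZero_vec f c))
      (LineIn.self_mem_span (C.isNowhereZero_vec f c)) _⟩

lemma map_elt {T' T : Scheme.{u}} (g : T' ⟶ T) (f : T ⟶ C.U.toScheme) (c : Fin r → Γ(T, ⊤)) :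
    F.pointedLinePresheaf.map g (C.elt f c) = C.elt (g ≫ f) fun j => g.appTop.hom (c j) := by
  refine Subtype.ext (Prod.ext ?_ ?_)
  · refine (LineIn.map_span g _ (C.isNowhereZero_vec f c)).trans ?_
    simp only [comp_vec]
    rfl
  · refine (F.comp_scale g _ _).trans ?_
    rw [comp_vec]
    rfl

lemma elt_injective {T : Scheme.{u}} {f f' : T ⟶ C.U.toScheme} {c c' : Fin r → Γ(T, ⊤)}
    (h : C.elt f c = C.elt f' c') : f = f' ∧ c = c' := by
  have h1 := congrArg (fun p => p.1.1.base) h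
  have h2 : C.vec f c ≫ F.total.hom = C.vec f' c' ≫ F.total.hom := h1
  rw [vec, vec, comb_hom, comb_hom, cancel_mono] at h2
  subst h2
  refine ⟨rfl, ?_⟩
  obtain ⟨a, ha⟩ := LineIn.exists_scale_of_span_eq (C.isNowhereZero_vec f c)
    (C.isNowhereZero_vec f c') (congrArg (fun p => p.1.1) h)
  rw [vec, vec, scale_comb] at ha
  have h3 := comb_injective C.isFrame f ha
  have h4 : a = 1 := by simpa using congrFun h3 C.i
  simp only [h4, one_mul] at h3
  have h5 : F.scale (c C.i) (C.vec f c) = F.scale (c' C.i) (C.vec f c') :=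
    congrArg (fun p => p.1.2) h
  have h6 : C.vec f c = C.vec f c' := congrArg (comb C.b f) h3
  rw [h6] at h5
  have h7 := F.scale_injective (C.isNowhereZero_vec f c') h5
  funext j
  by_cases hj : j = C.i
  · rw [hj, h7]
  · simpa [hj] using congrFun h3 j

/-- The affine chart. -/
def scheme : Scheme.{u} := 𝔸(ULift.{u} (Fin r); C.U)

/-- The projection of the chart. -/
def proj : C.scheme ⟶ C.U.toScheme := 𝔸(ULift.{u} (Fin r); C.U) ↘ C.U

/-- The coordinates on the chart. -/
def coord (j : Fin r) : Γ(C.scheme, ⊤) := AffineSpace.coord C.U.toScheme (ULift.up j)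

lemma exists_hom {T : Scheme.{u}} (f : T ⟶ C.U.toScheme) (c : Fin r → Γ(T, ⊤)) :
    ∃ k : T ⟶ C.scheme, k ≫ C.proj = f ∧ ∀ j, k.appTop.hom (C.coord j) = c j :=
  ⟨AffineSpace.homOfVector f fun j => c j.down, AffineSpace.homOfVector_over _ _,
    fun _ => AffineSpace.homOfVector_appTop_coord _ _ _⟩

lemma scheme_hom_ext {T : Scheme.{u}} {k k' : T ⟶ C.scheme} (h : k ≫ C.proj = k' ≫ C.proj)
    (h' : ∀ j, k.appTop.hom (C.coord j) = k'.appTop.hom (C.coord j)) : k = k' :=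
  AffineSpace.hom_ext h fun j => h' j.down

/-- The universal element over the chart. -/
def univ : F.pointedLinePresheaf.obj C.scheme := C.elt C.proj C.coord

/-- A line with a generator whose coefficient of index `i` is invertible lies in the chart. -/
lemma exists_hom_of_isUnit {T : Scheme.{u}} (h : F.pointedLinePresheaf.obj T)
    (f : T ⟶ C.U.toScheme) (d : Fin r → Γ(T, ⊤)) (hd : IsUnit (d C.i))
    (hs : h.1.1 = F.span (comb C.b f d) (isNowhereZero_comb C.isFrame f d C.i hd)) :
    ∃ k : T ⟶ C.scheme, F.pointedLinePresheaf.map k C.univ = h := by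
  obtain ⟨e, he⟩ := hd.exists_left_inv
  have hmem := h.2
  rw [hs, LineIn.mem_span] at hmem
  obtain ⟨m, hm⟩ := hmem
  rw [Category.id_comp, scale_comb] at hm
  let c : Fin r → Γ(T, ⊤) := Function.update (fun j => e * d j) C.i (m * d C.i)
  have hc : Function.update c C.i 1 = fun j => e * d j := by
    funext j
    by_cases hj : j = C.i
    · subst hj
      simp [he]
    · simp [c, hj]
  have hv : C.vec f c = comb C.b f fun j => e * d j := congrArg (comb C.b f) hc
  obtain ⟨k, hk, hk'⟩ := C.exists_hom f c
  refine ⟨k, ?_⟩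
  rw [univ, map_elt, hk, funext hk']
  refine Subtype.ext (Prod.ext ?_ ?_)
  · refine Eq.trans ?_ hs.symm
    refine LineIn.span_eq_of_scale (C.isNowhereZero_vec f c)
      (isNowhereZero_comb C.isFrame f d C.i hd) (d C.i) e ?_ ?_
    · rw [hv, scale_comb]
      congr 1
      funext j
      rw [← mul_assoc, mul_comm (d C.i), he, one_mul]
    · rw [hv, scale_comb]
  · refine Eq.trans ?_ hm
    change F.scale (c C.i) (C.vec f c) = _
    rw [hv, scale_comb]
    congr 1
    funext j
    simp only [c, Function.update_self]
    rw [mul_assoc, ← mul_assoc (d C.i), mul_comm (d C.i), he, one_mul]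

/-- Local coordinates of a line at a point which is mapped into `U`. -/
lemma exists_coords {T : Scheme.{u}} (l : F.LineIn T) (x : T) (hx : l.base x ∈ C.U) :
    ∃ (W : T.Opens) (f : W.toScheme ⟶ C.U.toScheme) (d : Fin r → Γ(W.toScheme, ⊤))
      (hv : F.IsNowhereZero (comb C.b f d)), x ∈ W ∧ l.map W.ι = F.span (comb C.b f d) hv := by
  obtain ⟨W, hW, hWN, v, hv, e⟩ := l.exists_map_eq_span x (l.base ⁻¹ᵁ C.U) hx
  have hr : Set.range (W.ι ≫ l.base) ⊆ Set.range C.U.ι := by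
    rintro _ ⟨y, rfl⟩
    rw [Scheme.Opens.range_ι]
    exact hWN y.2
  have hf := IsOpenImmersion.lift_fac C.U.ι (W.ι ≫ l.base) hr
  set f := IsOpenImmersion.lift C.U.ι (W.ι ≫ l.base) hr
  have hvb : v ≫ F.total.hom = f ≫ C.U.ι := by
    rw [hf]
    exact (congrArg LineIn.base e).symm
  obtain ⟨d, rfl⟩ := exists_eq_comb C.isFrame f v hvb
  exact ⟨W, f, d, hv, hW, e⟩

/-- A line with a generator whose coefficient of index `i` does not vanish at a point lies in the
chart near this point. -/
lemma exists_hom_of_mem {T : Scheme.{u}} (h : F.pointedLinePresheaf.obj T) {W : T.Opens}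
    (f : W.toScheme ⟶ C.U.toScheme) (d : Fin r → Γ(W.toScheme, ⊤))
    (hv : F.IsNowhereZero (comb C.b f d)) (e : h.1.1.map W.ι = F.span (comb C.b f d) hv)
    (x : W.toScheme) (hx : x ∈ W.toScheme.basicOpen (d C.i)) : ∃ W' : T.Opens, W.ι x ∈ W' ∧
      ∃ k : W'.toScheme ⟶ C.scheme, F.pointedLinePresheaf.map k C.univ =
        F.pointedLinePresheaf.map W'.ι h := by
  let B := W.toScheme.basicOpen (d C.i)
  let W' := W.ι ''ᵁ B
  have hr : Set.range W'.ι ⊆ Set.range (B.ι ≫ W.ι) := by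
    rw [Scheme.Opens.range_ι]
    rintro _ ⟨y, hy, rfl⟩
    exact ⟨⟨y, hy⟩, rfl⟩
  obtain ⟨j, hj, hjB⟩ : ∃ j : W'.toScheme ⟶ W.toScheme, j ≫ W.ι = W'.ι ∧ Set.range j ⊆ B := by
    refine ⟨IsOpenImmersion.lift (B.ι ≫ W.ι) W'.ι hr ≫ B.ι, ?_, ?_⟩
    · rw [Category.assoc]
      exact IsOpenImmersion.lift_fac _ _ _
    · rintro _ ⟨y, rfl⟩
      exact (IsOpenImmersion.lift (B.ι ≫ W.ι) W'.ι hr y).2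
  refine ⟨W', ⟨x, hx, rfl⟩, ?_⟩
  refine C.exists_hom_of_isUnit _ (j ≫ f) (fun i => j.appTop.hom (d i)) ?_ ?_
  · exact isUnit_appTop_of_range_subset _ _ hjB
  · change h.1.1.map W'.ι = _
    simp only [← comp_comb]
    rw [← hj, LineIn.map_comp, e, LineIn.map_span]

/-- The chart of lines on which the coefficient of index `i` does not vanish, with a section. -/
lemma isChart_univ : F.pointedLinePresheaf.IsChart C.univ where
  inj k k' h := by
    rw [univ, map_elt, map_elt] at h
    obtain ⟨h1, h2⟩ := C.elt_injective h
    exact C.scheme_hom_ext h1 (congrFun h2)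
  opn {T' T} g h k e y := by
    rw [univ, map_elt] at e
    have e1 : F.span _ (C.isNowhereZero_vec (k ≫ C.proj) fun j => k.appTop.hom (C.coord j)) =
      h.1.1.map g := congrArg (fun p => p.1.1) e
    have hb : (k ≫ C.proj) ≫ C.U.ι = g ≫ h.1.1.base := by
      have := congrArg LineIn.base e1
      exact (comb_hom _ _ _).symm.trans this
    have hx : h.1.1.base (g y) ∈ C.U := by
      have := congrArg (fun f => f y) hb
      change C.U.ι ((k ≫ C.proj) y) = h.1.1.base (g y) at this
      rw [← this]
      exact ((k ≫ C.proj) y).2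
    obtain ⟨W, f, d, hv, hxW, e2⟩ := C.exists_coords h.1.1 (g y) hx
    let x' : W.toScheme := ⟨g y, hxW⟩
    refine C.exists_hom_of_mem h f d hv e2 x' ?_
    -- over `g⁻¹ W` the generator is a multiple of the normalized one
    have e3 := congrArg (LineIn.map (g ⁻¹ᵁ W).ι) e1
    rw [← LineIn.map_comp, ← morphismRestrict_ι, LineIn.map_comp, e2, LineIn.map_span,
      LineIn.map_span] at e3
    obtain ⟨a, ha⟩ := LineIn.exists_scale_of_span_eq _ _ e3.symm
    have hf : (g ∣_ W) ≫ f = (g ⁻¹ᵁ W).ι ≫ k ≫ C.proj := by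
      have h1 := congrArg LineIn.base e2
      have h2 : W.ι ≫ h.1.1.base = f ≫ C.U.ι := h1.trans (comb_hom _ _ _)
      rw [← cancel_mono C.U.ι, Category.assoc, ← h2, ← Category.assoc, morphismRestrict_ι]
      simp only [Category.assoc] at hb ⊢
      rw [hb]
    rw [comp_comb, comp_vec, vec, scale_comb, hf] at ha
    have h4 := congrFun (comb_injective C.isFrame _ ha) C.i
    simp only [Function.update_self] at h4
    have h5 : IsUnit ((g ∣_ W).appTop.hom (d C.i)) := IsUnit.of_mul_eq_one_right _ h4
    have h6 := range_subset_basicOpen _ _ h5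
    let y' : (g ⁻¹ᵁ W).toScheme := ⟨y, hxW⟩
    have h7 : (g ∣_ W) y' = x' := by
      apply W.ι.isOpenEmbedding.injective
      exact congrArg (fun f => f y') (morphismRestrict_ι g W)
    rw [← h7]
    exact h6 ⟨y', rfl⟩

end LineChart

/-- The charts cover: a generator of a line has a nonzero coefficient at every point. -/
lemma exists_lineChart {T : Scheme.{u}} (h : F.pointedLinePresheaf.obj T) (x : T) :
    ∃ W : T.Opens, x ∈ W ∧ ∃ (C : F.LineChart) (k : W.toScheme ⟶ C.scheme),
      F.pointedLinePresheaf.map k C.univ = F.pointedLinePresheaf.map W.ι h := by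
  obtain ⟨U, hU, b, hb⟩ := F.exists_frame (h.1.1.base x)
  -- a bundle of rank zero has no nowhere vanishing section
  have hr : 0 < r := by
    rcases Nat.eq_zero_or_pos r with rfl | hr
    · exfalso
      obtain ⟨V, j, hj, ⟨z, hz⟩, v, hv, e⟩ := h.1.1.exists_gen x
      refine hv z ((F.mem_zeroLocus_iff (F.asSection v) z).2 ?_)
      obtain ⟨W, hW, b, hb⟩ := F.exists_isFrame (Over.mk (v ≫ F.total.hom)) z
      obtain ⟨p, -⟩ := exists_residuePoint_lift (Over.mk (v ≫ F.total.hom)) hW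
      have hs : ∀ s : residuePoint (Over.mk (v ≫ F.total.hom)) z ⟶ F.total, s = 0 := fun s => by
        obtain ⟨c, rfl⟩ := (hb _ p).2 s
        simp
      exact hs _
    · exact hr
  obtain ⟨W, f, d, hv, hxW, e⟩ := (⟨U, b, hb, ⟨0, hr⟩⟩ : F.LineChart).exists_coords h.1.1 x hU
  let x' : W.toScheme := ⟨x, hxW⟩
  have h1 : ¬ ∀ i, x' ∉ W.toScheme.basicOpen (d i) := by
    rw [← comb_mem_zeroLocus_iff hb f d]
    exact hv _
  push Not at h1
  obtain ⟨i, hi⟩ := h1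
  obtain ⟨W', hx', k, hk⟩ := (⟨U, b, hb, i⟩ : F.LineChart).exists_hom_of_mem h f d hv e ⟨x, hxW⟩ hi
  exact ⟨W', hx', ⟨U, b, hb, i⟩, k, hk⟩

theorem exists_representing_pointedLinePresheaf : ∃ (L : Scheme.{u})
    (h : F.pointedLinePresheaf.obj L), ∀ T : Scheme.{u},
      Function.Bijective (fun k : T ⟶ L => F.pointedLinePresheaf.map k h) :=
  SchemePresheaf.exists_representing _ F.pointedLinePresheaf_isSheaf
    (fun C : F.LineChart => C.scheme) (fun C => C.univ) (fun C => C.isChart_univ)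
    fun h x => F.exists_lineChart h x

end VectorBundle

end

section

/-! ### The projective bundle -/

namespace VectorBundle

variable {X : Scheme.{u}} {r : ℕ} (F : VectorBundle X r)

lemma scale_zero {T : Scheme.{u}} (v : T ⟶ F.total.left) :
    F.scale 0 v = (v ≫ F.total.hom) ≫ F.zeroSection := by
  have h := F.scale_left (T := Over.mk (v ≫ F.total.hom)) 0 (F.asSection v)
  rw [zero_smul, F.zero_left] at h
  exact h

namespace LineIn

variable {F} {T : Scheme.{u}} (l : F.LineIn T)

lemma exists_common_generator {T' : Scheme.{u}} (t : T' ⟶ T) (y : T') :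
    ∃ W : T'.Opens, y ∈ W ∧ ∃ v : W.toScheme ⟶ F.total.left, v ∈ l.mem (W.ι ≫ t) ∧
      ∀ w ∈ l.mem (W.ι ≫ t), ∃ a, F.scale a v = w := by
  obtain ⟨W, hW, -, v₀, hv₀, e⟩ := l.exists_map_eq_span (t y) ⊤ (Set.mem_univ _)
  have hm : l.mem ((t ⁻¹ᵁ W).ι ≫ t) = (F.span v₀ hv₀).mem (t ∣_ W) := by
    rw [← e]
    change _ = l.mem _
    rw [morphismRestrict_ι]
  refine ⟨t ⁻¹ᵁ W, hW, (t ∣_ W) ≫ v₀, ?_, fun w hw => ?_⟩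
  · rw [hm]
    exact ⟨1, F.scale_one _⟩
  · rw [hm] at hw
    exact hw

lemma zero_mem {T' : Scheme.{u}} (t : T' ⟶ T) : (t ≫ l.base) ≫ F.zeroSection ∈ l.mem t := by
  refine l.isLocal _ _ fun y => ?_
  obtain ⟨W, hW, v, hv, -⟩ := l.exists_common_generator t y
  refine ⟨W, hW, ?_⟩
  have h := l.scale_mem hv 0
  rw [scale_zero, l.hom _ _ hv] at h
  simpa only [Category.assoc] using h

lemma add_mem {T' : Over X} (t : T'.left ⟶ T) {s s' : T' ⟶ F.total} (hs : s.left ∈ l.mem t)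
    (hs' : s'.left ∈ l.mem t) : (s + s').left ∈ l.mem t := by
  refine l.isLocal _ _ fun y => ?_
  obtain ⟨W, hW, v, hv, h⟩ := l.exists_common_generator t y
  refine ⟨W, hW, ?_⟩
  obtain ⟨a, ha⟩ := h _ (l.restrict W.ι _ _ hs)
  obtain ⟨b, hb⟩ := h _ (l.restrict W.ι _ _ hs')
  have hv' : v ≫ F.total.hom = (res T' W).hom := by
    rw [← F.scale_hom a, ha, Category.assoc, Over.w]
    rfl
  let a' : Γ((res T' W).left, ⊤) := a
  let b' : Γ((res T' W).left, ⊤) := b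
  let V : res T' W ⟶ F.total := Over.homMk v hv'
  have h1 : resι T' W ≫ s = a' • V := by
    ext1
    exact ha.symm.trans (F.scale_left a' V)
  have h2 : resι T' W ≫ s' = b' • V := by
    ext1
    exact hb.symm.trans (F.scale_left b' V)
  have h3 : resι T' W ≫ (s + s') = (a' + b') • V := by
    rw [F.comp_add, h1, h2, add_smul]
  have h4 : W.ι ≫ (s + s').left = F.scale (a' + b') v :=
    (congrArg (fun s => s.left) h3).trans (F.scale_left (a' + b') V).symm
  rw [h4]
  exact l.scale_mem hv _

end LineIn

/-- The projective bundle of lines in `F`, with the total space `L` of the tautological line. -/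
structure ProjectiveBundle where
  G : Scheme.{u}
  line : F.LineIn G
  bijective : ∀ T : Scheme.{u}, Function.Bijective fun k : T ⟶ G => line.map k
  L : Scheme.{u}
  p : L ⟶ G
  w : L ⟶ F.total.left
  w_mem : w ∈ line.mem p
  existsUnique : ∀ {T : Scheme.{u}} (t : T ⟶ G) (v : T ⟶ F.total.left), v ∈ line.mem t →
    ∃! s : T ⟶ L, s ≫ p = t ∧ s ≫ w = v

/-- The presheaf of lines is represented by the zero section of the total space `L` of the
tautological line. Without a description of the zero section in `L`, this is the fixed locus of the
endomorphism of `L` which replaces the section of the line by zero. -/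
theorem exists_projectiveBundle : Nonempty F.ProjectiveBundle := by
  obtain ⟨L, h, hL⟩ := F.exists_representing_pointedLinePresheaf
  have hz : ∀ {T : Scheme.{u}} (l : F.LineIn T), l.base ≫ F.zeroSection ∈ l.mem (𝟙 T) := fun l => by
    have := l.zero_mem (𝟙 _)
    rwa [Category.id_comp] at this
  -- the endomorphism of `L` which replaces the section of the line by zero
  obtain ⟨z, hz'⟩ := (hL L).2 ⟨(h.1.1, h.1.1.base ≫ F.zeroSection), hz _⟩
  have hext : ∀ {T : Scheme.{u}} (k k' : T ⟶ L), h.1.1.map k = h.1.1.map k' →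
      k ≫ h.1.2 = k' ≫ h.1.2 → k = k' := fun k k' e e' =>
    (hL _).1 (Subtype.ext (Prod.ext e e'))
  have hsurj : ∀ {T : Scheme.{u}} (l : F.LineIn T) (v : T ⟶ F.total.left), v ∈ l.mem (𝟙 T) →
      ∃ k : T ⟶ L, h.1.1.map k = l ∧ k ≫ h.1.2 = v := fun l v hv => by
    obtain ⟨k, hk⟩ := (hL _).2 ⟨(l, v), hv⟩
    exact ⟨k, congrArg (fun p => p.1.1) hk, congrArg (fun p => p.1.2) hk⟩
  have hz1 : h.1.1.map z = h.1.1 := congrArg (fun p => p.1.1) hz'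
  have hz2 : z ≫ h.1.2 = h.1.1.base ≫ F.zeroSection := congrArg (fun p => p.1.2) hz'
  -- its fixed locus
  let ε := Limits.equalizer.ι (𝟙 L) z
  have hε : ε ≫ z = ε := by
    have := Limits.equalizer.condition (𝟙 L) z
    rw [Category.comp_id] at this
    exact this.symm
  let l := h.1.1.map ε
  have hl : ∀ T : Scheme.{u}, Function.Bijective fun k : T ⟶ _ => l.map k := by
    refine fun T => ⟨fun k k' e => ?_, fun l' => ?_⟩
    · simp only [l, ← LineIn.map_comp] at e
      have hb : (k ≫ ε) ≫ h.1.1.base = (k' ≫ ε) ≫ h.1.1.base := congrArg LineIn.base e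
      refine (cancel_mono ε).1 (hext _ _ e ?_)
      rw [← hε, Category.assoc, Category.assoc, Category.assoc, Category.assoc, hz2,
        ← Category.assoc, ← Category.assoc, ← Category.assoc, ← Category.assoc, hb]
    · obtain ⟨m, hm, hm'⟩ := hsurj l' _ (hz l')
      have hmz : m ≫ 𝟙 L = m ≫ z := by
        rw [Category.comp_id]
        refine hext _ _ ?_ ?_
        · rw [LineIn.map_comp, hz1]
        · rw [hm', Category.assoc, hz2, ← hm]
          exact Category.assoc _ _ _
      refine ⟨Limits.equalizer.lift m hmz, ?_⟩
      simp only [l, ← LineIn.map_comp]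
      rw [Limits.equalizer.lift_ι, hm]
  obtain ⟨p, hp⟩ := (hl L).2 h.1.1
  have hp' : l.map p = h.1.1 := hp
  have hmp : ∀ {T : Scheme.{u}} (t : T ⟶ L), l.mem (t ≫ p) = h.1.1.mem t := fun t => by
    rw [← hp']
    rfl
  refine ⟨⟨_, l, hl, L, p, h.1.2, ?_, fun {T} t v hv => ?_⟩⟩
  · have := h.2
    rwa [← hmp, Category.id_comp] at this
  · have hv' : v ∈ (l.map t).mem (𝟙 T) := by
      change v ∈ l.mem _
      rwa [Category.id_comp]
    obtain ⟨s, hs, hs'⟩ := hsurj _ v hv'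
    refine ⟨s, ⟨(hl T).1 ?_, hs'⟩, fun s' hs'' => hext _ _ ?_ (hs''.2.trans hs'.symm)⟩
    · change l.map (s ≫ p) = l.map t
      rw [LineIn.map_comp, hp', hs]
    · rw [← hp', ← LineIn.map_comp, hs''.1, ← hs, ← hp', ← LineIn.map_comp]

namespace ProjectiveBundle

variable {F} (P : F.ProjectiveBundle)

/-- The sections of the tautological line over `T ⟶ G`. -/
def tautological (T : Over P.G) : Submodule Γ(T.left, ⊤) (PullbackSections P.line.base F T) where
  carrier := {s | (show (Over.map P.line.base).obj T ⟶ F.total from s).left ∈ P.line.mem T.hom}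
  zero_mem' := by
    have h := P.line.zero_mem T.hom
    have h2 := F.zero_left ((Over.map P.line.base).obj T)
    rw [Over.map_obj_hom] at h2
    rw [← h2] at h
    exact h
  add_mem' {s s'} hs hs' := P.line.add_mem (T' := (Over.map P.line.base).obj T) T.hom hs hs'
  smul_mem' a s hs := by
    have h := P.line.scale_mem hs a
    rw [F.scale_left (T := (Over.map P.line.base).obj T)] at h
    exact h

/-- The functor of sections of the tautological line bundle. -/
def sectionFunctor : SectionFunctor P.G 1 where
  total := Over.mk P.p
  M T := P.tautological T
  e T := Equiv.ofBijective (fun s => ⟨(Over.homMk (s.left ≫ P.w) (by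
      have h := P.line.hom _ _ (P.line.restrict s.left _ _ P.w_mem)
      have h2 : s.left ≫ P.p = T.hom := Over.w s
      rw [h2] at h
      exact h) : (Over.map P.line.base).obj T ⟶ F.total), by
      have h := P.line.restrict s.left _ _ P.w_mem
      have h2 : s.left ≫ P.p = T.hom := Over.w s
      rw [h2] at h
      exact h⟩) (by
    refine ⟨fun s s' e => ?_, fun v => ?_⟩
    · have e' : s.left ≫ P.w = s'.left ≫ P.w := congrArg (fun v => v.1.left) e
      obtain ⟨_, _, h⟩ := P.existsUnique (s.left ≫ P.p) _ (P.line.restrict s.left _ _ P.w_mem)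
      ext1
      exact (h _ ⟨rfl, rfl⟩).trans (h _ ⟨(Over.w s').trans (Over.w s).symm, e'.symm⟩).symm
    · obtain ⟨s, ⟨h, h'⟩, -⟩ := P.existsUnique T.hom _ v.2
      refine ⟨Over.homMk s h, Subtype.ext ?_⟩
      exact Over.OverMorphism.ext h')
  map g s := ⟨(Over.map P.line.base).map g ≫ s.1, by
    have h := P.line.restrict g.left _ _ s.2
    rw [Over.w g] at h
    exact h⟩
  map_add g s t := Subtype.ext (F.comp_add ((Over.map P.line.base).map g) s.1 t.1)
  map_smul g a s := Subtype.ext (F.comp_smul ((Over.map P.line.base).map g) a s.1)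
  e_comp g s := Subtype.ext (Over.OverMorphism.ext (Category.assoc _ _ _))
  frame x := by
    obtain ⟨W, hW, -, v, hv, e⟩ := P.line.exists_map_eq_span x ⊤ (Set.mem_univ _)
    have hm : ∀ {T' : Scheme.{u}} (t : T' ⟶ W), P.line.mem (t ≫ W.ι) =
        Set.range fun a => F.scale a (t ≫ v) := fun t =>
      congrArg (fun l => l.mem t) e
    have hvm : v ∈ P.line.mem W.ι := by
      have := LineIn.self_mem_span hv
      rw [← e] at this
      change v ∈ P.line.mem _ at this
      rwa [Category.id_comp] at this
    let b : P.tautological (Over.mk W.ι) := ⟨(Over.homMk v (P.line.hom _ _ hvm) :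
      (Over.map P.line.base).obj (Over.mk W.ι) ⟶ F.total), hvm⟩
    refine ⟨W, hW, fun _ => b, fun T g => ?_⟩
    have hn : F.IsNowhereZero (g.left ≫ v) := hv.comp _
    let s : (Over.map P.line.base).obj T ⟶ F.total := (Over.map P.line.base).map g ≫ b.1
    have hs : ∀ c : Fin 1 → Γ(T.left, ⊤), (∑ i : Fin 1, c i •
        (⟨s, by
          have h := P.line.restrict g.left _ _ b.2
          rw [Over.w g] at h
          exact h⟩ : P.tautological T)).1 = (show Γ(((Over.map P.line.base).obj T).left, ⊤) from c
            0) • s := fun c => by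
      rw [Fin.sum_univ_one]
      rfl
    refine ⟨fun c c' h => ?_, fun t => ?_⟩
    · have h1 := (hs c).symm.trans ((congrArg Subtype.val h).trans (hs c'))
      have h2 := F.smul_injective_of_isNowhereZero (s := s) hn h1
      funext i
      rw [Subsingleton.elim i 0]
      exact h2
    · have ht := t.2
      have hT : T.hom = g.left ≫ W.ι := (Over.w g).symm
      change _ ∈ P.line.mem T.hom at ht
      rw [hT, hm] at ht
      obtain ⟨a, ha⟩ := ht
      refine ⟨fun _ => a, Subtype.ext ((hs fun _ => a).trans ?_)⟩
      refine Over.OverMorphism.ext ?_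
      exact (F.scale_left (T := (Over.map P.line.base).obj T) a s).symm.trans ha

/-- The tautological line bundle. -/
def bundle : VectorBundle P.G 1 := P.sectionFunctor.bundle

/-- The sections of the tautological line bundle. -/
def sections (T : Over P.G) : (T ⟶ P.bundle.total) ≃ₗ[Γ(T.left, ⊤)] P.tautological T :=
  P.sectionFunctor.sections T

lemma sections_comp {T' T : Over P.G} (g : T' ⟶ T) (s : T ⟶ P.bundle.total) :
    (P.sections T' (g ≫ s)).1 = (Over.map P.line.base).map g ≫ (P.sections T s).1 :=
  congrArg Subtype.val (P.sectionFunctor.sections_comp g s)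

/-- The inclusion of the tautological line bundle. -/
def incl : BundleHom P.line.base P.bundle F :=
  .ofPush (fun T s => (P.sections T s).1)
    (fun g s => P.sections_comp g s)
    (fun T s t => congrArg Subtype.val (map_add (P.sections T) s t))
    (fun T a s => congrArg Subtype.val (LinearEquiv.map_smul (P.sections T) a s))

lemma incl_push (T : Over P.G) (s : T ⟶ P.bundle.total) :
    P.incl.push s = (P.sections T s).1 := BundleHom.ofPush_push _ _ _ _ _ _

end ProjectiveBundle
end VectorBundle

end

section

/-! ### The Grassmannian of lines -/

namespace BundleHom

variable {T X : Scheme.{u}} {f : T ⟶ X} {r : ℕ} {W : VectorBundle T 1} {F : VectorBundle X r}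
  (h : BundleHom f W F)

variable {h} in
lemma IsSubbundle.isNowhereZero (hh : h.IsSubbundle) {T₁ : Over T} {b : Fin 1 → (T₁ ⟶ W.total)}
    (hb : W.IsFrame b) : F.IsNowhereZero (h.push (b 0)).left := by
  intro x hx
  have h1 := (F.mem_zeroLocus_iff (h.push (b 0)) x).1 hx
  have h2 : h.push (residuePointι T₁ x ≫ b 0) = 0 := by
    ext1
    have h3 := congrArg (fun s => s.left) h1
    simp only [F.zero_left] at h3 ⊢
    rw [push_left]
    refine (Category.assoc _ _ _).trans (h3.trans ?_)
    congr 1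
  have h4 : residuePointι T₁ x ≫ b 0 = 0 :=
    hh (T₁.left.residueField x) (T₁.left.fromSpecResidueField x ≫ T₁.hom)
      (h2.trans (h.push_zero (residuePoint T₁ x)).symm)
  have h5 := @(hb _ (residuePointι T₁ x)).1 1 0 (by simp [h4])
  have h6 : (1 : Γ((residuePoint T₁ x).left, ⊤)) = 0 := congrFun h5 0
  obtain ⟨a, b, hab⟩ := (isField_residuePoint T₁ x).exists_pair_ne
  exact hab (by rw [← one_mul a, ← one_mul b, h6, zero_mul, zero_mul])

variable {h} in
lemma IsSubbundle.push_injective (hh : h.IsSubbundle) (T₁ : Over T) :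
    Function.Injective (h.push (T := T₁)) := by
  intro s s' e
  refine W.section_ext _ _ fun T' g b hb => ?_
  obtain ⟨c, hc⟩ := (hb _ (𝟙 _)).2 (g ≫ s)
  obtain ⟨c', hc'⟩ := (hb _ (𝟙 _)).2 (g ≫ s')
  simp only [Category.id_comp, Fin.sum_univ_one] at hc hc'
  have h1 : h.push (g ≫ s) = h.push (g ≫ s') := by rw [push_comp, push_comp, e]
  rw [← hc, ← hc', push_smul, push_smul] at h1
  rw [← hc, ← hc']
  congr 1
  exact F.smul_injective_of_isNowhereZero (hh.isNowhereZero hb) h1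

/-- The line which is the image of a subbundle of rank `1`. -/
def toLine (hh : h.IsSubbundle) : F.LineIn T where
  base := f
  mem t := {v | ∃ s, s ≫ W.total.hom = t ∧ s ≫ h.left = v}
  hom := by
    rintro T' t _ ⟨s, rfl, rfl⟩
    rw [Category.assoc, h.left_comp, Category.assoc]
  restrict := by
    rintro T'' T' g t _ ⟨s, rfl, rfl⟩
    exact ⟨g ≫ s, Category.assoc _ _ _, Category.assoc _ _ _⟩
  isLocal {T'} t v hv := by
    obtain ⟨s, hs⟩ := exists_of_locally (T := Over.mk t) (Z := W.total)
      (fun {T₂} g s => s.left ≫ h.left = g.left ≫ v)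
      (fun {T₂ T₃} k g s e => by
        rw [Over.comp_left, Category.assoc, e, Over.comp_left, Category.assoc])
      (fun {T₂} g s s' e e' => hh.push_injective _ (by ext1; exact e.trans e'.symm))
      (fun y => by
        obtain ⟨N, hN, s, hs, hs'⟩ := hv y
        exact ⟨N, hN, Over.homMk s hs, hs'⟩)
    refine ⟨s.left, Over.w s, ?_⟩
    refine Scheme.hom_ext_of_forall _ _ fun x => ?_
    obtain ⟨N, hN, e⟩ := hs x
    exact ⟨N, hN, (Category.assoc _ _ _).symm.trans e⟩
  exists_gen x := by
    obtain ⟨U, hU, b, hb⟩ := W.exists_frame x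
    refine ⟨U, U.ι, inferInstance, by simpa using hU, (b 0).left ≫ h.left,
      hh.isNowhereZero hb, fun T' t => ?_⟩
    let g : Over.mk (t ≫ U.ι) ⟶ Over.mk U.ι := Over.homMk t
    have key : ∀ a : Γ((Over.mk (t ≫ U.ι)).left, ⊤),
        (a • (g ≫ b 0)).left ≫ h.left = F.scale a (t ≫ (b 0).left ≫ h.left) := fun a => by
      have h1 := congrArg (fun s => s.left) (h.push_smul a (g ≫ b 0))
      have h2 := F.scale_left (T := (Over.map f).obj (Over.mk (t ≫ U.ι))) a (h.push (g ≫ b 0))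
      rw [push_left, Over.comp_left, Category.assoc] at h2
      exact h1.trans h2.symm
    refine Set.Subset.antisymm ?_ ?_
    · rintro _ ⟨s, hs, rfl⟩
      obtain ⟨c, hc⟩ := (hb _ g).2 (Over.homMk s hs)
      simp only [Fin.sum_univ_one] at hc
      refine ⟨c 0, ?_⟩
      have h1 := congrArg (fun s => s.left ≫ h.left) hc
      exact (key _).symm.trans h1
    · rintro _ ⟨a, rfl⟩
      let a' : Γ((Over.mk (t ≫ U.ι)).left, ⊤) := a
      exact ⟨_, Over.w (a' • (g ≫ b 0)), key a'⟩

end BundleHom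

namespace VectorBundle

/-- The identification of the two iterated changes of base. -/
def mapAssoc {T G X : Scheme.{u}} (g : T ⟶ G) (π : G ⟶ X) (T' : Over T) :
    (Over.map π).obj ((Over.map g).obj T') ⟶ (Over.map (g ≫ π)).obj T' :=
  Over.homMk (𝟙 T'.left) (by simp)

namespace ProjectiveBundle

variable {X : Scheme.{u}} {r : ℕ} {F : VectorBundle X r} (P : F.ProjectiveBundle)

lemma incl_isSubbundle : P.incl.IsSubbundle := by
  intro K _ p s s' h
  rw [incl_push, incl_push] at h
  exact (P.sections _).injective (Subtype.ext h)

lemma toLine_incl : P.incl.toLine P.incl_isSubbundle = P.line := by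
  refine LineIn.ext rfl ?_
  funext T t
  refine Set.Subset.antisymm ?_ ?_
  · rintro _ ⟨s, hs, rfl⟩
    let s' : Over.mk t ⟶ P.bundle.total := Over.homMk s hs
    have h := (P.sections _ s').2
    rw [← incl_push] at h
    exact h
  · intro v hv
    let v' : P.tautological (Over.mk t) := ⟨(Over.homMk v (P.line.hom _ _ hv) :
      (Over.map P.line.base).obj (Over.mk t) ⟶ F.total), hv⟩
    let s := (P.sections _).symm v'
    refine ⟨s.left, Over.w s, ?_⟩
    have h := P.incl_push _ s
    rw [LinearEquiv.apply_symm_apply] at h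
    exact congrArg (fun s => s.left) h

/-- Rank one subbundles of a pullback of `F` correspond to lines in `F` by `toLine`, so the
projective bundle has the universal property of the Grassmannian. -/
lemma isGrassmannian : IsGrassmannian F 1 P.line.base P.bundle P.incl where
  isSubbundle := P.incl_isSubbundle
  existsUnique T f W h hh := by
    obtain ⟨g, hg⟩ := (P.bijective T).2 (h.toLine hh)
    have hg' : P.line.map g = h.toLine hh := hg
    obtain rfl : g ≫ P.line.base = f := congrArg LineIn.base hg'
    refine ⟨g, ⟨rfl, ?_⟩, ?_⟩
    · have hmem : ∀ {T' : Over T} (s : T' ⟶ W.total),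
          (mapAssoc g P.line.base T' ≫ h.push s).left ∈ P.line.mem (T'.hom ≫ g) := fun {T'} s => by
        change _ ∈ (P.line.map g).mem T'.hom
        rw [hg']
        exact ⟨s.left, Over.w s, (Category.id_comp _).symm⟩
      let φ : ∀ T' : Over T, (T' ⟶ W.total) → P.tautological ((Over.map g).obj T') :=
        fun T' s => ⟨mapAssoc g P.line.base T' ≫ h.push s, hmem s⟩
      let k : BundleHom g W P.bundle := .ofPush
        (fun T' s => (P.sections _).symm (φ T' s))
        (fun {T'' T'} g' s => by
          apply (P.sections _).injective
          rw [LinearEquiv.apply_symm_apply]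
          refine Subtype.ext ?_
          rw [P.sections_comp, LinearEquiv.apply_symm_apply]
          refine Over.OverMorphism.ext ?_
          change 𝟙 _ ≫ (g'.left ≫ s.left) ≫ h.left = g'.left ≫ 𝟙 _ ≫ s.left ≫ h.left
          simp only [Category.id_comp, Category.assoc])
        (fun T' s t => by
          rw [← map_add]
          congr 1
          refine Subtype.ext ?_
          change mapAssoc g P.line.base T' ≫ h.push (s + t) = mapAssoc g P.line.base T' ≫ h.push s +
            mapAssoc g P.line.base T' ≫ h.push t
          rw [h.push_add, F.comp_add])
        (fun T' a s => by
          refine Eq.trans ?_ (LinearEquiv.map_smul (P.sections ((Over.map g).obj T')).symm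
            (show Γ(((Over.map g).obj T').left, ⊤) from a) (φ T' s))
          congr 1
          refine Subtype.ext ?_
          change mapAssoc g P.line.base T' ≫ h.push (a • s) =
            (show Γ(((Over.map P.line.base).obj ((Over.map g).obj T')).left, ⊤) from a) •
            (mapAssoc g P.line.base T' ≫ h.push s)
          rw [h.push_smul, F.comp_smul]
          congr 1)
      have hk : ∀ {T' : Over T} (s : T' ⟶ W.total),
          P.sections _ (k.push s) = φ T' s := fun s => by
        have h1 : k.push s = (P.sections _).symm (φ _ s) :=
          BundleHom.ofPush_push _ _ _ _ _ _
        rw [h1, LinearEquiv.apply_symm_apply]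
      refine ⟨k, BundleHom.isCartesian_of_push_bijective _ fun T' => ⟨fun s s' e => ?_,
        fun v => ?_⟩, ?_⟩
      · have h1 := congrArg (P.sections _) e
        rw [hk, hk] at h1
        refine hh.push_injective _ (Over.OverMorphism.ext ?_)
        have h2 : 𝟙 _ ≫ (h.push s).left = 𝟙 _ ≫ (h.push s').left :=
          congrArg (fun v => v.1.left) h1
        simpa only [Category.id_comp] using h2
      · have h1 := (P.sections _ v).2
        have h2 : (show (Over.map P.line.base).obj ((Over.map g).obj T') ⟶ F.total from
          (P.sections _ v).1).left ∈ (P.line.map g).mem T'.hom := h1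
        rw [hg'] at h2
        obtain ⟨s, hs, hs'⟩ := h2
        refine ⟨Over.homMk s hs, (P.sections _).injective ?_⟩
        rw [hk]
        refine Subtype.ext (Over.OverMorphism.ext ?_)
        exact (Category.id_comp _).trans hs'
      · have h1 := P.incl_push _ (k.push (𝟙 W.total))
        rw [hk] at h1
        have h2 : ((𝟙 W.total : W.total ⟶ W.total).left ≫ k.left) ≫ P.incl.left =
          𝟙 _ ≫ (𝟙 W.total : W.total ⟶ W.total).left ≫ h.left := congrArg (fun s => s.left) h1
        simpa only [Over.id_left, Category.id_comp] using h2
    · rintro g' ⟨hb, k, hk, hk'⟩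
      refine (P.bijective T).1 (Eq.trans ?_ hg'.symm)
      refine LineIn.ext hb ?_
      change (fun {T' : Scheme.{u}} (t : T' ⟶ T) => P.line.mem (t ≫ g')) = _
      funext T' t
      have h0 : P.line.mem (t ≫ g') = (P.incl.toLine P.incl_isSubbundle).mem (t ≫ g') := by
        rw [toLine_incl]
      refine h0.trans (Set.Subset.antisymm ?_ ?_)
      · rintro _ ⟨s, hs, rfl⟩
        refine ⟨hk.lift s t hs, hk.lift_snd _ _ _, ?_⟩
        rw [← hk', ← Category.assoc, hk.lift_fst]
      · rintro _ ⟨s, rfl, rfl⟩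
        refine ⟨s ≫ k.left, ?_, ?_⟩
        · rw [Category.assoc, k.left_comp, Category.assoc]
        · rw [Category.assoc, hk']

end ProjectiveBundle
end VectorBundle

end

section

/-! ### Total spaces of vector bundles belong to the category -/

namespace VectorBundle

variable {X : Scheme.{u}} {r : ℕ} (E : VectorBundle X r)

/-- The functor of sections of `E ⊕ 𝒪_X`. -/
def addOneFunctor : SectionFunctor X (r + 1) where
  total := Over.mk ((𝔸(PUnit.{u + 1}; E.total.left) ↘ E.total.left) ≫ E.total.hom)
  M T := (T ⟶ E.total) × Γ(T.left, ⊤)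
  e T :=
    { toFun s := (Over.homMk (s.left ≫ (𝔸(PUnit.{u + 1}; E.total.left) ↘ E.total.left))
          ((Category.assoc _ _ _).trans (Over.w s)),
        s.left.appTop.hom (AffineSpace.coord E.total.left PUnit.unit))
      invFun p := Over.homMk (AffineSpace.homOfVector p.1.left fun _ => p.2) (by
        have h := AffineSpace.homOfVector_over p.1.left (fun _ : PUnit.{u + 1} => p.2)
        change _ ≫ _ ≫ E.total.hom = _
        rw [← Category.assoc, h, Over.w])
      left_inv s := by
        ext1
        refine AffineSpace.hom_ext ?_ fun i => ?_
        · exact AffineSpace.homOfVector_over _ _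
        · exact AffineSpace.homOfVector_appTop_coord _ _ _
      right_inv p := by
        refine Prod.ext (Over.OverMorphism.ext ?_) ?_
        · exact AffineSpace.homOfVector_over _ _
        · exact AffineSpace.homOfVector_appTop_coord _ _ _ }
  map g p := (g ≫ p.1, g.left.appTop.hom p.2)
  map_add g s t := Prod.ext (E.comp_add g s.1 t.1) (g.left.appTop.hom.map_add s.2 t.2)
  map_smul g a s := Prod.ext (E.comp_smul g a s.1) (g.left.appTop.hom.map_mul a s.2)
  e_comp g s := Prod.ext (Over.OverMorphism.ext (Category.assoc _ _ _))
    (congrArg (fun f => f.hom (AffineSpace.coord E.total.left PUnit.unit))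
      (Scheme.Hom.comp_appTop g.left s.left))
  frame x := by
    obtain ⟨U, hU, b, hb⟩ := E.exists_frame x
    refine ⟨U, hU, Fin.cons (0, 1) fun i => (b i, 0), fun T g => ?_⟩
    have key : ∀ c : Fin (r + 1) → Γ(T.left, ⊤), (∑ i, c i •
        ((g ≫ ((Fin.cons (0, 1) (fun i => (b i, 0)) : Fin (r + 1) → (Over.mk U.ι ⟶ E.total) ×
          Γ((Over.mk U.ι).left, ⊤)) i).1,
          g.left.appTop.hom ((Fin.cons (0, 1) (fun i => (b i, 0)) :
            Fin (r + 1) → (Over.mk U.ι ⟶ E.total) × Γ((Over.mk U.ι).left, ⊤)) i).2) :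
              (T ⟶ E.total) × Γ(T.left, ⊤))) =
        (∑ i, c (Fin.succ i) • (g ≫ b i), c 0) := fun c => by
      rw [Fin.sum_univ_succ]
      refine Prod.ext ?_ ?_
      · simp [E.comp_zero, Prod.fst_sum]
      · simp [Prod.snd_sum]
    refine ⟨fun c c' h => ?_, fun p => ?_⟩
    · have h1 := (key c).symm.trans (h.trans (key c'))
      have h2 := (hb T g).1 (congrArg Prod.fst h1)
      funext i
      refine Fin.cases ?_ (fun i => ?_) i
      · exact congrArg Prod.snd h1
      · exact congrFun h2 i
    · obtain ⟨c, hc⟩ := (hb T g).2 p.1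
      refine ⟨Fin.cons p.2 c, (key _).trans (Prod.ext ?_ ?_)⟩
      · simpa using hc
      · simp

/-- The bundle `E ⊕ 𝒪_X`. -/
def addOne : VectorBundle X (r + 1) := E.addOneFunctor.bundle

/-- The projection `E ⊕ 𝒪_X ⟶ E`. -/
def addOneProj : E.addOne.total.left ⟶ E.total.left := 𝔸(PUnit.{u + 1}; E.total.left) ↘ E.total.left

/-- The second component of a morphism to `E ⊕ 𝒪_X`. -/
def lastCoord {T : Scheme.{u}} (v : T ⟶ E.addOne.total.left) : Γ(T, ⊤) :=
  v.appTop.hom (AffineSpace.coord E.total.left PUnit.unit)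

lemma lastCoord_comp {T' T : Scheme.{u}} (g : T' ⟶ T) (v : T ⟶ E.addOne.total.left) :
    E.lastCoord (g ≫ v) = g.appTop.hom (E.lastCoord v) := rfl

lemma addOneProj_hom : E.addOneProj ≫ E.total.hom = E.addOne.total.hom := rfl

/-- The morphism to `E ⊕ 𝒪_X` with given components. -/
def addOnePair {T : Scheme.{u}} (s : T ⟶ E.total.left) (a : Γ(T, ⊤)) : T ⟶ E.addOne.total.left :=
  AffineSpace.homOfVector s fun _ => a

lemma addOnePair_proj {T : Scheme.{u}} (s : T ⟶ E.total.left) (a : Γ(T, ⊤)) :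
    E.addOnePair s a ≫ E.addOneProj = s := AffineSpace.homOfVector_over _ _

lemma lastCoord_addOnePair {T : Scheme.{u}} (s : T ⟶ E.total.left) (a : Γ(T, ⊤)) :
    E.lastCoord (E.addOnePair s a) = a := AffineSpace.homOfVector_appTop_coord _ _ _

lemma addOne_hom_ext {T : Scheme.{u}} {v w : T ⟶ E.addOne.total.left}
    (h : v ≫ E.addOneProj = w ≫ E.addOneProj) (h' : E.lastCoord v = E.lastCoord w) : v = w :=
  AffineSpace.hom_ext h fun _ => h'

lemma lastCoord_smul {T : Over X} (a : Γ(T.left, ⊤)) (s : T ⟶ E.addOne.total) :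
    E.lastCoord (a • s).left = a * E.lastCoord s.left :=
  congrArg Prod.snd (LinearEquiv.map_smul (E.addOneFunctor.sections T) a s)

lemma lastCoord_zero (T : Over X) : E.lastCoord (0 : T ⟶ E.addOne.total).left = 0 :=
  congrArg Prod.snd (map_zero (E.addOneFunctor.sections T))

lemma lastCoord_scale {T : Scheme.{u}} (a : Γ(T, ⊤)) (v : T ⟶ E.addOne.total.left) :
    E.lastCoord (E.addOne.scale a v) = a * E.lastCoord v :=
  E.lastCoord_smul (T := Over.mk (v ≫ E.addOne.total.hom)) a (E.addOne.asSection v)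

lemma isNowhereZero_of_isUnit_lastCoord {T : Scheme.{u}} (v : T ⟶ E.addOne.total.left)
    (hv : IsUnit (E.lastCoord v)) : E.addOne.IsNowhereZero v := by
  intro x hx
  have h := (E.addOne.mem_zeroLocus_iff (E.addOne.asSection v) x).1 hx
  have h1 := congrArg (fun s => E.lastCoord s.left) h
  simp only [lastCoord_zero] at h1
  have h2 : IsUnit ((T.fromSpecResidueField x).appTop.hom (E.lastCoord v)) := hv.map _
  have h3 := (isUnit_iff_forall_residuePoint (Over.mk (v ≫ E.addOne.total.hom)) (E.lastCoord v)).1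
    hv x
  exact h3 h1

/-- The affine chart `E` of the projective bundle of `E ⊕ 𝒪_X`. -/
def affineLine {T : Scheme.{u}} (s : T ⟶ E.total.left) : E.addOne.LineIn T :=
  E.addOne.span (E.addOnePair s 1) (E.isNowhereZero_of_isUnit_lastCoord _ (by
    rw [lastCoord_addOnePair]; exact isUnit_one))

lemma comp_addOnePair {T' T : Scheme.{u}} (g : T' ⟶ T) (s : T ⟶ E.total.left) (a : Γ(T, ⊤)) :
    g ≫ E.addOnePair s a = E.addOnePair (g ≫ s) (g.appTop.hom a) := by
  refine E.addOne_hom_ext ?_ ?_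
  · rw [Category.assoc, addOnePair_proj, addOnePair_proj]
  · rw [lastCoord_comp, lastCoord_addOnePair, lastCoord_addOnePair]

lemma map_affineLine {T' T : Scheme.{u}} (g : T' ⟶ T) (s : T ⟶ E.total.left) :
    (E.affineLine s).map g = E.affineLine (g ≫ s) := by
  rw [affineLine, LineIn.map_span]
  simp only [comp_addOnePair, map_one]
  rfl

lemma affineLine_injective {T : Scheme.{u}} {s s' : T ⟶ E.total.left}
    (h : E.affineLine s = E.affineLine s') : s = s' := by
  obtain ⟨a, ha⟩ := LineIn.exists_scale_of_span_eq _ _ h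
  have h1 := congrArg E.lastCoord ha
  rw [lastCoord_scale, lastCoord_addOnePair, lastCoord_addOnePair, mul_one] at h1
  rw [h1, scale_one] at ha
  rw [← E.addOnePair_proj s 1, ha, addOnePair_proj]

lemma exists_affineLine_eq {T : Scheme.{u}} (v : T ⟶ E.addOne.total.left)
    (hv : IsUnit (E.lastCoord v)) : ∃ s, E.affineLine s =
      E.addOne.span v (E.isNowhereZero_of_isUnit_lastCoord _ hv) := by
  obtain ⟨e, he⟩ := hv.exists_left_inv
  refine ⟨E.addOne.scale e v ≫ E.addOneProj, ?_⟩
  have h1 : E.addOnePair (E.addOne.scale e v ≫ E.addOneProj) 1 = E.addOne.scale e v := by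
    refine E.addOne_hom_ext (addOnePair_proj _ _ _) ?_
    rw [lastCoord_addOnePair, lastCoord_scale, he]
  refine LineIn.span_eq_of_scale _ _ (E.lastCoord v) e ?_ h1.symm
  rw [h1, scale_scale, mul_comm, he, scale_one]

/-- If a line becomes of the form `affineLine` after a base change, then it is of this form near the
image of the base change: the last coordinate of a generator does not vanish there. -/
lemma exists_affineLine_eq_map {T' T : Scheme.{u}} (g : T' ⟶ T) (l : E.addOne.LineIn T)
    (k : T' ⟶ E.total.left) (h' : E.affineLine k = l.map g) (y : T') :
    ∃ W : T.Opens, g y ∈ W ∧ ∃ s : W.toScheme ⟶ E.total.left, E.affineLine s = l.map W.ι := by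
  obtain ⟨W, hxW, -, v, hv, e⟩ := LineIn.exists_map_eq_span l (g y) ⊤ (Set.mem_univ _)
  have e3 := congrArg (LineIn.map (g ⁻¹ᵁ W).ι) h'
  rw [← LineIn.map_comp, ← morphismRestrict_ι, LineIn.map_comp, e, LineIn.map_span,
    map_affineLine] at e3
  obtain ⟨a, ha⟩ := LineIn.exists_scale_of_span_eq _ _ e3.symm
  have h4 := congrArg E.lastCoord ha
  rw [lastCoord_scale, lastCoord_addOnePair, lastCoord_comp] at h4
  have h6 := range_subset_basicOpen _ _ (IsUnit.of_mul_eq_one_right _ h4)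
  let y' : (g ⁻¹ᵁ W).toScheme := ⟨y, hxW⟩
  have h7 : W.ι ((g ∣_ W) y') = g y := congrArg (fun f => f y') (morphismRestrict_ι g W)
  have h8 : (g ∣_ W) y' ∈ W.toScheme.basicOpen (E.lastCoord v) := h6 ⟨y', rfl⟩
  let B := W.toScheme.basicOpen (E.lastCoord v)
  let W' := W.ι ''ᵁ B
  have hr : Set.range W'.ι ⊆ Set.range (B.ι ≫ W.ι) := by
    rw [Scheme.Opens.range_ι]
    rintro _ ⟨y, hy, rfl⟩
    exact ⟨⟨y, hy⟩, rfl⟩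
  obtain ⟨j, hj, hjB⟩ : ∃ j : W'.toScheme ⟶ W.toScheme, j ≫ W.ι = W'.ι ∧ Set.range j ⊆ B := by
    refine ⟨IsOpenImmersion.lift (B.ι ≫ W.ι) W'.ι hr ≫ B.ι, ?_, ?_⟩
    · rw [Category.assoc]
      exact IsOpenImmersion.lift_fac _ _ _
    · rintro _ ⟨y, rfl⟩
      exact (IsOpenImmersion.lift (B.ι ≫ W.ι) W'.ι hr y).2
  obtain ⟨s, hs⟩ := E.exists_affineLine_eq (j ≫ v) (by
    rw [lastCoord_comp]
    exact isUnit_appTop_of_range_subset _ _ hjB)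
  refine ⟨W', ⟨_, h8, h7⟩, s, ?_⟩
  rw [hs, ← hj, LineIn.map_comp, e, LineIn.map_span]

/-- The lines in `E ⊕ 𝒪_X` generated by a vector `(s, 1)` form an open subfunctor, represented by
`E`. -/
lemma isChart_affineLine : E.addOne.linePresheaf.IsChart (E.affineLine (𝟙 E.total.left)) := by
  have hm : ∀ {T : Scheme.{u}} (k : T ⟶ E.total.left),
      E.addOne.linePresheaf.map k (E.affineLine (𝟙 E.total.left)) = E.affineLine k := fun k => by
    refine (E.map_affineLine k (𝟙 _)).trans ?_
    rw [Category.comp_id]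
  refine ⟨fun k k' h => E.affineLine_injective ((hm k).symm.trans (h.trans (hm k'))),
    fun g l k h y => ?_⟩
  obtain ⟨W, hW, s, hs⟩ := E.exists_affineLine_eq_map g l k ((hm k).symm.trans h) y
  exact ⟨W, hW, s, (hm s).trans hs⟩

/-- The total space of `E` is an open subscheme of the projective bundle of `E ⊕ 𝒪_X`. -/
lemma exists_isOpenImmersion (P : E.addOne.ProjectiveBundle) :
    ∃ j : E.total.left ⟶ P.G, IsOpenImmersion j ∧ j ≫ P.line.base = E.total.hom := by
  obtain ⟨j, hj⟩ := (P.bijective _).2 (E.affineLine (𝟙 _))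
  have hj' : P.line.map j = E.affineLine (𝟙 _) := hj
  obtain ⟨D, k, hk, hD⟩ := E.isChart_affineLine.exists_opens E.addOne.linePresheaf_isSheaf P.line
  obtain ⟨l, hl, hl'⟩ := hD _ j (𝟙 _) (((E.affineLine (𝟙 _)).map_id).trans hj'.symm)
  have hkj : k ≫ j = D.ι := by
    refine (P.bijective _).1 ?_
    change P.line.map (k ≫ j) = P.line.map D.ι
    rw [LineIn.map_comp, hj']
    exact hk
  have : IsIso l := ⟨k, hl', by rw [← cancel_mono D.ι, Category.assoc, hl, hkj, Category.id_comp]⟩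
  refine ⟨j, ?_, ?_⟩
  · rw [← hl]
    infer_instance
  · have h := congrArg LineIn.base hj'
    change j ≫ P.line.base = E.addOnePair _ _ ≫ E.addOne.total.hom at h
    rw [h, ← addOneProj_hom, ← Category.assoc, addOnePair_proj, Category.id_comp]

/-- The total space is locally the product with an affine space. -/
lemma isAffineHom : IsAffineHom E.total.hom := by
  choose U hU b hb using E.exists_frame
  choose W hW hxW hWU using fun x => exists_isAffineOpen_mem_and_subset (x := x) (U := U x) (hU x)
  refine isAffineHom_of_forall_exists_isAffineOpen _ fun x => ⟨W x, hxW x, hW x, ?_⟩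
  let j : Over.mk (W x).ι ⟶ Over.mk (U x).ι := Over.homMk (X.homOfLE (hWU x)) (X.homOfLE_ι _)
  have hb' : E.IsFrame (b x) := hb x
  have hc := E.homOfSections_isCartesian (hb'.comp j)
  have hp := isPullback_morphismRestrict E.total.hom (W x)
  have : IsAffine (trivial (W x).toScheme r).total.left := by
    have : IsAffine (W x).toScheme := hW x
    exact inferInstanceAs (IsAffine 𝔸(ULift.{u} (Fin r); (W x).toScheme))
  exact IsAffine.of_isIso (hp.isoIsPullback _ _ hc.flip).hom

/-- `E` is a quasi-compact open subscheme of the Grassmannian of lines in `E ⊕ 𝒪_X` and affine over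
`X`. -/
theorem mem_totalOver {k : Scheme.{u}} (V : SchemeCategory k) {X : Over k} (hX : V.Mem X)
    (E : VectorBundle X.left r) : V.Mem (totalOver X E) := by
  obtain ⟨P⟩ := E.addOne.exists_projectiveBundle
  obtain ⟨j, hj, hjπ⟩ := E.exists_isOpenImmersion P
  have := E.isAffineHom
  have := V.compactSpace X hX
  have : CompactSpace E.total.left := QuasiCompact.compactSpace_of_compactSpace E.total.hom
  have h := V.grassmannian_mem X hX _ 1 _ P.G P.line.base P.bundle P.incl P.isGrassmannian
    E.total.left j hj this (by rwa [hjπ])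
  rwa [hjπ] at h

end VectorBundle

end

section

/-! ### Affine spaces -/

/-- `q : Y ⟶ X` is an affine space over `X` with the coordinate functions `c`. -/
def IsAffineSpace {Y X : Scheme.{u}} (q : Y ⟶ X) {ι : Type} (c : ι → Γ(Y, ⊤)) : Prop :=
  ∀ (T : Scheme.{u}) (f : T ⟶ X) (d : ι → Γ(T, ⊤)),
    ∃! g : T ⟶ Y, g ≫ q = f ∧ ∀ i, g.appTop.hom (c i) = d i

lemma appTop_comp {T'' T' T : Scheme.{u}} (g : T'' ⟶ T') (f : T' ⟶ T) (a : Γ(T, ⊤)) :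
    (g ≫ f).appTop.hom a = g.appTop.hom (f.appTop.hom a) :=
  congrArg (fun φ => φ.hom a) (Scheme.Hom.comp_appTop g f)

lemma appTop_id {T : Scheme.{u}} (a : Γ(T, ⊤)) : (𝟙 T : T ⟶ T).appTop.hom a = a := by simp

namespace IsAffineSpace

variable {Y X : Scheme.{u}} {q : Y ⟶ X} {ι : Type} {c : ι → Γ(Y, ⊤)}

lemma hom_ext (h : IsAffineSpace q c) {T : Scheme.{u}} {g g' : T ⟶ Y} (e : g ≫ q = g' ≫ q)
    (e' : ∀ i, g.appTop.hom (c i) = g'.appTop.hom (c i)) : g = g' :=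
  (h T (g' ≫ q) fun i => g'.appTop.hom (c i)).unique ⟨e, e'⟩ ⟨rfl, fun _ => rfl⟩

lemma exists_hom (h : IsAffineSpace q c) {T : Scheme.{u}} (f : T ⟶ X) (d : ι → Γ(T, ⊤)) :
    ∃ g : T ⟶ Y, g ≫ q = f ∧ ∀ i, g.appTop.hom (c i) = d i := (h T f d).exists

/-- Affine spaces with the same index set are isomorphic. -/
lemma exists_iso (h : IsAffineSpace q c) {Y' : Scheme.{u}} {q' : Y' ⟶ X} {c' : ι → Γ(Y', ⊤)}
    (h' : IsAffineSpace q' c') : ∃ f : Y ⟶ Y', IsIso f ∧ f ≫ q' = q ∧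
      ∀ i, f.appTop.hom (c' i) = c i := by
  obtain ⟨f, hf, hf'⟩ := h'.exists_hom q c
  obtain ⟨g, hg, hg'⟩ := h.exists_hom q' c'
  refine ⟨f, ⟨g, ?_, ?_⟩, hf, hf'⟩
  · refine h.hom_ext ?_ fun i => ?_
    · rw [Category.assoc, hg, hf, Category.id_comp]
    · rw [appTop_comp, hg', hf', appTop_id]
  · refine h'.hom_ext ?_ fun i => ?_
    · rw [Category.assoc, hf, hg, Category.id_comp]
    · rw [appTop_comp, hf', hg', appTop_id]

lemma reindex (h : IsAffineSpace q c) {κ : Type} (e : κ ≃ ι) :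
    IsAffineSpace q (fun i => c (e i)) := by
  intro T f d
  obtain ⟨g, hg, hg'⟩ := h.exists_hom f fun i => d (e.symm i)
  refine ⟨g, ⟨hg, fun i => by rw [hg', Equiv.symm_apply_apply]⟩, fun g' hg'' => ?_⟩
  refine h.hom_ext (hg''.1.trans hg.symm) fun i => ?_
  have := hg''.2 (e.symm i)
  simp only [Equiv.apply_symm_apply] at this
  rw [this, hg']

lemma baseChange (h : IsAffineSpace q c) {Y' X' : Scheme.{u}} {q' : Y' ⟶ X'} {f : X' ⟶ X}
    {g : Y' ⟶ Y} (hp : IsPullback g q' q f) :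
    IsAffineSpace q' (fun i => g.appTop.hom (c i)) := by
  intro T t d
  obtain ⟨m, hm, hm'⟩ := h.exists_hom (t ≫ f) d
  refine ⟨hp.lift m t hm, ⟨hp.lift_snd _ _ _, fun i => ?_⟩, fun m' hm'' => ?_⟩
  · rw [← appTop_comp, hp.lift_fst, hm']
  · refine hp.hom_ext ?_ (hm''.1.trans (hp.lift_snd _ _ _).symm)
    rw [hp.lift_fst]
    refine h.hom_ext ?_ fun i => ?_
    · rw [Category.assoc, hp.w, ← Category.assoc, hm''.1, hm]
    · rw [appTop_comp, hm''.2, hm']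

/-- Projecting to some of the coordinates exhibits an affine space as an affine space over an
affine space. -/
lemma exists_split (h : IsAffineSpace q c) (p : ι → Prop) {Y₁ : Scheme.{u}} {q₁ : Y₁ ⟶ X}
    {c₁ : {i // p i} → Γ(Y₁, ⊤)} (h₁ : IsAffineSpace q₁ c₁) :
    ∃ r : Y ⟶ Y₁, r ≫ q₁ = q ∧ (∀ i, r.appTop.hom (c₁ i) = c i) ∧
      IsAffineSpace r (fun i : {i // ¬ p i} => c i) := by
  classical
  obtain ⟨r, hr, hr'⟩ := h₁.exists_hom q fun i => c i
  refine ⟨r, hr, hr', fun T f d => ?_⟩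
  obtain ⟨g, hg, hg'⟩ := h.exists_hom (f ≫ q₁)
    fun i => if hi : p i then f.appTop.hom (c₁ ⟨i, hi⟩) else d ⟨i, hi⟩
  refine ⟨g, ⟨h₁.hom_ext ?_ fun i => ?_, fun i => ?_⟩, fun g' hg'' => ?_⟩
  · rw [Category.assoc, hr, hg]
  · rw [appTop_comp, hr', hg', dif_pos i.2]
  · rw [hg', dif_neg i.2]
  · refine h.hom_ext ?_ fun i => ?_
    · rw [hg, ← hr, ← Category.assoc, hg''.1]
    · rw [hg']
      split_ifs with hi
      · rw [← hr' ⟨i, hi⟩, ← appTop_comp, hg''.1]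
      · exact hg''.2 ⟨i, hi⟩

lemma isIso_of_isEmpty [IsEmpty ι] (h : IsAffineSpace q c) : IsIso q := by
  obtain ⟨g, hg, -⟩ := h.exists_hom (𝟙 X) isEmptyElim
  refine ⟨g, h.hom_ext ?_ isEmptyElim, hg⟩
  rw [Category.assoc, hg, Category.comp_id, Category.id_comp]

end IsAffineSpace

lemma isAffineSpace_affineSpace (X : Scheme.{u}) (ι : Type) :
    IsAffineSpace (𝔸(ULift.{u} ι; X) ↘ X) (fun i => AffineSpace.coord X (ULift.up i)) := by
  intro T f d
  refine ⟨AffineSpace.homOfVector f fun i => d i.down, ⟨AffineSpace.homOfVector_over _ _,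
    fun i => AffineSpace.homOfVector_appTop_coord _ _ _⟩, fun g hg => ?_⟩
  refine AffineSpace.hom_ext (hg.1.trans (AffineSpace.homOfVector_over _ _).symm) fun i => ?_
  rw [AffineSpace.homOfVector_appTop_coord]
  exact hg.2 i.down

lemma isAffineSpace_line (X : Scheme.{u}) {ι : Type} [Unique ι] :
    IsAffineSpace (𝔸(PUnit.{u + 1}; X) ↘ X)
      (fun _ : ι => AffineSpace.coord X PUnit.unit) := by
  intro T f d
  refine ⟨AffineSpace.homOfVector f fun _ => d default, ⟨AffineSpace.homOfVector_over _ _,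
    fun i => ?_⟩, fun g hg => ?_⟩
  · rw [Unique.eq_default i]
    exact AffineSpace.homOfVector_appTop_coord _ _ _
  · refine AffineSpace.hom_ext (hg.1.trans (AffineSpace.homOfVector_over _ _).symm) fun i => ?_
    rw [AffineSpace.homOfVector_appTop_coord]
    exact hg.2 default

lemma VectorBundle.isAffineSpace_trivial (X : Scheme.{u}) (r : ℕ) :
    IsAffineSpace (trivial X r).total.hom (fun i => coords (trivial X r).total (𝟙 _) i) := by
  have h := isAffineSpace_affineSpace X (Fin r)
  have e : ∀ i, coords (trivial X r).total (𝟙 _) i = AffineSpace.coord X (ULift.up i) := fun i => by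
    rw [coords_apply]
    exact appTop_id _
  simp only [e]
  exact h

/-! ### Homotopy invariance -/

variable {k : Scheme.{u}} {V : SchemeCategory k}

/-- A morphism of `k`-schemes is an isomorphism if the underlying morphism is. -/
lemma over_isIso {Y X : Over k} (f : Y ⟶ X) [h : IsIso f.left] : IsIso f := by
  have : IsIso ((Over.forget k).map f) := h
  exact isIso_of_reflects_iso f (Over.forget k)

/-- A finite-dimensional affine space is the total space of a trivial bundle. -/
lemma IsAffineSpace.mem {Y X : Over k} (q : Y ⟶ X) {ι : Type} [Finite ι] {c : ι → Γ(Y.left, ⊤)}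
    (h : IsAffineSpace q.left c) (hX : V.Mem X) : V.Mem Y := by
  obtain ⟨r, ⟨e⟩⟩ := Finite.exists_equiv_fin ι
  obtain ⟨f, hf, hfq, -⟩ := (h.reindex e.symm).exists_iso
    (VectorBundle.isAffineSpace_trivial X.left r)
  have hf' : f ≫ (totalOver X (VectorBundle.trivial X.left r)).hom = Y.hom := by
    change f ≫ _ ≫ X.hom = _
    rw [← Category.assoc, hfq, Over.w]
  let f' : Y ⟶ totalOver X (VectorBundle.trivial X.left r) := Over.homMk f hf'
  have : IsIso f' := over_isIso f' (h := hf)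
  exact SchemeCategory.mem_of_isIso f' (VectorBundle.mem_totalOver V hX _)

namespace CohomologyTheory

variable {A : CohomologyTheory.{u, w} V}

lemma pullTop_bijective_of_isAffineSpace_line {Y X : Over k} (q : Y ⟶ X) {ι : Type} [Unique ι]
    {c : ι → Γ(Y.left, ⊤)} (h : IsAffineSpace q.left c) (hX : V.Mem X) :
    Function.Bijective (A.pullTop q) := by
  let L : Over k := Over.mk ((𝔸(PUnit.{u + 1}; X.left) ↘ X.left) ≫ X.hom)
  let l : L ⟶ X := Over.homMk (𝔸(PUnit.{u + 1}; X.left) ↘ X.left)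
  obtain ⟨f, hf, hfq, -⟩ := h.exists_iso (isAffineSpace_line X.left (ι := ι))
  have hf' : f ≫ L.hom = Y.hom := by
    change f ≫ _ ≫ X.hom = _
    rw [← Category.assoc, hfq, Over.w]
  let f' : Y ⟶ L := Over.homMk f hf'
  have hf'' : IsIso f' := over_isIso f' (h := hf)
  have hL : V.Mem L := (isAffineSpace_line X.left (ι := ι)).mem l hX
  have hY := SchemeCategory.mem_of_isIso f' hL
  have e : f' ≫ l = q := by ext1; exact hfq
  have h1 : Function.Bijective (A.pull f' (Z := ⊤) (Z' := ⊤) (subset_top _)) :=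
    pull_bijective_of_isIso f' (SchemeCategory.pair_top hL) (preim_top _) _
  have h2 : Function.Bijective (A.pull l (Z := ⊤) (Z' := ⊤) (subset_top _)) := A.homotopy hX
  refine bijective_of_eq (h1.comp h2) fun a => ?_
  rw [Function.comp_apply, pull_pull f' l (SchemeCategory.pair_top hX)
    (SchemeCategory.pair_top hL) (SchemeCategory.pair_top hY)]
  exact A.pull_congr e.symm _ _ a

/-- Homotopy invariance for affine spaces, by induction on the number of coordinates. -/
lemma pullTop_bijective_of_isAffineSpace {Y X : Over k} (q : Y ⟶ X) {ι : Type} [Finite ι]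
    {c : ι → Γ(Y.left, ⊤)} (h : IsAffineSpace q.left c) (hX : V.Mem X) :
    Function.Bijective (A.pullTop q) := by
  classical
  have := Fintype.ofFinite ι
  induction hn : Fintype.card ι generalizing Y X ι with
  | zero =>
    have : IsEmpty ι := Fintype.card_eq_zero_iff.1 hn
    have := h.isIso_of_isEmpty
    have : IsIso q := over_isIso q
    exact pull_bijective_of_isIso q (SchemeCategory.pair_top hX) (preim_top _) _
  | succ n ih =>
    obtain ⟨i₀⟩ : Nonempty ι := Fintype.card_pos_iff.1 (by omega)
    let p : ι → Prop := fun i => i ≠ i₀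
    have h₁ := isAffineSpace_affineSpace X.left {i // p i}
    obtain ⟨r, hr, -, hra⟩ := h.exists_split p h₁
    let Y₁ : Over k := Over.mk ((𝔸(ULift.{u} {i // p i}; X.left) ↘ X.left) ≫ X.hom)
    let q₁ : Y₁ ⟶ X := Over.homMk (𝔸(ULift.{u} {i // p i}; X.left) ↘ X.left)
    have hr' : r ≫ Y₁.hom = Y.hom := by
      change r ≫ _ ≫ X.hom = _
      rw [← Category.assoc, hr, Over.w]
    let r' : Y ⟶ Y₁ := Over.homMk r hr'
    have hY₁ : V.Mem Y₁ := IsAffineSpace.mem q₁ h₁ hX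
    have hY : V.Mem Y := IsAffineSpace.mem q h hX
    have b₁ : Function.Bijective (A.pullTop q₁) := ih q₁ h₁ hX inferInstance (by
      rw [Fintype.card_subtype_compl, hn, Fintype.card_subtype_eq]
      rfl)
    let _ : Unique {i // ¬ p i} :=
      { default := ⟨i₀, by simp [p]⟩
        uniq := fun i => Subtype.ext (not_not.1 i.2) }
    have b₂ : Function.Bijective (A.pullTop r') :=
      pullTop_bijective_of_isAffineSpace_line r' hra hY₁
    have e : r' ≫ q₁ = q := by ext1; exact hr
    refine bijective_of_eq (b₂.comp b₁) fun a => ?_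
    have := pull_pull (A := A) r' q₁ (SchemeCategory.pair_top hX)
      (SchemeCategory.pair_top hY₁) (SchemeCategory.pair_top hY) (subset_top _) (subset_top _) a
    refine Eq.trans ?_ this.symm
    exact A.pull_congr e.symm _ _ a

end CohomologyTheory

end

section

/-! ### Bundles of affine spaces -/

lemma range_of_isPullback {P X Y Z : Scheme.{u}} {fst : P ⟶ X} {snd : P ⟶ Y} {f : X ⟶ Z}
    {g : Y ⟶ Z} (h : IsPullback fst snd f g) : Set.range fst = f ⁻¹' Set.range g := by
  rw [← Scheme.Pullback.range_fst, ← h.isoPullback_hom_fst]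
  ext x
  constructor
  · rintro ⟨y, rfl⟩
    exact ⟨h.isoPullback.hom y, by rw [Scheme.Hom.comp_apply]⟩
  · rintro ⟨y, rfl⟩
    refine ⟨h.isoPullback.inv y, ?_⟩
    rw [← Scheme.Hom.comp_apply, Iso.inv_hom_id_assoc]

/-- `q : Y ⟶ X` is an affine space locally on `X`. -/
def IsLocallyAffineSpace {Y X : Scheme.{u}} (q : Y ⟶ X) : Prop :=
  ∀ x : X, ∃ W : X.Opens, x ∈ W ∧ ∃ (Y' : Scheme.{u}) (g : Y' ⟶ Y) (q' : Y' ⟶ W.toScheme),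
    IsPullback g q' q W.ι ∧
      ∃ (ι : Type) (_ : Finite ι) (c : ι → Γ(Y', ⊤)), IsAffineSpace q' c

lemma IsAffineSpace.isLocallyAffineSpace {Y X : Scheme.{u}} {q : Y ⟶ X} {ι : Type} [Finite ι]
    {c : ι → Γ(Y, ⊤)} (h : IsAffineSpace q c) : IsLocallyAffineSpace q := fun x =>
  ⟨⊤, Set.mem_univ x, _, _, _, IsPullback.of_hasPullback q _, ι, inferInstance, _,
    h.baseChange (IsPullback.of_hasPullback q _)⟩

lemma IsLocallyAffineSpace.baseChange {Y X Y' X' : Scheme.{u}} {q : Y ⟶ X}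
    (h : IsLocallyAffineSpace q) {q' : Y' ⟶ X'} {f : X' ⟶ X} {g : Y' ⟶ Y}
    (hp : IsPullback g q' q f) : IsLocallyAffineSpace q' := by
  intro x
  obtain ⟨W, hx, Y₁, g₁, q₁, hp₁, ι, hι, c, hc⟩ := h (f x)
  have h₁ := IsPullback.of_hasPullback q₁ (f ∣_ W)
  have h₂ : IsPullback (Limits.pullback.fst q₁ (f ∣_ W) ≫ g₁) (Limits.pullback.snd q₁ (f ∣_ W)) q
      ((f ⁻¹ᵁ W).ι ≫ f) := by
    have := (h₁.flip.paste_vert hp₁.flip).flip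
    rwa [morphismRestrict_ι] at this
  refine ⟨f ⁻¹ᵁ W, hx, _, hp.lift (Limits.pullback.fst q₁ (f ∣_ W) ≫ g₁)
    (Limits.pullback.snd q₁ (f ∣_ W) ≫ (f ⁻¹ᵁ W).ι) ?_, Limits.pullback.snd q₁ (f ∣_ W),
    ?_, ι, hι, _, hc.baseChange h₁⟩
  · rw [Category.assoc]; exact h₂.w
  · refine (IsPullback.of_right (h₁₂ := g) (h₂₂ := f) (v₁₃ := q) ?_ (hp.lift_snd _ _ _) hp)
    rwa [hp.lift_fst]

variable {k : Scheme.{u}} {V : SchemeCategory k}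

lemma isPullback_of_isOpenImmersion {Y X B C : Over k} {q : Y ⟶ X} {b : B ⟶ X} {c : C ⟶ Y}
    {q' : C ⟶ B} [IsOpenImmersion b.left] [IsOpenImmersion c.left] (e : c ≫ q = q' ≫ b)
    (hr : Set.range c.left = q.left ⁻¹' Set.range b.left) :
    IsPullback c.left q'.left q.left b.left := by
  exact (IsOpenImmersion.isPullback _ _ _ _ (congrArg (fun f => f.left) e)
    (Opens.ext hr.symm)).flip

lemma isPullback_complMap {Y X : Over k} (q : Y ⟶ X) (Z : Closeds X.left) :
    IsPullback (complι Y (preim q Z)).left (complMap q (preim_subset q Z)).left q.left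
      (complι X Z).left := by
  refine isPullback_of_isOpenImmersion (complMap_comp _ _).symm ?_
  rw [range_complι, range_complι]
  rfl

namespace RingCohomologyTheory

variable {A : RingCohomologyTheory.{u, w} V}

lemma sumMap_unit {Y X : Over k} (q : Y ⟶ X) {Z : Closeds X.left} {Z' : Closeds Y.left}
    (pZ' : V.Pair Y Z') (h : q.left ⁻¹' (Z : Set X.left) ⊆ Z') (a : Unit → A.obj X Z) :
    A.sumMap q (fun _ => A.unit Y) h a = A.pull q h (a ()) := by
  rw [sumMap_apply, Fintype.sum_unique, mul_unit pZ' pZ', CohomologyTheory.ext_self pZ']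

/-- Homotopy invariance for affine bundles: locality on the base, applied to multiplication by the
single class `1`. -/
lemma pullTop_bijective_of_isLocallyAffineSpace {Y X : Over k} (q : Y ⟶ X)
    (h : IsLocallyAffineSpace q.left) (hY : V.Mem Y) (hX : V.Mem X) :
    Function.Bijective (A.pullTop q) := by
  have key : Function.Bijective (A.sumMapTop q (fun _ : Unit => A.unit Y)) := by
    refine sumMapTop_bijective_of_locally hY hX fun x => ?_
    obtain ⟨W, hx, Y₁, g₁, q₁, hp₁, ι, hι, c, hc⟩ := h x
    refine ⟨W, hx, fun U hU hUW => ?_⟩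
    have h₁ := IsPullback.of_hasPullback q₁ (X.left.homOfLE hUW)
    have h₂ := h₁.flip.paste_vert hp₁.flip
    rw [Scheme.homOfLE_ι] at h₂
    have hc' := hc.baseChange h₁
    let B : Over k := Over.mk (U.ι ≫ X.hom)
    let b : B ⟶ X := Over.homMk U.ι
    let g := Limits.pullback.fst q₁ (X.left.homOfLE hUW) ≫ g₁
    let C : Over k := Over.mk (g ≫ Y.hom)
    let c : C ⟶ Y := Over.homMk g
    let q' : C ⟶ B := Over.homMk (Limits.pullback.snd q₁ (X.left.homOfLE hUW)) (by
      change _ ≫ U.ι ≫ X.hom = g ≫ Y.hom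
      rw [← Category.assoc, h₂.w, Category.assoc, Over.w])
    have hb : IsOpenImmersion b.left := inferInstanceAs (IsOpenImmersion U.ι)
    have hco : IsOpenImmersion c.left := MorphismProperty.of_isPullback h₂ hb
    have hbr : Set.range b.left = U := Scheme.Opens.range_ι U
    have hB : V.Mem B := SchemeCategory.mem_open b hX (by rw [hbr]; exact hU)
    have hC : V.Mem C := IsAffineSpace.mem q' hc' hB
    refine SumMapBijectiveOver.of_exists (b := b) (c := c) (q' := q') hY hC hB
      (by ext1; exact h₂.w.symm) hbr ?_ ?_
    · rw [← hbr]
      exact range_of_isPullback h₂.flip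
    · simp only [pullTop_unit c hY hC]
      have e : ∀ a : Unit → A.obj B ⊤, A.sumMapTop q' (fun _ => A.unit C) a =
        A.pullTop q' (a ()) := sumMap_unit q' (SchemeCategory.pair_top hC) (subset_top _)
      exact bijective_of_eq ((CohomologyTheory.pullTop_bijective_of_isAffineSpace q' hc' hB).comp
        (Equiv.funUnique Unit _).bijective) e
  have e : ∀ a : A.obj X ⊤, A.pullTop q a =
      A.sumMapTop q (fun _ => A.unit Y) (fun _ => a) := fun a =>
    (sumMap_unit q (SchemeCategory.pair_top hY) (subset_top _) (fun _ => a)).symm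
  exact bijective_of_eq (key.comp (Equiv.funUnique Unit _).symm.bijective) e

/-- Homotopy invariance with supports. -/
lemma pull_bijective_of_isLocallyAffineSpace {Y X : Over k} (q : Y ⟶ X)
    (h : IsLocallyAffineSpace q.left) (hY : V.Mem Y) {Z : Closeds X.left} (pZ : V.Pair X Z) :
    Function.Bijective (A.pull q (preim_subset q Z)) := by
  have pY := pZ.preim q hY
  have key : Function.Bijective (A.sumMap q (fun _ : Unit => A.unit Y) (preim_subset q Z)) := by
    refine sumMap_bijective_of_compl q hY _ pZ ?_ ?_
    · have e : ∀ a : Unit → A.obj X ⊤, A.sumMapTop q (fun _ => A.unit Y) a =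
        A.pullTop q (a ()) := sumMap_unit q (SchemeCategory.pair_top hY) (subset_top _)
      exact bijective_of_eq ((pullTop_bijective_of_isLocallyAffineSpace q h hY pZ.1).comp
        (Equiv.funUnique Unit _).bijective) e
    · simp only [pullTop_unit _ hY pY.2]
      have e : ∀ a : Unit → A.obj (compl X Z) ⊤,
        A.sumMapTop (complMap q (preim_subset q Z)) (fun _ => A.unit _) a =
          A.pullTop (complMap q (preim_subset q Z)) (a ()) :=
        sumMap_unit _ (SchemeCategory.pair_top pY.2) (subset_top _)
      exact bijective_of_eq ((pullTop_bijective_of_isLocallyAffineSpace _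
        (h.baseChange (isPullback_complMap q Z)) pY.2 pZ.2).comp
          (Equiv.funUnique Unit _).bijective) e
  have e : ∀ a : A.obj X Z, A.pull q (preim_subset q Z) a =
      A.sumMap q (fun _ => A.unit Y) (preim_subset q Z) (fun _ => a) := fun a =>
    (sumMap_unit q pY (preim_subset q Z) (fun _ => a)).symm
  exact bijective_of_eq (key.comp (Equiv.funUnique Unit _).symm.bijective) e

end RingCohomologyTheory

namespace VectorBundle

lemma isLocallyAffineSpace {X : Scheme.{u}} {r : ℕ} (E : VectorBundle X r) :
    IsLocallyAffineSpace E.total.hom := by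
  intro x
  obtain ⟨U, hU, e, he⟩ := E.exists_frame x
  have h := homOfSections_isCartesian (f := U.ι) (b := e) (E := E) he
  exact ⟨U, hU, _, _, _, h, Fin r, inferInstance, _, isAffineSpace_trivial _ _⟩

end VectorBundle

end

section

/-! ### Composition of morphisms of bundles -/

/-- The identification of the two iterated changes of base. -/
def mapComp {T G X : Scheme.{u}} (g : T ⟶ G) (π : G ⟶ X) (T' : Over T) :
    (Over.map (g ≫ π)).obj T' ⟶ (Over.map π).obj ((Over.map g).obj T') :=
  Over.homMk (𝟙 T'.left) (by simp)

lemma mapComp_app {T G X : Scheme.{u}} (g : T ⟶ G) (π : G ⟶ X) (T' : Over T)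
    (a : Γ(T'.left, ⊤)) : (mapComp g π T').left.appTop.hom a = a := appTop_id a

namespace BundleHom

variable {T G X : Scheme.{u}} {g : T ⟶ G} {π : G ⟶ X} {r m n : ℕ} {F : VectorBundle T r}
  {E : VectorBundle G m} {D : VectorBundle X n}

/-- The composition of morphisms of vector bundles covering `g` and `π`. -/
def comp (h : BundleHom g F E) (h' : BundleHom π E D) : BundleHom (g ≫ π) F D :=
  .ofPush (fun T' s => mapComp g π T' ≫ h'.push (h.push s))
    (fun {T'' T'} f s => by
      rw [push_comp, push_comp]
      ext1
      change 𝟙 _ ≫ f.left ≫ _ = f.left ≫ 𝟙 _ ≫ _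
      simp)
    (fun T' s t => by rw [push_add, push_add, D.comp_add])
    (fun T' a s => by
      rw [push_smul]
      refine (congrArg (mapComp g π T' ≫ ·) (h'.push_smul _ _)).trans ?_
      rw [D.comp_smul]
      congr 1)

lemma comp_push (h : BundleHom g F E) (h' : BundleHom π E D) {T' : Over T} (s : T' ⟶ F.total) :
    (h.comp h').push s = mapComp g π T' ≫ h'.push (h.push s) := ofPush_push _ _ _ _ _ _

lemma comp_left (h : BundleHom g F E) (h' : BundleHom π E D) :
    (h.comp h').left = h.left ≫ h'.left := by
  change 𝟙 _ ≫ (𝟙 _ ≫ h.left) ≫ h'.left = _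
  simp

lemma IsCartesian.comp {h : BundleHom g F E} {h' : BundleHom π E D} (hh : h.IsCartesian)
    (hh' : h'.IsCartesian) : (h.comp h').IsCartesian := by
  change IsPullback _ _ _ _
  rw [comp_left]
  exact (hh.flip.paste_vert hh'.flip).flip

lemma IsCartesian.isSubbundle_comp {h : BundleHom g F E} {h' : BundleHom π E D}
    (hh : h.IsCartesian) (hh' : ∀ T', Function.Injective (h'.push (T := T'))) :
    (h.comp h').IsSubbundle := by
  intro K _ p s t hst
  apply (hh.push_bijective h _).1
  apply hh'
  ext1
  have := congrArg (fun s => s.left) hst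
  simp only [push_left, comp_left] at this
  simpa [push_left] using! this

lemma IsIsometric.comp {F : SymplecticBundle T r} {E : SymplecticBundle G m}
    {D : SymplecticBundle X n} {h : BundleHom g F.toVectorBundle E.toVectorBundle}
    {h' : BundleHom π E.toVectorBundle D.toVectorBundle} (hh : h.IsIsometric)
    (hh' : h'.IsIsometric) : (h.comp h').IsIsometric := by
  intro T' s t
  rw [comp_push, comp_push, D.form_comp, hh', hh]
  exact mapComp_app _ _ _ _

lemma IsIsometric.push_injective {F : SymplecticBundle T 2} {E : SymplecticBundle G m}
    {h : BundleHom g F.toVectorBundle E.toVectorBundle} (hh : h.IsIsometric) (T' : Over T) :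
    Function.Injective (h.push (T := T')) := by
  intro s t hst
  refine F.ext_of_form _ _ fun T'' f w => ?_
  rw [← hh, ← hh, push_comp, push_comp, hst]

end BundleHom

/-! ### Coordinates on quaternionic projective bundles -/

/-- The standard symplectic form. -/
def hypPairing {R : Type*} [CommRing R] {n : ℕ} (a b : Fin n ⊕ Fin n → R) : R :=
  ∑ j, (a (.inr j) * b (.inl j) - a (.inl j) * b (.inr j))

lemma map_hypPairing {R R' : Type*} [CommRing R] [CommRing R'] {n : ℕ} (f : R →+* R')
    (a b : Fin n ⊕ Fin n → R) : f (hypPairing a b) = hypPairing (fun i => f (a i)) fun i =>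
      f (b i) := by
  simp [hypPairing]

/-- Coordinates exhibiting `π : R ⟶ X` with the rank two bundle `U` as the quaternionic
projective bundle of the trivial symplectic bundle of rank `2 n`: `vec s` is the coordinate
vector of a section `s` of `U ⊆ 𝒪 ^ (2 n)`. -/
structure HPCoords {R X : Scheme.{u}} (π : R ⟶ X) (U : SymplecticBundle R 2) (n : ℕ) where
  vec : ∀ T : Over R, (T ⟶ U.total) →ₗ[Γ(T.left, ⊤)] (Fin n ⊕ Fin n → Γ(T.left, ⊤))
  vec_comp : ∀ {T' T : Over R} (g : T' ⟶ T) (s : T ⟶ U.total) (i : Fin n ⊕ Fin n),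
    vec T' (g ≫ s) i = g.left.appTop.hom (vec T s i)
  form_eq : ∀ (T : Over R) (s t : T ⟶ U.total), U.form T s t = hypPairing (vec T s) (vec T t)
  exists_lift : ∀ (T : Scheme.{u}) (f : T ⟶ X) (a b : Fin n ⊕ Fin n → Γ(T, ⊤)),
    IsUnit (hypPairing a b) → ∃ g : T ⟶ R, g ≫ π = f ∧
      ∃ u v : Over.mk g ⟶ U.total, vec _ u = a ∧ vec _ v = b
  hom_ext : ∀ (T : Scheme.{u}) (g g' : T ⟶ R), g ≫ π = g' ≫ π →
    ∀ (u v : Over.mk g ⟶ U.total) (u' v' : Over.mk g' ⟶ U.total),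
      vec _ u = vec _ u' → vec _ v = vec _ v' → IsUnit (hypPairing (vec _ u) (vec _ v)) → g = g'

namespace SymplecticBundle

variable {X : Scheme.{u}} {n r : ℕ} {E : SymplecticBundle X r}

lemma IsHyperbolic.form_sum {T : Over X} {e : Fin n ⊕ Fin n → (T ⟶ E.total)}
    (he : E.IsHyperbolic e) (a b : Fin n ⊕ Fin n → Γ(T.left, ⊤)) :
    E.form T (∑ i, a i • e i) (∑ i, b i • e i) = hypPairing a b := by
  have h := he.hyperbolicCoords_sum a
  have h1 : ∀ j, E.form T (∑ i, a i • e i) (e (.inr j)) = - a (.inl j) := fun j => by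
    rw [← congrFun h (.inl j)]
    exact (neg_neg _).symm
  have h2 : ∀ j, E.form T (∑ i, a i • e i) (e (.inl j)) = a (.inr j) := fun j =>
    congrFun h (.inr j)
  rw [_root_.map_sum, Fintype.sum_sum_type, hypPairing, ← Finset.sum_add_distrib]
  refine Finset.sum_congr rfl fun j _ => ?_
  rw [LinearMap.map_smul, LinearMap.map_smul, h1, h2, smul_eq_mul, smul_eq_mul]
  ring

lemma hyperbolicCoords_comp {T' T : Over X} (g : T' ⟶ T) (e : Fin n ⊕ Fin n → (T ⟶ E.total))
    (s : T ⟶ E.total) (i : Fin n ⊕ Fin n) :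
    E.hyperbolicCoords (fun i => g ≫ e i) (g ≫ s) i =
      g.left.appTop.hom (E.hyperbolicCoords e s i) := by
  rcases i with i | i
  · refine (congrArg Neg.neg (E.form_comp g s (e (.inr i)))).trans ?_
    exact (RingHom.map_neg _ _).symm
  · exact E.form_comp g s (e (.inl i))

end SymplecticBundle

section Extraction

variable {X S : Scheme.{u}} {f : X ⟶ S} {n : ℕ} {E : SymplecticBundle S (2 * n)}
  (e : Fin n ⊕ Fin n → (Over.mk f ⟶ E.total))

/-- The section of `f^* E` with given coordinates in the frame `e`. -/
def frameSection {T : Scheme.{u}} (t : T ⟶ X) (c : Fin n ⊕ Fin n → Γ(T, ⊤)) : T ⟶ E.total.left :=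
  (∑ i, (show Γ((Over.mk (t ≫ f)).left, ⊤) from c i) •
    ((Over.homMk t : Over.mk (t ≫ f) ⟶ Over.mk f) ≫ e i)).left

lemma left_eq_frameSection {Z : Over S} (m : Z ⟶ Over.mk f) (c : Fin n ⊕ Fin n → Γ(Z.left, ⊤)) :
    (∑ i, c i • (m ≫ e i)).left = frameSection e m.left c := by
  let θ : Over.mk (m.left ≫ f) ⟶ Z := Over.homMk (𝟙 Z.left) (by
    exact (Category.id_comp Z.hom).trans (Over.w m).symm)
  have h : θ ≫ (∑ i, c i • (m ≫ e i)) = ∑ i, (show Γ((Over.mk (m.left ≫ f)).left, ⊤) from c i) •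
    ((Over.homMk m.left : Over.mk (m.left ≫ f) ⟶ Over.mk f) ≫ e i) := by
    rw [E.comp_sum]
    refine Finset.sum_congr rfl fun i _ => ?_
    rw [E.comp_smul]
    congr 1
  have h' := congrArg (fun s => s.left) h
  refine Eq.trans ?_ h'
  change _ = 𝟙 _ ≫ _
  rw [Category.id_comp]

end Extraction

end

section

/-! ### Coordinates from a hyperbolic frame -/

section Plane

open QuatProj.VectorBundle

variable {T S : Scheme.{u}} {q : T ⟶ S} {r : ℕ} {E : SymplecticBundle S r}
  (w : Fin 2 → (Over.mk q ⟶ E.total))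

lemma form_homOfSections_push (T' : Over T) (s s' : T' ⟶ (trivial T 2).total) :
    E.form _ ((homOfSections (E := E.toVectorBundle) w).push s) ((homOfSections w).push s') =
      (show Γ(((Over.map q).obj T').left, ⊤) from coords T' s 0 * coords T' s' 1 -
        coords T' s 1 * coords T' s' 0) *
        (toBase q T').left.appTop.hom (E.form _ (w 0) (w 1)) := by
  let d : Fin 2 → Γ(((Over.map q).obj T').left, ⊤) := coords T' s
  let d' : Fin 2 → Γ(((Over.map q).obj T').left, ⊤) := coords T' s'
  have h1 : (homOfSections (E := E.toVectorBundle) w).push s =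
    ∑ i, d i • (toBase q T' ≫ w i) := homOfSections_push w T' s
  have h2 : (homOfSections (E := E.toVectorBundle) w).push s' =
    ∑ i, d' i • (toBase q T' ≫ w i) := homOfSections_push w T' s'
  rw [h1, h2, Fin.sum_univ_two, Fin.sum_univ_two, ← E.form_comp]
  simp only [_root_.map_add, LinearMap.add_apply, _root_.map_smul, LinearMap.smul_apply,
    E.form_self, E.form_neg (toBase q T' ≫ w 1) (toBase q T' ≫ w 0), smul_eq_mul]
  change _ = (d 0 * d' 1 - d 1 * d' 0) * _
  ring

/-- Two sections with invertible pairing span a nondegenerate plane. -/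
lemma eq_of_form_homOfSections_push (hw : IsUnit (E.form _ (w 0) (w 1))) {T' : Over T}
    (s s' : T' ⟶ (trivial T 2).total)
    (hs : ∀ t, E.form _ ((homOfSections (E := E.toVectorBundle) w).push s)
        ((homOfSections w).push t) =
      E.form _ ((homOfSections (E := E.toVectorBundle) w).push s') ((homOfSections w).push t)) :
    s = s' := by
  have hu := hw.map (toBase q T').left.appTop.hom
  have h := fun d : Fin 2 → Γ(T'.left, ⊤) => hs ((coords T').symm d)
  simp only [form_homOfSections_push, LinearEquiv.apply_symm_apply] at h
  have h0 := hu.mul_right_cancel (h ![1, 0])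
  have h1 := hu.mul_right_cancel (h ![0, 1])
  simp only [Matrix.cons_val_zero, Matrix.cons_val_one, mul_zero, mul_one, zero_sub, sub_zero,
    neg_inj] at h0 h1
  apply (coords T').injective
  funext l
  fin_cases l
  · exact h1
  · exact h0

end Plane

section Extraction

open QuatProj.VectorBundle

variable {X S P R : Scheme.{u}} {f : X ⟶ S} {n : ℕ} {E : SymplecticBundle S (2 * n)}
  {e : Fin n ⊕ Fin n → (Over.mk f ⟶ E.total)} {π : P ⟶ S} {U : SymplecticBundle P 2}
  {ι : BundleHom π U.toVectorBundle E.toVectorBundle} {p : R ⟶ P} {π' : R ⟶ X}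
  (hp : IsPullback p π' π f) (U' : SymplecticBundle R 2)
  (h : BundleHom p U'.toVectorBundle U.toVectorBundle)

/-- The structure morphism to `X` of an `R`-scheme, over `S`. -/
def toBaseOfPullback (T : Over R) : (Over.map (p ≫ π)).obj T ⟶ Over.mk f :=
  Over.homMk (T.hom ≫ π') (by
    change (T.hom ≫ π') ≫ f = T.hom ≫ p ≫ π
    rw [Category.assoc, hp.w])

variable (e) (ι) in
/-- The coordinates of a section of the tautological subbundle. -/
def tautologicalCoords (T : Over R) :
    (T ⟶ U'.total) →ₗ[Γ(T.left, ⊤)] (Fin n ⊕ Fin n → Γ(T.left, ⊤)) where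
  toFun s := E.hyperbolicCoords (fun i => toBaseOfPullback hp T ≫ e i) ((h.comp ι).push s)
  map_add' s t := by
    rw [BundleHom.push_add]
    exact (E.hyperbolicCoords (fun i => toBaseOfPullback hp T ≫ e i)).map_add _ _
  map_smul' a s := by
    rw [BundleHom.push_smul]
    exact (E.hyperbolicCoords (fun i => toBaseOfPullback hp T ≫ e i)).map_smul _ _

variable (e) in
lemma tautologicalCoords_comp {T' T : Over R} (g : T' ⟶ T) (s : T ⟶ U'.total)
    (i : Fin n ⊕ Fin n) : tautologicalCoords e ι hp U' h T' (g ≫ s) i =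
      g.left.appTop.hom (tautologicalCoords e ι hp U' h T s i) := by
  have h1 : ∀ i, (Over.map (p ≫ π)).map g ≫ toBaseOfPullback hp T ≫ e i =
      toBaseOfPullback hp T' ≫ e i := fun i => by
    rw [← Category.assoc]
    congr 1
    ext1
    change g.left ≫ T.hom ≫ π' = T'.hom ≫ π'
    rw [← Category.assoc, Over.w]
  have h2 := SymplecticBundle.hyperbolicCoords_comp (E := E) ((Over.map (p ≫ π)).map g)
    (fun i => toBaseOfPullback hp T ≫ e i) ((h.comp ι).push s) i
  simp only [h1, ← BundleHom.push_comp] at h2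
  exact h2

/-- A vector of the tautological plane, as a combination of the hyperbolic frame of `E`. -/
lemma push_eq_sum (he : E.IsHyperbolic e) (hf : E.IsFrame e) (T : Over R) (s : T ⟶ U'.total) :
    (h.comp ι).push s =
      ∑ i, (show Γ(((Over.map (p ≫ π)).obj T).left, ⊤) from tautologicalCoords e ι hp U' h T s i) •
        (toBaseOfPullback hp T ≫ e i) := by
  obtain ⟨c, hc⟩ := (hf _ (toBaseOfPullback hp T)).2 ((h.comp ι).push s)
  have h1 := (he.comp (toBaseOfPullback hp T)).hyperbolicCoords_sum c
  have hc' : ∑ i, c i • (toBaseOfPullback hp T ≫ e i) = (h.comp ι).push s := hc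
  have h2 : tautologicalCoords e ι hp U' h T s = c := by
    rw [← h1, hc']; rfl
  rw [h2]
  exact hc'.symm

lemma push_left_eq (he : E.IsHyperbolic e) (hf : E.IsFrame e) (T : Over R) (s : T ⟶ U'.total) :
    s.left ≫ h.left ≫ ι.left =
      frameSection e (T.hom ≫ π') (tautologicalCoords e ι hp U' h T s) := by
  have h1 := congrArg (fun s => s.left) (push_eq_sum hp U' h (ι := ι) he hf T s)
  simp only [BundleHom.push_left, BundleHom.comp_left] at h1
  exact h1.trans (left_eq_frameSection e (toBaseOfPullback hp T) _)

lemma form_eq_hypPairing (hi : h.IsIsometric) (hι : ι.IsIsometric) (he : E.IsHyperbolic e)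
    (hf : E.IsFrame e) (T : Over R) (s t : T ⟶ U'.total) : U'.form T s t =
      hypPairing (tautologicalCoords e ι hp U' h T s) (tautologicalCoords e ι hp U' h T t) := by
  have h1 := (he.comp (toBaseOfPullback hp T)).form_sum
    (tautologicalCoords e ι hp U' h T s) (tautologicalCoords e ι hp U' h T t)
  have h2 := push_eq_sum hp U' h (ι := ι) he hf T s
  have h3 := push_eq_sum hp U' h (ι := ι) he hf T t
  have h4 : E.form ((Over.map (p ≫ π)).obj T) ((h.comp ι).push s) ((h.comp ι).push t) =
      U'.form T s t := hi.comp hι T s t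
  exact h4.symm.trans
    ((congrArg₂ (fun a b => E.form ((Over.map (p ≫ π)).obj T) a b) h2 h3).trans h1)

lemma frameSection_injective (hf : E.IsFrame e) {T : Scheme.{u}} {t t' : T ⟶ X} (ht : t = t')
    {c c' : Fin n ⊕ Fin n → Γ(T, ⊤)} (hc : frameSection e t c = frameSection e t' c') : c = c' := by
  subst ht
  exact (hf _ (Over.homMk t : Over.mk (t ≫ f) ⟶ Over.mk f)).1 (Over.OverMorphism.ext hc)

lemma tautologicalCoords_homOfSections {T : Scheme.{u}} (g : T ⟶ R)
    (w : Fin 2 → (Over.mk g ⟶ U'.total)) (T' : Over T) (s : T' ⟶ (trivial T 2).total) :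
    tautologicalCoords e ι hp U' h _ ((homOfSections (E := U'.toVectorBundle) w).push s) =
      fun i => ∑ l, coords T' s l *
        T'.hom.appTop.hom (tautologicalCoords e ι hp U' h (Over.mk g) (w l) i) := by
  rw [homOfSections_push, _root_.map_sum]
  funext i
  rw [Finset.sum_apply]
  refine Finset.sum_congr rfl fun l _ => ?_
  rw [LinearMap.map_smul]
  exact congrArg (coords T' s l * ·) (tautologicalCoords_comp e hp U' h (toBase g T') (w l) i)

variable {U'} {h}

/-- Two vectors of functions with invertible pairing span a nondegenerate plane, which is the
pullback of the tautological plane along a morphism to `R`. -/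
lemma exists_tautological_lift (hc : h.IsCartesian) (hE : IsQuaternionicProjectiveBundle E π U ι)
    (he : E.IsHyperbolic e) (hf : E.IsFrame e) (T : Scheme.{u}) (t : T ⟶ X)
    (a b : Fin n ⊕ Fin n → Γ(T, ⊤)) (hab : IsUnit (hypPairing a b)) :
    ∃ g : T ⟶ R, g ≫ π' = t ∧ ∃ u v : Over.mk g ⟶ U'.total,
      tautologicalCoords e ι hp U' h _ u = a ∧ tautologicalCoords e ι hp U' h _ v = b := by
  obtain ⟨G, πG, UG, ιG, j, k, hG, hj, hjπ, hopen, hk, hkι, hι⟩ := hE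
  let t' : Over.mk (t ≫ f) ⟶ Over.mk f := Over.homMk t
  let c : Fin 2 → Fin n ⊕ Fin n → Γ(T, ⊤) := ![a, b]
  let w : Fin 2 → (Over.mk (t ≫ f) ⟶ E.total) := fun l =>
    ∑ i, (show Γ((Over.mk (t ≫ f)).left, ⊤) from c l i) • (t' ≫ e i)
  have hw : ∀ l l', E.form _ (w l) (w l') = hypPairing (c l) (c l') := fun l l' =>
    (he.comp t').form_sum _ _
  let h₀ : BundleHom (t ≫ f) (trivial T 2) E.toVectorBundle := homOfSections w
  have hw' : IsUnit (E.form _ (w 0) (w 1)) := by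
    rw [hw]; exact hab
  -- `w 0` and `w 1` span a subbundle, classified by a morphism to the Grassmannian; its image lies
  -- in the open subset `P`, as the form is nondegenerate at every point
  have hsub : h₀.IsSubbundle := fun K _ q s s' hss =>
    eq_of_form_homOfSections_push w hw' s s' fun t => by rw [hss]
  obtain ⟨g₀, ⟨hg₀, k₀, hk₀, hk₀ι⟩, -⟩ := hG.existsUnique T (t ≫ f) _ h₀ hsub
  have hrange : Set.range g₀ ⊆ Set.range j := by
    rintro _ ⟨x, rfl⟩
    let q := T.fromSpecResidueField x
    have := (hopen (T.residueField x) (q ≫ g₀)).2 ?_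
    · let z : Spec (T.residueField x) := IsLocalRing.closedPoint _
      have hz : q z = x := T.fromSpecResidueField_apply x z
      refine this ⟨z, ?_⟩
      rw [Scheme.Hom.comp_apply, hz]
    · intro s hs
      obtain ⟨s₀, rfl⟩ := (hk₀.push_bijective k₀ (fieldPoint _ q)).2 s
      let m : (Over.map πG).obj ((Over.map g₀).obj (fieldPoint _ q)) ⟶
          (Over.map (t ≫ f)).obj (fieldPoint _ q) := Over.homMk (𝟙 _) (by
        change 𝟙 _ ≫ q ≫ t ≫ f = (q ≫ g₀) ≫ πG
        rw [Category.id_comp, Category.assoc, hg₀])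
      have hm : ∀ s : fieldPoint _ q ⟶ (trivial T 2).total,
          ιG.push (k₀.push s) = m ≫ h₀.push s := fun s => by
        ext1
        change (s.left ≫ k₀.left) ≫ ιG.left = 𝟙 _ ≫ s.left ≫ h₀.left
        rw [Category.id_comp, Category.assoc, hk₀ι]
      have h0 : s₀ = 0 := eq_of_form_homOfSections_push w hw' s₀ 0 fun s' => by
        have h1 := hs (k₀.push s')
        have h2 : E.form _ (m ≫ h₀.push s₀) (m ≫ h₀.push s') = 0 := by
          rw [← hm, ← hm]; exact h1
        rw [E.form_comp] at h2
        have h3 := (appTop_id _).symm.trans h2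
        refine Eq.trans h3 ?_
        rw [BundleHom.push_zero, _root_.map_zero]
        rfl
      rw [h0]
      exact k₀.push_zero _
  let g₁ : T ⟶ P := IsOpenImmersion.lift j g₀ hrange
  have hg₁ : g₁ ≫ j = g₀ := IsOpenImmersion.lift_fac _ _ _
  have hg₁π : g₁ ≫ π = t ≫ f := by rw [← hjπ, ← Category.assoc, hg₁, hg₀]
  let g : T ⟶ R := hp.lift g₁ t hg₁π
  have hgp : g ≫ p = g₁ := hp.lift_fst _ _ _
  have hgπ : g ≫ π' = t := hp.lift_snd _ _ _
  refine ⟨g, hgπ, ?_⟩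
  have hsec : ∀ l : Fin 2, ∃ u : Over.mk g ⟶ U'.total,
      tautologicalCoords e ι hp U' h _ u = c l := by
    intro l
    let s₀ : Over.mk (𝟙 T) ⟶ (trivial T 2).total := (coords (Over.mk (𝟙 T))).symm (Pi.single l 1)
    have hs₀ : s₀.left ≫ (trivial T 2).total.hom = 𝟙 T := Over.w s₀
    have hkj := hc.flip.paste_vert hk.flip
    have h1 : g ≫ p ≫ j = (s₀.left ≫ k₀.left) ≫ UG.total.hom := by
      rw [Category.assoc, k₀.left_comp, ← Category.assoc, ← Category.assoc, hgp, hg₁]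
      exact ((congrArg (· ≫ g₀) hs₀).trans (Category.id_comp g₀)).symm
    let u : Over.mk g ⟶ U'.total := Over.homMk (hkj.lift g (s₀.left ≫ k₀.left) h1)
      (hkj.lift_fst _ _ _)
    refine ⟨u, ?_⟩
    have h2 : u.left ≫ h.left ≫ ι.left = s₀.left ≫ h₀.left := by
      rw [← hk₀ι, ← hkι]
      have := hkj.lift_snd _ _ h1
      simp only [← Category.assoc] at this ⊢
      exact congrArg (· ≫ ιG.left) this
    rw [push_left_eq hp U' h he hf] at h2
    have h3 : h₀.push s₀ = toBase (t ≫ f) (Over.mk (𝟙 T)) ≫ w l := by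
      refine (homOfSections_push w _ s₀).trans ?_
      rw [LinearEquiv.apply_symm_apply]
      refine (Finset.sum_eq_single l (fun i _ hi => ?_) fun hl => ?_).trans ?_
      · rw [Pi.single_eq_of_ne hi]
        exact zero_smul _ _
      · exact absurd (Finset.mem_univ l) hl
      · rw [Pi.single_eq_same]
        exact one_smul _ _
    have h4 : s₀.left ≫ h₀.left = frameSection e t (c l) := by
      refine (congrArg (fun s => s.left) h3).trans ?_
      exact (Category.id_comp (w l).left)
    exact frameSection_injective hf hgπ (h2.trans h4)
  obtain ⟨u, hu⟩ := hsec 0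
  obtain ⟨v, hv⟩ := hsec 1
  exact ⟨u, v, hu, hv⟩

lemma tautological_hom_ext (hc : h.IsCartesian) (hi : h.IsIsometric)
    (hE : IsQuaternionicProjectiveBundle E π U ι)
    (he : E.IsHyperbolic e) (hf : E.IsFrame e) (T : Scheme.{u}) (g g' : T ⟶ R)
    (hgg : g ≫ π' = g' ≫ π') (u v : Over.mk g ⟶ U'.total) (u' v' : Over.mk g' ⟶ U'.total)
    (hu : tautologicalCoords e ι hp U' h _ u = tautologicalCoords e ι hp U' h _ u')
    (hv : tautologicalCoords e ι hp U' h _ v = tautologicalCoords e ι hp U' h _ v')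
    (huv : IsUnit (hypPairing (tautologicalCoords e ι hp U' h _ u)
      (tautologicalCoords e ι hp U' h _ v))) : g = g' := by
  obtain ⟨G, πG, UG, ιG, j, k, hG, hj, hjπ, hopen, hk, hkι, hι⟩ := hE
  have hform := form_eq_hypPairing hp U' h hi hι he hf
  have huv' := huv
  rw [← hform] at huv
  rw [hu, hv, ← hform] at huv'
  let m : BundleHom g (trivial T 2) U'.toVectorBundle := homOfSections ![u, v]
  let m' : BundleHom g' (trivial T 2) U'.toVectorBundle := homOfSections ![u', v']
  have hm : m.IsCartesian := homOfSections_isCartesian (U'.isFrame_pair huv)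
  have hm' : m'.IsCartesian := homOfSections_isCartesian (U'.isFrame_pair huv')
  have hleft : m.left ≫ h.left ≫ ι.left = m'.left ≫ h.left ≫ ι.left := by
    let Z := (trivial T 2).total
    have h1 := push_left_eq hp U' h (ι := ι) he hf _ (m.push (𝟙 Z))
    have h2 := push_left_eq hp U' h (ι := ι) he hf _ (m'.push (𝟙 Z))
    have e1 : (m.push (𝟙 Z)).left = m.left := Category.id_comp _
    have e2 : (m'.push (𝟙 Z)).left = m'.left := Category.id_comp _
    rw [e1] at h1
    rw [e2] at h2
    rw [h1, h2]
    have h3 : ((Over.map g).obj Z).hom ≫ π' = ((Over.map g').obj Z).hom ≫ π' := by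
      change (Z.hom ≫ g) ≫ π' = (Z.hom ≫ g') ≫ π'
      rw [Category.assoc, hgg, Category.assoc]
    have h4 : tautologicalCoords e ι hp U' h _ (m.push (𝟙 Z)) =
        tautologicalCoords e ι hp U' h _ (m'.push (𝟙 Z)) := by
      refine (tautologicalCoords_homOfSections hp U' h g ![u, v] Z (𝟙 Z)).trans
        (Eq.trans ?_ (tautologicalCoords_homOfSections hp U' h g' ![u', v'] Z (𝟙 Z)).symm)
      simp only [Fin.sum_univ_two, Matrix.cons_val_zero, Matrix.cons_val_one, hu, hv]
    exact congrArg₂ (fun a b => frameSection e a b) h3 h4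
  let κ := h.comp ι
  have hsub : (m.comp κ).IsSubbundle :=
    hm.isSubbundle_comp (hi.comp hι).push_injective
  have hb := (hG.existsUnique T (g ≫ p ≫ π) _ (m.comp κ) hsub).unique
    (y₁ := (g ≫ p) ≫ j) (y₂ := (g' ≫ p) ≫ j) ⟨?_, (m.comp h).comp k, (hm.comp hc).comp hk, ?_⟩
    ⟨?_, (m'.comp h).comp k, (hm'.comp hc).comp hk, ?_⟩
  · refine hp.hom_ext ?_ hgg
    exact (cancel_mono j).1 hb
  · rw [Category.assoc, hjπ, Category.assoc]
  · simp only [BundleHom.comp_left, Category.assoc, hkι, κ]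
  · rw [Category.assoc, hjπ, Category.assoc, hp.w, ← Category.assoc, ← hgg, Category.assoc]
  · simp only [BundleHom.comp_left, Category.assoc, hkι, κ, hleft]

/-- The pullback of a quaternionic projective bundle to a base on which the symplectic bundle has
a hyperbolic frame. -/
def IsQuaternionicProjectiveBundle.hpCoords (hE : IsQuaternionicProjectiveBundle E π U ι)
    (hc : h.IsCartesian) (hi : h.IsIsometric) (he : E.IsHyperbolic e) (hf : E.IsFrame e) :
    HPCoords π' U' n where
  vec := tautologicalCoords e ι hp U' h
  vec_comp := tautologicalCoords_comp e hp U' h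
  form_eq := form_eq_hypPairing hp U' h hi (by
    obtain ⟨_, _, _, _, _, _, -, -, -, -, -, -, hι⟩ := hE
    exact hι) he hf
  exists_lift := exists_tautological_lift hp hc hE he hf
  hom_ext := tautological_hom_ext hp hc hi hE he hf

end Extraction

end

section

/-! ### Dual sections and Plücker coordinates -/

namespace HPCoords

variable {R X : Scheme.{u}} {π : R ⟶ X} {U : SymplecticBundle R 2} {n : ℕ} (C : HPCoords π U n)

/-- Base change of coordinates. -/
def baseChange {R' X' : Scheme.{u}} {π' : R' ⟶ X'} {g : R' ⟶ R} {f : X' ⟶ X}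
    (hp : IsPullback g π' π f) {U' : SymplecticBundle R' 2}
    {k : BundleHom g U'.toVectorBundle U.toVectorBundle} (hk : k.IsCartesian)
    (hi : k.IsIsometric) : HPCoords π' U' n where
  vec T :=
    { toFun := fun s => C.vec ((Over.map g).obj T) (k.push s)
      map_add' := fun s t => by
        rw [k.push_add]
        exact (C.vec ((Over.map g).obj T)).map_add _ _
      map_smul' := fun a s => by
        rw [k.push_smul]
        exact (C.vec ((Over.map g).obj T)).map_smul _ _ }
  vec_comp m s i := by
    have := C.vec_comp ((Over.map g).map m) (k.push s) i
    rw [← k.push_comp] at this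
    exact this
  form_eq T s t := (hi T s t).symm.trans (C.form_eq _ _ _)
  exists_lift T t a b hab := by
    obtain ⟨g₀, hg₀, u, v, rfl, rfl⟩ := C.exists_lift T (t ≫ f) a b hab
    obtain ⟨m, rfl, hm⟩ : ∃ m : T ⟶ R', m ≫ g = g₀ ∧ m ≫ π' = t :=
      ⟨hp.lift g₀ t hg₀, hp.lift_fst _ _ _, hp.lift_snd _ _ _⟩
    obtain ⟨u', rfl⟩ := (hk.push_bijective k (Over.mk m)).2 u
    obtain ⟨v', rfl⟩ := (hk.push_bijective k (Over.mk m)).2 v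
    exact ⟨m, hm, u', v', rfl, rfl⟩
  hom_ext T m m' hmm u v u' v' hu hv huv := by
    refine hp.hom_ext (C.hom_ext T (m ≫ g) (m' ≫ g) ?_ (k.push u) (k.push v) (k.push u')
      (k.push v') hu hv huv) hmm
    rw [Category.assoc, hp.w, ← Category.assoc, hmm, Category.assoc, Category.assoc, hp.w]

lemma exists_dualSection (x : Fin n ⊕ Fin n) : ∃ s : Over.mk (𝟙 R) ⟶ U.total,
    ∀ (T : Over R) (g : T ⟶ Over.mk (𝟙 R)) (w : T ⟶ U.total),
      U.form T (g ≫ s) w = C.vec T w x :=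
  U.exists_dual (fun T _ => (LinearMap.proj x).comp (C.vec T)) fun h _ w => C.vec_comp h w x

/-- The section of `U` which is dual to the coordinate `x`, over an `R`-scheme `T`. -/
def dual (x : Fin n ⊕ Fin n) (T : Over R) : T ⟶ U.total :=
  (Over.homMk T.hom : T ⟶ Over.mk (𝟙 R)) ≫ (C.exists_dualSection x).choose

lemma form_dual (x : Fin n ⊕ Fin n) {T : Over R} (w : T ⟶ U.total) :
    U.form T (C.dual x T) w = C.vec T w x :=
  (C.exists_dualSection x).choose_spec T _ w

lemma comp_dual (x : Fin n ⊕ Fin n) {T' T : Over R} (g : T' ⟶ T) :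
    g ≫ C.dual x T = C.dual x T' := by
  rw [dual, dual, ← Category.assoc]
  congr 1
  ext1
  exact Over.w g

lemma dual_eq {T : Over R} {u v : T ⟶ U.total} (h : U.form T u v = 1) (x : Fin n ⊕ Fin n) :
    C.dual x T = C.vec T v x • u - C.vec T u x • v := by
  have := U.eq_of_form_eq_one h (C.dual x T)
  rwa [form_dual, form_dual] at this

/-- The Plücker coordinate with index `(inr j, inl j)`. -/
def plucker (j : Fin n) (T : Over R) : Γ(T.left, ⊤) :=
  U.form T (C.dual (.inr j) T) (C.dual (.inl j) T)

lemma plucker_comp (j : Fin n) {T' T : Over R} (g : T' ⟶ T) :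
    g.left.appTop.hom (C.plucker j T) = C.plucker j T' := by
  rw [plucker, ← U.form_comp, comp_dual, comp_dual, plucker]

/-- The global function `plucker j` is the minor of index `inr j, inl j` of any basis `u, v` of
the tautological plane, divided by the value of the form on `u, v`. -/
lemma plucker_mul_form (j : Fin n) {T : Over R} (u v : T ⟶ U.total) :
    C.plucker j T * U.form T u v =
      C.vec T u (.inr j) * C.vec T v (.inl j) - C.vec T u (.inl j) * C.vec T v (.inr j) := by
  have h := congrArg (fun s => U.form T s (C.dual (.inr j) T))
    (U.form_cyclic u v (C.dual (.inl j) T))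
  simp only [_root_.map_add, LinearMap.add_apply, _root_.map_smul, LinearMap.smul_apply,
    smul_eq_mul,
    LinearMap.map_zero, LinearMap.zero_apply] at h
  rw [U.form_neg (C.dual (.inl j) T) (C.dual (.inr j) T), U.form_neg u (C.dual (.inr j) T),
    U.form_neg v (C.dual (.inr j) T), U.form_neg v (C.dual (.inl j) T)] at h
  simp only [form_dual] at h
  rw [plucker, form_dual]
  linear_combination -h

/-- The form is the sum of the minors, by the definition of the hyperbolic pairing. -/
lemma sum_plucker (T : Over R) : ∑ j, C.plucker j T = 1 := by
  refine function_eq_of_locally _ _ fun x => ?_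
  obtain ⟨W, hx, u, v, huv⟩ := U.exists_form_eq_one T x
  refine ⟨W, hx, ?_⟩
  rw [_root_.map_sum, _root_.map_one]
  have h1 : ∀ j, W.ι.appTop.hom (C.plucker j T) = C.plucker j (res T W) := fun j =>
    C.plucker_comp j (resι T W)
  have h2 : ∀ j, C.plucker j (res T W) = C.vec _ u (.inr j) * C.vec _ v (.inl j) -
      C.vec _ u (.inl j) * C.vec _ v (.inr j) := fun j => by
    rw [← C.plucker_mul_form j u v, huv, mul_one]
  rw [Finset.sum_congr rfl fun j _ => (h1 j).trans (h2 j)]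
  exact (C.form_eq _ u v).symm.trans huv

/-- Where `plucker j` is invertible, the coordinates `inr j` and `inl j` determine a vector of the
plane. -/
lemma eq_of_vec_eq (j : Fin n) {T : Over R} (hj : IsUnit (C.plucker j T)) {u v : T ⟶ U.total}
    (h : C.vec T u (.inr j) = C.vec T v (.inr j)) (h' : C.vec T u (.inl j) = C.vec T v (.inl j)) :
    u = v := by
  have key : ∀ w : T ⟶ U.total, C.plucker j T • w =
      C.vec T w (.inr j) • C.dual (.inl j) T - C.vec T w (.inl j) • C.dual (.inr j) T := fun w => by
    have := U.form_cyclic (C.dual (.inr j) T) (C.dual (.inl j) T) w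
    rw [U.form_neg w] at this
    simp only [form_dual] at this
    rw [plucker, form_dual, ← sub_eq_zero, ← this]
    module
  obtain ⟨c, hc⟩ := hj
  have h1 : (c : Γ(T.left, ⊤)) • u = (c : Γ(T.left, ⊤)) • v := by
    rw [hc, key, key, h, h']
  have h2 := congrArg (fun w => ((c⁻¹ : (Γ(T.left, ⊤))ˣ) : Γ(T.left, ⊤)) • w) h1
  simpa only [smul_smul, Units.inv_mul, one_smul] using h2

/-- Where the Plücker coordinate is invertible, the tautological plane has a unique basis whose
coordinates with indices `inr j` and `inl j` form the identity matrix. -/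
lemma exists_normalized (j : Fin n) {T : Over R} (hj : IsUnit (C.plucker j T)) :
    ∃ u v : T ⟶ U.total, C.vec T u (.inr j) = 1 ∧ C.vec T u (.inl j) = 0 ∧
      C.vec T v (.inr j) = 0 ∧ C.vec T v (.inl j) = 1 := by
  obtain ⟨c, hc⟩ := hj
  have h1 : C.vec T (C.dual (.inl j) T) (.inr j) = c := by rw [hc, plucker, form_dual]
  have h2 : C.vec T (C.dual (.inr j) T) (.inl j) = - c := by
    rw [hc, plucker, U.form_neg, form_dual, neg_neg]
  have h3 : ∀ x, C.vec T (C.dual x T) x = 0 := fun x => by rw [← form_dual, U.form_self]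
  refine ⟨((c⁻¹ : (Γ(T.left, ⊤))ˣ) : Γ(T.left, ⊤)) • C.dual (.inl j) T,
    -((c⁻¹ : (Γ(T.left, ⊤))ˣ) : Γ(T.left, ⊤)) • C.dual (.inr j) T, ?_⟩
  simp only [LinearMap.map_smul, Pi.smul_apply, smul_eq_mul, h1, h2, h3, Units.inv_mul, mul_zero,
    neg_mul_neg, and_self]

open Classical in
/-- The vectors with prescribed coordinates outside of `inr j` and `inl j`, where their
coordinates form the identity matrix. -/
def normalizedVec {A : Type*} [CommRing A] (j : Fin n)
    (d : {p : Fin 2 × (Fin n ⊕ Fin n) // p.2 ≠ .inl j ∧ p.2 ≠ .inr j} → A) (l : Fin 2)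
    (x : Fin n ⊕ Fin n) : A :=
  if h : x ≠ .inl j ∧ x ≠ .inr j then d ⟨(l, x), h⟩
  else if (l = 0 ∧ x = .inr j) ∨ (l = 1 ∧ x = .inl j) then 1 else 0

lemma map_normalizedVec {A B : Type*} [CommRing A] [CommRing B] (f : A →+* B) (j : Fin n)
    (d : {p : Fin 2 × (Fin n ⊕ Fin n) // p.2 ≠ .inl j ∧ p.2 ≠ .inr j} → A) (l : Fin 2)
    (x : Fin n ⊕ Fin n) : f (normalizedVec j d l x) = normalizedVec j (fun p => f (d p)) l x := by
  unfold normalizedVec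
  split_ifs <;> simp

/-- The locus is isomorphic to a principal open subset of an affine space: the affine space
parametrizes pairs of vectors normalized as in `exists_normalized`, and the open subset is the one
where their pairing is invertible. -/
lemma isAffineOpen_basicOpen_plucker [IsAffine X] (j : Fin n) :
    IsAffineOpen (R.basicOpen (C.plucker j (Over.mk (𝟙 R)))) := by
  let ι := {p : Fin 2 × (Fin n ⊕ Fin n) // p.2 ≠ .inl j ∧ p.2 ≠ .inr j}
  let B := 𝔸(ULift.{u} ι; X)
  let q : B ⟶ X := 𝔸(ULift.{u} ι; X) ↘ X
  let c : ι → Γ(B, ⊤) := fun i => AffineSpace.coord X (ULift.up i)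
  have hB : IsAffineSpace q c := isAffineSpace_affineSpace X ι
  have hBa : IsAffine B := inferInstanceAs (IsAffine 𝔸(ULift.{u} ι; X))
  let J : Γ(B, ⊤) := hypPairing (normalizedVec j c 0) (normalizedVec j c 1)
  let D' : B.Opens := B.basicOpen J
  let D : R.Opens := R.basicOpen (C.plucker j (Over.mk (𝟙 R)))
  have hD' : IsAffine D' := (isAffineOpen_top B).basicOpen J
  have hJ : ∀ {T : Scheme.{u}} (m : T ⟶ B), m.appTop.hom J = hypPairing
      (normalizedVec j (fun i => m.appTop.hom (c i)) 0)
      (normalizedVec j (fun i => m.appTop.hom (c i)) 1) := fun m => by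
    simp only [J, map_hypPairing, map_normalizedVec]
  have hv : ∀ {A : Type u} [CommRing A] (d : ι → A), normalizedVec j d 0 (.inr j) = 1 ∧
      normalizedVec j d 0 (.inl j) = 0 ∧ normalizedVec j d 1 (.inr j) = 0 ∧
      normalizedVec j d 1 (.inl j) = 1 := fun d => by
    simp [normalizedVec]
  -- from the principal open subset of affine space to `R`
  obtain ⟨g, hgπ, u', v', hu', hv'⟩ := C.exists_lift D' (D'.ι ≫ q)
    (normalizedVec j (fun i => D'.ι.appTop.hom (c i)) 0)
    (normalizedVec j (fun i => D'.ι.appTop.hom (c i)) 1) (by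
      rw [← hJ]
      exact isUnit_appTop_of_range_subset _ _ (by rw [Scheme.Opens.range_ι]))
  have hPu : ∀ {T : Over R} (u v : T ⟶ U.total), C.vec T u (.inr j) = 1 → C.vec T u (.inl j) = 0 →
      C.vec T v (.inr j) = 0 → C.vec T v (.inl j) = 1 → C.plucker j T * U.form T u v = 1 := by
    intro T u v h1 h2 h3 h4
    rw [plucker_mul_form, h1, h2, h3, h4]
    ring
  have hgu : IsUnit (C.plucker j (Over.mk g)) := by
    refine IsUnit.of_mul_eq_one _ (hPu u' v' ?_ ?_ ?_ ?_)
    · rw [hu']; exact (hv _).1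
    · rw [hu']; exact (hv _).2.1
    · rw [hv']; exact (hv _).2.2.1
    · rw [hv']; exact (hv _).2.2.2
  have hgD : Set.range g ⊆ Set.range D.ι := by
    rw [Scheme.Opens.range_ι]
    refine range_subset_basicOpen g _ ?_
    have := C.plucker_comp j (Over.homMk g : Over.mk g ⟶ Over.mk (𝟙 R))
    exact this ▸ hgu
  let a : D'.toScheme ⟶ D.toScheme := IsOpenImmersion.lift D.ι g hgD
  have ha : a ≫ D.ι = g := IsOpenImmersion.lift_fac _ _ _
  -- from the principal open subset of `R` to affine space
  have hDu : IsUnit (C.plucker j (Over.mk D.ι)) := by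
    have := C.plucker_comp j (Over.homMk D.ι : Over.mk D.ι ⟶ Over.mk (𝟙 R))
    rw [← this]
    exact isUnit_appTop_of_range_subset D.ι _ (by rw [Scheme.Opens.range_ι])
  obtain ⟨u, v, hu1, hu2, hv1, hv2⟩ := C.exists_normalized j hDu
  let w : Fin 2 → (Over.mk D.ι ⟶ U.total) := ![u, v]
  obtain ⟨b₀, hb₀, hb₀'⟩ := hB.exists_hom (D.ι ≫ π) fun i => C.vec _ (w i.1.1) i.1.2
  have hw : ∀ l, normalizedVec j (fun i => b₀.appTop.hom (c i)) l = C.vec _ (w l) := by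
    intro l
    funext x
    simp only [hb₀']
    unfold normalizedVec
    split_ifs with h1 h2
    · rfl
    · rcases h2 with ⟨rfl, rfl⟩ | ⟨rfl, rfl⟩
      · exact hu1.symm
      · exact hv2.symm
    · have h3 : x = .inl j ∨ x = .inr j := by tauto
      fin_cases l <;> rcases h3 with rfl | rfl
      · exact hu2.symm
      · simp at h2
      · simp at h2
      · exact hv1.symm
  have hbJ : IsUnit (b₀.appTop.hom J) := by
    rw [hJ, hw, hw]
    refine IsUnit.of_mul_eq_one_right (C.plucker j (Over.mk D.ι)) ?_
    have := hPu u v hu1 hu2 hv1 hv2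
    rwa [C.form_eq] at this
  let b : D.toScheme ⟶ D'.toScheme := IsOpenImmersion.lift D'.ι b₀ (by
    rw [Scheme.Opens.range_ι]
    exact range_subset_basicOpen b₀ _ hbJ)
  have hb : b ≫ D'.ι = b₀ := IsOpenImmersion.lift_fac _ _ _
  have hba : b ≫ a = 𝟙 _ := by
    rw [← cancel_mono D.ι, Category.assoc, ha, Category.id_comp]
    have hb' : ∀ l, (fun x => b.appTop.hom (normalizedVec j (fun i => D'.ι.appTop.hom (c i)) l x)) =
        C.vec _ (w l) := fun l => by
      rw [← hw]
      funext x
      rw [map_normalizedVec]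
      simp only [← appTop_comp, hb]
    let β : Over.mk (b ≫ g) ⟶ Over.mk g := Over.homMk b
    have h0 : C.vec _ (β ≫ u') = C.vec _ (w 0) := by
      rw [← hb', ← hu']
      exact funext fun x => C.vec_comp β u' x
    have h1 : C.vec _ (β ≫ v') = C.vec _ (w 1) := by
      rw [← hb', ← hv']
      exact funext fun x => C.vec_comp β v' x
    refine C.hom_ext D (b ≫ g) D.ι ?_ (β ≫ u') (β ≫ v') (w 0) (w 1) h0 h1 ?_
    · rw [Category.assoc, hgπ, ← Category.assoc, hb, hb₀]
    · rw [h0, h1, ← hw, ← hw, ← hJ]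
      exact hbJ
  have hab : a ≫ b = 𝟙 _ := by
    rw [← cancel_mono D'.ι, Category.assoc, hb, Category.id_comp]
    let α : Over.mk g ⟶ Over.mk D.ι := Over.homMk a ha
    have hu0 : α ≫ u = u' := by
      refine C.eq_of_vec_eq j hgu ?_ ?_
      · rw [C.vec_comp, hu1, hu', _root_.map_one]
        exact (hv _).1.symm
      · rw [C.vec_comp, hu2, hu', _root_.map_zero]
        exact (hv _).2.1.symm
    have hv0 : α ≫ v = v' := by
      refine C.eq_of_vec_eq j hgu ?_ ?_
      · rw [C.vec_comp, hv1, hv', _root_.map_zero]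
        exact (hv _).2.2.1.symm
      · rw [C.vec_comp, hv2, hv', _root_.map_one]
        exact (hv _).2.2.2.symm
    refine hB.hom_ext ?_ fun i => ?_
    · rw [Category.assoc, hb₀, ← Category.assoc, ha, hgπ]
    · rw [appTop_comp, hb₀']
      obtain ⟨⟨l, x⟩, hx⟩ := i
      have h3 : normalizedVec j (fun i => D'.ι.appTop.hom (c i)) l x =
        D'.ι.appTop.hom (c ⟨(l, x), hx⟩) := dif_pos hx
      rw [← h3]
      refine (C.vec_comp α (w l) x).symm.trans ?_
      fin_cases l
      · exact congrFun ((congrArg (C.vec _) hu0).trans hu') x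
      · exact congrFun ((congrArg (C.vec _) hv0).trans hv') x
  have : IsIso b := ⟨a, hba, hab⟩
  exact IsAffine.of_isIso b

lemma isAffine [IsAffine X] (C : HPCoords π U n) : IsAffine R := by
  refine isAffine_of_isAffineOpen_basicOpen
    (Set.range fun j => C.plucker j (Over.mk (𝟙 R))) ?_ ?_
  · rw [Ideal.eq_top_iff_one, ← C.sum_plucker (Over.mk (𝟙 R))]
    exact Ideal.sum_mem _ fun j _ => Ideal.subset_span ⟨j, rfl⟩
  · rintro _ ⟨j, rfl⟩
    exact C.isAffineOpen_basicOpen_plucker j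

end HPCoords

end

section

/-! ### Membership of quaternionic projective bundles -/

lemma SymplecticBundle.exists_isHyperbolic_opens {S : Scheme.{u}} {n : ℕ}
    (E : SymplecticBundle S (2 * n)) (x : S) : ∃ W : S.Opens, x ∈ W ∧
      ∃ e : Fin n ⊕ Fin n → (Over.mk W.ι ⟶ E.total), E.IsHyperbolic e ∧ E.IsFrame e := by
  obtain ⟨W, hx, e, he, hf⟩ := E.exists_isHyperbolic (Over.mk (𝟙 S)) x
  let m : Over.mk (Scheme.Opens.ι (X := S) W) ⟶ res (Over.mk (𝟙 S)) W :=
    Over.homMk (𝟙 _) (by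
      change 𝟙 _ ≫ Scheme.Opens.ι (X := S) W ≫ 𝟙 S = _
      rw [Category.id_comp, Category.comp_id]
      rfl)
  exact ⟨W, hx, _, he.comp m, hf.comp m⟩

/-- Over an affine open subset with a hyperbolic frame the projective bundle is affine. -/
lemma IsQuaternionicProjectiveBundle.isAffineHom {S P : Scheme.{u}} {n : ℕ}
    {E : SymplecticBundle S (2 * n)} {π : P ⟶ S} {U : SymplecticBundle P 2}
    {ι : BundleHom π U.toVectorBundle E.toVectorBundle}
    (hP : IsQuaternionicProjectiveBundle E π U ι) : IsAffineHom π := by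
  refine isAffineHom_of_forall_exists_isAffineOpen π fun x => ?_
  obtain ⟨W, hW, e, he, hf⟩ := E.exists_isHyperbolic_opens x
  obtain ⟨W', hW', hxW', hle⟩ := exists_isAffineOpen_mem_and_subset (x := x) (U := W) hW
  refine ⟨W', hxW', hW', ?_⟩
  let m : Over.mk W'.ι ⟶ Over.mk W.ι := Over.homMk (S.homOfLE hle) (S.homOfLE_ι hle)
  have : IsAffine W' := hW'
  exact (hP.hpCoords (isPullback_morphismRestrict π W').flip (U.pullbackHom_isCartesian _)
    (U.pullbackHom_isIsometric _) (he.comp m) (hf.comp m)).isAffine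

/-- The projective bundle is open in a Grassmannian bundle, quasi-compact, and affine over the
base. -/
lemma IsQuaternionicProjectiveBundle.mem {k : Scheme.{u}} {V : SchemeCategory k} {S P : Over k}
    (hS : V.Mem S) {n : ℕ} {E : SymplecticBundle S.left (2 * n)} {π : P ⟶ S}
    {U : SymplecticBundle P.left 2} {ι : BundleHom π.left U.toVectorBundle E.toVectorBundle}
    (hP : IsQuaternionicProjectiveBundle E π.left U ι) : V.Mem P := by
  have haff := hP.isAffineHom
  obtain ⟨G, πG, UG, ιG, j, k', hG, hj, hjπ, -⟩ := hP
  have := V.compactSpace S hS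
  have hc : CompactSpace P.left := QuasiCompact.compactSpace_of_compactSpace π.left
  have h := V.grassmannian_mem S hS (2 * n) 2 E.toVectorBundle G πG UG ιG hG P.left j hj hc
    (by rw [hjπ]; exact haff)
  let f : P ⟶ Over.mk ((j ≫ πG) ≫ S.hom) := Over.homMk (𝟙 _) (by
    change 𝟙 _ ≫ (j ≫ πG) ≫ S.hom = P.hom
    rw [Category.id_comp, hjπ, Over.w])
  have : IsIso f := over_isIso f (h := inferInstanceAs (IsIso (𝟙 P.left)))
  exact SchemeCategory.mem_of_isIso f h

end

section

/-! ### The cells of a quaternionic projective bundle -/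

section CellVectors

variable {n : ℕ}

/-- The indices of the free coordinates of the cell number `i`. -/
abbrev CellIndex (n : ℕ) (i : Fin n) : Type :=
  {p : Fin 2 × (Fin n ⊕ Fin n) // p ≠ (0, .inl i) ∧ p ≠ (0, .inr i) ∧ p ≠ (1, .inr i)}

variable {A : Type*} [CommRing A] (i : Fin n) (d : CellIndex n i → A)

open Classical in
/-- The second basis vector of the normalized basis of a plane in the cell number `i`. -/
def cellVec (x : Fin n ⊕ Fin n) : A :=
  if h : x ≠ .inr i then d ⟨(1, x), by simp, by simp, fun h' => h (Prod.ext_iff.1 h').2⟩ else 1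

open Classical in
/-- The free coordinates of the first basis vector. -/
def cellCovec₀ (x : Fin n ⊕ Fin n) : A :=
  if h : x ≠ .inl i ∧ x ≠ .inr i then
    d ⟨(0, x), fun h' => h.1 (Prod.ext_iff.1 h').2, fun h' => h.2 (Prod.ext_iff.1 h').2, by simp⟩
  else 0

open Classical in
/-- The first basis vector of the normalized basis of a plane in the cell number `i`: its
coordinate `inr i` vanishes and its pairing with the second basis vector is `1`. -/
def cellCovec (x : Fin n ⊕ Fin n) : A :=
  cellCovec₀ i d x + if x = .inl i then hypPairing (cellCovec₀ i d) (cellVec i d) - 1 else 0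

lemma map_cellVec {B : Type*} [CommRing B] (f : A →+* B) (x : Fin n ⊕ Fin n) :
    f (cellVec i d x) = cellVec i (fun p => f (d p)) x := by
  unfold cellVec
  split_ifs <;> simp

lemma map_cellCovec {B : Type*} [CommRing B] (f : A →+* B) (x : Fin n ⊕ Fin n) :
    f (cellCovec i d x) = cellCovec i (fun p => f (d p)) x := by
  have h : ∀ x, f (cellCovec₀ i d x) = cellCovec₀ i (fun p => f (d p)) x := fun x => by
    unfold cellCovec₀
    split_ifs <;> simp
  unfold cellCovec
  rw [_root_.map_add, h]
  split_ifs
  · rw [_root_.map_sub, map_hypPairing, _root_.map_one]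
    simp only [h, map_cellVec]
  · rw [_root_.map_zero]

lemma cellVec_inr : cellVec i d (.inr i) = 1 := by simp [cellVec]

lemma cellCovec_inr : cellCovec i d (.inr i) = 0 := by simp [cellCovec, cellCovec₀]

lemma cellVec_of_index (x : Fin n ⊕ Fin n) (h) : cellVec i d x = d ⟨(1, x), h⟩ :=
  dif_pos fun hx => h.2.2 (by rw [hx])

lemma cellCovec_of_index (x : Fin n ⊕ Fin n) (h) : cellCovec i d x = d ⟨(0, x), h⟩ := by
  have h1 : x ≠ .inl i := fun hx => h.1 (by rw [hx])
  have h2 : x ≠ .inr i := fun hx => h.2.1 (by rw [hx])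
  rw [cellCovec, cellCovec₀, if_neg h1, dif_pos ⟨h1, h2⟩, add_zero]

/-- The coordinate `inl i` of the covector enters the pairing only through its product with the
coordinate `inr i` of the vector. -/
lemma hypPairing_update (a b : Fin n ⊕ Fin n → A) (c : A) [DecidableEq (Fin n ⊕ Fin n)] :
    hypPairing (fun x => a x + if x = .inl i then c else 0) b =
      hypPairing a b - c * b (.inr i) := by
  have h : ∀ j, (a (.inr j) + if (Sum.inr j : Fin n ⊕ Fin n) = .inl i then c else 0) * b (.inl j) -
      (a (.inl j) + if (Sum.inl j : Fin n ⊕ Fin n) = .inl i then c else 0) * b (.inr j) =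
      (a (.inr j) * b (.inl j) - a (.inl j) * b (.inr j)) - if j = i then c * b (.inr j) else
        0 := by
    intro j
    rw [if_neg (by simp)]
    by_cases hj : j = i
    · rw [if_pos (by rw [hj]), if_pos hj]; ring
    · rw [if_neg (by simpa using hj), if_neg hj]; ring
  refine (Finset.sum_congr rfl fun j _ => h j).trans ?_
  rw [Finset.sum_sub_distrib, Finset.sum_ite_eq' Finset.univ i, if_pos (Finset.mem_univ i),
    hypPairing]

/-- The dependent coordinate of the covector is chosen to make the pairing one. -/
lemma hypPairing_cell : hypPairing (cellCovec i d) (cellVec i d) = 1 := by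
  classical
  have := hypPairing_update i (cellCovec₀ i d) (cellVec i d)
    (hypPairing (cellCovec₀ i d) (cellVec i d) - 1)
  rw [cellVec_inr, mul_one, sub_sub_cancel] at this
  rw [← this]
  congr 1

/-- A normalized pair of vectors is determined by its free coordinates. -/
lemma eq_cell_of_normalized {a b : Fin n ⊕ Fin n → A} (h : hypPairing a b = 1)
    (ha : a (.inr i) = 0) (hb : b (.inr i) = 1)
    (hda : ∀ x h, d ⟨(0, x), h⟩ = a x) (hdb : ∀ x h, d ⟨(1, x), h⟩ = b x) :
    cellCovec i d = a ∧ cellVec i d = b := by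
  classical
  have h1 : cellVec i d = b := by
    funext x
    unfold cellVec
    split_ifs with hx
    · exact hdb _ _
    · rw [not_not.1 hx, hb]
  refine ⟨?_, h1⟩
  have h2 : a = fun x => cellCovec₀ i d x + if x = .inl i then a (.inl i) else 0 := by
    funext x
    unfold cellCovec₀
    split_ifs with hx h' h'
    · exact absurd h' hx.1
    · rw [hda, add_zero]
    · rw [h', zero_add]
    · have : x = .inr i := by tauto
      rw [this, ha, add_zero]
  have h3 := hypPairing_update i (cellCovec₀ i d) b (a (.inl i))
  rw [← h2, h, hb, mul_one] at h3
  rw [h2]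
  funext x
  unfold cellCovec
  rw [h1]
  congr 1
  split_ifs
  · rw [h3]; ring
  · rfl

end CellVectors

namespace HPCoords

variable {R X : Scheme.{u}} {π : R ⟶ X} {U : SymplecticBundle R 2} {n : ℕ} (C : HPCoords π U n)

lemma vec_injective (T : Over R) : Function.Injective (C.vec T) := by
  intro s t h
  refine U.ext_of_form _ _ fun T' g w => ?_
  rw [C.form_eq, C.form_eq]
  congr 1
  funext x
  rw [C.vec_comp, C.vec_comp, h]

/-- The cell number `i`: the space of planes with a basis `k, v` such that `k` has pairing `1` with
`v` and vanishing coordinate `inr i`, and `v` has coordinate `inr i` equal to `1`. -/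
structure Cell (i : Fin n) where
  Y : Scheme.{u}
  ρ : Y ⟶ R
  c : CellIndex n i → Γ(Y, ⊤)
  isAffineSpace : IsAffineSpace (ρ ≫ π) c
  k : Over.mk ρ ⟶ U.total
  v : Over.mk ρ ⟶ U.total
  vec_k : C.vec _ k = cellCovec i c
  vec_v : C.vec _ v = cellVec i c

lemma nonempty_cell (i : Fin n) : Nonempty (C.Cell i) := by
  let Y := 𝔸(ULift.{u} (CellIndex n i); X)
  let q : Y ⟶ X := 𝔸(ULift.{u} (CellIndex n i); X) ↘ X
  let c : CellIndex n i → Γ(Y, ⊤) := fun i => AffineSpace.coord X (ULift.up i)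
  have hY : IsAffineSpace q c := isAffineSpace_affineSpace X _
  obtain ⟨ρ, hρ, k, v, hk, hv⟩ := C.exists_lift Y q (cellCovec i c) (cellVec i c)
    (by rw [hypPairing_cell]; exact isUnit_one)
  exact ⟨Y, ρ, c, by rw [hρ]; exact hY, k, v, hk, hv⟩

namespace Cell

variable {C} {i : Fin n} (D : C.Cell i)

lemma form_k_v : U.form _ D.k D.v = 1 := by
  rw [C.form_eq, D.vec_k, D.vec_v]
  exact hypPairing_cell i D.c

lemma dual_eq (x : Fin n ⊕ Fin n) : C.dual x (Over.mk D.ρ) =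
    C.vec _ D.v x • D.k - C.vec _ D.k x • D.v := C.dual_eq D.form_k_v x

/-- In the cell number `i` the first basis vector is the dual of the coordinate `inr i`. -/
lemma dual_eq_k : C.dual (.inr i) (Over.mk D.ρ) = D.k := by
  have h1 : C.vec _ D.v (.inr i) = 1 := by rw [D.vec_v]; exact cellVec_inr i D.c
  have h2 : C.vec _ D.k (.inr i) = 0 := by rw [D.vec_k]; exact cellCovec_inr i D.c
  rw [D.dual_eq, h1, h2, one_smul, zero_smul, sub_zero]

/-- Morphisms to a cell are determined by the plane and the normalized basis. -/
lemma hom_ext {T : Scheme.{u}} {y y' : T ⟶ D.Y} (h : y ≫ D.ρ = y' ≫ D.ρ)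
    (hv : (Over.homMk y h : Over.mk (y' ≫ D.ρ) ⟶ Over.mk D.ρ) ≫ D.v =
      (Over.homMk y' : Over.mk (y' ≫ D.ρ) ⟶ Over.mk D.ρ) ≫ D.v) : y = y' := by
  have hk : (Over.homMk y h : Over.mk (y' ≫ D.ρ) ⟶ Over.mk D.ρ) ≫ D.k =
      (Over.homMk y' : Over.mk (y' ≫ D.ρ) ⟶ Over.mk D.ρ) ≫ D.k := by
    rw [← D.dual_eq_k, C.comp_dual, C.comp_dual]
  refine D.isAffineSpace.hom_ext ?_ fun p => ?_
  · rw [← Category.assoc, h, Category.assoc]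
  · obtain ⟨⟨l, x⟩, hx⟩ := p
    fin_cases l
    · have h1 : D.c ⟨(0, x), hx⟩ = C.vec _ D.k x := by rw [D.vec_k, cellCovec_of_index _ _ _ hx]
      refine (congrArg y.appTop.hom h1).trans (Eq.trans ?_ (congrArg y'.appTop.hom h1).symm)
      have h2 := congrFun (congrArg (C.vec _) hk) x
      rw [C.vec_comp, C.vec_comp] at h2
      exact h2
    · have h1 : D.c ⟨(1, x), hx⟩ = C.vec _ D.v x := by rw [D.vec_v, cellVec_of_index _ _ _ hx]
      refine (congrArg y.appTop.hom h1).trans (Eq.trans ?_ (congrArg y'.appTop.hom h1).symm)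
      have h2 := congrFun (congrArg (C.vec _) hv) x
      rw [C.vec_comp, C.vec_comp] at h2
      exact h2

/-- The cell number `i` lies over the locus where the dual of the coordinate `inr i` does not
vanish. -/
lemma range_subset : Set.range D.ρ ⊆
    ((C.dual (.inr i) (Over.mk (𝟙 R))).left ⁻¹' (U.zeroLocus : Set U.total.left))ᶜ := by
  rintro _ ⟨y, rfl⟩ hy
  have h1 : (C.dual (.inr i) (Over.mk D.ρ)).left y ∈ U.zeroLocus := by
    rw [← C.comp_dual (.inr i) (Over.homMk D.ρ : Over.mk D.ρ ⟶ Over.mk (𝟙 R))]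
    exact hy
  rw [D.dual_eq_k, U.mem_zeroLocus_iff] at h1
  have h2 := U.form_comp (residuePointι (Over.mk D.ρ) y) D.k D.v
  rw [h1, D.form_k_v, LinearMap.map_zero, LinearMap.zero_apply, _root_.map_one] at h2
  obtain ⟨a, b, hab⟩ := (isField_residuePoint (Over.mk D.ρ) y).exists_pair_ne
  exact hab (by rw [← one_mul a, ← one_mul b, ← h2, zero_mul, zero_mul])

/-- Near a point at which the dual of the coordinate `inr i` does not vanish there is a section
of `U` whose coordinate `inr i` is `1`. -/
lemma _root_.QuatProj.HPCoords.exists_vec_eq_one (C : HPCoords π U n) (i : Fin n) (T : Over R)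
    (x : T.left) (hx : (C.dual (.inr i) T).left x ∉ U.zeroLocus) :
    ∃ W : T.left.Opens, x ∈ W ∧ ∃ v : res T W ⟶ U.total, C.vec _ v (.inr i) = 1 := by
  obtain ⟨W, hW, b, hb, c, hc, l, hl⟩ := U.exists_isUnit_coeff (C.dual (.inr i) T) x hx
  have hd : IsUnit (U.form _ (b 0) (b 1)) := U.isUnit_form_of_isFrame hb
  have h0 : U.form _ (C.dual (.inr i) (res T W)) (b 1) = c 0 * U.form _ (b 0) (b 1) := by
    rw [← C.comp_dual _ (resι T W), hc, Fin.sum_univ_two, LinearMap.map_add, LinearMap.add_apply,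
      LinearMap.map_smul, LinearMap.map_smul, LinearMap.smul_apply, LinearMap.smul_apply,
      U.form_self, smul_zero, add_zero, smul_eq_mul]
  have h1 : U.form _ (C.dual (.inr i) (res T W)) (b 0) = c 1 * - U.form _ (b 0) (b 1) := by
    rw [← C.comp_dual _ (resι T W), hc, Fin.sum_univ_two, LinearMap.map_add, LinearMap.add_apply,
      LinearMap.map_smul, LinearMap.map_smul, LinearMap.smul_apply, LinearMap.smul_apply,
      U.form_self, smul_zero, zero_add, smul_eq_mul, U.form_neg (b 1)]
  obtain ⟨v, hv⟩ : ∃ v, IsUnit (U.form _ (C.dual (.inr i) (res T W)) v) := by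
    fin_cases l
    · exact ⟨b 1, by rw [h0]; exact hl.mul hd⟩
    · exact ⟨b 0, by rw [h1]; exact hl.mul hd.neg⟩
  rw [C.form_dual] at hv
  obtain ⟨a, ha⟩ := hv
  refine ⟨W, hW, ((a⁻¹ : (Γ((res T W).left, ⊤))ˣ) : Γ((res T W).left, ⊤)) • v, ?_⟩
  rw [LinearMap.map_smul, Pi.smul_apply, ← ha, smul_eq_mul, Units.inv_mul]

/-- The cell number `i` is an affine line locally on the locus where the dual of the coordinate
`inr i` does not vanish. -/
lemma isLocallyAffineSpace {O : Scheme.{u}} (j : O ⟶ R) [IsOpenImmersion j] (hj : Set.range j =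
      ((C.dual (.inr i) (Over.mk (𝟙 R))).left ⁻¹' (U.zeroLocus : Set U.total.left))ᶜ)
    (ρ' : D.Y ⟶ O) (hρ' : ρ' ≫ j = D.ρ) : IsLocallyAffineSpace ρ' := by
  intro x
  obtain ⟨W, hx, v₀, hv₀⟩ := C.exists_vec_eq_one i (Over.mk j) x (by
    rw [← C.comp_dual (.inr i) (Over.homMk j : Over.mk j ⟶ Over.mk (𝟙 R))]
    have : j x ∈ Set.range j := ⟨x, rfl⟩
    rw [hj] at this
    exact this)
  -- over `W` there is a vector `v₀` with coordinate `inr i` equal to one, and the other such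
  -- vectors are `v₀ + z k`, where `k`, the dual section, generates the vectors with coordinate zero
  let L := 𝔸(ULift.{u} Unit; W.toScheme)
  let q' : L ⟶ W.toScheme := 𝔸(ULift.{u} Unit; W.toScheme) ↘ W.toScheme
  let z : Γ(L, ⊤) := AffineSpace.coord W.toScheme (ULift.up ())
  have hL : IsAffineSpace q' fun _ : Unit => z := isAffineSpace_affineSpace _ _
  let S := Over.mk (q' ≫ W.ι ≫ j)
  let m : S ⟶ res (Over.mk j) W := Over.homMk q'
  let k₁ : S ⟶ U.total := C.dual (.inr i) S
  let v₁ : S ⟶ U.total := m ≫ v₀ + (show Γ(S.left, ⊤) from z) • k₁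
  have hk₁v₀ : U.form S k₁ (m ≫ v₀) = 1 := by
    rw [C.form_dual, C.vec_comp, hv₀, _root_.map_one]
  have hk₁v₁ : U.form S k₁ v₁ = 1 := by
    rw [LinearMap.map_add, LinearMap.map_smul, U.form_self, smul_zero, add_zero, hk₁v₀]
  have hz : U.form S v₁ (m ≫ v₀) = z := by
    rw [LinearMap.map_add, LinearMap.add_apply, LinearMap.map_smul, LinearMap.smul_apply,
      U.form_self, zero_add, hk₁v₀]
    exact mul_one z
  obtain ⟨g, hgπ, hg⟩ := D.isAffineSpace.exists_hom (q' ≫ W.ι ≫ j ≫ π) fun p =>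
    C.vec S (if p.1.1 = 0 then k₁ else v₁) p.1.2
  have hcell := eq_cell_of_normalized i (fun p => g.appTop.hom (D.c p)) (a := C.vec S k₁)
    (b := C.vec S v₁) (by rw [← C.form_eq, hk₁v₁]) (by rw [← C.form_dual, U.form_self])
    (by rw [← C.form_dual]; exact hk₁v₁) (fun x h => hg _) (fun x h => hg _)
  have hgv : ∀ x, g.appTop.hom (C.vec _ D.v x) = C.vec S v₁ x := fun x => by
    rw [D.vec_v, ← hcell.2]; exact map_cellVec _ _ _ _
  have hgk : ∀ x, g.appTop.hom (C.vec _ D.k x) = C.vec S k₁ x := fun x => by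
    rw [D.vec_k, ← hcell.1]; exact map_cellCovec _ _ _ _
  let γ' : Over.mk (g ≫ D.ρ) ⟶ Over.mk D.ρ := Over.homMk g
  have hgρ : g ≫ D.ρ = q' ≫ W.ι ≫ j := by
    have h1 : C.vec _ (γ' ≫ D.k) = C.vec S k₁ := funext fun x =>
      (C.vec_comp γ' D.k x).trans (hgk x)
    have h2 : C.vec _ (γ' ≫ D.v) = C.vec S v₁ := funext fun x =>
      (C.vec_comp γ' D.v x).trans (hgv x)
    refine C.hom_ext L _ _ ?_ (γ' ≫ D.k) (γ' ≫ D.v) k₁ v₁ h1 h2 ?_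
    · rw [Category.assoc, hgπ]; simp only [Category.assoc]
    · rw [h1, h2, ← C.form_eq, hk₁v₁]; exact isUnit_one
  let γ : S ⟶ Over.mk D.ρ := Over.homMk g hgρ
  have hγv : γ ≫ D.v = v₁ := C.vec_injective S (funext fun x => (C.vec_comp γ D.v x).trans (hgv x))
  have hw : g ≫ ρ' = q' ≫ W.ι := by
    rw [← cancel_mono j, Category.assoc, hρ', hgρ, Category.assoc]
  refine ⟨W, hx, L, g, q', ?_, Unit, inferInstance, _, hL⟩
  -- the parameter `z` is recovered as the pairing of the vector with `v₀`
  have key : ∀ (T : Scheme.{u}) (y : T ⟶ D.Y) (t : T ⟶ W.toScheme), y ≫ ρ' = t ≫ W.ι →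
      ∃! ℓ : T ⟶ L, ℓ ≫ g = y ∧ ℓ ≫ q' = t := by
    intro T y t hyt
    have hyt' : y ≫ D.ρ = t ≫ W.ι ≫ j := by
      rw [← hρ', ← Category.assoc, hyt, Category.assoc]
    let T₀ : Over R := Over.mk (y ≫ D.ρ)
    let t₀ : T₀ ⟶ res (Over.mk j) W := Over.homMk t hyt'.symm
    let y₀ : T₀ ⟶ Over.mk D.ρ := Over.homMk y
    let zT : Γ(T₀.left, ⊤) := U.form T₀ (y₀ ≫ D.v) (t₀ ≫ v₀)
    have hkv : U.form T₀ (C.dual (.inr i) T₀) (y₀ ≫ D.v) = 1 := by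
      rw [← C.comp_dual _ y₀, D.dual_eq_k, U.form_comp, D.form_k_v, _root_.map_one]
    have hkv₀ : U.form T₀ (C.dual (.inr i) T₀) (t₀ ≫ v₀) = 1 := by
      rw [C.form_dual, C.vec_comp, hv₀, _root_.map_one]
    have hyv : y₀ ≫ D.v = t₀ ≫ v₀ + zT • C.dual (.inr i) T₀ := by
      have := U.eq_of_form_eq_one hkv (t₀ ≫ v₀)
      rw [U.form_neg _ (y₀ ≫ D.v), U.form_neg _ (C.dual (.inr i) T₀), hkv₀] at this
      rw [this]
      simp only [zT]
      module
    obtain ⟨ℓ, hℓ, hℓz⟩ := hL.exists_hom t fun _ => zT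
    have hℓρ : ℓ ≫ g ≫ D.ρ = y ≫ D.ρ := by
      rw [hgρ, ← Category.assoc, hℓ, hyt']
    let ℓ₀ : T₀ ⟶ S := Over.homMk ℓ (by
      change ℓ ≫ q' ≫ W.ι ≫ j = y ≫ D.ρ
      rw [← hgρ, hℓρ])
    refine ⟨ℓ, ⟨?_, hℓ⟩, fun ℓ' hℓ' => ?_⟩
    · have hℓρ' : (ℓ ≫ g) ≫ D.ρ = y ≫ D.ρ := by rw [Category.assoc, hℓρ]
      refine D.hom_ext hℓρ' ?_
      have h1 : (Over.homMk (ℓ ≫ g) hℓρ' :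
          Over.mk (y ≫ D.ρ) ⟶ Over.mk D.ρ) = ℓ₀ ≫ γ := rfl
      have h2 : ℓ₀ ≫ m = t₀ := by ext1; exact hℓ
      rw [h1, Category.assoc, hγv, U.comp_add, U.comp_smul, C.comp_dual, ← Category.assoc, h2]
      refine Eq.trans ?_ hyv.symm
      congr 2
      exact hℓz ()
    · obtain ⟨hℓ'g, hℓ'q⟩ : ℓ' ≫ g = y ∧ ℓ' ≫ q' = t := hℓ'
      let ℓ₁ : T₀ ⟶ S := Over.homMk ℓ' (by
        change ℓ' ≫ q' ≫ W.ι ≫ j = y ≫ D.ρ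
        rw [← hgρ, ← Category.assoc, hℓ'g])
      have h1 : ℓ₁ ≫ γ = y₀ := by ext1; exact hℓ'g
      have h2 : ℓ₁ ≫ m = t₀ := by ext1; exact hℓ'q
      have h3 := U.form_comp ℓ₁ v₁ (m ≫ v₀)
      rw [hz, ← hγv, ← Category.assoc, ← Category.assoc, h1, h2] at h3
      exact hL.hom_ext (hℓ'q.trans hℓ.symm) fun _ => h3.symm.trans (hℓz ()).symm
  refine IsPullback.of_isLimit' ⟨hw⟩ (Limits.PullbackCone.IsLimit.mk _
    (fun s => (key s.pt s.fst s.snd s.condition).choose)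
    (fun s => (key s.pt s.fst s.snd s.condition).choose_spec.1.1)
    (fun s => (key s.pt s.fst s.snd s.condition).choose_spec.1.2)
    (fun s m h1 h2 => (key s.pt s.fst s.snd s.condition).choose_spec.2 m ⟨h1, h2⟩))

end Cell
end HPCoords

end

section

/-! ### Thom classes along sections -/

section Sections

variable {k : Scheme.{u}} {V : SchemeCategory k}

/-- The morphism to the total space of `E` given by a section of `E` over an `X`-scheme. -/
def sectionHom {Y X : Over k} (f : Y ⟶ X) {r : ℕ} {E : VectorBundle X.left r}
    (s : Over.mk f.left ⟶ E.total) : Y ⟶ totalOver X E :=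
  Over.homMk s.left (by
    change s.left ≫ E.total.hom ≫ X.hom = Y.hom
    rw [← Category.assoc, Over.w s]
    exact Over.w f)

lemma sectionHom_proj {Y X : Over k} (f : Y ⟶ X) {r : ℕ} {E : VectorBundle X.left r}
    (s : Over.mk f.left ⟶ E.total) : sectionHom f s ≫ projOver X E = f := by
  ext1
  exact Over.w s

/-- The zero section, as a closed subset of the total space over `k`. -/
def zeroSet (X : Over k) {r : ℕ} (E : VectorBundle X.left r) : Closeds (totalOver X E).left :=
  E.zeroLocus

lemma pair_preim_zeroSet {Y X : Over k} (hY : V.Mem Y) {r : ℕ} {E : VectorBundle X.left r}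
    (g : Y ⟶ totalOver X E) : V.Pair Y (preim g (zeroSet X E)) := by
  rw [SchemeCategory.pair_iff hY]
  have := V.compactSpace Y hY
  have : CompactSpace (Over.mk (g ≫ projOver X E).left).left := this
  exact E.isCompact_preimage_zeroLocus_compl (T := Over.mk (g ≫ projOver X E).left)
    (Over.homMk g.left)

lemma pair_zeroSet {X : Over k} (hX : V.Mem X) {r : ℕ} (E : VectorBundle X.left r) :
    V.Pair (totalOver X E) (zeroSet X E) := by
  have := pair_preim_zeroSet (VectorBundle.mem_totalOver V hX E) (𝟙 (totalOver X E))
  rwa [preim_id] at this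

lemma BundleHom.IsCartesian.preim_zeroSet {Y X : Over k} {f : Y ⟶ X} {r n : ℕ}
    {F : VectorBundle Y.left r} {E : VectorBundle X.left n} {h : BundleHom f.left F E}
    (hh : h.IsCartesian) : preim h.over (zeroSet X E) = zeroSet Y F := by
  refine le_antisymm hh.preimage_zeroLocus ?_
  rintro _ ⟨y, rfl⟩
  exact ⟨f.left y, by
    change (f.left ≫ E.zeroSection) y = h.left (F.zeroSection y)
    rw [← h.zeroSection_comp_left]
    rfl⟩

/-- The supports of Thom classes along sections which correspond under a base change agree. -/
lemma preim_preim_zeroSet {Y' Y X X' : Over k} {E : SymplecticBundle X.left 2}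
    {F : SymplecticBundle X'.left 2}
    {b : X' ⟶ X} {h : BundleHom b.left F.toVectorBundle E.toVectorBundle} (hc : h.IsCartesian)
    {f : Y' ⟶ Y} {g : Y ⟶ totalOver X E.toVectorBundle}
    {g' : Y' ⟶ totalOver X' F.toVectorBundle} (e : f ≫ g = g' ≫ h.over) :
    preim f (preim g (zeroSet X E.toVectorBundle)) = preim g' (zeroSet X' F.toVectorBundle) := by
  rw [← preim_comp, e, preim_comp, hc.preim_zeroSet]

end Sections

namespace SymplecticThomStructure

open CohomologyTheory RingCohomologyTheory

variable {k : Scheme.{u}} {V : SchemeCategory k} {A : RingCohomologyTheory.{u, w} V}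
  (Th : SymplecticThomStructure A)

/-- The Thom class `Th(E, φ)`, with its support written as a subset of the `k`-scheme `E`. -/
def thomClass (X : Over k) (E : SymplecticBundle X.left 2) :
    A.obj (totalOver X E.toVectorBundle) (zeroSet X E.toVectorBundle) := Th.thom X E

/-- The negative of the pullback of the Thom class of `E` along a morphism `g` to its total space.
With this sign it maps to the Pontryagin class of `E` when the support is forgotten. -/
def thomAlong {Y X : Over k} {E : SymplecticBundle X.left 2} (g : Y ⟶ totalOver X
    E.toVectorBundle) :
    A.obj Y (preim g (zeroSet X E.toVectorBundle)) :=
  - A.pull g (preim_subset _ _) (Th.thomClass X E)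

lemma pull_thomAlong_of_isCartesian {Y' Y X X' : Over k} (hY' : V.Mem Y') (hY : V.Mem Y)
    (hX : V.Mem X) (hX' : V.Mem X') {E : SymplecticBundle X.left 2} {F : SymplecticBundle X'.left 2}
    {b : X' ⟶ X} {h : BundleHom b.left F.toVectorBundle E.toVectorBundle} (hc : h.IsCartesian)
    (hi : h.IsIsometric) {f : Y' ⟶ Y} {g : Y ⟶ totalOver X E.toVectorBundle}
    {g' : Y' ⟶ totalOver X' F.toVectorBundle} (e : f ≫ g = g' ≫ h.over)
    (hs : f.left ⁻¹' (preim g (zeroSet X E.toVectorBundle) : Set Y.left) ⊆ preim g'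
      (zeroSet X' F.toVectorBundle)) :
    A.pull f hs (Th.thomAlong g) = Th.thomAlong g' := by
  have hh : h.over.left ⁻¹' (zeroSet X E.toVectorBundle : Set (totalOver X E.toVectorBundle).left) ⊆
      zeroSet X' F.toVectorBundle := hc.preimage_zeroLocus
  have hn : A.pull h.over hh (Th.thomClass X E) = Th.thomClass X' F :=
    Th.natural b F E hX' hX h hc hi
  rw [thomAlong, map_neg, pull_square e (pair_zeroSet hX _) (pair_preim_zeroSet hY g)
    (pair_zeroSet hX' _) (pair_preim_zeroSet hY' g') _ _ hh (preim_subset _ _), hn]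
  rfl

/-- Homotopy invariance: all sections of `E` pull the Thom class back to the same class in
`A(X)`. -/
lemma ext_thomAlong {Y X : Over k} (hY : V.Mem Y) (hX : V.Mem X) {E : SymplecticBundle X.left 2}
    (g : Y ⟶ totalOver X E.toVectorBundle) :
    A.ext le_top (Th.thomAlong g) =
      A.pullTop (g ≫ projOver X E.toVectorBundle) (Th.pontryagin X E) := by
  have hE := VectorBundle.mem_totalOver V hX E.toVectorBundle
  have h0 : zeroOver X E.toVectorBundle ≫ projOver X E.toVectorBundle = 𝟙 X := by
    ext1
    exact E.zeroSection_comp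
  obtain ⟨b, hb⟩ := (pullTop_bijective_of_isLocallyAffineSpace
    (A := A) (projOver X E.toVectorBundle) E.isLocallyAffineSpace hE hX).2
      (A.ext le_top (Th.thomClass X E))
  have h1 : Th.pontryagin X E = - b := by
    change - A.pullTop (zeroOver X E.toVectorBundle) (A.ext le_top (Th.thomClass X E)) = _
    rw [← hb, pullTop_pullTop _ _ hX hE hX]
    exact congrArg _ (pull_eq_self h0 (SchemeCategory.pair_top hX) _ b)
  rw [h1, thomAlong, map_neg, map_neg, ← pullTop_pullTop _ _ hX hE hY, hb,
    ext_pull _ (pair_zeroSet hX _) (pair_preim_zeroSet hY g) (SchemeCategory.pair_top hY)]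
  exact congrArg _ (pull_ext g (pair_zeroSet hX _) (SchemeCategory.pair_top hE)
    (SchemeCategory.pair_top hY) _ _ _).symm

/-- Pontryagin classes are natural. -/
lemma pullTop_pontryagin {Y X : Over k} (hY : V.Mem Y) (hX : V.Mem X) {f : Y ⟶ X}
    {F : SymplecticBundle Y.left 2} {E : SymplecticBundle X.left 2}
    {h : BundleHom f.left F.toVectorBundle E.toVectorBundle} (hc : h.IsCartesian)
    (hi : h.IsIsometric) : A.pullTop f (Th.pontryagin X E) = Th.pontryagin Y F := by
  have hF := VectorBundle.mem_totalOver V hY F.toVectorBundle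
  have h0 : zeroOver Y F.toVectorBundle ≫ projOver Y F.toVectorBundle = 𝟙 Y := by
    ext1
    exact F.zeroSection_comp
  have e : zeroOver Y F.toVectorBundle ≫ h.over = f ≫ zeroOver X E.toVectorBundle := by
    ext1
    exact h.zeroSection_comp_left
  have h1 := Th.ext_thomAlong hY hX (f ≫ zeroOver X E.toVectorBundle)
  have h2 := Th.ext_thomAlong hY hY (zeroOver Y F.toVectorBundle)
  have e1 : (f ≫ zeroOver X E.toVectorBundle) ≫ projOver X E.toVectorBundle = f := by
    ext1
    change (f.left ≫ E.zeroSection) ≫ E.total.hom = f.left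
    rw [Category.assoc, E.zeroSection_comp, Category.comp_id]
  have h3 : A.pullTop (zeroOver Y F.toVectorBundle ≫ projOver Y F.toVectorBundle)
      (Th.pontryagin Y F) = Th.pontryagin Y F := pull_eq_self h0 (SchemeCategory.pair_top hY) _ _
  have h4 : A.pullTop ((f ≫ zeroOver X E.toVectorBundle) ≫ projOver X E.toVectorBundle)
      (Th.pontryagin X E) = A.pullTop f (Th.pontryagin X E) := A.pull_congr e1 _ _ _
  rw [← h4, ← h3, ← h1, ← h2]
  have e' : 𝟙 Y ≫ f ≫ zeroOver X E.toVectorBundle = zeroOver Y F.toVectorBundle ≫ h.over := by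
    rw [Category.id_comp, e]
  have hs : (𝟙 Y : Y ⟶ Y).left ⁻¹' (preim (f ≫ zeroOver X E.toVectorBundle)
    (zeroSet X E.toVectorBundle) :
      Set Y.left) ⊆ preim (zeroOver Y F.toVectorBundle) (zeroSet Y F.toVectorBundle) := by
    exact (preim_preim_zeroSet hc e').le
  have h5 := Th.pull_thomAlong_of_isCartesian hY hY hX hY hc hi e' hs
  rw [← h5]
  have := ext_pull (A := A.toCohomologyTheory) (𝟙 Y) (pair_preim_zeroSet hY
    (f ≫ zeroOver X E.toVectorBundle))
    (pair_preim_zeroSet hY (zeroOver Y F.toVectorBundle)) (SchemeCategory.pair_top hY) le_top hs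
    (Th.thomAlong (f ≫ zeroOver X E.toVectorBundle))
  exact this.symm

end SymplecticThomStructure

/-! ### Coordinate classes -/

section CoordinateClasses

open QuatProj.VectorBundle

variable {k : Scheme.{u}} {V : SchemeCategory k}

/-- The section of `Hyp(𝒪_X)` with coordinates `a, b`. -/
def hypSection {X : Scheme.{u}} (T : Over X) (a b : Γ(T.left, ⊤)) :
    T ⟶ (SymplecticBundle.hyp X).total :=
  (coords T).symm ![a, b]

lemma hypSection_form {X : Scheme.{u}} (T : Over X) (a b c d : Γ(T.left, ⊤)) :
    (SymplecticBundle.hyp X).form T (hypSection T a b) (hypSection T c d) = b * c - a * d := by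
  refine (SymplecticBundle.hyp_form _ _).trans ?_
  unfold hypSection
  rw [LinearEquiv.apply_symm_apply, LinearEquiv.apply_symm_apply]
  rfl

lemma comp_hypSection {X : Scheme.{u}} {T' T : Over X} (g : T' ⟶ T) (a b : Γ(T.left, ⊤)) :
    g ≫ hypSection T a b = hypSection T' (g.left.appTop.hom a) (g.left.appTop.hom b) := by
  refine (coords_symm_comp g ![a, b]).trans ?_
  unfold hypSection
  congr 1
  funext i
  fin_cases i <;> rfl

lemma hypSection_eq {X : Scheme.{u}} (T : Over X) (a b : Γ(T.left, ⊤)) :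
    a • hypSection T 1 0 + b • hypSection T 0 1 = hypSection T a b := by
  have h : a • (coords (X := X) T).symm ![1, 0] + b • (coords T).symm ![0, 1] =
      (coords T).symm ![a, b] := by
    rw [← LinearEquiv.map_smul, ← LinearEquiv.map_smul, ← LinearEquiv.map_add]
    congr 1
    funext i
    fin_cases i <;> simp
  exact h

lemma isIsometric_of_form_eq_neg_one {Y X : Scheme.{u}} {f : Y ⟶ X} {E : SymplecticBundle X 2}
    {w : Fin 2 → (Over.mk f ⟶ E.total)} (hw : E.form _ (w 0) (w 1) = -1) :
    BundleHom.IsIsometric (F := SymplecticBundle.hyp Y)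
      (homOfSections (E := E.toVectorBundle) w) := by
  intro T s t
  refine (form_homOfSections_push w T s t).trans ?_
  rw [hw, _root_.map_neg, _root_.map_one, mul_neg, mul_one, SymplecticBundle.hyp_form]
  exact neg_sub _ _

lemma isCartesian_of_form_eq_neg_one {Y X : Scheme.{u}} {f : Y ⟶ X} {E : SymplecticBundle X 2}
    {a b : Over.mk f ⟶ E.total} (hw : E.form _ a b = -1) :
    (homOfSections (E := E.toVectorBundle) ![a, b]).IsCartesian :=
  homOfSections_isCartesian (E.isFrame_pair (by rw [hw]; exact isUnit_one.neg))

lemma hypSection_homOfSections {Y X : Scheme.{u}} {f : Y ⟶ X} {E : SymplecticBundle X 2}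
    (w : Fin 2 → (Over.mk f ⟶ E.total)) (a b : Γ(Y, ⊤)) :
    (hypSection (Over.mk (𝟙 Y)) a b).left ≫ (homOfSections (E := E.toVectorBundle) w).left =
      ((show Γ((Over.mk f).left, ⊤) from a) • w 0 +
        (show Γ((Over.mk f).left, ⊤) from b) • w 1).left := by
  let s : Over.mk (𝟙 Y) ⟶ (VectorBundle.trivial Y 2).total := (coords (Over.mk (𝟙 Y))).symm ![a, b]
  have hs : coords _ s = ![a, b] := LinearEquiv.apply_symm_apply _ _
  have h := homOfSections_push (E := E.toVectorBundle) w (Over.mk (𝟙 Y)) s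
  let θ : Over.mk f ⟶ (Over.map f).obj (Over.mk (𝟙 Y)) := Over.homMk (𝟙 Y) (by
    change 𝟙 Y ≫ 𝟙 Y ≫ f = f
    simp)
  have hθ : ∀ l, θ ≫ toBase f (Over.mk (𝟙 Y)) ≫ w l = w l := fun l => by
    have : θ ≫ toBase f (Over.mk (𝟙 Y)) = 𝟙 _ := by
      ext1
      exact Category.comp_id _
    rw [← Category.assoc, this, Category.id_comp]
  have hθ' : ∀ c : Γ(Y, ⊤), θ.left.appTop.hom c = c := appTop_id
  have h' := congrArg (fun t => θ ≫ t) h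
  simp only [Fin.sum_univ_two] at h'
  have h'' := congrArg (fun t => t.left) h'
  refine Eq.trans ?_ (h''.trans ?_)
  · change _ = 𝟙 Y ≫ s.left ≫ _
    rw [Category.id_comp]
    rfl
  · congr 1
    have h0 : θ.left.appTop.hom (coords (Over.mk (𝟙 Y)) s 0) = a := (hθ' _).trans (congrFun hs 0)
    have h1 : θ.left.appTop.hom (coords (Over.mk (𝟙 Y)) s 1) = b := (hθ' _).trans (congrFun hs 1)
    exact congrArg₂ (fun (c d : Γ((Over.mk f).left, ⊤)) => c • w 0 + d • w 1) h0 h1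

/-- The base change morphism `Hyp(𝒪_Y) ⟶ Hyp(𝒪_X)`. -/
def hypBaseChange {Y X : Scheme.{u}} (f : Y ⟶ X) :
    BundleHom f (SymplecticBundle.hyp Y).toVectorBundle (SymplecticBundle.hyp X).toVectorBundle :=
  homOfSections (E := (SymplecticBundle.hyp X).toVectorBundle)
    ![hypSection (Over.mk f) 1 0, hypSection (Over.mk f) 0 1]

lemma hypBaseChange_form {Y X : Scheme.{u}} (f : Y ⟶ X) : (SymplecticBundle.hyp X).form (Over.mk f)
    (hypSection (Over.mk f) 1 0) (hypSection (Over.mk f) 0 1) = -1 := by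
  rw [hypSection_form]
  simp

lemma hypBaseChange_isIsometric {Y X : Scheme.{u}} (f : Y ⟶ X) :
    BundleHom.IsIsometric (F := SymplecticBundle.hyp Y) (E := SymplecticBundle.hyp X)
      (hypBaseChange f) :=
  isIsometric_of_form_eq_neg_one (hypBaseChange_form f)

lemma hypBaseChange_isCartesian {Y X : Scheme.{u}} (f : Y ⟶ X) : (hypBaseChange f).IsCartesian :=
  isCartesian_of_form_eq_neg_one (hypBaseChange_form f)

lemma hypSection_hypBaseChange {Y X : Scheme.{u}} (f : Y ⟶ X) (a b : Γ(Y, ⊤)) :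
    (hypSection (Over.mk (𝟙 Y)) a b).left ≫ (hypBaseChange f).left =
      (hypSection (Over.mk f) a b).left := by
  refine (hypSection_homOfSections (E := SymplecticBundle.hyp X) _ a b).trans ?_
  exact congrArg (fun t => t.left) (hypSection_eq (Over.mk f) a b)

/-- The morphism `Y ⟶ Hyp(𝒪_Y)` with coordinates `a, b`. -/
def hypHom (Y : Over k) (a b : Γ(Y.left, ⊤)) :
    Y ⟶ totalOver Y (SymplecticBundle.hyp Y.left).toVectorBundle :=
  sectionHom (𝟙 Y) (hypSection (Over.mk (𝟙 Y.left)) a b)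

lemma comp_hypHom {Y' Y : Over k} (g : Y' ⟶ Y) (a b : Γ(Y.left, ⊤)) :
    g ≫ hypHom Y a b = hypHom Y' (g.left.appTop.hom a) (g.left.appTop.hom b) ≫
      (hypBaseChange g.left).over := by
  ext1
  have h := comp_hypSection (Over.homMk g.left : Over.mk g.left ⟶ Over.mk (𝟙 Y.left)) a b
  exact (congrArg (fun s => s.left) h).trans (hypSection_hypBaseChange g.left _ _).symm

/-- The common zeros of two functions. -/
def common (Y : Over k) (a b : Γ(Y.left, ⊤)) : Closeds Y.left :=
  preim (hypHom Y a b) (zeroSet Y (SymplecticBundle.hyp Y.left).toVectorBundle)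

lemma pair_common {Y : Over k} (hY : V.Mem Y) (a b : Γ(Y.left, ⊤)) : V.Pair Y (common Y a b) :=
  pair_preim_zeroSet hY _

lemma preim_common {Y' Y : Over k} (g : Y' ⟶ Y) (a b : Γ(Y.left, ⊤)) :
    preim g (common Y a b) = common Y' (g.left.appTop.hom a) (g.left.appTop.hom b) :=
  preim_preim_zeroSet (E := SymplecticBundle.hyp Y.left) (F := SymplecticBundle.hyp Y'.left)
    (hypBaseChange_isCartesian g.left) (comp_hypHom g a b)

variable {A : RingCohomologyTheory.{u, w} V} (Th : SymplecticThomStructure A)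

/-- The class supported on the common zeros of two functions which is the pullback of the Thom
class of the trivial bundle. -/
def coordClass (Y : Over k) (a b : Γ(Y.left, ⊤)) : A.obj Y (common Y a b) :=
  Th.thomAlong (E := SymplecticBundle.hyp Y.left) (hypHom Y a b)

lemma pull_coordClass {Y' Y : Over k} (hY' : V.Mem Y') (hY : V.Mem Y) (g : Y' ⟶ Y)
    (a b : Γ(Y.left, ⊤)) {a' b' : Γ(Y'.left, ⊤)} (ha : g.left.appTop.hom a = a')
    (hb : g.left.appTop.hom b = b')
    (h : g.left ⁻¹' (common Y a b : Set Y.left) ⊆ common Y' a' b') :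
    A.pull g h (coordClass Th Y a b) = coordClass Th Y' a' b' := by
  subst ha hb
  exact Th.pull_thomAlong_of_isCartesian hY' hY hY hY' (hypBaseChange_isCartesian g.left)
    (hypBaseChange_isIsometric g.left) (comp_hypHom g a b) h

end CoordinateClasses

end

section

/-! ### Products with a supported class -/

/-- The intersection of the first `r` members of a family of closed subsets. -/
def iterInf {α : Type*} [TopologicalSpace α] (N : ℕ → Closeds α) : ℕ → Closeds α
  | 0 => ⊤
  | r + 1 => iterInf N r ⊓ N r

lemma iterInf_succ_le {α : Type*} [TopologicalSpace α] (N : ℕ → Closeds α) (r : ℕ) :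
    iterInf N (r + 1) ≤ iterInf N r := inf_le_left

section

variable {k : Scheme.{u}} {V : SchemeCategory k}

lemma preim_iterInf {Y' Y : Over k} (f : Y' ⟶ Y) {N : ℕ → Closeds Y.left}
    {N' : ℕ → Closeds Y'.left} {r : ℕ} (h : ∀ m < r, preim f (N m) = N' m) :
    preim f (iterInf N r) = iterInf N' r := by
  induction r with
  | zero => rfl
  | succ r ih =>
    change preim f (iterInf N r) ⊓ preim f (N r) = iterInf N' r ⊓ N' r
    rw [ih fun m hm => h m (by omega), h r (by omega)]

lemma pair_iterInf {Y : Over k} (hY : V.Mem Y) {N : ℕ → Closeds Y.left} {r : ℕ}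
    (h : ∀ m < r, V.Pair Y (N m)) : V.Pair Y (iterInf N r) := by
  induction r with
  | zero => exact SchemeCategory.pair_top hY
  | succ r ih => exact (ih fun m hm => h m (by omega)).inf (h r (by omega))

end

namespace RingCohomologyTheory

open CohomologyTheory SchemeCategory

variable {k : Scheme.{u}} {V : SchemeCategory k} (A : RingCohomologyTheory.{u, w} V)

/-- For `q : Y ⟶ X` and `τ ∈ A_M(Y)` the map `A_Z(X) ⟶ A_K(Y)`, `a ↦ q^A(a) ∪ τ`, where
`q⁻¹(Z) ∩ M ⊆ K`. -/
def mulMap {Y X : Over k} (q : Y ⟶ X) (Z : Closeds X.left) {M K : Closeds Y.left} (τ : A.obj Y M)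
    (h : preim q Z ⊓ M ≤ K) : A.obj X Z →+ A.obj Y K :=
  ((A.mul h).flip τ).comp (A.pull q (preim_subset q Z))

lemma mulMap_apply {Y X : Over k} (q : Y ⟶ X) (Z : Closeds X.left) {M K : Closeds Y.left}
    (τ : A.obj Y M) (h : preim q Z ⊓ M ≤ K) (a : A.obj X Z) :
    A.mulMap q Z τ h a = A.mul h (A.pull q (preim_subset q Z) a) τ := rfl

/-- The product `t 0 ∪ ⋯ ∪ t (r - 1)`. -/
def prodCls {Y : Over k} {N : ℕ → Closeds Y.left} (t : ∀ m, A.obj Y (N m)) :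
    ∀ r, A.obj Y (iterInf N r)
  | 0 => A.unit Y
  | r + 1 => A.mul le_rfl (prodCls t r) (t r)

variable {A}

lemma pull_mulMap {Y' Y X : Over k} {f : Y' ⟶ Y} {q : Y ⟶ X} {q' : Y' ⟶ X} (e : f ≫ q = q')
    {Z : Closeds X.left} {M K : Closeds Y.left} {M' K' : Closeds Y'.left} (pZ : V.Pair X Z)
    (pM : V.Pair Y M) (pK : V.Pair Y K) (pM' : V.Pair Y' M') (pK' : V.Pair Y' K')
    (hM : f.left ⁻¹' (M : Set Y.left) ⊆ M') (hK : f.left ⁻¹' (K : Set Y.left) ⊆ K')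
    (τ : A.obj Y M) (h : preim q Z ⊓ M ≤ K) (h' : preim q' Z ⊓ M' ≤ K') (a : A.obj X Z) :
    A.pull f hK (A.mulMap q Z τ h a) = A.mulMap q' Z (A.pull f hM τ) h' a := by
  subst e
  have hZ : f.left ⁻¹' (preim q Z : Set Y.left) ⊆ preim (f ≫ q) Z := by
    rw [preim_comp]; exact preim_subset _ _
  have pY' := pZ.preim (f ≫ q) pM'.1
  rw [mulMap_apply, mulMap_apply, pull_mul f (pZ.preim q pM.1) pM pK pY' pM' pK' hZ hM hK h h',
    pull_pull f q pZ (pZ.preim q pM.1) pY']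

lemma mulMap_mulMap {Y Y₁ X : Over k} {r : Y ⟶ Y₁} {q₁ : Y₁ ⟶ X} {q : Y ⟶ X} (e : r ≫ q₁ = q)
    {Z : Closeds X.left} {M₁ K₁ : Closeds Y₁.left} {M₁' M L K : Closeds Y.left} (pZ : V.Pair X Z)
    (pM₁ : V.Pair Y₁ M₁) (pK₁ : V.Pair Y₁ K₁) (pM₁' : V.Pair Y M₁') (pM : V.Pair Y M)
    (pL : V.Pair Y L) (pK : V.Pair Y K)
    (τ₁ : A.obj Y₁ M₁) (τ : A.obj Y M) (h₁ : preim q₁ Z ⊓ M₁ ≤ K₁) (h : preim r K₁ ⊓ M ≤ K)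
    (hM₁ : r.left ⁻¹' (M₁ : Set Y₁.left) ⊆ M₁') (h₁' : preim q Z ⊓ M₁' ≤ preim r K₁)
    (hL : M₁' ⊓ M ≤ L) (h' : preim q Z ⊓ L ≤ K) (a : A.obj X Z) :
    A.mulMap r K₁ τ h (A.mulMap q₁ Z τ₁ h₁ a) =
      A.mulMap q Z (A.mul hL (A.pull r hM₁ τ₁) τ) h' a := by
  rw [mulMap_apply, pull_mulMap e pZ pM₁ pK₁ pM₁' (pK₁.preim r pM.1) hM₁ _ τ₁ h₁ h₁', mulMap_apply,
    mulMap_apply]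
  exact mul_assoc (pZ.preim q pM.1) pM₁' pM (pK₁.preim r pM.1) pL pK _ _ _ _ _ _ _

lemma mulMap_bijective_congr {Y X : Over k} {q : Y ⟶ X} {Z : Closeds X.left}
    {M K K' : Closeds Y.left} {τ : A.obj Y M} {h : preim q Z ⊓ M ≤ K} (e : K = K')
    (h' : preim q Z ⊓ M ≤ K') (hb : Function.Bijective (A.mulMap q Z τ h)) :
    Function.Bijective (A.mulMap q Z τ h') := by
  subst e
  exact hb

lemma pull_prodCls {Y' Y : Over k} (hY : V.Mem Y) (hY' : V.Mem Y') (f : Y' ⟶ Y)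
    {N : ℕ → Closeds Y.left} {N' : ℕ → Closeds Y'.left} (t : ∀ m, A.obj Y (N m))
    (t' : ∀ m, A.obj Y' (N' m)) (r : ℕ) (p : ∀ m < r, V.Pair Y (N m))
    (p' : ∀ m < r, V.Pair Y' (N' m))
    (hN : ∀ m < r, f.left ⁻¹' (N m : Set Y.left) ⊆ N' m)
    (ht : ∀ m (hm : m < r), A.pull f (hN m hm) (t m) = t' m)
    (h : f.left ⁻¹' (iterInf N r : Set Y.left) ⊆ iterInf N' r) :
    A.pull f h (A.prodCls t r) = A.prodCls t' r := by
  induction r with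
  | zero => exact pullTop_unit f hY hY'
  | succ r ih =>
    have h₁ : f.left ⁻¹' (iterInf N r : Set Y.left) ⊆ iterInf N' r := by
      clear ih h ht p p'
      induction r with
      | zero => exact subset_top _
      | succ r ih => exact fun x hx => ⟨ih (fun m hm => hN m (by omega)) hx.1, hN r (by omega) hx.2⟩
    have ih' := ih (fun m hm => p m (by omega)) (fun m hm => p' m (by omega))
      (fun m hm => hN m (by omega)) (fun m hm => ht m (by omega)) h₁
    have q₁ := pair_iterInf hY fun m (hm : m < r) => p m (by omega)
    have q₁' := pair_iterInf hY' fun m (hm : m < r) => p' m (by omega)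
    have := pull_mul f q₁ (p r (by omega)) (pair_iterInf hY p) q₁' (p' r (by omega))
      (pair_iterInf hY' p') h₁ (hN r (by omega)) h le_rfl le_rfl (A.prodCls t r) (t r)
    refine this.trans ?_
    rw [ih', ht r (by omega)]
    rfl

end RingCohomologyTheory

/-! ### Thom isomorphisms for trivial bundles -/

open CohomologyTheory RingCohomologyTheory SchemeCategory

variable {k : Scheme.{u}} {V : SchemeCategory k} {A : RingCohomologyTheory.{u, w} V}
  (Th : SymplecticThomStructure A)

/-- The Thom isomorphism `A_Z(X) ≅ A_{Z × 0}(X × 𝔸²)` holds. -/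
def ThomIso (X : Over k) (Z : Closeds X.left) : Prop :=
  ∀ (Y : Over k) (q : Y ⟶ X) (a b : Γ(Y.left, ⊤)), IsAffineSpace q.left ![a, b] →
    Function.Bijective (A.mulMap q Z (coordClass Th Y a b) le_rfl)

lemma hyp_isTrivial (X : Scheme.{u}) : (SymplecticBundle.hyp X).IsTrivial 1 := by
  let H := SymplecticBundle.hyp X
  let w : Fin 2 → (Over.mk (𝟙 X) ⟶ H.total) :=
    ![hypSection (Over.mk (𝟙 X)) 1 0, hypSection (Over.mk (𝟙 X)) 0 1]
  have hw : H.IsFrame w := H.isFrame_pair (by rw [hypBaseChange_form]; exact isUnit_one.neg)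
  have h01 : H.form _ (w 0) (w 1) = -1 := hypBaseChange_form _
  have h10 : H.form _ (w 1) (w 0) = 1 := by rw [H.form_neg, h01, neg_neg]
  let ε : Fin 1 ⊕ Fin 1 ≃ Fin 2 := finSumFinEquiv
  have e0 : ε (.inl 0) = 0 := rfl
  have e1 : ε (.inr 0) = 1 := rfl
  have j01 : Matrix.J (Fin 1) Γ(X, ⊤) (.inl 0) (.inr 0) = -1 := by simp [Matrix.J]
  have j10 : Matrix.J (Fin 1) Γ(X, ⊤) (.inr 0) (.inl 0) = 1 := by simp [Matrix.J]
  have j00 : Matrix.J (Fin 1) Γ(X, ⊤) (.inl 0) (.inl 0) = 0 := by simp [Matrix.J]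
  have j11 : Matrix.J (Fin 1) Γ(X, ⊤) (.inr 0) (.inr 0) = 0 := by simp [Matrix.J]
  refine ⟨fun i => w (ε i), hw.reindex ε, fun i j => ?_⟩
  rcases i with i | i <;> rcases j with j | j <;> obtain rfl := Subsingleton.elim i 0 <;>
    obtain rfl := Subsingleton.elim j 0
  · exact (H.form_self _ _).trans j00.symm
  · refine Eq.trans ?_ (h01.trans j01.symm)
    change H.form _ (w (ε (.inl 0))) (w (ε (.inr 0))) = _
    rw [e0, e1]
  · refine Eq.trans ?_ (h10.trans j10.symm)
    change H.form _ (w (ε (.inr 0))) (w (ε (.inl 0))) = _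
    rw [e0, e1]
  · exact (H.form_self _ _).trans j11.symm

/-- The Thom isomorphism without supports is the nondegeneracy axiom, as `coordClass` is the Thom
class of the trivial bundle up to a sign. -/
lemma thomIso_top {X : Over k} (hX : V.Mem X) : ThomIso Th X ⊤ := by
  intro Y q a b hq
  have hY : V.Mem Y := hq.mem q hX
  let H := SymplecticBundle.hyp X.left
  let L := totalOver X H.toVectorBundle
  let s := hypSection (Over.mk q.left) a b
  let e : Y ⟶ L := sectionHom q s
  have hL : V.Mem L := VectorBundle.mem_totalOver V hX _
  have he : hypHom Y a b ≫ (hypBaseChange q.left).over = e := by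
    ext1
    exact hypSection_hypBaseChange q.left a b
  have hq' : e ≫ projOver X H.toVectorBundle = q := sectionHom_proj q s
  have hT := VectorBundle.isAffineSpace_trivial X.left 2
  obtain ⟨f, hf, hfq, hfc⟩ := hq.exists_iso hT
  have hef : e.left = f := by
    refine hT.hom_ext ?_ fun i => ?_
    · exact (Over.w s).trans hfq.symm
    · rw [hfc]
      have h2 := VectorBundle.coords_comp ((VectorBundle.coords (Over.mk q.left)).symm ![a, b])
        (𝟙 (VectorBundle.trivial X.left 2).total) i
      rw [Category.comp_id, LinearEquiv.apply_symm_apply] at h2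
      exact h2.symm
  have hei : IsIso e := over_isIso e (h := by rw [hef]; exact hf)
  have pL := pair_zeroSet hX H.toVectorBundle
  have pH := pair_zeroSet hY (SymplecticBundle.hyp Y.left).toVectorBundle
  have pC := pair_common hY a b
  have hce : preim e (zeroSet X H.toVectorBundle) = common Y a b := by
    rw [← he, preim_comp, (hypBaseChange_isCartesian q.left).preim_zeroSet]
    rfl
  have hs : e.left ⁻¹' (zeroSet X H.toVectorBundle : Set L.left) ⊆ common Y a b := hce.le
  have hcl : coordClass Th Y a b = - A.pull e hs (Th.thomClass X H) := by
    have hh : (hypBaseChange q.left).over.left ⁻¹' (zeroSet X H.toVectorBundle : Set L.left) ⊆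
        zeroSet Y (SymplecticBundle.hyp Y.left).toVectorBundle :=
      (hypBaseChange_isCartesian q.left).preimage_zeroLocus
    have hn : A.pull _ hh (Th.thomClass X H) = Th.thomClass Y (SymplecticBundle.hyp Y.left) :=
      Th.natural q _ _ hY hX _ (hypBaseChange_isCartesian q.left)
        (hypBaseChange_isIsometric q.left)
    rw [coordClass, SymplecticThomStructure.thomAlong, ← hn]
    exact congrArg Neg.neg ((pull_pull (hypHom Y a b) (hypBaseChange q.left).over pL pH pC hh
      (preim_subset _ _) _).trans (A.pull_congr he _ _ _))
  have h1 : Function.Bijective fun a' : A.obj X ⊤ =>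
    A.lact (A.pullTop (projOver X H.toVectorBundle) a') (Th.thomClass X H) :=
      Th.nondegenerate X H hX (hyp_isTrivial _)
  have h2 := pull_bijective_of_isIso (A := A.toCohomologyTheory) e pL hce hs
  have h3 : Function.Bijective (A.mulMap q ⊤ (coordClass Th Y a b)
      (K := common Y a b) inf_le_right) := by
    refine bijective_of_eq (((AddEquiv.neg _).bijective.comp h2).comp h1) fun a' => ?_
    have pLt := SchemeCategory.pair_top hL
    have pYt := SchemeCategory.pair_top hY
    have h4 : A.pull e hs (A.lact (A.pullTop (projOver X H.toVectorBundle) a')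
        (Th.thomClass X H)) = _ :=
      pull_mul e pLt pL pL pYt pC pC (subset_top _) hs hs inf_le_right inf_le_right _ _
    have h5 : A.pullTop e (A.pullTop (projOver X H.toVectorBundle) a') = A.pullTop q a' := by
      rw [pullTop_pullTop _ _ hX hL hY]
      exact A.pull_congr hq' _ _ _
    rw [mulMap_apply, hcl, _root_.map_neg]
    refine congrArg Neg.neg ?_
    refine Eq.trans ?_ h4.symm
    exact congrArg (fun t => A.mul inf_le_right t (A.pull e hs (Th.thomClass X H))) h5.symm
  exact mulMap_bijective_congr (inf_eq_right.2 le_top).symm _ h3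

/-- Iterated Thom isomorphism for `r` disjoint pairs of coordinates. In the induction the last pair
is split off, so the Thom isomorphism is applied at the support of the product of the other classes,
which is proper only if `2 ≤ r`. -/
lemma prodCls_bijective {X : Over k} (hX : V.Mem X) (r : ℕ)
    (hT : ∀ (Y₁ : Over k) (q₁ : Y₁ ⟶ X) (κ : Type) [Finite κ] (d : κ → Γ(Y₁.left, ⊤)),
      IsAffineSpace q₁.left d → ∀ Z, V.Pair Y₁ Z → Z = ⊤ ∨ 2 ≤ r → ThomIso Th Y₁ Z)
    {Y : Over k} (q : Y ⟶ X) {ι : Type} [Finite ι] {c : ι → Γ(Y.left, ⊤)}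
    (hc : IsAffineSpace q.left c) (a b : ℕ → Γ(Y.left, ⊤)) (α β : Fin r → ι)
    (hαβ : Function.Injective (Sum.elim α β)) (ha : ∀ m : Fin r, a m = c (α m))
    (hb : ∀ m : Fin r, b m = c (β m)) :
    Function.Bijective (A.mulMap q ⊤ (A.prodCls (fun m => coordClass Th Y (a m) (b m)) r)
      (K := iterInf (fun m => common Y (a m) (b m)) r) inf_le_right) := by
  classical
  induction r generalizing Y ι with
  | zero =>
    have hY : V.Mem Y := hc.mem q hX
    have pY := SchemeCategory.pair_top hY
    refine bijective_of_eq (pullTop_bijective_of_isAffineSpace (A := A.toCohomologyTheory) q hc hX)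
      fun a' => ?_
    rw [mulMap_apply]
    exact (mul_unit pY pY inf_le_left (A.pull q (preim_subset q ⊤) a')).trans (ext_self pY _ _)
  | succ r ih =>
    have hY : V.Mem Y := hc.mem q hX
    let i₀ := α (Fin.last r)
    let i₁ := β (Fin.last r)
    have h01 : i₀ ≠ i₁ := fun h => by
      have := @hαβ (.inl (Fin.last r)) (.inr (Fin.last r)) h
      simp at this
    let p : ι → Prop := fun i => i ≠ i₀ ∧ i ≠ i₁
    have h₁ := isAffineSpace_affineSpace X.left {i // p i}
    obtain ⟨g, hg, hgc, hga⟩ := hc.exists_split p h₁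
    let Y₁ : Over k := Over.mk ((𝔸(ULift.{u} {i // p i}; X.left) ↘ X.left) ≫ X.hom)
    let q₁ : Y₁ ⟶ X := Over.homMk (𝔸(ULift.{u} {i // p i}; X.left) ↘ X.left)
    have hg' : g ≫ Y₁.hom = Y.hom := by
      change g ≫ _ ≫ X.hom = _
      rw [← Category.assoc, hg, Over.w]
    let g' : Y ⟶ Y₁ := Over.homMk g hg'
    have e : g' ≫ q₁ = q := by ext1; exact hg
    have hY₁ : V.Mem Y₁ := IsAffineSpace.mem q₁ h₁ hX
    let c₁ : {i // p i} → Γ(Y₁.left, ⊤) := fun i => AffineSpace.coord X.left (ULift.up i)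
    have hα : ∀ m : Fin r, p (α m.castSucc) := fun m => ⟨fun h => by
      have := @hαβ (.inl m.castSucc) (.inl (Fin.last r)) h
      simp [Fin.castSucc_ne_last] at this, fun h => by
      have := @hαβ (.inl m.castSucc) (.inr (Fin.last r)) h
      simp at this⟩
    have hβ : ∀ m : Fin r, p (β m.castSucc) := fun m => ⟨fun h => by
      have := @hαβ (.inr m.castSucc) (.inl (Fin.last r)) h
      simp at this, fun h => by
      have := @hαβ (.inr m.castSucc) (.inr (Fin.last r)) h
      simp [Fin.castSucc_ne_last] at this⟩
    let α₁ : Fin r → {i // p i} := fun m => ⟨α m.castSucc, hα m⟩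
    let β₁ : Fin r → {i // p i} := fun m => ⟨β m.castSucc, hβ m⟩
    -- only the values at `m < r` matter
    let a₁ : ℕ → Γ(Y₁.left, ⊤) := fun m => if h : m < r then c₁ (α₁ ⟨m, h⟩) else 0
    let b₁ : ℕ → Γ(Y₁.left, ⊤) := fun m => if h : m < r then c₁ (β₁ ⟨m, h⟩) else 0
    have hi₁ : Function.Injective (Sum.elim α₁ β₁) := by
      intro x y hxy
      rcases x with x | x <;> rcases y with y | y
      · have := @hαβ (.inl x.castSucc) (.inl y.castSucc) (congrArg Subtype.val hxy)
        simpa using this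
      · have := @hαβ (.inl x.castSucc) (.inr y.castSucc) (congrArg Subtype.val hxy)
        simp at this
      · have := @hαβ (.inr x.castSucc) (.inl y.castSucc) (congrArg Subtype.val hxy)
        simp at this
      · have := @hαβ (.inr x.castSucc) (.inr y.castSucc) (congrArg Subtype.val hxy)
        simpa using this
    have hIH := ih (fun Y₁ q₁ κ _ d hd Z pZ hZ => hT Y₁ q₁ κ d hd Z pZ
      (hZ.imp id fun h => by omega))
      q₁ h₁ a₁ b₁ α₁ β₁ hi₁ (fun m => dif_pos m.2) (fun m => dif_pos m.2)
    let N₁ : ℕ → Closeds Y₁.left := fun m => common Y₁ (a₁ m) (b₁ m)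
    let N : ℕ → Closeds Y.left := fun m => common Y (a m) (b m)
    have hga' : ∀ m < r, g'.left.appTop.hom (a₁ m) = a m := fun m hm => by
      have h1 : a₁ m = c₁ (α₁ ⟨m, hm⟩) := dif_pos hm
      rw [h1]
      exact (hgc _).trans (ha ⟨m, by omega⟩).symm
    have hgb' : ∀ m < r, g'.left.appTop.hom (b₁ m) = b m := fun m hm => by
      have h1 : b₁ m = c₁ (β₁ ⟨m, hm⟩) := dif_pos hm
      rw [h1]
      exact (hgc _).trans (hb ⟨m, by omega⟩).symm
    have hN : ∀ m < r, preim g' (N₁ m) = N m := fun m hm => by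
      refine (preim_common g' _ _).trans ?_
      rw [hga' m hm, hgb' m hm]
    have hK : preim g' (iterInf N₁ r) = iterInf N r := preim_iterInf g' hN
    have pN₁ : ∀ m < r, V.Pair Y₁ (N₁ m) := fun m _ => pair_common hY₁ _ _
    have pN : ∀ m, V.Pair Y (N m) := fun m => pair_common hY _ _
    have pK₁ := pair_iterInf hY₁ pN₁
    -- for `r = 0` the support is the whole space
    have hThom : ThomIso Th Y₁ (iterInf N₁ r) := by
      refine hT Y₁ q₁ _ _ h₁ _ pK₁ ?_
      rcases r with _ | r
      · exact .inl rfl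
      · exact .inr (by omega)
    have hpair : IsAffineSpace g'.left ![a r, b r] := by
      have hi₀ : ¬ p i₀ := fun h => h.1 rfl
      have hi₁' : ¬ p i₁ := fun h => h.2 rfl
      let ε : Fin 2 ≃ {i // ¬ p i} := Equiv.ofBijective ![⟨i₀, hi₀⟩, ⟨i₁, hi₁'⟩] (by
        constructor
        · intro x y hxy
          fin_cases x <;> fin_cases y
          · rfl
          · exact absurd (congrArg Subtype.val hxy) h01
          · exact absurd (congrArg Subtype.val hxy) h01.symm
          · rfl
        · rintro ⟨i, hi⟩
          by_cases h : i = i₀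
          · exact ⟨0, Subtype.ext h.symm⟩
          · refine ⟨1, Subtype.ext ?_⟩
            by_contra h'
            exact hi ⟨h, fun h'' => h' h''.symm⟩)
      have := hga.reindex ε
      have e1 : (fun l => c (ε l)) = ![a r, b r] := by
        funext l
        fin_cases l
        · exact (ha (Fin.last r)).symm
        · exact (hb (Fin.last r)).symm
      rw [← e1]
      exact this
    have hb := hThom Y g' (a r) (b r) hpair
    have hmul : preim g' (iterInf N₁ r) ⊓ N r ≤ iterInf N (r + 1) := by rw [hK]; exact le_rfl
    have hb' := mulMap_bijective_congr (h := le_rfl) (K' := iterInf N (r + 1))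
      (by rw [hK]; rfl) hmul hb
    refine bijective_of_eq (hb'.comp hIH) fun a' => ?_
    have pX := SchemeCategory.pair_top hX
    have pIr := pair_iterInf hY fun m (_ : m < r) => pN m
    have pIr1 := pair_iterInf hY fun m (_ : m < r + 1) => pN m
    have hcl := pull_prodCls hY₁ hY g' (fun m => coordClass Th Y₁ (a₁ m) (b₁ m))
      (fun m => coordClass Th Y (a m) (b m)) r pN₁ (fun m _ => pN m) (fun m hm => (hN m hm).le)
      (fun m hm => pull_coordClass Th hY hY₁ g' _ _ (hga' m hm) (hgb' m hm) _) hK.le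
    have := mulMap_mulMap e pX pK₁ pK₁ pIr (pN r) pIr1 pIr1
      (A.prodCls (fun m => coordClass Th Y₁ (a₁ m) (b₁ m)) r) (coordClass Th Y (a r) (b r))
      inf_le_right hmul hK.le (inf_le_right.trans hK.ge) le_rfl inf_le_right a'
    rw [hcl] at this
    exact this.symm

end

section

/-! ### Splitting off cells -/

/-- Here `f` splits the surjection `c` with kernel `H₁`. -/
lemma bijective_iff_of_split {P Q H₁ H₀ L : Type*} [AddCommGroup P] [AddCommGroup Q]
    [AddCommGroup H₁] [AddCommGroup H₀] [AddCommGroup L] (f : P →+ H₀) (g : Q →+ H₁)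
    (e : H₁ →+ H₀) (c : H₀ →+ L) (hce : ∀ x, c (e x) = 0) (hex : ∀ y, c y = 0 → ∃ x, e x = y)
    (he : Function.Injective e) (hcf : Function.Bijective fun p => c (f p)) :
    Function.Bijective (fun x : P × Q => f x.1 + e (g x.2)) ↔ Function.Bijective g := by
  constructor
  · rintro ⟨h1, h2⟩
    refine ⟨fun x y hxy => ?_, fun z => ?_⟩
    · exact congrArg Prod.snd (@h1 (0, x) (0, y) (by simp only [hxy]))
    · obtain ⟨⟨p, x⟩, hx⟩ := h2 (e z)
      have hp : p = 0 := hcf.1 (by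
        have := congrArg c hx
        simpa only [map_add, hce, add_zero, map_zero] using this)
      subst hp
      refine ⟨x, he ?_⟩
      simpa using hx
  · rintro ⟨h1, h2⟩
    refine ⟨?_, fun y => ?_⟩
    · rintro ⟨p, x⟩ ⟨p', x'⟩ h
      obtain rfl : p = p' := hcf.1 (by
        have := congrArg c h
        simpa only [map_add, hce, add_zero] using this)
      obtain rfl : x = x' := h1 (he (add_left_cancel h))
      rfl
    · obtain ⟨p, hp⟩ := hcf.2 (c y)
      obtain ⟨z, hz⟩ := hex (y - f p) (by rw [map_sub, sub_eq_zero]; exact hp.symm)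
      obtain ⟨x, rfl⟩ := h2 z
      exact ⟨(p, x), by simp only [hz]; abel⟩

namespace RingCohomologyTheory

open CohomologyTheory SchemeCategory

variable {k : Scheme.{u}} {V : SchemeCategory k} {A : RingCohomologyTheory.{u, w} V}

lemma mul_pow {X : Over k} (hX : V.Mem X) (ζ : A.obj X ⊤) (j : ℕ) :
    A.mul inf_le_left ζ (A.pow ζ j) = A.pow ζ (j + 1) := by
  have pX := SchemeCategory.pair_top hX
  induction j with
  | zero =>
    change A.mul inf_le_left ζ (A.unit X) = A.mul inf_le_right (A.unit X) ζ
    rw [mul_unit pX pX, unit_mul pX pX]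
  | succ j ih =>
    change A.mul inf_le_left ζ (A.mul inf_le_right (A.pow ζ j) ζ) =
      A.mul inf_le_right (A.pow ζ (j + 1)) ζ
    rw [← ih]
    exact (mul_assoc pX pX pX pX pX pX _ _ _ _ _ _ _).symm

lemma pullTop_pow {X' X : Over k} (f : X' ⟶ X) (hX : V.Mem X) (hX' : V.Mem X') (ζ : A.obj X ⊤)
    (j : ℕ) : A.pullTop f (A.pow ζ j) = A.pow (A.pullTop f ζ) j := by
  have pX := SchemeCategory.pair_top hX
  have pX' := SchemeCategory.pair_top hX'
  induction j with
  | zero => exact pullTop_unit f hX hX'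
  | succ j ih =>
    refine (pull_mul f pX pX pX pX' pX' pX' (subset_top _) (subset_top _) (subset_top _)
      inf_le_right inf_le_right (A.pow ζ j) ζ).trans ?_
    exact congrArg (fun t => A.mul inf_le_right t (A.pullTop f ζ)) ih

lemma pull_complι_ext {X : Over k} {Z N : Closeds X.left} (pZ : V.Pair X Z) (pN : V.Pair X N)
    (h : Z ≤ N) (d : A.obj X Z) :
    A.pull (complι X Z) (preim_subset (complι X Z) N) (A.ext h d) = 0 := by
  have pU := pN.preim (complι X Z) pZ.2
  rw [pull_ext _ pZ pN pU]
  have e : preim (complι X Z) Z = ⊥ := by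
    ext x
    have hx := Set.mem_range_self (f := (complι X Z).left) x
    rw [range_complι] at hx
    simpa using hx
  have h4 := obj_eq_zero_of_eq_bot pZ.2 e (A.pull (complι X Z) (preim_subset _ _) d)
  rw [← A.ext_pull _ pZ (pZ.preim _ pZ.2) pU (fun x hx => h hx) (preim_subset _ _), h4, map_zero]

variable (A) in
/-- For classes `τ i ∈ A_M(Y)` the map `A_Z(X) ^ ι ⟶ A_K(Y)`, `a ↦ ∑ q^A(a i) ∪ τ i`. -/
def supMap {ι : Type*} [Fintype ι] {Y X : Over k} (q : Y ⟶ X) (Z : Closeds X.left)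
    {M K : Closeds Y.left} (τ : ι → A.obj Y M) (h : preim q Z ⊓ M ≤ K) :
    (ι → A.obj X Z) →+ A.obj Y K :=
  ∑ i, (A.mulMap q Z (τ i) h).comp (Pi.evalAddMonoidHom _ i)

lemma supMap_apply {ι : Type*} [Fintype ι] {Y X : Over k} (q : Y ⟶ X) (Z : Closeds X.left)
    {M K : Closeds Y.left} (τ : ι → A.obj Y M) (h : preim q Z ⊓ M ≤ K) (a : ι → A.obj X Z) :
    A.supMap q Z τ h a = ∑ i, A.mulMap q Z (τ i) h (a i) := by
  simp [supMap]

/-- Classes `t 0, t 1, …` on `R` with supports `N 0, N 1, …`, all of which become equal to `ζ` when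
the supports are forgotten. -/
structure Tower (A : RingCohomologyTheory.{u, w} V) (R : Over k) where
  mem : V.Mem R
  N : ℕ → Closeds R.left
  pair : ∀ m, V.Pair R (N m)
  t : ∀ m, A.obj R (N m)
  ζ : A.obj R ⊤
  ext_t : ∀ m, A.ext le_top (t m) = ζ

namespace Tower

variable {R : Over k} (T : Tower A R)

lemma pair_iterInf (r : ℕ) : V.Pair R (iterInf T.N r) :=
  QuatProj.pair_iterInf T.mem fun m _ => T.pair m

/-- The class `t 0 ∪ ⋯ ∪ t (r - 1) ∪ ζ ^ j`. -/
def cls (r j : ℕ) : A.obj R (iterInf T.N r) := A.mul inf_le_left (A.prodCls T.t r) (A.pow T.ζ j)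

lemma cls_zero_right (r : ℕ) : T.cls r 0 = A.prodCls T.t r :=
  (mul_unit (T.pair_iterInf r) (T.pair_iterInf r) _ _).trans (ext_self (T.pair_iterInf r) _ _)

lemma cls_zero_left (j : ℕ) : T.cls 0 j = A.pow T.ζ j :=
  (unit_mul (pair_top T.mem) (pair_top T.mem) _ _).trans (ext_self (pair_top T.mem) _ _)

/-- Forgetting the support of the last factor of the product turns this factor into `ζ`. -/
lemma ext_cls (r j : ℕ) (h : iterInf T.N (r + 1) ≤ iterInf T.N r) :
    A.ext h (T.cls (r + 1) j) = T.cls r (j + 1) := by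
  have p₁ := T.pair_iterInf (r + 1)
  have p := T.pair_iterInf r
  have pR := pair_top T.mem
  have h1 : A.ext h (A.prodCls T.t (r + 1)) = A.mul inf_le_left (A.prodCls T.t r) T.ζ := by
    refine (ext_mul p (T.pair r) p₁ p pR p le_rfl le_top h le_rfl inf_le_left
      (A.prodCls T.t r) (T.t r)).trans ?_
    rw [ext_self p, T.ext_t]
  refine (ext_mul p₁ pR p₁ p pR p h le_rfl h inf_le_left inf_le_left _ _).trans ?_
  rw [h1, ext_self pR]
  refine (mul_assoc p pR pR p pR p _ _ inf_le_left inf_le_left _ _ _).trans ?_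
  rw [mul_pow T.mem]
  rfl

lemma ext_top_cls (r j : ℕ) : A.ext le_top (T.cls r j) = A.pow T.ζ (r + j) := by
  induction r generalizing j with
  | zero => rw [T.cls_zero_left, zero_add]; exact ext_self (pair_top T.mem) _ _
  | succ r ih =>
    rw [← ext_ext (T.pair_iterInf (r + 1)) (T.pair_iterInf r) (pair_top T.mem)
      (iterInf_succ_le T.N r) le_top,
      T.ext_cls, ih]
    congr 1
    omega

/-- `ζ ^ r` comes from a class supported on the intersection of the first `r` members. -/
lemma pow_eq_zero {r : ℕ} (h : iterInf T.N r = ⊥) : A.pow T.ζ r = 0 := by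
  rw [← add_zero r, ← T.ext_top_cls, obj_eq_zero_of_eq_bot T.mem h (T.cls r 0), map_zero]

variable {X : Over k} (q : R ⟶ X)

/-- The map `A_Z(X) ^ m ⟶ A_K(R)`, `a ↦ ∑ q^A(a j) ∪ t 0 ∪ ⋯ ∪ t (r - 1) ∪ ζ ^ j`, where `K` is the
intersection of `q⁻¹(Z)` with `N 0, …, N (r - 1)`. -/
def map (Z : Closeds X.left) (r m : ℕ) :
    (Fin m → A.obj X Z) →+ A.obj R (preim q Z ⊓ iterInf T.N r) :=
  A.supMap q Z (fun j : Fin m => T.cls r j) le_rfl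

/-- The restriction to `R ∖ N r` of the map `a ↦ q^A(a) ∪ t 0 ∪ ⋯ ∪ t (r - 1)`. -/
def cellMap (Z : Closeds X.left) (r : ℕ) : A.obj X Z →+
    A.obj (compl R (T.N r)) (preim (complι R (T.N r)) (preim q Z ⊓ iterInf T.N r)) :=
  (A.pull (complι R (T.N r)) (preim_subset _ _)).comp
    (A.mulMap q Z (A.prodCls T.t r) le_rfl)

lemma map_zero_bijective_iff (Z : Closeds X.left) (pZ : V.Pair X Z) (m : ℕ) :
    Function.Bijective (T.map q Z 0 m) ↔
      Function.Bijective (A.sumMap q (fun j : Fin m => A.pow T.ζ j) (preim_subset q Z)) := by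
  have pR := pair_top T.mem
  have pq := pZ.preim q T.mem
  have hb := ext_bijective (A := A.toCohomologyTheory) (pq.inf pR) (inf_eq_left.2 le_top)
    (inf_le_left : preim q Z ⊓ ⊤ ≤ preim q Z)
  have e : ∀ a, A.ext inf_le_left (T.map q Z 0 m a) =
      A.sumMap q (fun j : Fin m => A.pow T.ζ j) (preim_subset q Z) a := fun a => by
    rw [map, supMap_apply, map_sum, sumMap_apply]
    refine Finset.sum_congr rfl fun j _ => ?_
    rw [mulMap_apply]
    refine (ext_mul pq (T.pair_iterInf 0) (pq.inf (T.pair_iterInf 0)) pq pR pq le_rfl le_top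
      inf_le_left le_rfl inf_le_left _ _).trans ?_
    rw [ext_self pq, T.ext_top_cls, zero_add]
  exact (Function.Bijective.of_comp_iff' hb _).symm.trans
    ⟨fun h => bijective_of_eq h fun a => (e a).symm, fun h => bijective_of_eq h e⟩

lemma map_bijective_of_eq_bot (Z : Closeds X.left) {r : ℕ} (h : iterInf T.N r = ⊥) :
    Function.Bijective (T.map q Z r 0) := by
  have z : ∀ a : A.obj R (preim q Z ⊓ iterInf T.N r), a = 0 :=
    obj_eq_zero_of_eq_bot T.mem (by rw [h, inf_bot_eq])
  exact ⟨fun a b _ => Subsingleton.elim a b, fun a => ⟨0, by rw [map_zero, z a]⟩⟩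

/-- The first summand extends the class of the cell over the whole of `R`; the others are supported
on the next member of the tower. -/
lemma map_succ (Z : Closeds X.left) (pZ : V.Pair X Z) (r m : ℕ)
    (h : preim q Z ⊓ iterInf T.N (r + 1) ≤ preim q Z ⊓ iterInf T.N r)
    (a : Fin (m + 1) → A.obj X Z) :
    T.map q Z r (m + 1) a = A.mulMap q Z (A.prodCls T.t r) le_rfl (a 0) +
      A.ext h (T.map q Z (r + 1) m fun j => a j.succ) := by
  have pq := pZ.preim q T.mem
  have p₁ := T.pair_iterInf (r + 1)
  have p := T.pair_iterInf r
  rw [map, supMap_apply, Fin.sum_univ_succ, map, supMap_apply, _root_.map_sum]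
  congr 1
  · exact congrArg (fun c => A.mulMap q Z c le_rfl (a 0)) (T.cls_zero_right r)
  · refine Finset.sum_congr rfl fun j _ => ?_
    rw [mulMap_apply, mulMap_apply]
    refine Eq.trans ?_ (ext_mul pq p₁ (pq.inf p₁) pq p (pq.inf p) le_rfl (iterInf_succ_le T.N r) h
      le_rfl
      le_rfl _ _).symm
    rw [ext_self pq, T.ext_cls]
    rfl

/-- One cell is split off by the sequence of the triple of supports with indices `r + 1` and `r`. -/
lemma map_bijective_iff (Z : Closeds X.left) (pZ : V.Pair X Z) (r m : ℕ)
    (hcell : Function.Bijective (T.cellMap q Z r)) :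
    Function.Bijective (T.map q Z r (m + 1)) ↔ Function.Bijective (T.map q Z (r + 1) m) := by
  have pq := pZ.preim q T.mem
  let K := preim q Z ⊓ iterInf T.N r
  let K' := preim q Z ⊓ iterInf T.N (r + 1)
  have pK : V.Pair R K := pq.inf (T.pair_iterInf r)
  have pK' : V.Pair R K' := pq.inf (T.pair_iterInf (r + 1))
  have h : K' ≤ K := inf_le_inf_left _ inf_le_left
  let f := A.mulMap q Z (A.prodCls T.t r) (K := K) le_rfl
  let c := A.pull (complι R K') (preim_subset (complι R K') K)
  have hcf : Function.Bijective fun p => c (f p) := by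
    -- by excision, restriction to the smaller open subset `R ∖ N r` loses nothing
    let β : compl R (T.N r) ⟶ compl R K' := complMap (𝟙 R)
      (id_subset (inf_le_right.trans inf_le_right))
    have hβ : β ≫ complι R K' = complι R (T.N r) := (complMap_comp _ _).trans (Category.comp_id _)
    have : IsOpenImmersion β.left := by
      have : IsOpenImmersion (β.left ≫ (complι R K').left) := by
        rw [← Over.comp_left, hβ]; infer_instance
      exact IsOpenImmersion.of_comp _ (complι R K').left
    have e : preim β (preim (complι R K') K) = preim (complι R (T.N r)) K := by
      rw [← preim_comp, hβ]
    have hr : (preim (complι R K') K : Set (compl R K').left) ⊆ Set.range β.left := by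
      intro x hx
      have h1 := Set.mem_range_self (f := (complι R K').left) x
      rw [range_complι] at h1
      have h2 : (complι R K').left x ∈ Set.range (complι R (T.N r)).left := by
        rw [range_complι]
        exact fun h3 => h1 ⟨hx.1, hx.2, h3⟩
      obtain ⟨y, hy⟩ := h2
      refine ⟨y, (complι R K').left.isOpenEmbedding.injective ?_⟩
      rw [← hy, ← hβ]
      rfl
    have hb := pull_bijective_of_isOpenImmersion (A := A.toCohomologyTheory) β
      (pK.preim _ pK'.2) (T.pair r).2 e hr e.le
    rw [← Function.Bijective.of_comp_iff' hb]
    refine bijective_of_eq hcell fun a => ?_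
    exact (pull_pull β (complι R K') pK (pK.preim _ pK'.2) (pK.preim _ (T.pair r).2) _ _ _).trans
      (A.pull_congr hβ _ _ _)
  have hs : Function.Surjective c := fun y => by
    obtain ⟨p, hp⟩ := hcf.2 y
    exact ⟨f p, hp⟩
  have key := bijective_iff_of_split f (T.map q Z (r + 1) m) (A.ext h) c
    (fun x => pull_complι_ext pK' pK h x) (fun y hy => triple_exact pK' pK h y hy)
    (triple_injective pK' pK h hs) hcf
  rw [← key]
  have hu : Function.Bijective fun a : Fin (m + 1) → A.obj X Z =>
    (a 0, fun j : Fin m => a j.succ) :=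
    (Fin.consEquiv fun _ => A.obj X Z).symm.bijective
  rw [← Function.Bijective.of_comp_iff _ hu]
  exact ⟨fun hb => bijective_of_eq hb fun a => (T.map_succ q Z pZ r m h a).symm,
    fun hb => bijective_of_eq hb fun a => T.map_succ q Z pZ r m h a⟩

lemma map_zero_bijective (Z : Closeds X.left) (pZ : V.Pair X Z) {n : ℕ}
    (hcell : ∀ r < n, Function.Bijective (T.cellMap q Z r)) (h : iterInf T.N n = ⊥) :
    Function.Bijective (T.map q Z 0 n) := by
  have key : ∀ m r, r + m = n → Function.Bijective (T.map q Z r m) := by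
    intro m
    induction m with
    | zero =>
      rintro r rfl
      exact T.map_bijective_of_eq_bot q Z h
    | succ m ih =>
      intro r hr
      exact (T.map_bijective_iff q Z pZ r m (hcell r (by omega))).2 (ih (r + 1) (by omega))
  exact key n 0 (by omega)

/-- If the intersection of `N 0, …, N r` is empty, then the last cell is the end of the tower. -/
lemma cellMap_bijective_of_map_bijective (Z : Closeds X.left) (pZ : V.Pair X Z) {r : ℕ}
    (h : iterInf T.N (r + 1) = ⊥) (hb : Function.Bijective (T.map q Z r 1)) :
    Function.Bijective (T.cellMap q Z r) := by
  have pK := (pZ.preim q T.mem).inf (T.pair_iterInf r)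
  have hr : ((preim q Z ⊓ iterInf T.N r : Closeds R.left) : Set R.left) ⊆
      Set.range (complι R (T.N r)).left := by
    intro x hx
    rw [range_complι]
    intro hx'
    have : x ∈ iterInf T.N (r + 1) := ⟨hx.2, hx'⟩
    rw [h] at this
    exact this
  have h1 := pull_bijective_of_isOpenImmersion (A := A.toCohomologyTheory) (complι R (T.N r)) pK
    (T.pair r).2 rfl hr (preim_subset _ _)
  have h2 : Function.Bijective (A.mulMap q Z (A.prodCls T.t r)
      (le_refl (preim q Z ⊓ iterInf T.N r))) := by
    refine bijective_of_eq (hb.comp (Equiv.funUnique (Fin 1) _).symm.bijective) fun a => ?_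
    rw [Function.comp_apply, map, supMap_apply, Fin.sum_univ_one]
    exact congrArg (fun c => A.mulMap q Z c le_rfl a) (T.cls_zero_right r).symm
  exact h1.comp h2

end Tower
end RingCohomologyTheory

end

section

/-! ### The tower of a quaternionic projective bundle -/

namespace HPCoords

variable {R X : Scheme.{u}} {π : R ⟶ X} {U : SymplecticBundle R 2} {n : ℕ} (C : HPCoords π U n)

/-- The dual of the coordinate `inr m`, and zero for `m ≥ n`. -/
def dualAt (m : ℕ) (T : Over R) : T ⟶ U.total :=
  if h : m < n then C.dual (.inr ⟨m, h⟩) T else 0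

lemma dualAt_val (i : Fin n) (T : Over R) : C.dualAt i T = C.dual (.inr i) T := dif_pos i.2

lemma comp_dualAt (m : ℕ) {T' T : Over R} (g : T' ⟶ T) : g ≫ C.dualAt m T = C.dualAt m T' := by
  unfold dualAt
  split_ifs
  · exact C.comp_dual _ g
  · exact U.comp_zero g

/-- The locus where the dual of the coordinate `inr m` vanishes. -/
def locus (m : ℕ) : Set R := (C.dualAt m (Over.mk (𝟙 R))).left ⁻¹' (U.zeroLocus : Set U.total.left)

lemma mem_locus_iff (m : ℕ) (T : Over R) (x : T.left) :
    T.hom x ∈ C.locus m ↔ (C.dualAt m T).left x ∈ U.zeroLocus := by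
  rw [← C.comp_dualAt m (Over.homMk T.hom : T ⟶ Over.mk (𝟙 R))]
  rfl

/-- The duals of the coordinates `inr m` have no common zero, as the tautological bundle is
nondegenerate. -/
lemma exists_notMem_locus (x : R) : ∃ m < n, x ∉ C.locus m := by
  by_contra! hcon
  let T : Over R := Over.mk (𝟙 R)
  have hz : ∀ (j : Fin n) (w : residuePoint T x ⟶ U.total), C.vec _ w (.inr j) = 0 := fun j w => by
    have h1 : (C.dual (.inr j) T).left x ∈ U.zeroLocus := by
      rw [← C.dualAt_val]
      exact (C.mem_locus_iff j T x).1 (hcon j j.2)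
    rw [U.mem_zeroLocus_iff, C.comp_dual] at h1
    rw [← C.form_dual, h1, LinearMap.map_zero, LinearMap.zero_apply]
  have hf : ∀ s t : residuePoint T x ⟶ U.total, U.form _ s t = 0 := fun s t => by
    rw [C.form_eq]
    refine Finset.sum_eq_zero fun j _ => ?_
    rw [hz, hz, zero_mul, mul_zero, sub_zero]
  obtain ⟨W, hW, a, b, hab⟩ := U.exists_form_eq_one T x
  obtain ⟨p, -⟩ := exists_residuePoint_lift T hW
  have h1 : U.form _ (p ≫ a) (p ≫ b) = 1 := by
    rw [U.form_comp, hab, _root_.map_one]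
  rw [hf] at h1
  obtain ⟨y, z, hyz⟩ := (isField_residuePoint T x).exists_pair_ne
  exact hyz (by rw [← one_mul y, ← one_mul z, ← h1, zero_mul, zero_mul])

variable {R' X' : Scheme.{u}} {π' : R' ⟶ X'} {g : R' ⟶ R} {f : X' ⟶ X}
    (hp : IsPullback g π' π f) {U' : SymplecticBundle R' 2}
    {k : BundleHom g U'.toVectorBundle U.toVectorBundle} (hk : k.IsCartesian) (hi : k.IsIsometric)

lemma push_dual_baseChange (x : Fin n ⊕ Fin n) (T : Over R') :
    k.push ((C.baseChange hp hk hi).dual x T) = C.dual x ((Over.map g).obj T) := by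
  obtain ⟨s, hs⟩ := (hk.push_bijective k T).2 (C.dual x ((Over.map g).obj T))
  rw [← hs]
  congr 1
  refine U'.ext_of_form _ _ fun T' m w => ?_
  rw [(C.baseChange hp hk hi).comp_dual, form_dual, ← hi, k.push_comp, hs, C.comp_dual, C.form_dual]
  rfl

lemma push_dualAt_baseChange (m : ℕ) (T : Over R') :
    k.push ((C.baseChange hp hk hi).dualAt m T) = C.dualAt m ((Over.map g).obj T) := by
  unfold dualAt
  split_ifs
  · exact C.push_dual_baseChange hp hk hi _ T
  · exact k.push_zero T

lemma locus_baseChange (m : ℕ) : (C.baseChange hp hk hi).locus m = g ⁻¹' C.locus m := by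
  ext x
  have h1 := C.push_dualAt_baseChange hp hk hi m (Over.mk (𝟙 R'))
  have h2 := C.mem_locus_iff m ((Over.map g).obj (Over.mk (𝟙 R'))) x
  have h3 : ((Over.map g).obj (Over.mk (𝟙 R'))).hom = g := Category.id_comp g
  have h4 : g x ∈ C.locus m ↔ k.left (((C.baseChange hp hk hi).dualAt m (Over.mk (𝟙 R'))).left x) ∈
      U.zeroLocus := by
    rw [h3, ← h1] at h2
    exact h2
  refine Iff.trans ?_ h4.symm
  constructor
  · rintro ⟨y, hy⟩
    refine ⟨g y, ?_⟩
    rw [← hy, ← Scheme.Hom.comp_apply, ← Scheme.Hom.comp_apply, k.zeroSection_comp_left]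
  · exact fun h => (BundleHom.IsCartesian.preimage_zeroLocus _ hk) h

end HPCoords

open CohomologyTheory RingCohomologyTheory SchemeCategory

variable {k : Scheme.{u}} {V : SchemeCategory k} {A : RingCohomologyTheory.{u, w} V}
  (Th : SymplecticThomStructure A)

namespace HPCoords

variable {R X : Over k} {q : R ⟶ X} {U : SymplecticBundle R.left 2} {n : ℕ}
  (C : HPCoords q.left U n)

/-- The tower given by the duals of the coordinates `inr m`, over an `R`-scheme `O`. -/
def tower (hR : V.Mem R) {O : Over k} (hO : V.Mem O) (u : O ⟶ R) : Tower A O where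
  mem := hO
  N m := preim (sectionHom u (C.dualAt m (Over.mk u.left))) (zeroSet R U.toVectorBundle)
  pair _ := pair_preim_zeroSet hO _
  t m := Th.thomAlong (sectionHom u (C.dualAt m (Over.mk u.left)))
  ζ := A.pullTop u (Th.pontryagin R U)
  ext_t _ := (Th.ext_thomAlong hO hR _).trans (A.pull_congr (sectionHom_proj _ _) _ _ _)

variable (hR : V.Mem R) {O : Over k} (hO : V.Mem O) (u : O ⟶ R)

lemma mem_tower_N_iff (m : ℕ) (x : O.left) : x ∈ (C.tower Th hR hO u).N m ↔ u.left x ∈ C.locus m :=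
  (C.mem_locus_iff m (Over.mk u.left) x).symm

lemma mem_iterInf_tower_N_iff (r : ℕ) (x : O.left) :
    x ∈ iterInf (C.tower Th hR hO u).N r ↔ ∀ m < r, u.left x ∈ C.locus m := by
  induction r with
  | zero => exact ⟨fun _ m hm => by omega, fun _ => Set.mem_univ x⟩
  | succ r ih =>
    refine Iff.trans (and_congr ih (C.mem_tower_N_iff Th hR hO u r x)) ?_
    constructor
    · rintro ⟨h1, h2⟩ m hm
      rcases Nat.lt_succ_iff_lt_or_eq.1 hm with h | rfl
      exacts [h1 m h, h2]
    · exact fun h => ⟨fun m hm => h m (by omega), h r (by omega)⟩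

namespace Cell

variable {C} {i : Fin n} (D : C.Cell i)

/-- The cell as a `k`-scheme. -/
def toOver : Over k := Over.mk (D.ρ ≫ R.hom)

/-- The structure morphism of a cell. -/
def hom : D.toOver ⟶ R := Over.homMk D.ρ

/-- The coordinate `inr m` of the second basis vector. -/
def vecAt (m : ℕ) : Γ(D.toOver.left, ⊤) := if h : m < n then C.vec _ D.v (.inr ⟨m, h⟩) else 0

/-- The coordinate `inr m` of the first basis vector. -/
def covecAt (m : ℕ) : Γ(D.toOver.left, ⊤) := if h : m < n then C.vec _ D.k (.inr ⟨m, h⟩) else 0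

lemma form_k_neg_v : U.form _ D.k (-D.v) = -1 := by
  rw [_root_.map_neg, D.form_k_v]

/-- The isometry of `Hyp(𝒪)` with the pullback of `U` given by the normalized basis. -/
def hypIso : BundleHom D.hom.left (SymplecticBundle.hyp D.toOver.left).toVectorBundle
    U.toVectorBundle :=
  VectorBundle.homOfSections (f := D.ρ) (E := U.toVectorBundle) ![D.k, -D.v]

lemma hypIso_isCartesian : D.hypIso.IsCartesian := isCartesian_of_form_eq_neg_one D.form_k_neg_v

lemma hypIso_isIsometric : BundleHom.IsIsometric (F := SymplecticBundle.hyp D.toOver.left)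
    D.hypIso :=
  isIsometric_of_form_eq_neg_one (w := ![D.k, -D.v]) D.form_k_neg_v

/-- On the cell, the basis `k, -v` identifies the tautological plane with the trivial bundle, and
the `m`-th dual section has the coordinates `inr m` of `v` and `k` in this basis. -/
lemma comp_sectionHom_dualAt {u : O ⟶ R} (ρ : D.toOver ⟶ O) (hρ : ρ ≫ u = D.hom) (m : ℕ) :
    ρ ≫ sectionHom u (C.dualAt m (Over.mk u.left)) =
      hypHom D.toOver (D.vecAt m) (D.covecAt m) ≫ D.hypIso.over := by
  ext1
  have hρ' : ρ.left ≫ u.left = D.ρ := congrArg (fun f => f.left) hρ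
  have h1 := congrArg (fun s => s.left) (C.comp_dualAt m
    (Over.homMk ρ.left hρ' : Over.mk D.ρ ⟶ Over.mk u.left))
  refine Eq.trans h1 (Eq.trans ?_ (hypSection_homOfSections (E := U) (f := D.ρ) ![D.k, -D.v]
    (D.vecAt m) (D.covecAt m)).symm)
  congr 1
  by_cases hm : m < n
  · have e1 : D.vecAt m = C.vec _ D.v (.inr ⟨m, hm⟩) := dif_pos hm
    have e2 : D.covecAt m = C.vec _ D.k (.inr ⟨m, hm⟩) := dif_pos hm
    rw [e1, e2]
    refine (dif_pos hm).trans ((D.dual_eq (.inr ⟨m, hm⟩)).trans ?_)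
    rw [sub_eq_add_neg, ← smul_neg]
    rfl
  · have e1 : D.vecAt m = 0 := dif_neg hm
    have e2 : D.covecAt m = 0 := dif_neg hm
    rw [e1, e2]
    refine (dif_neg hm).trans ?_
    have h0 : (0 : Γ((Over.mk D.ρ).left, ⊤)) • D.k + (0 : Γ((Over.mk D.ρ).left, ⊤)) • (-D.v) =
      0 := by
      rw [zero_smul, zero_smul, add_zero]
    exact h0.symm

lemma range_hom_subset : Set.range D.hom.left ⊆ (C.locus i)ᶜ := by
  have := D.range_subset
  rw [← C.dualAt_val] at this
  exact this

end Cell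
end HPCoords

end

section

/-! ### Comparison with the cells -/

open CohomologyTheory RingCohomologyTheory SchemeCategory

variable {k : Scheme.{u}} {V : SchemeCategory k} {A : RingCohomologyTheory.{u, w} V}
  (Th : SymplecticThomStructure A)

namespace HPCoords

variable {R X : Over k} {q : R ⟶ X} {U : SymplecticBundle R.left 2} {n : ℕ}
  {C : HPCoords q.left U n} (hR : V.Mem R) {O : Over k} (hO : V.Mem O) (u : O ⟶ R)

namespace Cell

variable {i : Fin n} (D : C.Cell i)

lemma mem (hX : V.Mem X) : V.Mem D.toOver := IsAffineSpace.mem (D.hom ≫ q) D.isAffineSpace hX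

/-- The product of the coordinate classes of the pairs `(v m, k m)` for `m < r`. -/
def coordProd (r : ℕ) :
    A.obj D.toOver (iterInf (fun m => common D.toOver (D.vecAt m) (D.covecAt m)) r) :=
  A.prodCls (fun m => coordClass Th D.toOver (D.vecAt m) (D.covecAt m)) r

/-- The cell is an affine bundle over the locus where the dual of the coordinate `inr i` does not
vanish, so it computes the cohomology of that locus. -/
lemma cellMap_bijective_iff [IsOpenImmersion u.left] (hu : (C.locus i)ᶜ ⊆ Set.range u.left)
    {Z : Closeds X.left} (pZ : V.Pair X Z) :
    Function.Bijective ((C.tower Th hR hO u).cellMap (u ≫ q) Z i) ↔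
      Function.Bijective (A.mulMap (D.hom ≫ q) Z (D.coordProd Th i) le_rfl) := by
  let T := C.tower Th hR hO u
  have hD : V.Mem D.toOver := D.mem pZ.1
  let ρ := openLift u D.hom (D.range_hom_subset.trans hu)
  have hρ : ρ ≫ u = D.hom := openLift_comp _ _ _
  have hr : Set.range ρ.left ⊆ Set.range (complι O (T.N i)).left := by
    rw [range_complι]
    rintro _ ⟨x, rfl⟩ hx
    have h1 := (C.mem_tower_N_iff Th hR hO u i (ρ.left x)).1 hx
    have h2 : u.left (ρ.left x) = D.hom.left x := by rw [← hρ]; rfl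
    rw [h2] at h1
    exact D.range_hom_subset ⟨x, rfl⟩ h1
  let ρ' := openLift (complι O (T.N i)) ρ hr
  have hρ' : ρ' ≫ complι O (T.N i) = ρ := openLift_comp _ _ _
  let K := preim (u ≫ q) Z ⊓ iterInf T.N i
  have pK : V.Pair O K := (pZ.preim _ hO).inf (T.pair_iterInf i)
  have hj : Set.range ((complι O (T.N i)).left ≫ u.left) =
      ((C.dual (.inr i) (Over.mk (𝟙 R.left))).left ⁻¹' (U.zeroLocus : Set U.total.left))ᶜ := by
    rw [← C.dualAt_val]
    refine Set.Subset.antisymm ?_ fun x hx => ?_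
    · rintro _ ⟨x, rfl⟩ hx
      have h1 := Set.mem_range_self (f := (complι O (T.N i)).left) x
      rw [range_complι] at h1
      exact h1 ((C.mem_tower_N_iff Th hR hO u i _).2 hx)
    · obtain ⟨y, rfl⟩ := hu hx
      have h1 : y ∈ Set.range (complι O (T.N i)).left := by
        rw [range_complι]
        exact fun h => hx ((C.mem_tower_N_iff Th hR hO u i _).1 h)
      obtain ⟨z, rfl⟩ := h1
      exact ⟨z, rfl⟩
  have hloc : IsLocallyAffineSpace ρ'.left :=
    D.isLocallyAffineSpace ((complι O (T.N i)).left ≫ u.left) hj ρ'.left (by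
      have := congrArg (fun f => f.left) (show ρ' ≫ complι O (T.N i) ≫ u = D.hom by
        rw [← Category.assoc, hρ', hρ])
      exact this)
  have pK' := pK.preim (complι O (T.N i)) (T.pair i).2
  have hb := pull_bijective_of_isLocallyAffineSpace (A := A) ρ' hloc hD pK'
  let N' : ℕ → Closeds D.toOver.left := fun m => common D.toOver (D.vecAt m) (D.covecAt m)
  have pN' : ∀ m < i.val, V.Pair D.toOver (N' m) := fun m _ => pair_common hD _ _
  have hN : ∀ m < i.val, preim ρ (T.N m) = N' m := fun m _ =>
    preim_preim_zeroSet (F := SymplecticBundle.hyp D.toOver.left) D.hypIso_isCartesian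
      (D.comp_sectionHom_dualAt ρ hρ m)
  have hM : preim ρ (iterInf T.N i) = iterInf N' i := preim_iterInf ρ hN
  have eq : ρ ≫ u ≫ q = D.hom ≫ q := by rw [← Category.assoc, hρ]
  have hK : preim ρ' (preim (complι O (T.N i)) K) = preim (D.hom ≫ q) Z ⊓ iterInf N' i := by
    rw [← preim_comp, hρ', preim_inf, hM, ← preim_comp, eq]
  have hcls : A.pull ρ hM.le (A.prodCls T.t i) = D.coordProd Th i :=
    pull_prodCls hO hD ρ T.t _ i (fun m _ => T.pair m) pN' (fun m hm => (hN m hm).le)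
      (fun m hm => Th.pull_thomAlong_of_isCartesian (F := SymplecticBundle.hyp D.toOver.left)
        hD hO hR hD D.hypIso_isCartesian D.hypIso_isIsometric (D.comp_sectionHom_dualAt ρ hρ m)
        (hN m hm).le) hM.le
  have hK' : ρ.left ⁻¹' (K : Set O.left) ⊆ preim ρ' (preim (complι O (T.N i)) K) := by
    rw [← preim_comp, hρ']
    exact preim_subset _ _
  have key : ∀ a, A.pull ρ' (preim_subset _ _) (T.cellMap (u ≫ q) Z i a) =
      A.mulMap (D.hom ≫ q) Z (D.coordProd Th i) hK.ge a := fun a => by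
    rw [← hcls]
    refine Eq.trans ?_ (pull_mulMap eq pZ (T.pair_iterInf i) pK (pair_iterInf hD pN')
      (pK'.preim ρ' hD) hM.le hK' (A.prodCls T.t i) le_rfl hK.ge a)
    exact (pull_pull ρ' (complι O (T.N i)) pK pK' (pK'.preim ρ' hD) _ _ _).trans
      (A.pull_congr hρ' _ _ _)
  rw [← Function.Bijective.of_comp_iff' hb]
  constructor
  · exact fun h => mulMap_bijective_congr hK le_rfl (bijective_of_eq h fun a => (key a).symm)
  · exact fun h => bijective_of_eq (mulMap_bijective_congr hK.symm hK.ge h) key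

/-- The cell number `0` at any support. -/
lemma coordProd_zero_bijective {Z : Closeds X.left} (pZ : V.Pair X Z) :
    Function.Bijective (A.mulMap (D.hom ≫ q) Z (D.coordProd Th 0) le_rfl) := by
  have hD := D.mem pZ.1
  have pq := pZ.preim (D.hom ≫ q) hD
  have e : preim (D.hom ≫ q) Z ⊓ ⊤ = preim (D.hom ≫ q) Z := inf_eq_left.2 le_top
  refine mulMap_bijective_congr (h := e.le) e.symm le_rfl (bijective_of_eq
    (pull_bijective_of_isLocallyAffineSpace (D.hom ≫ q)
      (IsAffineSpace.isLocallyAffineSpace D.isAffineSpace) hD pZ) fun a => ?_)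
  exact (mul_unit pq pq _ _).trans (ext_self pq _ _)

/-- The cells of a support which is the whole base. -/
lemma coordProd_top_bijective (hX : V.Mem X)
    (hT : ∀ (Y₁ : Over k) (q₁ : Y₁ ⟶ X) (κ : Type) [Finite κ] (d : κ → Γ(Y₁.left, ⊤)),
      IsAffineSpace q₁.left d → ∀ Z, V.Pair Y₁ Z → Z = ⊤ ∨ 2 ≤ i.val → ThomIso Th Y₁ Z) :
    Function.Bijective (A.mulMap (D.hom ≫ q) ⊤ (D.coordProd Th i) le_rfl) := by
  have hx : ∀ m : Fin i, (Sum.inr ⟨m, m.2.trans i.2⟩ : Fin n ⊕ Fin n) ≠ .inr i := fun m h => by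
    have := congrArg Fin.val (Sum.inr_injective h)
    exact m.2.ne this
  let α : Fin i → CellIndex n i := fun m => ⟨(1, .inr ⟨m, m.2.trans i.2⟩), by
    simpa [CellIndex] using hx m⟩
  let β : Fin i → CellIndex n i := fun m => ⟨(0, .inr ⟨m, m.2.trans i.2⟩), by
    simpa [CellIndex] using hx m⟩
  have hb := prodCls_bijective Th hX i hT (D.hom ≫ q) (c := D.c) D.isAffineSpace D.vecAt D.covecAt
    α β ?_ (fun m => ?_) fun m => ?_
  · exact mulMap_bijective_congr (Eq.symm (inf_eq_right.2 fun _ _ => trivial)) le_rfl hb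
  · rintro (x | x) (y | y) h
    · simpa [α, Fin.ext_iff] using h
    · simp [α, β] at h
    · simp [α, β] at h
    · simpa [β, Fin.ext_iff] using h
  · refine (dif_pos (m.2.trans i.2)).trans ?_
    rw [D.vec_v]
    exact cellVec_of_index i D.c _ _
  · refine (dif_pos (m.2.trans i.2)).trans ?_
    rw [D.vec_k]
    exact cellCovec_of_index i D.c _ _

end Cell
end HPCoords

end

section

/-! ### The projective bundle theorem for a hyperbolic bundle -/

open CohomologyTheory RingCohomologyTheory SchemeCategory

variable {k : Scheme.{u}} {V : SchemeCategory k} {A : RingCohomologyTheory.{u, w} V}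
  (Th : SymplecticThomStructure A)

namespace HPCoords

variable {R X : Over k} {q : R ⟶ X} {U : SymplecticBundle R.left 2} {n : ℕ}

/-- The loci with index less than `r` do not meet where one of them is avoided. -/
lemma iterInf_tower_eq_bot (C : HPCoords q.left U n) (hR : V.Mem R) {O : Over k} (hO : V.Mem O)
    (u : O ⟶ R) {r : ℕ}
    (hu : Set.range u.left ⊆ {x | ∃ m < r, x ∉ C.locus m}) :
    iterInf (C.tower Th hR hO u).N r = ⊥ := by
  ext x
  refine iff_of_false (fun h => ?_) id
  obtain ⟨m, hm, h'⟩ := hu ⟨x, rfl⟩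
  exact h' ((C.mem_iterInf_tower_N_iff Th hR hO u r x).1 h m hm)

/-- The projective bundle theorem for the union of the first `r` strata. The Thom isomorphism is
needed at proper supports only if there is a cell with index at least two, that is, if `2 < r`. -/
lemma sumMapTop_bijective_of_range (C : HPCoords q.left U n) (hX : V.Mem X) (hR : V.Mem R)
    {O : Over k} (hO : V.Mem O) (u : O ⟶ R) [IsOpenImmersion u.left]
    {r : ℕ} (hr : r ≤ n) (hu : Set.range u.left = {x | ∃ m < r, x ∉ C.locus m})
    (hT : ∀ (Y₁ : Over k) (q₁ : Y₁ ⟶ X) (κ : Type) [Finite κ] (d : κ → Γ(Y₁.left, ⊤)),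
      IsAffineSpace q₁.left d → ∀ Z, V.Pair Y₁ Z → Z = ⊤ ∨ 2 < r → ThomIso Th Y₁ Z) :
    Function.Bijective (A.sumMapTop (u ≫ q)
      (fun j : Fin r => A.pow (A.pullTop u (Th.pontryagin R U)) j)) := by
  have pX := pair_top hX
  let T := C.tower Th hR hO u
  have h1 := T.map_zero_bijective (u ≫ q) ⊤ pX (n := r) (fun i hi => by
    obtain ⟨D⟩ := C.nonempty_cell ⟨i, hi.trans_le hr⟩
    refine (D.cellMap_bijective_iff Th hR hO u ?_ pX).2 (D.coordProd_top_bijective Th hX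
      fun Y₁ q₁ κ _ d hd Z pZ hZ => hT Y₁ q₁ κ d hd Z pZ (hZ.imp_right fun h => h.trans_lt hi))
    rw [hu]
    exact fun x hx => ⟨i, hi, hx⟩) (C.iterInf_tower_eq_bot Th hR hO u hu.le)
  exact (T.map_zero_bijective_iff (u ≫ q) ⊤ pX r).1 h1

/-- The projective bundle theorem for the union of the first two strata, at any support: the five
lemma reduces it to the statement without supports over the base and over the complement of `Z`. -/
lemma sumMap_two_bijective (C : HPCoords q.left U n) (hX : V.Mem X) (hR : V.Mem R) {O : Over k}
    (hO : V.Mem O) (u : O ⟶ R) [IsOpenImmersion u.left]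
    (hn : 2 ≤ n) (hu : Set.range u.left = {x | ∃ m < 2, x ∉ C.locus m})
    {Z : Closeds X.left} (pZ : V.Pair X Z) :
    Function.Bijective (A.sumMap (u ≫ q)
      (fun j : Fin 2 => A.pow (A.pullTop u (Th.pontryagin R U)) j) (preim_subset (u ≫ q) Z)) := by
  have hT : ∀ {X : Over k}, V.Mem X → ∀ (Y₁ : Over k) (q₁ : Y₁ ⟶ X) (κ : Type) [Finite κ]
      (d : κ → Γ(Y₁.left, ⊤)), IsAffineSpace q₁.left d →
      ∀ Z, V.Pair Y₁ Z → Z = ⊤ ∨ 2 < 2 → ThomIso Th Y₁ Z := by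
    rintro X hX Y₁ q₁ κ _ d hd Z pZ (rfl | h)
    · exact thomIso_top Th pZ.1
    · omega
  have pR := pZ.preim q hR
  have pO := pZ.preim (u ≫ q) hO
  refine sumMap_bijective_of_compl (u ≫ q) hO _ pZ
    (C.sumMapTop_bijective_of_range Th hX hR hO u hn hu (hT hX)) ?_
  let g := complι R (preim q Z)
  let U' := U.pullback g.left
  have hk := U.toVectorBundle.pullbackHom_isCartesian g.left
  have hi : (U.pullbackHom g.left).IsIsometric := U.pullbackHom_isIsometric g.left
  let C' := C.baseChange (isPullback_complMap q Z) hk hi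
  have hs : u.left ⁻¹' (preim q Z : Set R.left) ⊆ preim (u ≫ q) Z := by
    rw [preim_comp]
    exact preim_subset _ _
  let u' : compl O (preim (u ≫ q) Z) ⟶ compl R (preim q Z) := complMap u hs
  have hu' : u' ≫ g = complι O (preim (u ≫ q) Z) ≫ u := complMap_comp _ _
  have : IsOpenImmersion u'.left := by
    have : IsOpenImmersion (u'.left ≫ g.left) := by
      rw [← Over.comp_left, hu']
      exact inferInstanceAs (IsOpenImmersion ((complι O (preim (u ≫ q) Z)).left ≫ u.left))
    exact IsOpenImmersion.of_comp _ g.left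
  have hr : Set.range u'.left = {x | ∃ m < 2, x ∉ C'.locus m} := by
    have h1 : {x | ∃ m < 2, x ∉ C'.locus m} = g.left ⁻¹' Set.range u.left := by
      rw [hu]
      ext x
      refine exists_congr fun m => and_congr_right fun _ => not_congr ?_
      exact Set.ext_iff.1 (C.locus_baseChange (isPullback_complMap q Z) hk hi m) x
    rw [h1]
    refine Set.Subset.antisymm ?_ ?_
    · rintro _ ⟨x, rfl⟩
      exact ⟨(complι O (preim (u ≫ q) Z)).left x, congrArg (fun f => f.left x) hu'.symm⟩
    · rintro x ⟨y, hy⟩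
      have hx := Set.mem_range_self (f := g.left) x
      rw [range_complι, ← hy] at hx
      have h2 : y ∈ Set.range (complι O (preim (u ≫ q) Z)).left := by
        rw [range_complι, preim_comp]
        exact hx
      obtain ⟨z, rfl⟩ := h2
      refine ⟨z, g.left.isOpenEmbedding.injective ?_⟩
      rw [← hy]
      exact congrArg (fun f => f.left z) hu'
  have h1 := C'.sumMapTop_bijective_of_range Th (q := complMap q (preim_subset q Z)) pZ.2 pR.2 pO.2
    u' hn hr (hT pZ.2)
  have e1 : u' ≫ complMap q (preim_subset q Z) = complMap (u ≫ q) (preim_subset (u ≫ q) Z) := by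
    have := mono_of_isOpenImmersion (complι X Z)
    rw [← cancel_mono (complι X Z), Category.assoc, complMap_comp, complMap_comp,
      ← Category.assoc, hu', Category.assoc]
  have e2 : ∀ j : Fin 2, A.pow (A.pullTop u' (Th.pontryagin (compl R (preim q Z)) U')) j =
      A.pullTop (complι O (preim (u ≫ q) Z)) (A.pow (A.pullTop u (Th.pontryagin R U)) j) := by
    intro j
    have e3 : A.pullTop u' (Th.pontryagin (compl R (preim q Z)) U') =
        A.pullTop (complι O (preim (u ≫ q) Z)) (A.pullTop u (Th.pontryagin R U)) := by
      have e4 := Th.pullTop_pontryagin pR.2 hR (f := g) hk hi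
      rw [← e4, pullTop_pullTop _ _ hR pR.2 pO.2, pullTop_pullTop _ _ hR hO pO.2]
      exact A.pull_congr hu' _ _ _
    rw [e3, pullTop_pow _ hO pO.2]
  rw [← e1]
  exact bijective_of_eq h1 fun a => congrArg
    (fun t => A.sumMapTop (u' ≫ complMap q (preim_subset q Z)) t a) (funext fun j => (e2 j).symm)

/-- The Thom isomorphism at any support: it computes the second of the first two strata, while their
union and the first one are known. -/
lemma thomIso (C : HPCoords q.left U n) (hX : V.Mem X) (hR : V.Mem R) (hn : 2 ≤ n)
    {Z : Closeds X.left} (pZ : V.Pair X Z) : ThomIso Th X Z := by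
  let T₀ := C.tower Th hR hR (𝟙 R)
  let O := compl R (iterInf T₀.N 2)
  let u : O ⟶ R := complι R (iterInf T₀.N 2)
  have hO : V.Mem O := (T₀.pair_iterInf 2).2
  have hu : Set.range u.left = {x | ∃ m < 2, x ∉ C.locus m} := by
    rw [range_complι]
    ext x
    refine (not_congr (C.mem_iterInf_tower_N_iff Th hR hR (𝟙 R) 2 x)).trans ?_
    rw [not_forall]
    exact exists_congr fun m => Classical.not_imp
  let T := C.tower Th hR hO u
  have hbot : iterInf T.N 2 = ⊥ := C.iterInf_tower_eq_bot Th hR hO u hu.le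
  -- the union of both strata
  have h2 : Function.Bijective (T.map (u ≫ q) Z 0 2) := (T.map_zero_bijective_iff (u ≫ q) Z pZ 2).2
    (C.sumMap_two_bijective Th hX hR hO u hn hu pZ)
  obtain ⟨D₀⟩ := C.nonempty_cell ⟨0, by omega⟩
  obtain ⟨D⟩ := C.nonempty_cell ⟨1, by omega⟩
  -- the first cell, whose class is the unit
  have h0 := (D₀.cellMap_bijective_iff Th hR hO u (by
    rw [hu]; exact fun x hx => ⟨0, by omega, hx⟩) pZ).2 (D₀.coordProd_zero_bijective Th pZ)
  -- what is left is the second cell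
  have h1 := T.cellMap_bijective_of_map_bijective (u ≫ q) Z pZ hbot
    ((T.map_bijective_iff (u ≫ q) Z pZ 0 1 h0).1 h2)
  have hcell := (D.cellMap_bijective_iff Th hR hO u (by
    rw [hu]; exact fun x hx => ⟨1, by omega, hx⟩) pZ).1 h1
  intro Y q₁ a b hY
  have mY : V.Mem Y := IsAffineSpace.mem q₁ hY hX
  have mD := D.mem hX
  -- the second cell is an affine space over `Y = X × 𝔸²`, by the coordinates `inr 0` of the vector
  -- and the covector
  let x : Fin 2 → CellIndex n ⟨1, by omega⟩ := ![⟨(1, .inr ⟨0, by omega⟩), by simp⟩,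
    ⟨(0, .inr ⟨0, by omega⟩), by simp⟩]
  have hx : Function.Injective x := by
    intro i j h
    fin_cases i <;> fin_cases j <;> simp [x] at h ⊢
  let ε : {i // i ∈ Set.range x} ≃ Fin 2 := (Equiv.ofInjective x hx).symm
  have hε : ∀ l, ε ⟨x l, l, rfl⟩ = l := fun l => (Equiv.ofInjective x hx).symm_apply_apply l
  obtain ⟨r, hr, hrc, hra⟩ := D.isAffineSpace.exists_split (· ∈ Set.range x) (hY.reindex ε)
  have ha : r.appTop.hom a = D.vecAt 0 := by
    have h1 := hrc ⟨x 0, 0, rfl⟩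
    rw [hε 0] at h1
    refine h1.trans (Eq.symm ((dif_pos (by omega)).trans ?_))
    rw [D.vec_v]
    exact cellVec_of_index _ D.c _ _
  have hb : r.appTop.hom b = D.covecAt 0 := by
    have h1 := hrc ⟨x 1, 1, rfl⟩
    rw [hε 1] at h1
    refine h1.trans (Eq.symm ((dif_pos (by omega)).trans ?_))
    rw [D.vec_k]
    exact cellCovec_of_index _ D.c _ _
  let r' : D.toOver ⟶ Y := Over.homMk r (by
    change r ≫ Y.hom = D.ρ ≫ R.hom
    rw [← Over.w q₁, ← Over.w q, ← Category.assoc, hr, Category.assoc])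
  have hr' : r' ≫ q₁ = D.hom ≫ q := by ext1; exact hr
  let M := common D.toOver (D.vecAt 0) (D.covecAt 0)
  have hM : preim r' (common Y a b) = M := (preim_common r' a b).trans (by
    change common D.toOver (r.appTop.hom a) (r.appTop.hom b) = M
    rw [ha, hb])
  have pM : V.Pair D.toOver M := pair_common mD _ _
  have pC : V.Pair Y (common Y a b) := pair_common mY _ _
  let M₁ := iterInf (fun m => common D.toOver (D.vecAt m) (D.covecAt m)) 1
  have hMM : M = M₁ := (inf_eq_right.2 fun _ _ => trivial).symm
  have pM₁ : V.Pair D.toOver M₁ := pair_iterInf mD fun m _ => pair_common mD _ _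
  have hcls : A.ext hMM.le (coordClass Th D.toOver (D.vecAt 0) (D.covecAt 0)) = D.coordProd Th 1 :=
    (unit_mul pM pM₁ (le_of_eq rfl) _).symm
  have hM₁ : r'.left ⁻¹' (common Y a b : Set Y.left) ⊆ M₁ := (hM.trans hMM).le
  have hcls' : A.pull r' hM₁ (coordClass Th Y a b) = D.coordProd Th 1 := by
    rw [← hcls, ← pull_coordClass Th mD mY r' a b ha hb hM.le]
    exact (ext_pull r' pC pM pM₁ hMM.le hM.le _).symm
  have pq := pZ.preim q₁ mY
  let K := preim q₁ Z ⊓ common Y a b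
  have pK : V.Pair Y K := pq.inf pC
  have hK : preim r' K = preim (D.hom ≫ q) Z ⊓ M₁ := by
    rw [preim_inf, hM, ← preim_comp, hr', hMM]
  have hb' := pull_bijective_of_isLocallyAffineSpace (A := A) r'
    (IsAffineSpace.isLocallyAffineSpace hra) mD pK
  rw [← Function.Bijective.of_comp_iff' hb']
  refine bijective_of_eq (mulMap_bijective_congr hK.symm hK.ge hcell) fun a' => ?_
  refine (pull_mulMap hr' pZ pC pK pM₁ (pK.preim r' mD) hM₁ (preim_subset _ _)
    (coordClass Th Y a b) le_rfl (by rw [hK]) a').trans ?_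
  exact congrArg (fun t => A.mulMap (D.hom ≫ q) Z t hK.ge a') hcls'

/-- The Thom isomorphism at any support of an affine space over `X`, from the base change of the
projective bundle. -/
lemma thomIso_of_isAffineSpace (C : HPCoords q.left U n) (hR : V.Mem R) {Y : Over k} (q₁ : Y ⟶ X)
    {κ : Type} [Finite κ] {d : κ → Γ(Y.left, ⊤)} (hd : IsAffineSpace q₁.left d) (hn : 2 ≤ n)
    {Z : Closeds Y.left} (pZ : V.Pair Y Z) : ThomIso Th Y Z := by
  have hp := IsPullback.of_hasPullback q.left q₁.left
  let R' : Over k := Over.mk (Limits.pullback.fst q.left q₁.left ≫ R.hom)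
  let g : R' ⟶ R := Over.homMk (Limits.pullback.fst q.left q₁.left)
  let q' : R' ⟶ Y := Over.homMk (Limits.pullback.snd q.left q₁.left) (by
    change _ ≫ Y.hom = _ ≫ R.hom
    rw [← Over.w q, ← Over.w q₁, ← Category.assoc, ← hp.w, Category.assoc])
  exact (C.baseChange (π' := q'.left) (g := g.left) hp
    (U.toVectorBundle.pullbackHom_isCartesian g.left)
    (U.pullbackHom_isIsometric g.left)).thomIso Th pZ.1
      (IsAffineSpace.mem g (hd.baseChange hp.flip) hR) hn pZ

/-- The projective bundle theorem for a hyperbolic bundle. -/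
lemma sumMapTop_pow_bijective (C : HPCoords q.left U n) (hX : V.Mem X) (hR : V.Mem R) :
    Function.Bijective (A.sumMapTop q (fun j : Fin n => A.pow (Th.pontryagin R U) j)) := by
  have : IsOpenImmersion (𝟙 R : R ⟶ R).left := inferInstanceAs (IsOpenImmersion (𝟙 R.left))
  have h := C.sumMapTop_bijective_of_range Th hX hR hR (𝟙 R) le_rfl (by
    refine Set.Subset.antisymm (fun x _ => C.exists_notMem_locus x) fun x _ => ⟨x, rfl⟩)
    fun Y₁ q₁ κ _ d hd Z pZ hZ => by
      rcases hZ with rfl | hn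
      · exact thomIso_top Th pZ.1
      · exact C.thomIso_of_isAffineSpace Th hR q₁ hd hn.le pZ
  have e : A.pullTop (𝟙 R) (Th.pontryagin R U) = Th.pontryagin R U :=
    pull_eq_self rfl (pair_top hR) _ _
  rw [e, Category.id_comp] at h
  exact h

/-- The members of the tower with index less than `n` have empty intersection. -/
lemma pow_pontryagin_eq_zero (C : HPCoords q.left U n) (hR : V.Mem R) : A.pow (Th.pontryagin R U)
    n = 0 := by
  let T := C.tower Th hR hR (𝟙 R)
  have h := T.pow_eq_zero (C.iterInf_tower_eq_bot Th hR hR (𝟙 R) fun x _ => C.exists_notMem_locus x)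
  have e : T.ζ = Th.pontryagin R U := pull_eq_self rfl (pair_top hR) _ _
  rwa [e] at h

end HPCoords

end

section

/-! ### Projective bundles over an arbitrary base -/

open CohomologyTheory RingCohomologyTheory SchemeCategory

variable {k : Scheme.{u}} {V : SchemeCategory k} {A : RingCohomologyTheory.{u, w} V}

section Global

variable (Th : SymplecticThomStructure A) {n : ℕ} {S P : Over k}
  {E : SymplecticBundle S.left (2 * n)} {π : P ⟶ S} {U : SymplecticBundle P.left 2}
  {ι : BundleHom π.left U.toVectorBundle E.toVectorBundle}

/-- The projective bundle theorem without supports, over any base `S' ⟶ S`. -/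
lemma sumMapTop_pow_bijective_of_isPullback (hS : V.Mem S)
    (hP : IsQuaternionicProjectiveBundle E π.left U ι) {S' P' : Over k} {b : S' ⟶ S} {g : P' ⟶ P}
    {q : P' ⟶ S'} (hp : IsPullback g.left q.left π.left b.left) (hS' : V.Mem S')
    (hP' : V.Mem P') : Function.Bijective (A.sumMapTop q
      (fun j : Fin n => A.pullTop g (A.pow (Th.pontryagin P U) j))) := by
  have hPm : V.Mem P := hP.mem hS
  refine sumMapTop_bijective_of_locally hP' hS' fun x => ?_
  obtain ⟨W, hW, e, he, hf⟩ := E.exists_isHyperbolic_opens (b.left x)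
  refine ⟨b.left ⁻¹ᵁ W, hW, fun T hT hTW => ?_⟩
  have h₁ := IsPullback.of_hasPullback q.left T.ι
  have h₂ := (h₁.flip.paste_vert hp.flip).flip
  let B : Over k := Over.mk (T.ι ≫ S'.hom)
  let β : B ⟶ S' := Over.homMk T.ι
  let C : Over k := Over.mk (Limits.pullback.fst q.left T.ι ≫ P'.hom)
  let c : C ⟶ P' := Over.homMk (Limits.pullback.fst q.left T.ι)
  let q' : C ⟶ B := Over.homMk (Limits.pullback.snd q.left T.ι) (by
    change _ ≫ T.ι ≫ S'.hom = _ ≫ P'.hom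
    rw [← Category.assoc, ← h₁.w, Category.assoc, Over.w])
  have hβ : IsOpenImmersion β.left := inferInstanceAs (IsOpenImmersion T.ι)
  have hc : IsOpenImmersion c.left := MorphismProperty.of_isPullback h₁.flip hβ
  have hβr : Set.range β.left = T := Scheme.Opens.range_ι T
  have hcr : Set.range c.left = q.left ⁻¹' T := by
    rw [← hβr]
    exact range_of_isPullback h₁
  have hB : V.Mem B := SchemeCategory.mem_open β hS' (by rw [hβr]; exact hT)
  have hC : V.Mem C := SchemeCategory.mem_open c hP' (by
    have := SchemeCategory.quasiCompact_left q hP' hS'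
    rw [hcr]
    exact q.left.isCompact_preimage hT)
  have hr : Set.range (T.ι ≫ b.left) ⊆ Set.range W.ι := by
    rw [Scheme.Opens.range_ι]
    rintro _ ⟨y, rfl⟩
    exact hTW y.2
  let m : Over.mk (T.ι ≫ b.left) ⟶ Over.mk W.ι :=
    Over.homMk (IsOpenImmersion.lift W.ι (T.ι ≫ b.left) hr) (IsOpenImmersion.lift_fac _ _ _)
  have hk := U.toVectorBundle.pullbackHom_isCartesian (c ≫ g).left
  have hi := U.pullbackHom_isIsometric (c ≫ g).left
  let D : HPCoords q'.left (U.pullback (c ≫ g).left) n :=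
    hP.hpCoords h₂ hk hi (he.comp m) (hf.comp m)
  refine SumMapBijectiveOver.of_exists (b := β) (c := c) (q' := q') hP' hC hB
    (by ext1; exact h₁.w) hβr hcr ?_
  refine bijective_of_eq (D.sumMapTop_pow_bijective Th hB hC) fun a =>
    congrArg (fun t => A.sumMapTop q' t a) (funext fun j => ?_)
  rw [pullTop_pullTop _ _ hPm hP' hC, pullTop_pow _ hPm hC]
  exact congrArg (fun t => A.pow t j) (Th.pullTop_pontryagin hC hPm hk hi)

/-- The projective bundle theorem with supports. -/
lemma sumMap_pow_bijective (hS : V.Mem S) (hP : IsQuaternionicProjectiveBundle E π.left U ι)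
    {Z : Closeds S.left} (pZ : V.Pair S Z) : Function.Bijective
      (A.sumMap π (fun j : Fin n => A.pow (Th.pontryagin P U) j) (preim_subset π Z)) := by
  have hPm : V.Mem P := hP.mem hS
  have hp : IsPullback (𝟙 P : P ⟶ P).left π.left π.left (𝟙 S : S ⟶ S).left :=
    IsPullback.of_horiz_isIso (fst := 𝟙 P.left) (g := 𝟙 S.left) ⟨by simp⟩
  have h := sumMapTop_pow_bijective_of_isPullback Th hS hP hp hS hPm
  have e : ∀ j : Fin n, A.pullTop (𝟙 P) (A.pow (Th.pontryagin P U) j) =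
      A.pow (Th.pontryagin P U) j := fun j => pull_eq_self rfl (pair_top hPm) _ _
  refine sumMap_bijective_of_compl π hPm _ pZ (bijective_of_eq h fun a =>
    congrArg (fun t => A.sumMapTop π t a) (funext fun j => (e j).symm)) ?_
  exact sumMapTop_pow_bijective_of_isPullback Th hS hP (isPullback_complMap π Z) pZ.2
    (pZ.preim π hPm).2

/-- If the bundle is trivial, then there are hyperbolic coordinates on all of the base. -/
lemma pow_pontryagin_eq_zero_of_isTrivial (hS : V.Mem S)
    (hP : IsQuaternionicProjectiveBundle E π.left U ι) (hE : E.IsTrivial n) :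
    A.pow (Th.pontryagin P U) n = 0 := by
  have hPm : V.Mem P := hP.mem hS
  obtain ⟨e, hf, he⟩ := hE
  have hp : IsPullback (𝟙 P : P ⟶ P).left π.left π.left (𝟙 S.left) :=
    IsPullback.of_horiz_isIso (fst := 𝟙 P.left) (g := 𝟙 S.left) ⟨by simp⟩
  have hk := U.toVectorBundle.pullbackHom_isCartesian (𝟙 P : P ⟶ P).left
  have hi := U.pullbackHom_isIsometric (𝟙 P : P ⟶ P).left
  have h := (hP.hpCoords hp hk hi he hf).pow_pontryagin_eq_zero Th (q := π) hPm
  rw [← Th.pullTop_pontryagin hPm hPm hk hi] at h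
  have e : A.pullTop (𝟙 P) (Th.pontryagin P U) = Th.pontryagin P U :=
    pull_eq_self rfl (pair_top hPm) _ _
  rwa [e] at h

end Global

/-! ### Two-sided linearity -/

/-- The Pontryagin class is central because the Thom class is. -/
lemma SymplecticThomStructure.mul_pontryagin (Th : SymplecticThomStructure A) {X : Over k}
    (hX : V.Mem X) (E : SymplecticBundle X.left 2) (a : A.obj X ⊤) :
    A.mul inf_le_right a (Th.pontryagin X E) = A.mul inf_le_left (Th.pontryagin X E) a := by
  have hE := VectorBundle.mem_totalOver V hX E.toVectorBundle
  have pX := pair_top hX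
  have pL := pair_zeroSet hX E.toVectorBundle
  have pT := pair_top hE
  let p := projOver X E.toVectorBundle
  let z := zeroOver X E.toVectorBundle
  let th : A.obj (totalOver X E.toVectorBundle) (zeroSet X E.toVectorBundle) := Th.thom X E
  have hc : A.mul inf_le_right (A.pullTop p a) th = A.mul inf_le_left th (A.pullTop p a) :=
    Th.central X E hX a
  have hzp : z ≫ p = 𝟙 X := by
    ext1
    change (𝟙 X.left ≫ E.zeroSection) ≫ E.total.hom = 𝟙 _
    rw [Category.id_comp, E.zeroSection_comp]
  have hpa : A.pullTop z (A.pullTop p a) = a :=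
    (pullTop_pullTop z p hX hE hX a).trans (pull_eq_self hzp pX _ a)
  have hζ : Th.pontryagin X E = -A.pull z (subset_top _) th :=
    congrArg Neg.neg (pull_ext z pL pT pX le_top (subset_top _) th)
  have h := congrArg (A.pull z (subset_top _)) hc
  have hl : A.pull z (subset_top _) (A.mul inf_le_right (A.pullTop p a) th) =
      A.mul inf_le_right a (A.pull z (subset_top _) th) := by
    refine (pull_mul z pT pL pL pX pX pX (subset_top _) (subset_top _) _ _ inf_le_right _ _).trans
      ?_
    exact congrArg (fun t => A.mul inf_le_right t (A.pull z (subset_top _) th)) hpa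
  have hr : A.pull z (subset_top _) (A.mul inf_le_left th (A.pullTop p a)) =
      A.mul inf_le_left (A.pull z (subset_top _) th) a := by
    refine (pull_mul z pL pT pL pX pX pX (subset_top _) (subset_top _) _ _ inf_le_left _ _).trans ?_
    exact congrArg (fun t => A.mul inf_le_left (A.pull z (subset_top _) th) t) hpa
  rw [hζ, _root_.map_neg, _root_.map_neg, AddMonoidHom.neg_apply, ← hl, ← hr, h]

namespace RingCohomologyTheory

lemma mul_pow_comm {X : Over k} (hX : V.Mem X) {ζ : A.obj X ⊤}
    (hζ : ∀ a : A.obj X ⊤, A.mul inf_le_right a ζ = A.mul inf_le_left ζ a) (a : A.obj X ⊤) (j : ℕ) :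
    A.mul inf_le_right a (A.pow ζ j) = A.mul inf_le_left (A.pow ζ j) a := by
  have pX := pair_top hX
  induction j with
  | zero => exact (mul_unit pX pX _ a).trans (unit_mul pX pX _ a).symm
  | succ j ih =>
    change A.mul inf_le_right a (A.mul inf_le_right (A.pow ζ j) ζ) =
      A.mul inf_le_left (A.mul inf_le_right (A.pow ζ j) ζ) a
    rw [← mul_assoc pX pX pX pX pX pX inf_le_right inf_le_right, ih,
      mul_assoc pX pX pX pX pX pX inf_le_left inf_le_right inf_le_right inf_le_right, hζ,
      mul_assoc pX pX pX pX pX pX inf_le_right inf_le_left inf_le_left inf_le_right]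

variable {P S : Over k} (π : P ⟶ S) (ζ : A.obj P ⊤) (n : ℕ) {Z : Closeds S.left}

lemma powerMap_eq_sumMap (Z : Closeds S.left) (a : Fin n → A.obj S Z) :
    powerMap A π ζ n Z a = A.sumMap π (fun j : Fin n => A.pow ζ j) (preim_subset π Z) a := rfl

variable (A) in
lemma powerMap_lact (hP : V.Mem P) (pZ : V.Pair S Z) (s : A.obj S ⊤) (a : Fin n → A.obj S Z) :
    powerMap A π ζ n Z (fun i => A.lact s (a i)) =
      A.lact (A.pullTop π s) (powerMap A π ζ n Z a) := by
  have pS := pair_top pZ.1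
  have pP := pair_top hP
  have pq := pZ.preim π hP
  rw [powerMap_eq_sumMap, powerMap_eq_sumMap, sumMap_apply, sumMap_apply, lact_eq_mul,
    _root_.map_sum]
  refine Finset.sum_congr rfl fun i _ => ?_
  rw [lact_eq_mul, pull_mul π pS pZ pZ pP pq pq (subset_top _) (preim_subset π Z) _ _ inf_le_right]
  exact mul_assoc pP pq pP pq pq pq _ _ _ _ _ _ _

variable (A) in
lemma powerMap_ract (hP : V.Mem P) (pZ : V.Pair S Z)
    (hζ : ∀ a : A.obj P ⊤, A.mul inf_le_right a ζ = A.mul inf_le_left ζ a)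
    (s : A.obj S ⊤) (a : Fin n → A.obj S Z) :
    powerMap A π ζ n Z (fun i => A.ract (a i) s) =
      A.ract (powerMap A π ζ n Z a) (A.pullTop π s) := by
  have pS := pair_top pZ.1
  have pP := pair_top hP
  have pq := pZ.preim π hP
  rw [powerMap_eq_sumMap, powerMap_eq_sumMap, sumMap_apply, sumMap_apply, ract_eq_mul,
    _root_.map_sum, AddMonoidHom.finsetSum_apply]
  refine Finset.sum_congr rfl fun i _ => ?_
  rw [ract_eq_mul, pull_mul π pZ pS pZ pq pP pq (preim_subset π Z) (subset_top _) _ _ inf_le_left,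
    mul_assoc pq pP pP pq pP pq inf_le_left inf_le_left inf_le_right inf_le_left]
  refine Eq.trans ?_ (mul_assoc pq pP pP pq pP pq inf_le_left inf_le_left inf_le_left inf_le_left
    _ _ _).symm
  exact congrArg (fun t => A.mul inf_le_left (A.pull π (preim_subset π Z) (a i)) t)
    (mul_pow_comm hP hζ _ _)

/-! ### Pontryagin classes -/

variable (A) in
/-- Up to signs, the coefficients of the relation are the coordinates of `-ζ ^ n` in the basis
`1, ζ, …, ζ ^ (n - 1)`, in the opposite order. -/
lemma pontryaginRelation_iff (p : Fin n → A.obj S ⊤) : PontryaginRelation A π ζ n p ↔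
    A.sumMapTop π (fun j : Fin n => A.pow ζ j)
      (fun j => (-1 : ℤ) ^ (j.rev.val + 1) • p j.rev) = -A.pow ζ n := by
  unfold PontryaginRelation
  rw [add_comm, add_eq_zero_iff_eq_neg]
  refine iff_of_eq (congrArg (· = -A.pow ζ n) ?_)
  rw [← Equiv.sum_comp Fin.revPerm, sumMap_apply]
  refine Finset.sum_congr rfl fun j _ => ?_
  have e : n - 1 - (Fin.revPerm j).val = j := by
    simp only [Fin.revPerm_apply, Fin.val_rev]
    omega
  rw [e, _root_.map_zsmul, _root_.map_zsmul, AddMonoidHom.zsmul_apply]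
  rfl

end RingCohomologyTheory

lemma bijective_signed_rev (n : ℕ) (G : Type*) [AddCommGroup G] :
    Function.Bijective fun (p : Fin n → G) (j : Fin n) => (-1 : ℤ) ^ (j.rev.val + 1) • p j.rev := by
  have h : ∀ (m : ℕ) (x : G), (-1 : ℤ) ^ m • (-1 : ℤ) ^ m • x = x := fun m x => by
    rw [smul_smul, ← _root_.mul_pow]
    simp
  refine Function.bijective_iff_has_inverse.2
    ⟨fun a i => (-1 : ℤ) ^ (i.val + 1) • a i.rev, fun p => ?_, fun a => ?_⟩ <;>
  · funext i
    simp only [Fin.rev_rev, h]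

end

end QuatProj

end

theorem mainTheorem1 {k : Scheme.{u}} {V : QuatProj.SchemeCategory k}
    (A : QuatProj.RingCohomologyTheory.{u, w} V) (Th : QuatProj.SymplecticThomStructure A)
    {n : ℕ} (S : Over k) (hS : V.Mem S) (E : QuatProj.SymplecticBundle S.left (2 * n))
    (P : Over k) (π : P ⟶ S) (U : QuatProj.SymplecticBundle P.left 2)
    (ι : QuatProj.BundleHom π.left U.toVectorBundle E.toVectorBundle)
    (hP : QuatProj.IsQuaternionicProjectiveBundle E π.left U ι) :
    let ζ := Th.pontryagin P U
    (∀ Z : Closeds S.left, V.Pair S Z →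
      Function.Bijective (QuatProj.powerMap A π ζ n Z) ∧
      (∀ a b, QuatProj.powerMap A π ζ n Z (a + b) =
        QuatProj.powerMap A π ζ n Z a + QuatProj.powerMap A π ζ n Z b) ∧
      (∀ (s : A.obj S ⊤) (a : Fin n → A.obj S Z),
        QuatProj.powerMap A π ζ n Z (fun i => A.lact s (a i)) =
          A.lact (A.pullTop π s) (QuatProj.powerMap A π ζ n Z a)) ∧
      (∀ (s : A.obj S ⊤) (a : Fin n → A.obj S Z),
        QuatProj.powerMap A π ζ n Z (fun i => A.ract (a i) s) =
          A.ract (QuatProj.powerMap A π ζ n Z a) (A.pullTop π s))) ∧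
    (∃! p : Fin n → A.obj S ⊤, QuatProj.PontryaginRelation A π ζ n p) ∧
    (E.IsTrivial n →
      ∀ p : Fin n → A.obj S ⊤, QuatProj.PontryaginRelation A π ζ n p → p = 0) := by
  intro ζ
  have hPm : V.Mem P := hP.mem hS
  have hb : Function.Bijective (A.sumMapTop π fun j : Fin n => A.pow ζ j) :=
    QuatProj.sumMap_pow_bijective Th hS hP (QuatProj.SchemeCategory.pair_top hS)
  have hb' := hb.comp (QuatProj.bijective_signed_rev n (A.obj S ⊤))
  refine ⟨fun Z pZ => ⟨QuatProj.sumMap_pow_bijective Th hS hP pZ,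
    map_add (A.sumMap π (fun j : Fin n => A.pow ζ j) subset_rfl),
    A.powerMap_lact π ζ n hPm pZ, A.powerMap_ract π ζ n hPm pZ (Th.mul_pontryagin hPm U)⟩, ?_,
    fun hE p hp => ?_⟩
  · obtain ⟨p, hp, hu⟩ := hb'.existsUnique (-A.pow ζ n)
    exact ⟨p, (A.pontryaginRelation_iff π ζ n p).2 hp,
      fun p' hp' => hu p' ((A.pontryaginRelation_iff π ζ n p').1 hp')⟩
  · have h := (A.pontryaginRelation_iff π ζ n p).1 hp
    rw [QuatProj.pow_pontryagin_eq_zero_of_isTrivial Th hS hP hE, neg_zero] at h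
    refine hb'.1 (h.trans ?_)
    simp only [Function.comp_apply, Pi.zero_apply, smul_zero]
    exact (map_zero (A.sumMapTop π fun j : Fin n => A.pow ζ j)).symm
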